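/- Let $\mathbb T=\mathbb R/\mathbb Z$, let $f(x)=a-x^2$ with $a\in(1,2)$ be such that $0$ is a strictly pre-periodic point of $f$, let $d\ge 2$ be an integer and let $\phi:\mathbb T\to\mathbb R$ be a non-constant real-analytic function. For $\alpha>0$ let $$F(\theta,x)=F_\alpha(\theta,x)=(d\theta,\ f(x)+\alpha\phi(\theta)),\qquad F^n(\theta,x)=(d^n\theta,\ f_n(\theta,x))\qquad((\theta,x)\in\mathbb T\times\mathbb R).$$ Let $p_1=\frac{-1-\sqrt{1+4a}}{2}$, let $1<\beta<|p_1|$ be such that $B=[-\beta,\beta]$ satisfies $f(B)\subset\operatorname{int}(B)$. Call $n_0\in\mathbb N$ a domination time if there are $C_1>0$ and $R_1\in(0,2)$ such that, for all sufficiently small $\alpha>0$ and all $(\theta,x)\in\mathbb T\times B$, $$\Big|\frac{\partial f_k}{\partial x}(\theta,x)\Big|\le C_1R_1^k\ \ (k\in\mathbb N)\quad\text{and}\quad \Big|\frac{\partial f_k}{\partial x}(\theta,x)\Big|\le R_1^k\le\frac{d^k}{6}\ \ (k\ge n_0).$$ Given such an $n_0$, and identifying $\mathbb T$ with $[0,1)$,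 call a curve $X:[0,1)\to B$ admissible if there are $n\ge n_0+1$, an interval $\omega=[j/d^n,(j+1)/d^n)$ with $0\le j<d^n$, and a point $x_0\in B$ such that $X(d^n\theta \bmod 1)=f_n(\theta,x_0)$ for all $\theta\in\omega$. Then domination times exist, and for every domination time $n_0$ there is $\alpha_0>0$ (depending only on $f,d,\phi,\beta,n_0$) such that for every $0<\alpha<\alpha_0$ and every admissible curve $X:[0,1)\to B$, $$\chi_-(\theta,X(\theta))=\liminf_{n\to\infty}\frac1n\log\Big|\frac{\partial f_n}{\partial x}(\theta,X(\theta))\Big|>0\qquad\text{for Lebesgue-a.e. }\theta\in[0,1),$$ where $\log 0=-\infty$. -/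

import Mathlib

open Set Filter MeasureTheory

/-- The quadratic map `f(x) = a - x²`. -/
def quadMap (a : ℝ) (x : ℝ) : ℝ := a - x ^ 2

/-- `0` is a strictly pre-periodic point of `f`: some iterate of it is a periodic point, but
`0` itself is not periodic. -/
def IsStrictlyPreperiodicZero (f : ℝ → ℝ) : Prop :=
  (0 : ℝ) ∉ Function.periodicPts f ∧ ∃ m : ℕ, f^[m] 0 ∈ Function.periodicPts f

/-- A function on the circle `ℝ/ℤ` is real-analytic if its `1`-periodic lift to `ℝ` is. -/
def IsRealAnalyticOnCircle (φ : UnitAddCircle → ℝ) : Prop :=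
  AnalyticOnNhd ℝ (fun t : ℝ => φ (t : UnitAddCircle)) univ

/-- The skew product `F(θ, x) = (dθ, f(x) + α φ(θ))` on `ℝ/ℤ × ℝ`. -/
noncomputable def skewMap (a : ℝ) (d : ℕ) (φ : UnitAddCircle → ℝ) (α : ℝ)
    (p : UnitAddCircle × ℝ) : UnitAddCircle × ℝ :=
  (d • p.1, quadMap a p.2 + α * φ p.1)

/-- The function `f_n` with `Fⁿ(θ, x) = (dⁿθ, f_n(θ, x))`. -/
noncomputable def fibreIter (a : ℝ) (d : ℕ) (φ : UnitAddCircle → ℝ) (α : ℝ) (n : ℕ)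
    (θ : UnitAddCircle) (x : ℝ) : ℝ :=
  ((skewMap a d φ α)^[n] (θ, x)).2

/-- The vertical derivative `∂f_n/∂x (θ, x)`. -/
noncomputable def vertDeriv (a : ℝ) (d : ℕ) (φ : UnitAddCircle → ℝ) (α : ℝ) (n : ℕ)
    (θ : UnitAddCircle) (x : ℝ) : ℝ :=
  deriv (fun y : ℝ => fibreIter a d φ α n θ y) x

/-- The lower vertical Lyapunov exponent `χ₋(θ, x) = liminf (1/n) log |∂f_n/∂x (θ, x)|`, as an
extended real number, with `log 0 = -∞`. -/
noncomputable def lowerVertExponent (a : ℝ) (d : ℕ) (φ : UnitAddCircle → ℝ) (α : ℝ)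
    (θ : UnitAddCircle) (x : ℝ) : EReal :=
  liminf (fun n : ℕ => (((1 / (n : ℝ) : ℝ)) : EReal) *
    ENNReal.log (ENNReal.ofReal |vertDeriv a d φ α n θ x|)) atTop

/-- The orientation-preserving fixed point `p₁ = (-1 - √(1 + 4a)) / 2` of `f`. -/
noncomputable def fixedPointOne (a : ℝ) : ℝ := (-1 - Real.sqrt (1 + 4 * a)) / 2

/-- `n₀` is a domination time (on the strip `ℝ/ℤ × [-β, β]`): there are `C₁ > 0` and
`R₁ ∈ (0, 2)` such that, for all sufficiently small `α > 0`, one has `|∂f_k/∂x| ≤ C₁ R₁ᵏ` on the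
strip for all `k`, and `|∂f_k/∂x| ≤ R₁ᵏ ≤ dᵏ / 6` on the strip for all `k ≥ n₀`. -/
def IsDominationTime (a : ℝ) (d : ℕ) (φ : UnitAddCircle → ℝ) (β : ℝ) (n₀ : ℕ) : Prop :=
  ∃ C₁ R₁ : ℝ, 0 < C₁ ∧ 0 < R₁ ∧ R₁ < 2 ∧
    ∃ α₁ : ℝ, 0 < α₁ ∧ ∀ α : ℝ, 0 < α → α < α₁ →
      ∀ θ : UnitAddCircle, ∀ x ∈ Icc (-β) β,
        (∀ k : ℕ, |vertDeriv a d φ α k θ x| ≤ C₁ * R₁ ^ k) ∧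
        (∀ k : ℕ, n₀ ≤ k →
          |vertDeriv a d φ α k θ x| ≤ R₁ ^ k ∧ R₁ ^ k ≤ (d : ℝ) ^ k / 6)

/-- A curve `X : [0, 1) → [-β, β]` is admissible if it is the image under `Fⁿ`, for some
`n ≥ n₀ + 1`, of a horizontal curve over an element `ω = [j/dⁿ, (j+1)/dⁿ)` of the `n`-th
partition: `X(dⁿ t mod 1) = f_n(t, x₀)` for all `t ∈ ω`, with `x₀ ∈ [-β, β]`.
Only the values of `X` on `[0, 1)` matter. -/
def IsAdmissibleCurve (a : ℝ) (d : ℕ) (φ : UnitAddCircle → ℝ) (β : ℝ) (n₀ : ℕ) (α : ℝ)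
    (X : ℝ → ℝ) : Prop :=
  MapsTo X (Ico 0 1) (Icc (-β) β) ∧
    ∃ n : ℕ, n₀ + 1 ≤ n ∧ ∃ j : ℕ, j < d ^ n ∧ ∃ x₀ ∈ Icc (-β) β,
      ∀ t ∈ Ico ((j : ℝ) / (d : ℝ) ^ n) (((j : ℝ) + 1) / (d : ℝ) ^ n),
        X (Int.fract ((d : ℝ) ^ n * t)) = fibreIter a d φ α n (t : UnitAddCircle) x₀

/-!
The proof tracks the orbits of a whole horizontal curve at once. The image of a horizontal segment
under a high iterate of the skew product is, over each `d`-adic interval, a curve of height `O(α)`.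
The vertical derivative along an orbit grows at a uniform rate while the orbit stays away from the
critical point `0`, and loses at most the factor `|x_i| / α`, up to a constant, at each passage
through the region `|x| ≲ √α`. It is therefore enough that deep passages, and passages which are
soon followed by another one, are rare for almost every starting point.

*Expansion of the quadratic map.* A branch of `f^n` without critical points maps an interval into
one of the complementary intervals of the postcritical set and expands its Hilbert metric
(`hilbertDensity_lt_growth`). Hence cycles are repelling (`one_lt_growth_of_periodic`), there is no
interval on which all iterates are monotone (`not_forall_zeroFree`), and orbits that avoid a
neighbourhood of `0` grow exponentially (`exists_expansion_away`). The critical orbit ends in a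
repelling cycle, so an orbit which passes `0` at distance `√α` shadows the critical orbit long
enough to regain its loss (`CritConst.exists_binding_time`, `CritConst.shadow_growth`). This
gives growth outside the region `|x| ≲ √α` (`CritConst.exists_free_growth`) and the factor
`|x_i| / α` for a passage (`SkewData.exists_passage_growth`).

*Non-flatness of image curves.* Vertical derivatives in `[-β, β]` are at most `C R^n` with
`R < 2 ≤ d` (`exists_domination`), so image curves, rescaled by `α` and by the length of the
`d`-adic intervals, are close to sums of series in the inverse branches of `θ ↦ dθ`. The set of such
limits is compact, and none of them is constant because `φ` is not constant. By unique continuation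
some derivative of bounded order is uniformly bounded below (`exists_nonflat`), which bounds the
conditional probability of `|x_i| ≤ α ε` by a constant times `ε^γ` (`exists_sublevel_estimate`,
`SkewData.exists_curveFamily`).

*Early returns.* The position after a passage determines, up to a small error, the value of the
cocycle series `∑ φ(d^k θ) / ∏ (-2 c_i)` along the critical orbit `c_i`
(`SkewData.exists_cocycleSeries_dist_le`). This series is a non-constant function that either is
real-analytic on `[0, ∞)` or oscillates on every `d`-adic interval, uniformly after rescaling; in
both cases its level sets are null sets (`volume_cocycleSeries_level`). A return within a bounded time `M` restricts the position
to a neighbourhood of finitely many points, so for small `α` its conditional probability is at most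
`1 / 8` (`SkewData.volume_short_return_le`).

*Counting.* An exponential supermartingale over the `d`-adic intervals turns these conditional
probabilities into bounds for the number of events (`volume_count_gt_le`), and the Borel-Cantelli
lemma makes them hold almost surely (`CurveFamily.ae_eventually_counts`). The total loss is then at
most a constant times the number of passages. Since most passages are followed by `M` free times and
`M` is arbitrary, the gain wins (`exponent_lower_bound`, `SkewData.exists_ae_growth`).
-/

open Topology

/-! ### Orbits, growth and the projective metric -/

/-- The vertical expansion `∏_{i<n} |2 xᵢ|` along a sequence of points, that is `|(fⁿ)'(x₀)|` when
`x` is an orbit of `f(x) = a - x²`. -/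
def growth (x : ℕ → ℝ) (n : ℕ) : ℝ := ∏ i ∈ Finset.range n, |2 * x i|

/-- The orbit of `x` under `f(x) = a - x²`. -/
def qorb (a x : ℝ) (n : ℕ) : ℝ := (quadMap a)^[n] x

lemma growth_zero (x : ℕ → ℝ) : growth x 0 = 1 := by simp [growth]

lemma growth_succ (x : ℕ → ℝ) (n : ℕ) : growth x (n + 1) = growth x n * |2 * x n| := by
  simp [growth, Finset.prod_range_succ]

lemma growth_nonneg (x : ℕ → ℝ) (n : ℕ) : 0 ≤ growth x n :=
  Finset.prod_nonneg fun _ _ => abs_nonneg _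

lemma growth_add (x : ℕ → ℝ) (m n : ℕ) :
    growth x (m + n) = growth x m * growth (fun i => x (m + i)) n := by
  simp [growth, Finset.prod_range_add]

lemma qorb_zero (a x : ℝ) : qorb a x 0 = x := rfl

lemma qorb_succ (a x : ℝ) (n : ℕ) : qorb a x (n + 1) = a - qorb a x n ^ 2 := by
  simp only [qorb, Function.iterate_succ_apply', quadMap]

lemma qorb_add (a x : ℝ) (m n : ℕ) : qorb a x (m + n) = qorb a (qorb a x m) n := by
  simp only [qorb]
  rw [add_comm, Function.iterate_add_apply]

lemma continuous_qorb (a : ℝ) (n : ℕ) : Continuous fun x => qorb a x n := by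
  induction n with
  | zero => exact continuous_id
  | succ n ih => simp only [qorb_succ]; fun_prop

lemma hasDerivAt_qorb (a x : ℝ) (n : ℕ) :
    HasDerivAt (fun y => qorb a y n) (∏ i ∈ Finset.range n, (-2 * qorb a x i)) x := by
  induction n with
  | zero => simpa [qorb_zero] using hasDerivAt_id' x
  | succ n ih =>
    simp only [qorb_succ, Finset.prod_range_succ]
    refine ((ih.pow 2).const_sub a).congr_deriv ?_
    push_cast
    ring

lemma abs_deriv_qorb (a x : ℝ) (n : ℕ) :
    |∏ i ∈ Finset.range n, (-2 * qorb a x i)| = growth (qorb a x) n := by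
  rw [Finset.abs_prod, growth]
  exact Finset.prod_congr rfl fun i _ => by rw [neg_mul, abs_neg]

/-- The parameters of the fibre map: `1 < a < 2`, the critical point `0` is strictly preperiodic
under `f(x) = a - x²`, and `-p` is the orientation-preserving fixed point of `f`. -/
structure PreperiodicParam (a p : ℝ) : Prop where
  one_lt : 1 < a
  lt_two : a < 2
  one_lt_p : 1 < p
  p_sq : p ^ 2 = a + p
  pre : IsStrictlyPreperiodicZero (quadMap a)

namespace PreperiodicParam

variable {a p : ℝ}

lemma p_lt_two (h : PreperiodicParam a p) : p < 2 := by
  nlinarith [h.p_sq, h.lt_two, h.one_lt_p]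

lemma a_lt_p (h : PreperiodicParam a p) : a < p := by
  nlinarith [h.p_sq, h.p_lt_two, h.one_lt_p]

lemma p_pos (h : PreperiodicParam a p) : 0 < p := by linarith [h.one_lt_p]

lemma map_le (h : PreperiodicParam a p) {x : ℝ} (hx : |x| ≤ p) : |a - x ^ 2| ≤ p := by
  have := sq_le_sq' (abs_le.1 hx).1 (abs_le.1 hx).2
  rw [abs_le]
  constructor <;> nlinarith [h.p_sq, h.a_lt_p, sq_nonneg x]

lemma qorb_le (h : PreperiodicParam a p) {x : ℝ} (hx : |x| ≤ p) (n : ℕ) : |qorb a x n| ≤ p := by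
  induction n with
  | zero => exact hx
  | succ n ih => rw [qorb_succ]; exact h.map_le ih

lemma qorb_p (h : PreperiodicParam a p) {x : ℝ} (hx : x = -p ∨ x = p) {n : ℕ} (hn : 1 ≤ n) :
    qorb a x n = -p := by
  induction n, hn using Nat.le_induction with
  | base => rw [qorb_succ, qorb_zero]; rcases hx with rfl | rfl <;> nlinarith [h.p_sq]
  | succ n _ ih => rw [qorb_succ, ih]; nlinarith [h.p_sq]

lemma qorb_zero_ne (h : PreperiodicParam a p) {n : ℕ} (hn : 1 ≤ n) : qorb a 0 n ≠ 0 := fun h0 =>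
  h.pre.1 ⟨n, hn, h0⟩

lemma exists_period (h : PreperiodicParam a p) :
    ∃ m q : ℕ, 1 ≤ m ∧ 1 ≤ q ∧ ∀ n, m ≤ n → qorb a 0 (n + q) = qorb a 0 n := by
  obtain ⟨m, q, hq, hm⟩ := h.pre.2
  refine ⟨m + 1, q, by omega, hq, fun n hn => ?_⟩
  obtain ⟨k, rfl⟩ := Nat.exists_eq_add_of_le (show m ≤ n by omega)
  have e : qorb a 0 (m + q) = qorb a 0 m := by
    rw [qorb_add]; exact hm
  rw [show m + k + q = m + q + k by ring, qorb_add, e, ← qorb_add]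

end PreperiodicParam

/-- The postcritical set of `f`, with the boundary fixed point `-p` added. -/
def postCrit (a p : ℝ) : Set ℝ := insert (-p) {y | ∃ j : ℕ, 1 ≤ j ∧ qorb a 0 j = y}

/-- No point of the open interval `(u, v)` reaches the critical point in fewer than `n` steps. -/
def ZeroFree (a : ℝ) (n : ℕ) (u v : ℝ) : Prop := ∀ i < n, ∀ y ∈ Ioo u v, qorb a y i ≠ 0

lemma ZeroFree.mono {a : ℝ} {m n : ℕ} {u v u' v' : ℝ} (h : ZeroFree a n u v) (hmn : m ≤ n)
    (hu : u ≤ u') (hv : v' ≤ v) : ZeroFree a m u' v' := fun i hi y hy =>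
  h i (hi.trans_le hmn) y ⟨hu.trans_lt hy.1, hy.2.trans_le hv⟩

lemma ZeroFree.mul_nonneg {a : ℝ} {n : ℕ} {u v : ℝ} (h : ZeroFree a n u v) (huv : u ≤ v) {i : ℕ}
    (hi : i < n) : 0 ≤ qorb a u i * qorb a v i := by
  by_contra! hneg
  have hmem : (0 : ℝ) ∈ uIcc (qorb a u i) (qorb a v i) := by
    rw [mem_uIcc]
    rcases mul_neg_iff.1 hneg with h1 | h1
    · exact Or.inr ⟨h1.2.le, h1.1.le⟩
    · exact Or.inl ⟨h1.1.le, h1.2.le⟩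
  obtain ⟨y, hy, hy0⟩ := intermediate_value_uIcc
    (f := fun x => qorb a x i) (continuous_qorb a i).continuousOn hmem
  rw [uIcc_of_le huv] at hy
  simp only at hy0
  refine h i hi y ⟨lt_of_le_of_ne hy.1 ?_, lt_of_le_of_ne hy.2 ?_⟩ hy0
  · rintro rfl; rw [hy0, zero_mul] at hneg; exact lt_irrefl _ hneg
  · rintro rfl; rw [hy0, mul_zero] at hneg; exact lt_irrefl _ hneg

/-- The density at `x` of the projective (Hilbert) metric of the interval with endpoints `u, v`. -/
noncomputable def hilbertDensity (u x v : ℝ) : ℝ := 1 / |x - u| + 1 / |v - x|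

lemma hilbertDensity_symm (u x v : ℝ) : hilbertDensity u x v = hilbertDensity v x u := by
  simp only [hilbertDensity, abs_sub_comm x u, abs_sub_comm v x, add_comm]

lemma hilbertDensity_neg (u x v : ℝ) : hilbertDensity (-u) (-x) (-v) = hilbertDensity u x v := by
  unfold hilbertDensity
  rw [show -x - -u = -(x - u) by ring, show -v - -x = -(v - x) by ring, abs_neg, abs_neg]

lemma hilbertDensity_lt_of_nonneg (a : ℝ) {u x v : ℝ} (hu : 0 ≤ u) (hux : u < x) (hxv : x < v) :
    hilbertDensity u x v <
      |2 * x| * hilbertDensity (a - u ^ 2) (a - x ^ 2) (a - v ^ 2) := by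
  have e1 : |a - x ^ 2 - (a - u ^ 2)| = (x - u) * (x + u) := by
    rw [abs_of_nonpos] <;> nlinarith
  have e2 : |a - v ^ 2 - (a - x ^ 2)| = (v - x) * (x + v) := by
    rw [abs_of_nonpos] <;> nlinarith
  have h1 : 0 < x - u := by linarith
  have h2 : 0 < v - x := by linarith
  have h3 : 0 < x + u := by linarith
  have h4 : 0 < x + v := by linarith
  have h5 : 0 < x := by linarith
  unfold hilbertDensity
  rw [e1, e2, abs_of_pos h1, abs_of_pos h2, abs_of_pos (by linarith : 0 < 2 * x)]
  have : 2 * x * (1 / ((x - u) * (x + u)) + 1 / ((v - x) * (x + v))) -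
      (1 / (x - u) + 1 / (v - x)) = (v - u) / ((x + u) * (x + v)) := by
    field_simp
    ring
  have : 0 < (v - u) / ((x + u) * (x + v)) := div_pos (by linarith) (by positivity)
  linarith

/-- The quadratic map expands the projective metric on each of its two branches. -/
lemma hilbertDensity_lt (a : ℝ) {u x v : ℝ} (huv : 0 ≤ u * v) (hx : 0 < (x - u) * (v - x)) :
    hilbertDensity u x v < |2 * x| * hilbertDensity (a - u ^ 2) (a - x ^ 2) (a - v ^ 2) ∧
      0 < ((a - x ^ 2) - (a - u ^ 2)) * ((a - v ^ 2) - (a - x ^ 2)) := by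
  have key : ∀ u v : ℝ, 0 ≤ u * v → u < x → x < v →
      hilbertDensity u x v < |2 * x| * hilbertDensity (a - u ^ 2) (a - x ^ 2) (a - v ^ 2) ∧
      0 < ((a - x ^ 2) - (a - u ^ 2)) * ((a - v ^ 2) - (a - x ^ 2)) := by
    intro u v huv hux hxv
    rcases le_or_gt 0 u with hu | hu
    · refine ⟨hilbertDensity_lt_of_nonneg a hu hux hxv, mul_pos_of_neg_of_neg ?_ ?_⟩ <;> nlinarith
    · have hv : v ≤ 0 := by nlinarith
      refine ⟨?_, mul_pos ?_ ?_⟩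
      · have := hilbertDensity_lt_of_nonneg a (u := -v) (x := -x) (v := -u)
          (by linarith) (by linarith) (by linarith)
        rw [hilbertDensity_neg, hilbertDensity_symm] at this
        rw [hilbertDensity_symm (a - u ^ 2)]
        simpa using this
      · nlinarith
      · nlinarith
  rcases pos_and_pos_or_neg_and_neg_of_mul_pos hx with h | h
  · exact key u v huv (by linarith) (by linarith)
  · have := key v u (by linarith) (by linarith) (by linarith)
    rw [hilbertDensity_symm u, hilbertDensity_symm (a - u ^ 2)]
    exact ⟨this.1, by linarith [this.2]⟩

/-- As long as the images of `u` and `v` do not lie on different sides of the critical point, the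
expansion of the projective metric persists under iteration. -/
lemma hilbertDensity_le_growth (a : ℝ) {u x v : ℝ} (n : ℕ)
    (huv : ∀ i < n, 0 ≤ qorb a u i * qorb a v i) (hx : 0 < (x - u) * (v - x)) :
    hilbertDensity u x v ≤
        growth (qorb a x) n * hilbertDensity (qorb a u n) (qorb a x n) (qorb a v n) ∧
      0 < (qorb a x n - qorb a u n) * (qorb a v n - qorb a x n) := by
  induction n with
  | zero => simpa [growth_zero, qorb_zero] using hx
  | succ n ih =>
    obtain ⟨h1, h2⟩ := ih fun i hi => huv i (by omega)
    obtain ⟨h3, h4⟩ := hilbertDensity_lt a (huv n (by omega)) h2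
    simp only [qorb_succ, growth_succ]
    refine ⟨h1.trans ?_, h4⟩
    rw [mul_assoc]
    exact mul_le_mul_of_nonneg_left h3.le (growth_nonneg _ _)

/-- The inequality is strict as soon as one step is made. -/
lemma hilbertDensity_lt_growth (a : ℝ) {u x v : ℝ} {n : ℕ} (hn : 1 ≤ n)
    (huv : ∀ i < n, 0 ≤ qorb a u i * qorb a v i) (hx : 0 < (x - u) * (v - x)) :
    hilbertDensity u x v <
        growth (qorb a x) n * hilbertDensity (qorb a u n) (qorb a x n) (qorb a v n) := by
  have h1 := hilbertDensity_lt a (by simpa [qorb_zero] using huv 0 hn) hx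
  have h2 := hilbertDensity_le_growth a (u := qorb a u 1) (x := qorb a x 1) (v := qorb a v 1)
    (n - 1) (fun i hi => by
      rw [← qorb_add, ← qorb_add]; exact huv (1 + i) (by omega))
    (by simpa [qorb_succ, qorb_zero] using h1.2)
  obtain ⟨k, rfl⟩ := Nat.exists_eq_add_of_le hn
  rw [growth_add, qorb_add, qorb_add, qorb_add]
  have e : growth (qorb a x) 1 = |2 * x| := by simp [growth, qorb_zero]
  rw [e, mul_assoc]
  simp only [Nat.add_sub_cancel_left] at h2
  have e2 : (fun i => qorb a x (1 + i)) = qorb a (qorb a x 1) := by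
    funext i; rw [qorb_add]
  rw [e2]
  refine h1.1.trans_le (mul_le_mul_of_nonneg_left ?_ (abs_nonneg _))
  simpa [qorb_succ, qorb_zero] using h2.1

/-- Maximal monotone branches: around a point that does not reach `0` in fewer than `n` steps there
is an interval with the same property, whose endpoints reach `0` or are `±p`. -/
lemma exists_maximal_zeroFree {a p : ℝ} {n : ℕ} {x : ℝ} (hx : x ∈ Ioo (-p) p)
    (h0 : ∀ i < n, qorb a x i ≠ 0) :
    ∃ u v, -p ≤ u ∧ u < x ∧ x < v ∧ v ≤ p ∧ ZeroFree a n u v ∧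
      (u = -p ∨ ∃ i < n, qorb a u i = 0) ∧ (v = p ∨ ∃ i < n, qorb a v i = 0) := by
  set Z : Set ℝ := {y | ∏ i ∈ Finset.range n, qorb a y i = 0} with hZ
  have hZc : IsClosed Z := isClosed_eq
    (continuous_finsetProd _ fun i _ => continuous_qorb a i) continuous_const
  have memZ : ∀ y, y ∈ Z ↔ ∃ i < n, qorb a y i = 0 := fun y => by
    simp [hZ, Finset.prod_eq_zero_iff]
  have hxZ : x ∉ Z := fun hh => by
    obtain ⟨i, hi, h⟩ := (memZ x).1 hh
    exact h0 i hi h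
  obtain ⟨u, ⟨hu1, hu2⟩, hu3⟩ := (isCompact_Icc (a := -p) (b := x)).inter_left
    (hZc.union (isClosed_singleton (x := -p))) |>.exists_isGreatest
    ⟨-p, Or.inr rfl, le_refl _, hx.1.le⟩
  obtain ⟨v, ⟨hv1, hv2⟩, hv3⟩ := (isCompact_Icc (a := x) (b := p)).inter_left
    (hZc.union (isClosed_singleton (x := p))) |>.exists_isLeast
    ⟨p, Or.inr rfl, hx.2.le, le_refl _⟩
  have hux : u < x := lt_of_le_of_ne hu2.2 (by
    rintro rfl
    rcases hu1 with h | h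
    · exact hxZ h
    · exact absurd h hx.1.ne')
  have hxv : x < v := lt_of_le_of_ne hv2.1 (by
    rintro rfl
    rcases hv1 with h | h
    · exact hxZ h
    · exact absurd h hx.2.ne)
  refine ⟨u, v, hu2.1, hux, hxv, hv2.2, ?_, ?_, ?_⟩
  · intro i hi y hy hy0
    have hyZ : y ∈ Z := (memZ y).2 ⟨i, hi, hy0⟩
    rcases le_total y x with hyx | hyx
    · exact absurd (hu3 ⟨Or.inl hyZ, hu2.1.trans hy.1.le, hyx⟩) (not_le.2 hy.1)
    · exact absurd (hv3 ⟨Or.inl hyZ, hyx, hy.2.le.trans hv2.2⟩) (not_le.2 hy.2)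
  · exact hu1.symm.imp id (memZ u).1
  · exact hv1.symm.imp id (memZ v).1

namespace PreperiodicParam

variable {a p : ℝ}

lemma qorb_mem_postCrit (h : PreperiodicParam a p) {u : ℝ} {n : ℕ} (hn : 1 ≤ n)
    (hu : u = -p ∨ u = p ∨ ∃ i < n, qorb a u i = 0) : qorb a u n ∈ postCrit a p := by
  rcases hu with hu | hu | ⟨i, hi, hu⟩
  · exact Or.inl (h.qorb_p (Or.inl hu) hn)
  · exact Or.inl (h.qorb_p (Or.inr hu) hn)
  · refine Or.inr ⟨n - i, by omega, ?_⟩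
    rw [← hu, ← qorb_add, Nat.add_sub_cancel' hi.le]

lemma finite_postCrit (h : PreperiodicParam a p) : (postCrit a p).Finite := by
  obtain ⟨m, q, hm, hq, hper⟩ := h.exists_period
  refine Set.Finite.insert _ ((Set.finite_range (fun i : Fin (m + q) => qorb a 0 i)).subset ?_)
  have key : ∀ n, ∃ i < m + q, qorb a 0 n = qorb a 0 i := by
    intro n
    induction n using Nat.strong_induction_on with
    | _ n ih =>
      rcases lt_or_ge n (m + q) with hn | hn
      · exact ⟨n, hn, rfl⟩
      · obtain ⟨i, hi, hi'⟩ := ih (n - q) (by omega)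
        refine ⟨i, hi, ?_⟩
        rw [← hi', ← hper (n - q) (by omega), Nat.sub_add_cancel (by omega)]
  rintro y ⟨j, -, rfl⟩
  obtain ⟨i, hi, hi'⟩ := key j
  exact ⟨⟨i, hi⟩, hi'.symm⟩

/-- A point whose `n`-th image is `δ`-far from the postcritical set lies in a monotone branch of
`fⁿ`, and the expansion at it is at least `2δ` over the length of the branch. -/
lemma exists_zeroFree_growth (h : PreperiodicParam a p) {n : ℕ} (hn : 1 ≤ n) {x δ : ℝ}
    (hx : |x| ≤ p) (hδ : 0 < δ) (hfar : ∀ e ∈ postCrit a p, δ ≤ |qorb a x n - e|) :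
    ∃ u v, -p ≤ u ∧ u < x ∧ x < v ∧ v ≤ p ∧ ZeroFree a n u v ∧
      2 * δ / (v - u) ≤ growth (qorb a x) n := by
  have hnot : qorb a x n ∉ postCrit a p := fun hh => by
    have := hfar _ hh; simp at this; linarith
  have hx' : x ∈ Ioo (-p) p := by
    have := abs_le.1 hx
    refine ⟨lt_of_le_of_ne this.1 ?_, lt_of_le_of_ne this.2 ?_⟩
    · intro e; exact hnot (h.qorb_mem_postCrit hn (Or.inl e.symm))
    · intro e; exact hnot (h.qorb_mem_postCrit hn (Or.inr (Or.inl e)))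
  obtain ⟨u, v, hu, hux, hxv, hv, hZ, hu', hv'⟩ := exists_maximal_zeroFree (a := a) (n := n) hx'
    fun i hi h0 => hnot (h.qorb_mem_postCrit hn (Or.inr (Or.inr ⟨i, hi, h0⟩)))
  refine ⟨u, v, hu, hux, hxv, hv, hZ, ?_⟩
  have hpos : 0 < (x - u) * (v - x) := mul_pos (by linarith) (by linarith)
  have h1 := (hilbertDensity_le_growth a (x := x) n
    (fun i hi => hZ.mul_nonneg (hux.trans hxv).le hi) hpos).1
  have h2 : hilbertDensity (qorb a u n) (qorb a x n) (qorb a v n) ≤ 2 / δ := by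
    have e1 := hfar _ (h.qorb_mem_postCrit hn (hu'.imp id Or.inr))
    have e2 := hfar _ (h.qorb_mem_postCrit hn (Or.inr hv'))
    rw [abs_sub_comm] at e2
    unfold hilbertDensity
    have := one_div_le_one_div_of_le hδ e1
    have := one_div_le_one_div_of_le hδ e2
    calc _ ≤ 1 / δ + 1 / δ := by linarith
      _ = 2 / δ := by ring
  -- The density is smallest at the midpoint of the branch.
  have h3 : 4 / (v - u) ≤ hilbertDensity u x v := by
    unfold hilbertDensity
    have A : 0 < x - u := by linarith
    have B : 0 < v - x := by linarith
    rw [abs_of_pos A, abs_of_pos B, div_add_div _ _ A.ne' B.ne',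
      div_le_div_iff₀ (by linarith) (by positivity)]
    nlinarith [sq_nonneg ((x - u) - (v - x))]
  have h4 : 4 / (v - u) ≤ growth (qorb a x) n * (2 / δ) :=
    h3.trans (h1.trans (mul_le_mul_of_nonneg_left h2 (growth_nonneg _ _)))
  have : 2 * δ / (v - u) = 4 / (v - u) * (δ / 2) := by ring
  rw [this]
  calc 4 / (v - u) * (δ / 2) ≤ growth (qorb a x) n * (2 / δ) * (δ / 2) := by gcongr
    _ = growth (qorb a x) n := by field_simp

/-- The preceding bound for a branch of the largest possible length `2p`. -/
lemma le_growth_of_far (h : PreperiodicParam a p) {n : ℕ} (hn : 1 ≤ n) {x δ : ℝ}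
    (hx : |x| ≤ p) (hδ : 0 < δ) (hfar : ∀ e ∈ postCrit a p, δ ≤ |qorb a x n - e|) :
    δ / p ≤ growth (qorb a x) n := by
  obtain ⟨u, v, hu, hux, hxv, hv, -, hg⟩ := h.exists_zeroFree_growth hn hx hδ hfar
  refine le_trans ?_ hg
  have := h.p_pos
  rw [div_le_div_iff₀ this (by linarith)]
  nlinarith

end PreperiodicParam

/-! ### Repelling cycles and the postcritical set -/

lemma continuous_growth_qorb (a : ℝ) (n : ℕ) : Continuous fun x => growth (qorb a x) n :=
  continuous_finsetProd _ fun i _ => ((continuous_qorb a i).const_mul 2 |>.abs)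

lemma growth_qorb_add (a x : ℝ) (m n : ℕ) :
    growth (qorb a x) (m + n) = growth (qorb a x) m * growth (qorb a (qorb a x m)) n := by
  rw [growth_add]
  congr 2
  funext i
  rw [qorb_add]

lemma exists_growth_eq_slope (a : ℝ) {x y : ℝ} (hxy : x < y) (n : ℕ) :
    ∃ z ∈ Ioo x y, |qorb a y n - qorb a x n| = growth (qorb a z) n * (y - x) := by
  obtain ⟨z, hz, h⟩ := exists_hasDerivAt_eq_slope (fun x => qorb a x n) _ hxy
    (continuous_qorb a n).continuousOn fun z _ => hasDerivAt_qorb a z n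
  refine ⟨z, hz, ?_⟩
  have h1 : 0 < y - x := by linarith
  rw [eq_div_iff h1.ne'] at h
  rw [← h, abs_mul, abs_of_pos h1, abs_deriv_qorb]

/-- The mean value theorem for the iterates of `f`. -/
lemma exists_growth_eq_dist (a : ℝ) (x y : ℝ) (n : ℕ) :
    ∃ z, |z - x| ≤ |y - x| ∧ |qorb a y n - qorb a x n| = growth (qorb a z) n * |y - x| := by
  rcases lt_trichotomy x y with h | h | h
  · obtain ⟨z, hz, e⟩ := exists_growth_eq_slope a h n
    refine ⟨z, ?_, by rw [e, abs_of_pos (sub_pos.2 h)]⟩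
    rw [abs_of_pos (sub_pos.2 h), abs_of_pos (sub_pos.2 hz.1)]
    linarith [hz.2]
  · exact ⟨x, by simp, by simp [h]⟩
  · obtain ⟨z, hz, e⟩ := exists_growth_eq_slope a h n
    refine ⟨z, ?_, by rw [abs_sub_comm, e, abs_of_neg (sub_neg.2 h)]; ring⟩
    rw [abs_of_neg (sub_neg.2 h), abs_of_neg (sub_neg.2 hz.2)]
    linarith [hz.1]

lemma growth_qorb_eq_zero {a x : ℝ} {n : ℕ} (h : growth (qorb a x) n = 0) :
    ∃ i < n, qorb a x i = 0 := by
  simpa [growth, Finset.prod_eq_zero_iff] using h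

lemma ZeroFree.injOn {a : ℝ} {n : ℕ} {u v : ℝ} (h : ZeroFree a n u v) :
    InjOn (fun x => qorb a x n) (Icc u v) := by
  have key : ∀ x ∈ Icc u v, ∀ y ∈ Icc u v, x < y → qorb a x n ≠ qorb a y n := by
    intro x hx y hy hxy he
    obtain ⟨z, hz, e⟩ := exists_growth_eq_slope a hxy n
    rw [he, sub_self, abs_zero, eq_comm, mul_eq_zero] at e
    rcases e with e | e
    · obtain ⟨i, hi, h0⟩ := growth_qorb_eq_zero e
      exact h i hi z ⟨hx.1.trans_lt hz.1, hz.2.trans_le hy.2⟩ h0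
    · linarith
  intro x hx y hy hxy
  by_contra hne
  rcases lt_or_gt_of_ne hne with hlt | hlt
  · exact key x hx y hy hlt hxy
  · exact key y hy x hx hlt hxy.symm

lemma ZeroFree.monotone {a : ℝ} {n : ℕ} {u v : ℝ} (h : ZeroFree a n u v) (huv : u ≤ v) :
    StrictMonoOn (fun x => qorb a x n) (Icc u v) ∨ StrictAntiOn (fun x => qorb a x n) (Icc u v) :=
  ContinuousOn.strictMonoOn_of_injOn_Icc' huv (continuous_qorb a n).continuousOn h.injOn

namespace PreperiodicParam

variable {a p : ℝ}

lemma exists_period_mul (h : PreperiodicParam a p) :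
    ∃ m q : ℕ, 1 ≤ m ∧ 1 ≤ q ∧ ∀ n, m ≤ n → ∀ k, qorb a 0 (n + k * q) = qorb a 0 n := by
  obtain ⟨m, q, hm, hq, hper⟩ := h.exists_period
  refine ⟨m, q, hm, hq, fun n hn k => ?_⟩
  induction k with
  | zero => simp
  | succ k ih => rw [show n + (k + 1) * q = n + k * q + q by ring, hper _ (by omega), ih]

/-- The orbit of a preimage of the critical point is finite, hence not strictly monotone along any
arithmetic progression of times. -/
lemma exists_recurrence (h : PreperiodicParam a p) {s : ℝ} {i : ℕ} (hs : qorb a s i = 0) {n : ℕ}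
    (hn : 1 ≤ n) : ∃ k l : ℕ, k < l ∧ qorb a s (k * n) = qorb a s (l * n) := by
  obtain ⟨m, q, hm, hq, hper⟩ := h.exists_period_mul
  have hle : i + m ≤ (i + m) * n := Nat.le_mul_of_pos_right _ hn
  refine ⟨i + m, i + m + q, by omega, ?_⟩
  rw [show (i + m) * n = i + ((i + m) * n - i) by omega,
    show (i + m + q) * n = i + (((i + m) * n - i) + n * q) by
      rw [add_mul _ q, mul_comm q]; omega, qorb_add, qorb_add, hs, hper _ (by omega)]

lemma qorb_neg_p (h : PreperiodicParam a p) (n : ℕ) : qorb a (-p) n = -p := by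
  rcases Nat.eq_zero_or_pos n with rfl | hn
  · rfl
  · exact h.qorb_p (Or.inl rfl) hn

lemma qorb_ne_zero_of_periodic (h : PreperiodicParam a p) {e : ℝ} {r : ℕ} (hr : 1 ≤ r)
    (hper : qorb a e r = e) (i : ℕ) : qorb a e i ≠ 0 := fun h0 =>
  h.qorb_zero_ne hr (by rw [← h0, ← qorb_add, add_comm, qorb_add, hper])

/-- Every cycle of `f` is hyperbolic repelling. Otherwise the expansion of the projective metric
forces a monotone branch around a point of the cycle to be pulled towards it from one side, and the
endpoint of the branch, which reaches the critical point, would have an infinite orbit. -/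
lemma one_lt_growth_of_periodic (h : PreperiodicParam a p) {e : ℝ} (he : |e| ≤ p) {r : ℕ}
    (hr : 1 ≤ r) (hper : qorb a e r = e) : 1 < growth (qorb a e) r := by
  rcases eq_or_ne e (-p) with rfl | hep
  · have : growth (qorb a (-p)) r = (2 * p) ^ r := by
      simp [growth, h.qorb_neg_p, abs_mul, abs_of_pos h.p_pos]
    rw [this]
    exact one_lt_pow₀ (by linarith [h.one_lt_p]) (by omega)
  have hep' : e ≠ p := fun hh => hep (by rw [← hper]; exact h.qorb_p (Or.inr hh) hr)
  have hn0 := h.qorb_ne_zero_of_periodic hr hper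
  by_contra! hle
  have hgr : growth (qorb a e) (r + r) ≤ 1 := by
    rw [growth_qorb_add, hper]
    exact mul_le_one₀ hle (growth_nonneg _ _) hle
  have hper2 : qorb a e (r + r) = e := by rw [qorb_add, hper, hper]
  set n := r + r with hn
  have hn1 : 1 ≤ n := by omega
  obtain ⟨s, t, hs, hse, het, ht, hZ, hs', ht'⟩ := exists_maximal_zeroFree (a := a) (n := n)
    (x := e) ⟨lt_of_le_of_ne (abs_le.1 he).1 hep.symm, lt_of_le_of_ne (abs_le.1 he).2 hep'⟩
    fun i _ => hn0 i
  -- The multiplier of `e` under `fⁿ`, where `n = 2r`, is a square, so that `fⁿ` increases on the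
  -- branch.
  have hmono : StrictMonoOn (fun x => qorb a x n) (Icc s t) := by
    rcases hZ.monotone (hse.trans het).le with hm | hm
    · exact hm
    · exfalso
      have hd := (hasDerivAt_qorb a e n)
      have hpos : 0 < ∏ i ∈ Finset.range n, (-2 * qorb a e i) := by
        rw [hn, Finset.prod_range_add]
        have : ∀ i ∈ Finset.range r, (-2 * qorb a e (r + i)) = -2 * qorb a e i := fun i _ => by
          rw [qorb_add, hper]
        rw [Finset.prod_congr rfl this]
        exact mul_self_pos.2 (Finset.prod_ne_zero_iff.2 fun i _ =>
          mul_ne_zero (by norm_num) (hn0 i))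
      have hle0 : ∏ i ∈ Finset.range n, (-2 * qorb a e i) ≤ 0 := by
        have := hm.antitoneOn.derivWithin_nonpos (x := e)
        rwa [hd.hasDerivWithinAt.derivWithin
          (uniqueDiffOn_Icc (hse.trans het) e ⟨hse.le, het.le⟩)] at this
      linarith
  have hGe : (fun x => qorb a x n) e = e := hper2
  -- If `fⁿ` moved `u` and `v` away from `e` (or fixed them), the projective density at `e` would
  -- not increase, although the multiplier is at most `1`: this contradicts
  -- `hilbertDensity_lt_growth`.
  have hnot : ∀ u ∈ Ico s e, ∀ v ∈ Ioc e t, ¬ (qorb a u n ≤ u ∧ v ≤ qorb a v n) := by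
    rintro u hu v hv ⟨h1, h2⟩
    have hlt := hilbertDensity_lt_growth a (x := e) hn1
      (fun i hi => (hZ.mono le_rfl hu.1 hv.2).mul_nonneg (hu.2.trans hv.1).le hi)
      (mul_pos (sub_pos.2 hu.2) (sub_pos.2 hv.1))
    rw [hper2] at hlt
    have hR : 0 ≤ hilbertDensity (qorb a u n) e (qorb a v n) := by
      unfold hilbertDensity; positivity
    have h3 : hilbertDensity (qorb a u n) e (qorb a v n) ≤ hilbertDensity u e v := by
      unfold hilbertDensity
      have a1 : 0 < e - u := sub_pos.2 hu.2
      have a2 : 0 < v - e := sub_pos.2 hv.1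
      rw [abs_of_pos a1, abs_of_pos a2, abs_of_pos (by linarith : 0 < e - qorb a u n),
        abs_of_pos (by linarith : 0 < qorb a v n - e)]
      exact add_le_add (one_div_le_one_div_of_le a1 (by linarith))
        (one_div_le_one_div_of_le a2 (by linarith))
    nlinarith
  -- Thus on one side of `e` every point is moved towards `e`, and the orbit of the endpoint of the
  -- branch under `fⁿ` is strictly monotone.
  by_cases hcase : ∀ u ∈ Ico s e, u < qorb a u n
  · rcases hs' with rfl | ⟨i, -, hi⟩
    · have := hcase (-p) ⟨le_refl _, hse⟩
      rw [h.qorb_neg_p] at this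
      exact lt_irrefl _ this
    · have hmem : ∀ k : ℕ, qorb a s (k * n) ∈ Ico s e := by
        intro k
        induction k with
        | zero => simpa [qorb_zero] using hse
        | succ k ih =>
          rw [show (k + 1) * n = k * n + n by ring, qorb_add]
          refine ⟨ih.1.trans (hcase _ ih).le, ?_⟩
          have := hmono ⟨ih.1, ih.2.le.trans het.le⟩ ⟨hse.le, het.le⟩ ih.2
          rwa [hGe] at this
      have hsm : StrictMono fun k : ℕ => qorb a s (k * n) := strictMono_nat_of_lt_succ fun k => by
        rw [show (k + 1) * n = k * n + n by ring, qorb_add]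
        exact hcase _ (hmem k)
      obtain ⟨k, l, hkl, heq⟩ := h.exists_recurrence hi hn1
      exact (hsm hkl).ne heq
  · push Not at hcase
    obtain ⟨u, hu, hu'⟩ := hcase
    have hcase : ∀ v ∈ Ioc e t, qorb a v n < v := fun v hv => by
      by_contra! hh; exact hnot u hu v hv ⟨hu', hh⟩
    rcases ht' with rfl | ⟨i, -, hi⟩
    · have := hmono ⟨hse.le, het.le⟩ ⟨(hse.trans het).le, le_refl _⟩ het
      rw [hGe] at this
      simp only at this
      rw [h.qorb_p (Or.inr rfl) hn1] at this
      linarith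
    · have hmem : ∀ k : ℕ, qorb a t (k * n) ∈ Ioc e t := by
        intro k
        induction k with
        | zero => simpa [qorb_zero] using het
        | succ k ih =>
          rw [show (k + 1) * n = k * n + n by ring, qorb_add]
          refine ⟨?_, (hcase _ ih).le.trans ih.2⟩
          have := hmono ⟨hse.le, het.le⟩ ⟨hse.le.trans ih.1.le, ih.2⟩ ih.1
          rwa [hGe] at this
      have hsm : StrictAnti fun k : ℕ => qorb a t (k * n) := strictAnti_nat_of_succ_lt fun k => by
        rw [show (k + 1) * n = k * n + n by ring, qorb_add]
        exact hcase _ (hmem k)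
      obtain ⟨k, l, hkl, heq⟩ := h.exists_recurrence hi hn1
      exact (hsm hkl).ne heq.symm

lemma abs_le_of_mem_postCrit (h : PreperiodicParam a p) {e : ℝ} (he : e ∈ postCrit a p) :
    |e| ≤ p := by
  rcases he with rfl | ⟨j, -, rfl⟩
  · rw [abs_neg, abs_of_pos h.p_pos]
  · exact h.qorb_le (by simpa using h.p_pos.le) j

lemma qorb_mem_postCrit_of_mem (h : PreperiodicParam a p) {e : ℝ} (he : e ∈ postCrit a p) (n : ℕ) :
    qorb a e n ∈ postCrit a p := by
  rcases he with rfl | ⟨j, hj, rfl⟩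
  · exact Or.inl (h.qorb_neg_p n)
  · exact Or.inr ⟨j + n, by omega, qorb_add a 0 j n⟩

lemma ne_zero_of_mem_postCrit (h : PreperiodicParam a p) {e : ℝ} (he : e ∈ postCrit a p) :
    e ≠ 0 := by
  rcases he with rfl | ⟨j, hj, rfl⟩
  · exact (neg_lt_zero.2 h.p_pos).ne
  · exact h.qorb_zero_ne hj

/-- A common iterate of `f` expands by the factor `2` around every postcritical point. -/
lemma exists_postCrit_expansion (h : PreperiodicParam a p) :
    ∃ Q : ℕ, 1 ≤ Q ∧ ∃ δ : ℝ, 0 < δ ∧ ∀ e ∈ postCrit a p, ∀ y, |y - e| ≤ δ →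
      2 ≤ growth (qorb a y) Q := by
  obtain ⟨m, q, hm, hq, hper⟩ := h.exists_period
  have hfix : ∀ e ∈ postCrit a p, qorb a (qorb a e m) q = qorb a e m := by
    rintro e (rfl | ⟨j, hj, rfl⟩)
    · simp [h.qorb_neg_p]
    · rw [← qorb_add, ← qorb_add, ← add_assoc, hper _ (by omega), qorb_add]
  have hgrow : ∀ e ∈ postCrit a p, ∀ᶠ k : ℕ in atTop, 4 ≤ growth (qorb a e) (m + k * q) := by
    intro e he
    set c := qorb a e m
    have hc : ∀ k : ℕ, qorb a c (k * q) = c := fun k => by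
      induction k with
      | zero => simp [qorb_zero]
      | succ k ih => rw [show (k + 1) * q = k * q + q by ring, qorb_add, ih, hfix e he]
    have hck : ∀ k : ℕ, growth (qorb a c) (k * q) = growth (qorb a c) q ^ k := fun k => by
      induction k with
      | zero => simp [growth_zero]
      | succ k ih => rw [show (k + 1) * q = k * q + q by ring, growth_qorb_add, ih, hc, pow_succ]
    have h1 : 1 < growth (qorb a c) q := h.one_lt_growth_of_periodic
      (h.abs_le_of_mem_postCrit (h.qorb_mem_postCrit_of_mem he m)) hq (hfix e he)
    have h2 : 0 < growth (qorb a e) m := by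
      refine lt_of_le_of_ne (growth_nonneg _ _) fun h0 => ?_
      obtain ⟨i, -, hi⟩ := growth_qorb_eq_zero h0.symm
      exact h.ne_zero_of_mem_postCrit (h.qorb_mem_postCrit_of_mem he i) hi
    have h3 := (tendsto_pow_atTop_atTop_of_one_lt h1).const_mul_atTop h2
    filter_upwards [h3.eventually_ge_atTop 4] with k hk
    rw [growth_qorb_add, hck]
    exact hk
  obtain ⟨k, hk⟩ := ((eventually_all_finite h.finite_postCrit).2 hgrow).exists
  refine ⟨m + k * q, by omega, ?_⟩
  have hδ : ∀ e ∈ postCrit a p, ∀ᶠ δ : ℝ in 𝓝[>] 0, ∀ y, |y - e| ≤ δ →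
      2 ≤ growth (qorb a y) (m + k * q) := by
    intro e he
    have := (continuous_growth_qorb a (m + k * q)).continuousAt.eventually_const_lt
      (show (2 : ℝ) < growth (qorb a e) (m + k * q) by linarith [hk e he])
    obtain ⟨δ, hδ, hball⟩ := Metric.eventually_nhds_iff.1 this
    filter_upwards [Ioo_mem_nhdsGT hδ] with δ' hδ' y hy
    exact (hball (by rw [Real.dist_eq]; exact hy.trans_lt hδ'.2)).le
  obtain ⟨δ, hδ1, hδ2⟩ := (((eventually_all_finite h.finite_postCrit).2 hδ).and
    self_mem_nhdsWithin).exists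
  exact ⟨δ, hδ2, hδ1⟩

lemma growth_le (h : PreperiodicParam a p) {x : ℝ} (hx : |x| ≤ p) (n : ℕ) :
    growth (qorb a x) n ≤ 4 ^ n := by
  induction n with
  | zero => simp [growth_zero]
  | succ n ih =>
    rw [growth_succ, pow_succ]
    have : |2 * qorb a x n| ≤ 4 := by
      rw [abs_mul, abs_two]; linarith [h.qorb_le hx n, h.p_lt_two]
    exact mul_le_mul ih this (abs_nonneg _) (by positivity)

lemma dist_qorb_le (h : PreperiodicParam a p) {x y : ℝ} (hx : |x| ≤ p) (hy : |y| ≤ p) (n : ℕ) :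
    |qorb a y n - qorb a x n| ≤ 4 ^ n * |y - x| := by
  induction n with
  | zero => simp [qorb_zero]
  | succ n ih =>
    have e : qorb a y (n + 1) - qorb a x (n + 1) =
        -(qorb a y n + qorb a x n) * (qorb a y n - qorb a x n) := by
      rw [qorb_succ, qorb_succ]; ring
    rw [e, abs_mul, abs_neg, pow_succ]
    have : |qorb a y n + qorb a x n| ≤ 4 := by
      refine (abs_add_le _ _).trans ?_
      linarith [h.qorb_le hx n, h.qorb_le hy n, h.p_lt_two]
    calc _ ≤ 4 * (4 ^ n * |y - x|) := by gcongr
      _ = _ := by ring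

/-- Distinct postcritical points are uniformly separated, there being finitely many of them. -/
lemma exists_gap (h : PreperiodicParam a p) :
    ∃ γ : ℝ, 0 < γ ∧ ∀ e ∈ postCrit a p, ∀ e' ∈ postCrit a p, |e - e'| < γ → e = e' := by
  have : ∀ z ∈ postCrit a p ×ˢ postCrit a p, ∀ᶠ γ : ℝ in 𝓝[>] 0,
      |z.1 - z.2| < γ → z.1 = z.2 := by
    intro z _
    by_cases hz : z.1 = z.2
    · exact Eventually.of_forall fun _ _ => hz
    · filter_upwards [Ioo_mem_nhdsGT (abs_pos.2 (sub_ne_zero.2 hz))] with γ hγ h'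
      exact absurd h' (not_lt.2 hγ.2.le)
  obtain ⟨γ, h1, h2⟩ := (((eventually_all_finite
    (h.finite_postCrit.prod h.finite_postCrit)).2 this).and self_mem_nhdsWithin).exists
  exact ⟨γ, h2, fun e he e' he' => h1 (e, e') ⟨he, he'⟩⟩

/-- An orbit that never meets the postcritical set is infinitely often at a definite distance from
it. -/
lemma exists_far_times (h : PreperiodicParam a p) :
    ∃ δ : ℝ, 0 < δ ∧ ∀ x, |x| ≤ p → (∀ n, qorb a x n ∉ postCrit a p) →
      ∀ n₀, ∃ n ≥ n₀, ∀ e ∈ postCrit a p, δ ≤ |qorb a x n - e| := by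
  obtain ⟨Q, hQ, δ, hδ, hexp⟩ := h.exists_postCrit_expansion
  obtain ⟨γ, hγ, hgap⟩ := h.exists_gap
  set L : ℝ := 4 ^ Q
  have hL : 0 < L := by positivity
  set η := min δ (γ / (L + 2)) with hη
  have hη0 : 0 < η := lt_min hδ (by positivity)
  have hηγ : (L + 1) * η < γ := by
    have : η ≤ γ / (L + 2) := min_le_right _ _
    rw [le_div_iff₀ (by positivity)] at this
    nlinarith
  refine ⟨η, hη0, fun x hx hP n₀ => ?_⟩
  by_contra! hno
  choose e he heη using fun k : ℕ => hno (n₀ + k * Q) (by omega)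
  -- Neighbouring postcritical points are separated by `γ`, so the point that the orbit follows
  -- moves along its own orbit.
  have hstep : ∀ k, e (k + 1) = qorb a (e k) Q := by
    intro k
    refine hgap _ (he _) _ (h.qorb_mem_postCrit_of_mem (he k) Q) ?_
    have h1 := heη (k + 1)
    rw [show n₀ + (k + 1) * Q = n₀ + k * Q + Q by ring, qorb_add] at h1
    have h2 := h.dist_qorb_le (h.abs_le_of_mem_postCrit (he k)) (h.qorb_le hx (n₀ + k * Q)) Q
    have h3 : L * |qorb a x (n₀ + k * Q) - e k| ≤ L * η := by gcongr; exact (heη k).le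
    calc |e (k + 1) - qorb a (e k) Q|
        = |(qorb a (qorb a x (n₀ + k * Q)) Q - qorb a (e k) Q) -
            (qorb a (qorb a x (n₀ + k * Q)) Q - e (k + 1))| := by congr 1; ring
      _ ≤ _ := abs_sub _ _
      _ < γ := by linarith
  -- Hence the distance to it doubles in each block of length `Q`.
  have hdist : ∀ k : ℕ, 2 ^ k * |qorb a x n₀ - e 0| ≤ |qorb a x (n₀ + k * Q) - e k| := by
    intro k
    induction k with
    | zero => simp
    | succ k ih =>
      rw [show n₀ + (k + 1) * Q = n₀ + k * Q + Q by ring, qorb_add, hstep]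
      obtain ⟨z, hz, hz'⟩ := exists_growth_eq_dist a (e k) (qorb a x (n₀ + k * Q)) Q
      rw [hz', pow_succ]
      have := hexp (e k) (he k) z (hz.trans ((heη k).le.trans (min_le_left _ _)))
      nlinarith [abs_nonneg (qorb a x (n₀ + k * Q) - e k)]
  have hpos : 0 < |qorb a x n₀ - e 0| := abs_pos.2 (sub_ne_zero.2 fun hh => hP n₀ (hh ▸ he 0))
  have hlim := (tendsto_pow_atTop_atTop_of_one_lt (one_lt_two (α := ℝ))).atTop_mul_const hpos
  obtain ⟨k, hk⟩ := (hlim.eventually_gt_atTop η).exists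
  linarith [hdist k, heη k]

/-- A strictly monotone orbit of `fⁿ` would converge to a fixed point of `fⁿ`, which repels. -/
lemma not_monotone_orbit (h : PreperiodicParam a p) {n : ℕ} (hn : 1 ≤ n) {y : ℕ → ℝ}
    (hy : ∀ k, y (k + 1) = qorb a (y k) n) (hyp : ∀ k, |y k| ≤ p)
    (hmono : StrictMono y ∨ StrictAnti y) : False := by
  have hconv : ∃ e, Tendsto y atTop (𝓝 e) ∧ ∀ k, |y (k + 1) - e| < |y k - e| := by
    rcases hmono with hm | hm
    · have hb : BddAbove (range y) := ⟨p, by rintro _ ⟨k, rfl⟩; exact (abs_le.1 (hyp k)).2⟩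
      refine ⟨_, tendsto_atTop_ciSup hm.monotone hb, fun k => ?_⟩
      have h1 := le_ciSup hb (k + 1)
      have h2 := hm (Nat.lt_succ_self k)
      rw [abs_of_nonpos (by linarith), abs_of_nonpos (by linarith)]
      linarith
    · have hb : BddBelow (range y) := ⟨-p, by rintro _ ⟨k, rfl⟩; exact (abs_le.1 (hyp k)).1⟩
      refine ⟨_, tendsto_atTop_ciInf hm.antitone hb, fun k => ?_⟩
      have h1 := ciInf_le hb (k + 1)
      have h2 := hm (Nat.lt_succ_self k)
      rw [abs_of_nonneg (by linarith), abs_of_nonneg (by linarith)]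
      linarith
  obtain ⟨e, he, hlt⟩ := hconv
  have hfix : qorb a e n = e := by
    refine tendsto_nhds_unique ?_ ((tendsto_add_atTop_iff_nat 1).2 he)
    simp only [hy]
    exact ((continuous_qorb a n).tendsto e).comp he
  have hep : |e| ≤ p := le_of_tendsto' he.abs hyp
  have h1 := h.one_lt_growth_of_periodic hep hn hfix
  obtain ⟨δ, hδ, hball⟩ := Metric.eventually_nhds_iff.1
    ((continuous_growth_qorb a n).continuousAt.eventually_const_lt h1)
  -- Near `e` the distance to `e` increases, although `y` converges to `e` monotonically.
  obtain ⟨k, hk⟩ := (he.eventually (Metric.ball_mem_nhds e hδ)).exists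
  obtain ⟨z, hz, hz'⟩ := exists_growth_eq_dist a e (y k) n
  rw [Real.dist_eq] at hk
  have h2 := hball (by rw [Real.dist_eq]; exact hz.trans_lt hk)
  have h3 := hlt k
  rw [hy k] at h3
  nth_rewrite 1 [← hfix] at h3
  rw [hz'] at h3
  nlinarith [abs_nonneg (y k - e)]

end PreperiodicParam

lemma finite_qorb_preimage (a : ℝ) {S : Set ℝ} (hS : S.Finite) (n : ℕ) :
    {x | qorb a x n ∈ S}.Finite := by
  induction n generalizing S with
  | zero => simpa [qorb_zero] using hS
  | succ n ih =>
    have : {x | a - x ^ 2 ∈ S}.Finite := by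
      refine Set.Finite.preimage' hS (f := fun x : ℝ => a - x ^ 2) fun b _ => ?_
      refine (Set.toFinite {√(a - b), -√(a - b)}).subset fun x hx => ?_
      have hx' : x ^ 2 = a - b := by
        simp only [mem_preimage, mem_singleton_iff] at hx; linarith
      have h0 : 0 ≤ a - b := hx' ▸ sq_nonneg x
      have : x ^ 2 = √(a - b) ^ 2 := by rw [Real.sq_sqrt h0, hx']
      exact sq_eq_sq_iff_eq_or_eq_neg.1 this
    simpa [qorb_succ] using ih this

/-! ### Absence of homtervals and expansion away from the critical point -/

/-- If the `n`-th and the `(n + q)`-th image of an interval overlap, then all images at times `n +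
kq` form a chain of overlapping intervals, whose union is connected. -/
lemma isPreconnected_iUnion_image {a : ℝ} {x y : ℝ} {n q : ℕ} {z : ℝ}
    (hz1 : z ∈ (fun w => qorb a w n) '' Ioo x y)
    (hz2 : z ∈ (fun w => qorb a w (n + q)) '' Ioo x y) :
    IsPreconnected (⋃ k : ℕ, (fun w => qorb a w (n + k * q)) '' Ioo x y) := by
  refine IsPreconnected.iUnion_of_chain (fun k => ?_) fun k => ?_
  · exact isPreconnected_Ioo.image _ (continuous_qorb a _).continuousOn
  · obtain ⟨w1, hw1, e1⟩ := hz1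
    obtain ⟨w2, hw2, e2⟩ := hz2
    refine ⟨qorb a z (k * q), ⟨w1, hw1, ?_⟩, ⟨w2, hw2, ?_⟩⟩
    · simp only at e1 ⊢
      rw [qorb_add, e1]
    · simp only at e2 ⊢
      rw [Order.succ_eq_add_one, show n + (k + 1) * q = n + q + k * q by ring, qorb_add, e2]

namespace PreperiodicParam

variable {a p : ℝ}

/-- There is no interval on which all iterates of `f` are monotone. -/
lemma not_forall_zeroFree (h : PreperiodicParam a p) {u v : ℝ} (hu : -p ≤ u) (huv : u < v)
    (hv : v ≤ p) : ¬ ∀ n, ZeroFree a n u v := by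
  intro hZ
  have habs : ∀ w ∈ Icc u v, |w| ≤ p := fun w hw =>
    abs_le.2 ⟨hu.trans hw.1, hw.2.trans hv⟩
  -- A point of the interval that never meets the postcritical set.
  obtain ⟨x, hxm, hxP⟩ : ∃ x ∈ Ioo u v, ∀ n, qorb a x n ∉ postCrit a p := by
    have hc : (⋃ n, {x | qorb a x n ∈ postCrit a p}).Countable :=
      countable_iUnion fun n => (finite_qorb_preimage a h.finite_postCrit n).countable
    obtain ⟨x, hx1, hx2⟩ := (hc.dense_compl ℝ).exists_mem_open isOpen_Ioo (nonempty_Ioo.2 huv)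
    exact ⟨x, hx2, fun n hn => hx1 (mem_iUnion.2 ⟨n, hn⟩)⟩
  set y := (x + v) / 2 with hy
  have hxy : x < y := by rw [hy]; linarith [hxm.2]
  have hyv : y < v := by rw [hy]; linarith [hxm.2]
  have hZxy : ∀ n, ZeroFree a n x y := fun n => (hZ n).mono le_rfl hxm.1.le hyv.le
  obtain ⟨δ, hδ, hfar⟩ := h.exists_far_times
  have hxp := habs x ⟨hxm.1.le, hxm.2.le⟩
  have hyp := habs y ⟨(hxm.1.trans hxy).le, hyv.le⟩
  -- The images of `(x, y)` are infinitely often of a definite length.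
  set c := min (δ / 2) (δ / 2 / p * (y - x)) with hc
  have hp0 := h.p_pos
  have hc0 : 0 < c := lt_min (by positivity) (mul_pos (by positivity) (by linarith))
  have hlen : ∀ n₀, ∃ n ≥ n₀, c ≤ |qorb a y n - qorb a x n| := by
    intro n₀
    obtain ⟨n, hn, hn'⟩ := hfar x hxp hxP (n₀ + 1)
    refine ⟨n, by omega, ?_⟩
    by_cases hbig : δ / 2 ≤ |qorb a y n - qorb a x n|
    · exact (min_le_left _ _).trans hbig
    push Not at hbig
    obtain ⟨z, hz, e⟩ := exists_growth_eq_slope a hxy n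
    have hzx : |qorb a z n - qorb a x n| ≤ |qorb a y n - qorb a x n| := by
      have mx : x ∈ Icc x y := ⟨le_rfl, hxy.le⟩
      have mz : z ∈ Icc x y := ⟨hz.1.le, hz.2.le⟩
      have my : y ∈ Icc x y := ⟨hxy.le, le_rfl⟩
      rcases (hZxy n).monotone hxy.le with hm | hm
      · have h1 := hm mx mz hz.1
        have h2 := hm mz my hz.2
        simp only at h1 h2
        rw [abs_of_pos (by linarith), abs_of_pos (by linarith)]
        linarith
      · have h1 := hm mx mz hz.1
        have h2 := hm mz my hz.2
        simp only at h1 h2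
        rw [abs_of_neg (by linarith), abs_of_neg (by linarith)]
        linarith
    have hzp := habs z ⟨(hxm.1.trans hz.1).le, (hz.2.trans hyv).le⟩
    have hg := h.le_growth_of_far (x := z) (δ := δ / 2) (n := n) (by omega) hzp (by linarith)
      fun e he => by
        have h1 := hn' e he
        have h2 := abs_sub_abs_le_abs_sub (qorb a x n - e) (qorb a x n - qorb a z n)
        rw [abs_sub_comm (qorb a x n) (qorb a z n)] at h2
        rw [show qorb a x n - e - (qorb a x n - qorb a z n) = qorb a z n - e by ring] at h2
        linarith
    refine (min_le_right _ _).trans ?_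
    rw [e]
    exact mul_le_mul_of_nonneg_right hg (by linarith)
  -- Hence two of these images overlap.
  obtain ⟨n, q, hq, z, hz1, hz2⟩ : ∃ n q : ℕ, 1 ≤ q ∧ ∃ z,
      z ∈ (fun w => qorb a w n) '' Ioo x y ∧ z ∈ (fun w => qorb a w (n + q)) '' Ioo x y := by
    choose N hN1 hN2 using hlen
    have : ∃ ν : ℕ → ℕ, StrictMono ν ∧ ∀ k, c ≤ |qorb a y (ν k) - qorb a x (ν k)| := by
      obtain ⟨ν, h1, h2⟩ := Filter.extraction_of_frequently_atTop
        (P := fun n => c ≤ |qorb a y n - qorb a x n|)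
        (frequently_atTop.2 fun n₀ => ⟨N n₀, hN1 n₀, hN2 n₀⟩)
      exact ⟨ν, h1, h2⟩
    obtain ⟨ν, hν1, hν2⟩ := this
    obtain ⟨⟨X, Y⟩, -, φ, hφ, hlim⟩ := (isCompact_Icc (a := -p) (b := p) |>.prod
      (isCompact_Icc (a := -p) (b := p))).tendsto_subseq
      (x := fun k => (qorb a x (ν k), qorb a y (ν k)))
      fun k => ⟨abs_le.1 (h.qorb_le hxp _), abs_le.1 (h.qorb_le hyp _)⟩
    have hX : Tendsto (fun k => qorb a x (ν (φ k))) atTop (𝓝 X) :=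
      (continuous_fst.tendsto _).comp hlim
    have hY : Tendsto (fun k => qorb a y (ν (φ k))) atTop (𝓝 Y) :=
      (continuous_snd.tendsto _).comp hlim
    have hXY : c ≤ |Y - X| := ge_of_tendsto' (hY.sub hX).abs fun k => hν2 _
    have hne : Y - X ≠ 0 := fun h0 => by rw [h0, abs_zero] at hXY; linarith
    have hmem : ∀ᶠ k in atTop, (X + Y) / 2 ∈ (fun w => qorb a w (ν (φ k))) '' Ioo x y := by
      rcases lt_or_gt_of_ne hne with hlt | hlt
      · filter_upwards [hX.eventually_const_lt (show (X + Y) / 2 < X by linarith),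
          hY.eventually_lt_const (show Y < (X + Y) / 2 by linarith)] with k h1 h2
        exact intermediate_value_Ioo' hxy.le (continuous_qorb a _).continuousOn ⟨h2, h1⟩
      · filter_upwards [hX.eventually_lt_const (show X < (X + Y) / 2 by linarith),
          hY.eventually_const_lt (show (X + Y) / 2 < Y by linarith)] with k h1 h2
        exact intermediate_value_Ioo hxy.le (continuous_qorb a _).continuousOn ⟨h1, h2⟩
    obtain ⟨k, hk⟩ := eventually_atTop.1 hmem
    have hlt : ν (φ k) < ν (φ (k + 1)) := hν1 (hφ (Nat.lt_succ_self k))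
    refine ⟨ν (φ k), ν (φ (k + 1)) - ν (φ k), by omega, (X + Y) / 2, hk k le_rfl, ?_⟩
    rw [Nat.add_sub_cancel' hlt.le]
    exact hk (k + 1) (Nat.le_succ k)
  -- The union of the images under iterates of `f^q` is an interval mapped into itself by `f^{2q}`,
  -- which is increasing there.
  set M := ⋃ k : ℕ, (fun w => qorb a w (n + k * q)) '' Ioo x y with hM
  have hMc : IsPreconnected M := isPreconnected_iUnion_image hz1 hz2
  have hMo : M.OrdConnected := hMc.ordConnected
  have hMp : ∀ w ∈ M, |w| ≤ p := by
    intro w hw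
    obtain ⟨k, w', hw', rfl⟩ := mem_iUnion.1 hw
    exact h.qorb_le (habs _ ⟨(hxm.1.trans hw'.1).le, (hw'.2.trans hyv).le⟩) _
  have hM0 : ∀ w ∈ M, ∀ i, qorb a w i ≠ 0 := by
    intro w hw i
    obtain ⟨k, w', hw', rfl⟩ := mem_iUnion.1 hw
    simp only
    rw [← qorb_add]
    exact hZxy (n + k * q + i + 1) _ (Nat.lt_succ_self _) w' hw'
  have hMq : ∀ w ∈ M, qorb a w q ∈ M := by
    intro w hw
    obtain ⟨k, w', hw', rfl⟩ := mem_iUnion.1 hw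
    refine mem_iUnion.2 ⟨k + 1, w', hw', ?_⟩
    simp only
    rw [← qorb_add]
    ring_nf
  have hM2 : ∀ w ∈ M, qorb a w (q + q) ∈ M := fun w hw => by
    rw [qorb_add]; exact hMq _ (hMq _ hw)
  -- The derivative of `f^q` has constant sign on the interval, so that of `f^{2q}`, a product of
  -- two values of it, is positive.
  have hsgn : ∀ w ∈ M, 0 < ∏ i ∈ Finset.range (q + q), (-2 * qorb a w i) := by
    intro w hw
    rw [Finset.prod_range_add]
    simp only [qorb_add]
    set D : ℝ → ℝ := fun w => ∏ i ∈ Finset.range q, (-2 * qorb a w i) with hD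
    have hDc : Continuous D := continuous_finsetProd _ fun i _ => (continuous_qorb a i).const_mul _
    have hD0 : ∀ w ∈ M, D w ≠ 0 := fun w hw => Finset.prod_ne_zero_iff.2 fun i _ =>
      mul_ne_zero (by norm_num) (hM0 w hw i)
    change 0 < D w * D (qorb a w q)
    by_contra! hneg
    have hw' := hMq w hw
    have hmem : (0 : ℝ) ∈ uIcc (D w) (D (qorb a w q)) := by
      rw [mem_uIcc]
      rcases mul_nonpos_iff.1 hneg with h1 | h1
      · exact Or.inr ⟨h1.2, h1.1⟩
      · exact Or.inl h1
    obtain ⟨t, ht, ht'⟩ := intermediate_value_uIcc hDc.continuousOn hmem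
    exact hD0 t (hMo.uIcc_subset hw hw' ht) ht'
  have hmono : StrictMonoOn (fun w => qorb a w (q + q)) M :=
    strictMonoOn_of_deriv_pos hMo.convex (continuous_qorb a _).continuousOn fun w hw => by
      rw [(hasDerivAt_qorb a w (q + q)).deriv]
      exact hsgn w (interior_subset hw)
  -- Cycles being repelling, not every point is fixed by `f^{2q}`.
  obtain ⟨z₀, hz₀, hz₀'⟩ : ∃ z₀ ∈ M, qorb a z₀ (q + q) ≠ z₀ := by
    by_contra! hfix
    obtain ⟨w₁, w₂, hlt, hw₁, hw₂⟩ : ∃ w₁ w₂, w₁ < w₂ ∧ w₁ ∈ M ∧ w₂ ∈ M := by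
      obtain ⟨s, hs⟩ : (Ioo x y).Nonempty := nonempty_Ioo.2 hxy
      obtain ⟨t, ht⟩ : (Ioo x s).Nonempty := nonempty_Ioo.2 hs.1
      have ht' : t ∈ Ioo x y := ⟨ht.1, ht.2.trans hs.2⟩
      have hne : qorb a t n ≠ qorb a s n := fun hh =>
        ht.2.ne ((hZxy n).injOn ⟨ht'.1.le, ht'.2.le⟩ ⟨hs.1.le, hs.2.le⟩ hh)
      have m1 : qorb a t n ∈ M := mem_iUnion.2 ⟨0, t, ht', by simp⟩
      have m2 : qorb a s n ∈ M := mem_iUnion.2 ⟨0, s, hs, by simp⟩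
      rcases lt_or_gt_of_ne hne with hl | hl
      · exact ⟨_, _, hl, m1, m2⟩
      · exact ⟨_, _, hl, m2, m1⟩
    obtain ⟨t, ht, e⟩ := exists_growth_eq_slope a hlt (q + q)
    have htM : t ∈ M := hMo.out hw₁ hw₂ ⟨ht.1.le, ht.2.le⟩
    have := h.one_lt_growth_of_periodic (hMp t htM) (by omega) (hfix t htM)
    rw [hfix _ hw₁, hfix _ hw₂, abs_of_pos (sub_pos.2 hlt)] at e
    nlinarith
  -- A point that is not fixed by an increasing map has a strictly monotone orbit.
  set w : ℕ → ℝ := fun k => qorb a z₀ (k * (q + q)) with hw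
  have hws : ∀ k, w (k + 1) = qorb a (w k) (q + q) := fun k => by
    simp only [hw]
    rw [add_mul, one_mul, qorb_add]
  have hwM : ∀ k, w k ∈ M := fun k => by
    induction k with
    | zero => simpa [hw, qorb_zero] using hz₀
    | succ k ih => rw [hws]; exact hM2 _ ih
  refine h.not_monotone_orbit (n := q + q) (by omega) hws (fun k => hMp _ (hwM k)) ?_
  have hw0 : w 0 = z₀ := by simp [hw, qorb_zero]
  rcases lt_or_gt_of_ne hz₀' with hl | hl
  · refine Or.inr (strictAnti_nat_of_succ_lt fun k => ?_)
    induction k with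
    | zero => rw [hws, hw0]; exact hl
    | succ k ih =>
      have e1 := hmono (hwM (k + 1)) (hwM k) ih
      simp only [← hws] at e1
      exact e1
  · refine Or.inl (strictMono_nat_of_lt_succ fun k => ?_)
    induction k with
    | zero => rw [hws, hw0]; exact hl
    | succ k ih =>
      have e1 := hmono (hwM k) (hwM (k + 1)) ih
      simp only [← hws] at e1
      exact e1

/-- The monotone branches of `fⁿ` shrink uniformly. -/
lemma exists_zeroFree_length_lt (h : PreperiodicParam a p) {ε : ℝ} (hε : 0 < ε) :
    ∃ n, ∀ u v, -p ≤ u → v ≤ p → ZeroFree a n u v → v - u < ε := by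
  by_contra! hno
  choose u v hu hv hZ hl using hno
  have hb : ∀ n, (u n, v n) ∈ Icc (-p) p ×ˢ Icc (-p) p := fun n =>
    ⟨⟨hu n, by linarith [hl n, hv n]⟩, ⟨by linarith [hl n, hu n], hv n⟩⟩
  obtain ⟨⟨U, V⟩, hUV, φ, hφ, hlim⟩ := (isCompact_Icc (a := -p) (b := p) |>.prod
    (isCompact_Icc (a := -p) (b := p))).tendsto_subseq hb
  have hU : Tendsto (fun k => u (φ k)) atTop (𝓝 U) := (continuous_fst.tendsto _).comp hlim
  have hV : Tendsto (fun k => v (φ k)) atTop (𝓝 V) := (continuous_snd.tendsto _).comp hlim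
  have hd : ε ≤ V - U := ge_of_tendsto' (hV.sub hU) fun k => hl _
  refine h.not_forall_zeroFree (u := U) (v := V) hUV.1.1 (by linarith) hUV.2.2 ?_
  intro n i hi y hy
  obtain ⟨k, h1, h2, h3⟩ := ((hU.eventually_lt_const hy.1).and
    ((hV.eventually_const_lt hy.2).and (hφ.tendsto_atTop.eventually_ge_atTop n))).exists
  exact hZ (φ k) i (by omega) y ⟨h1, h2⟩

/-- The expansion at a point whose image is far from the postcritical set is large after a long
time, since the branch of `fⁿ` at the point is short. -/
lemma exists_large_growth_of_far (h : PreperiodicParam a p) {δ Λ : ℝ} (hδ : 0 < δ) (hΛ : 0 < Λ) :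
    ∃ m, 1 ≤ m ∧ ∀ n, m ≤ n → ∀ x, |x| ≤ p → (∀ e ∈ postCrit a p, δ ≤ |qorb a x n - e|) →
      Λ ≤ growth (qorb a x) n := by
  obtain ⟨m, hm⟩ := h.exists_zeroFree_length_lt (ε := 2 * δ / Λ) (by positivity)
  refine ⟨m + 1, by omega, fun n hn x hx hfar => ?_⟩
  obtain ⟨u, v, hu, hux, hxv, hv, hZ, hg⟩ := h.exists_zeroFree_growth (by omega) hx hδ hfar
  have hl := hm u v hu hv (hZ.mono (by omega) le_rfl le_rfl)
  refine le_trans ?_ hg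
  rw [le_div_iff₀ (by linarith)]
  rw [lt_div_iff₀ hΛ] at hl
  linarith

lemma pow_le_growth {x : ℕ → ℝ} {δ : ℝ} (hδ : 0 ≤ δ) {n : ℕ} (hx : ∀ i < n, δ ≤ |x i|) :
    (2 * δ) ^ n ≤ growth x n := by
  rw [growth]
  calc (2 * δ) ^ n = ∏ _i ∈ Finset.range n, (2 * δ) := by simp
    _ ≤ _ := Finset.prod_le_prod (fun _ _ => by positivity) fun i hi => by
      rw [abs_mul, abs_two]
      have := hx i (Finset.mem_range.1 hi)
      linarith

/-- Uniform expansion along orbit segments that stay away from the critical point. -/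
lemma exists_expansion_away (h : PreperiodicParam a p) {δ : ℝ} (hδ : 0 < δ) :
    ∃ m, 1 ≤ m ∧ ∀ x, |x| ≤ p → (∀ i < m, δ ≤ |qorb a x i|) → 2 ≤ growth (qorb a x) m := by
  obtain ⟨Q, hQ, η, hη, hexp⟩ := h.exists_postCrit_expansion
  -- `τ` bounds from below the expansion in one step, and is at most one.
  set τ := min 1 (2 * δ) with hτ
  have hτ0 : 0 < τ := lt_min one_pos (by linarith)
  have hτ1 : τ ≤ 1 := min_le_left _ _
  have hlow : ∀ x : ℝ, ∀ n : ℕ, (∀ i < n, δ ≤ |qorb a x i|) → τ ^ n ≤ growth (qorb a x) n :=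
    fun x n hx => le_trans (by gcongr; exact min_le_right _ _) (pow_le_growth hδ.le hx)
  -- While the orbit is close to the postcritical set, it expands by a factor `2` in `Q` steps.
  have hnear : ∀ b : ℕ, ∀ x, (∀ i < b * Q, ∃ e ∈ postCrit a p, |qorb a x i - e| ≤ η) →
      2 ^ b ≤ growth (qorb a x) (b * Q) := by
    intro b
    induction b with
    | zero => intro x _; simp [growth_zero]
    | succ b ih =>
      intro x hx
      rw [show (b + 1) * Q = b * Q + Q by ring, growth_qorb_add, pow_succ]
      have h1 := ih x fun i hi => hx i (hi.trans_le (by nlinarith))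
      obtain ⟨e, he, he'⟩ := hx (b * Q) (by nlinarith)
      exact mul_le_mul h1 (hexp e he _ he') (by norm_num) (growth_nonneg _ _)
  obtain ⟨m₁, hm₁, hG⟩ := h.exists_large_growth_of_far hη (Λ := 2 / τ ^ (Q + 1)) (by positivity)
  -- The length `m` is chosen so that a stay of `b` blocks near the postcritical set compensates for
  -- the possible contraction at the other times.
  obtain ⟨b, hb⟩ := pow_unbounded_of_one_lt (2 / τ ^ (m₁ + 1 + Q)) (one_lt_two (α := ℝ))
  refine ⟨m₁ + 1 + (b + 1) * Q, by omega, fun x hx hfree => ?_⟩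
  set m := m₁ + 1 + (b + 1) * Q with hm
  -- Split `x, …` at the last time `< m` at distance `≥ η` from the postcritical set.
  have hblock : ∀ y k, (∀ i < k, δ ≤ |qorb a y i|) →
      (∀ i < k, ∃ e ∈ postCrit a p, |qorb a y i - e| ≤ η) →
      2 ^ (k / Q) * τ ^ Q ≤ growth (qorb a y) k := by
    intro y k h1 h2
    have hk : k = k / Q * Q + k % Q := (Nat.div_add_mod' k Q).symm
    conv_rhs => rw [hk, growth_qorb_add]
    have hle : k / Q * Q ≤ k := Nat.div_mul_le_self k Q
    refine mul_le_mul (hnear _ y fun i hi => h2 i (by omega)) ?_ (by positivity)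
      (growth_nonneg _ _)
    refine le_trans (pow_le_pow_of_le_one hτ0.le hτ1 (Nat.mod_lt k hQ).le) (hlow _ _ fun i hi => ?_)
    rw [← qorb_add]
    exact h1 _ (by omega)
  by_cases hall : ∀ i < m, ∃ e ∈ postCrit a p, |qorb a x i - e| ≤ η
  · refine le_trans ?_ (hblock x m hfree hall)
    have hbm : b ≤ m / Q := by
      rw [Nat.le_div_iff_mul_le hQ, hm]; nlinarith
    rw [div_lt_iff₀ (by positivity)] at hb
    calc (2 : ℝ) ≤ 2 ^ b * τ ^ (m₁ + 1 + Q) := hb.le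
      _ ≤ 2 ^ (m / Q) * τ ^ Q := mul_le_mul (pow_le_pow_right₀ (by norm_num) hbm)
          (pow_le_pow_of_le_one hτ0.le hτ1 (by omega)) (by positivity) (by positivity)
  · push Not at hall
    classical
    set S := (Finset.range m).filter fun i => ∀ e ∈ postCrit a p, η < |qorb a x i - e|
      with hS
    have hSne : S.Nonempty := by
      obtain ⟨i, hi, hi'⟩ := hall
      exact ⟨i, by simp only [hS, Finset.mem_filter, Finset.mem_range]; exact ⟨hi, hi'⟩⟩
    set i₀ := S.max' hSne with hi₀
    have hmem : i₀ ∈ S := S.max'_mem hSne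
    simp only [hS, Finset.mem_filter, Finset.mem_range] at hmem
    have hafter : ∀ i < m - (i₀ + 1), ∃ e ∈ postCrit a p,
        |qorb a (qorb a x (i₀ + 1)) i - e| ≤ η := by
      intro i hi
      by_contra! hcon
      rw [← qorb_add] at hcon
      have : i₀ + 1 + i ∈ S := by
        simp only [hS, Finset.mem_filter, Finset.mem_range]
        exact ⟨by omega, hcon⟩
      have := S.le_max' _ this
      omega
    have hB := hblock (qorb a x (i₀ + 1)) (m - (i₀ + 1))
      (fun i hi => by rw [← qorb_add]; exact hfree _ (by omega)) hafter
    have hsplit : growth (qorb a x) m =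
        growth (qorb a x) i₀ * |2 * qorb a x i₀| *
          growth (qorb a (qorb a x (i₀ + 1))) (m - (i₀ + 1)) := by
      rw [← growth_succ, ← growth_qorb_add, Nat.add_sub_cancel' hmem.1]
    have hone : τ ≤ |2 * qorb a x i₀| := by
      rw [abs_mul, abs_two]
      exact (min_le_right _ _).trans (by linarith [hfree i₀ hmem.1])
    rw [hsplit]
    -- If the last far time is late, its large expansion suffices; if it is early, the stay near the
    -- postcritical set after it is long.
    rcases le_or_gt m₁ i₀ with hcase | hcase
    · have hg := hG i₀ hcase x hx fun e he => (hmem.2 e he).le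
      have : 1 * τ ^ Q ≤ 2 ^ ((m - (i₀ + 1)) / Q) * τ ^ Q := by
        gcongr
        exact one_le_pow₀ (by norm_num)
      rw [one_mul] at this
      calc (2 : ℝ) = 2 / τ ^ (Q + 1) * τ * τ ^ Q := by field_simp; ring
        _ ≤ _ := mul_le_mul (mul_le_mul hg hone hτ0.le (growth_nonneg _ _)) (this.trans hB)
          (by positivity) (mul_nonneg (growth_nonneg _ _) (abs_nonneg _))
    · have hg : τ ^ m₁ ≤ growth (qorb a x) i₀ :=
        le_trans (pow_le_pow_of_le_one hτ0.le hτ1 hcase.le)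
          (hlow x i₀ fun i hi => hfree i (by omega))
      have hbm : b ≤ (m - (i₀ + 1)) / Q := by
        rw [Nat.le_div_iff_mul_le hQ]
        have : (b + 1) * Q = b * Q + Q := by ring
        omega
      rw [div_lt_iff₀ (by positivity)] at hb
      calc (2 : ℝ) ≤ 2 ^ b * τ ^ (m₁ + 1 + Q) := hb.le
        _ = τ ^ m₁ * τ * (2 ^ b * τ ^ Q) := by ring
        _ ≤ _ := mul_le_mul (mul_le_mul hg hone hτ0.le (growth_nonneg _ _))
          (le_trans (by gcongr; norm_num) hB) (by positivity)
          (mul_nonneg (growth_nonneg _ _) (abs_nonneg _))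

end PreperiodicParam

/-! ### Pseudo-orbits -/

/-- An `η`-pseudo-orbit of `f(x) = a - x²` in `[-p, p]`. -/
structure PseudoOrbit (a p η : ℝ) (x : ℕ → ℝ) : Prop where
  bound : ∀ i, |x i| ≤ p
  step : ∀ i, |x (i + 1) - (a - x i ^ 2)| ≤ η

namespace PseudoOrbit

variable {a p η : ℝ} {x : ℕ → ℝ}

lemma shift (hx : PseudoOrbit a p η x) (k : ℕ) : PseudoOrbit a p η fun i => x (k + i) :=
  ⟨fun _ => hx.bound _, fun _ => hx.step _⟩

lemma nonneg (hx : PseudoOrbit a p η x) : 0 ≤ η := (abs_nonneg _).trans (hx.step 0)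

lemma dist_qorb_le (h : PreperiodicParam a p) (hx : PseudoOrbit a p η x) (n : ℕ) :
    |x n - qorb a (x 0) n| ≤ 5 ^ n * η := by
  induction n with
  | zero => simpa [qorb_zero] using hx.nonneg
  | succ n ih =>
    have e : x (n + 1) - qorb a (x 0) (n + 1) = (x (n + 1) - (a - x n ^ 2)) +
        (-(x n + qorb a (x 0) n) * (x n - qorb a (x 0) n)) := by
      rw [qorb_succ]; ring
    have h1 : |x n + qorb a (x 0) n| ≤ 4 := (abs_add_le _ _).trans (by
      linarith [hx.bound n, h.qorb_le (hx.bound 0) n, h.p_lt_two])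
    have h2 : |-(x n + qorb a (x 0) n) * (x n - qorb a (x 0) n)| ≤ 4 * (5 ^ n * η) := by
      rw [abs_mul, abs_neg]
      exact mul_le_mul h1 ih (abs_nonneg _) (by norm_num)
    have h3 : (1 : ℝ) ≤ 5 ^ n := one_le_pow₀ (by norm_num)
    rw [e, pow_succ (5 : ℝ) n]
    refine (abs_add_le _ _).trans ?_
    nlinarith [hx.step n, hx.nonneg]

lemma dist_growth_le (h : PreperiodicParam a p) (hx : PseudoOrbit a p η x) (n : ℕ) :
    |growth x n - growth (qorb a (x 0)) n| ≤ 25 ^ n * η := by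
  induction n with
  | zero => simpa [growth_zero] using hx.nonneg
  | succ n ih =>
    have e : growth x (n + 1) - growth (qorb a (x 0)) (n + 1) =
        (growth x n - growth (qorb a (x 0)) n) * |2 * x n| +
          growth (qorb a (x 0)) n * (|2 * x n| - |2 * qorb a (x 0) n|) := by
      rw [growth_succ, growth_succ]; ring
    have h1 : |2 * x n| ≤ 4 := by
      rw [abs_mul, abs_two]; linarith [hx.bound n, h.p_lt_two]
    have h2 : |(|2 * x n| - |2 * qorb a (x 0) n|)| ≤ 2 * (5 ^ n * η) := by
      refine (abs_abs_sub_abs_le_abs_sub _ _).trans ?_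
      rw [← mul_sub, abs_mul, abs_two]
      linarith [hx.dist_qorb_le h n]
    have h3 : abs ((growth x n - growth (qorb a (x 0)) n) * |2 * x n|) ≤ 25 ^ n * η * 4 := by
      rw [abs_mul, abs_abs]
      exact mul_le_mul ih h1 (abs_nonneg _) (mul_nonneg (by positivity) hx.nonneg)
    have h4 : abs (growth (qorb a (x 0)) n * (|2 * x n| - |2 * qorb a (x 0) n|)) ≤
        4 ^ n * (2 * (5 ^ n * η)) := by
      rw [abs_mul, abs_of_nonneg (growth_nonneg _ _)]
      exact mul_le_mul (h.growth_le (hx.bound 0) n) h2 (abs_nonneg _) (by positivity)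
    have h5 : (4 : ℝ) ^ n * (2 * (5 ^ n * η)) ≤ 25 ^ n * η * 2 := by
      have : (4 : ℝ) ^ n * 5 ^ n ≤ 25 ^ n := by
        rw [← mul_pow]; exact pow_le_pow_left₀ (by norm_num) (by norm_num) n
      nlinarith [hx.nonneg, mul_le_mul_of_nonneg_right this hx.nonneg]
    rw [e, pow_succ (25 : ℝ) n]
    refine (abs_add_le _ _).trans ?_
    have := mul_nonneg (by positivity : (0 : ℝ) ≤ 25 ^ n) hx.nonneg
    linarith

end PseudoOrbit

/-- Expansion by `r` in each block of length `m` is exponential expansion. -/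
lemma exists_root_pow_le {r : ℝ} (hr : 1 < r) {m : ℕ} (hm : 1 ≤ m) :
    ∃ l : ℝ, 1 < l ∧ ∀ n : ℕ, l ^ n ≤ r ^ (n / m) * r := by
  have hm' : (0 : ℝ) < m := by exact_mod_cast hm
  set l : ℝ := r ^ (1 / (m : ℝ)) with hl
  have h1 : 1 < l := Real.one_lt_rpow hr (by positivity)
  have hlm : l ^ m = r := by
    rw [hl, ← Real.rpow_natCast, ← Real.rpow_mul (by linarith), one_div,
      inv_mul_cancel₀ hm'.ne', Real.rpow_one]
  refine ⟨l, h1, fun n => ?_⟩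
  conv_lhs => rw [← Nat.div_add_mod n m, pow_add, pow_mul, hlm]
  have h2 : l ^ (n % m) ≤ r := by
    rw [← hlm]; exact pow_le_pow_right₀ h1.le (Nat.mod_lt n hm).le
  exact mul_le_mul_of_nonneg_left h2 (by positivity)

namespace PreperiodicParam

variable {a p : ℝ}

lemma exists_postCrit_lower (h : PreperiodicParam a p) :
    ∃ σ : ℝ, 0 < σ ∧ ∀ e ∈ postCrit a p, σ ≤ |e| := by
  have : ∀ e ∈ postCrit a p, ∀ᶠ σ : ℝ in 𝓝[>] 0, σ ≤ |e| := fun e he => by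
    filter_upwards [Ioo_mem_nhdsGT (abs_pos.2 (h.ne_zero_of_mem_postCrit he))] with σ hσ
    exact hσ.2.le
  obtain ⟨σ, h1, h2⟩ := (((eventually_all_finite h.finite_postCrit).2 this).and
    self_mem_nhdsWithin).exists
  exact ⟨σ, h2, h1⟩

/-- Exponential expansion along the postcritical orbits. -/
lemma exists_postCrit_growth (h : PreperiodicParam a p) :
    ∃ κ l : ℝ, 0 < κ ∧ 1 < l ∧ ∀ e ∈ postCrit a p, ∀ n, κ * l ^ n ≤ growth (qorb a e) n := by
  obtain ⟨Q, hQ, δ, hδ, hexp⟩ := h.exists_postCrit_expansion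
  obtain ⟨σ, hσ, hlow⟩ := h.exists_postCrit_lower
  obtain ⟨l, hl, hl'⟩ := exists_root_pow_le (one_lt_two (α := ℝ)) hQ
  set τ := min 1 (2 * σ) with hτ
  have hτ0 : 0 < τ := lt_min one_pos (by linarith)
  refine ⟨τ ^ Q / 2, l, by positivity, hl, fun e he n => ?_⟩
  have hb : ∀ b : ℕ, 2 ^ b ≤ growth (qorb a e) (b * Q) := fun b => by
    induction b with
    | zero => simp [growth_zero]
    | succ b ih =>
      rw [show (b + 1) * Q = b * Q + Q by ring, growth_qorb_add, pow_succ]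
      exact mul_le_mul ih (hexp _ (h.qorb_mem_postCrit_of_mem he (b * Q)) _ (by simpa using hδ.le))
        (by norm_num) (growth_nonneg _ _)
  have hr : τ ^ Q ≤ growth (qorb a (qorb a e (n / Q * Q))) (n % Q) := by
    refine le_trans (pow_le_pow_of_le_one hτ0.le (min_le_left _ _) (Nat.mod_lt n hQ).le) ?_
    refine le_trans (pow_le_pow_left₀ hτ0.le (min_le_right _ _) _) (pow_le_growth hσ.le fun i _ => ?_)
    exact hlow _ (h.qorb_mem_postCrit_of_mem (h.qorb_mem_postCrit_of_mem he _) i)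
  have : growth (qorb a e) n = growth (qorb a e) (n / Q * Q) *
      growth (qorb a (qorb a e (n / Q * Q))) (n % Q) := by
    rw [← growth_qorb_add, Nat.div_add_mod']
  rw [this]
  calc τ ^ Q / 2 * l ^ n ≤ τ ^ Q / 2 * (2 ^ (n / Q) * 2) := by gcongr; exact hl' n
    _ = 2 ^ (n / Q) * τ ^ Q := by ring
    _ ≤ _ := mul_le_mul (hb _) hr (by positivity) (growth_nonneg _ _)

/-- Expansion of pseudo-orbits away from the critical point; the constant for a segment that ends
close to `0` does not depend on the size `δ` of the neighbourhood avoided before. -/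
lemma exists_growth_away (h : PreperiodicParam a p) :
    ∃ c ρ : ℝ, 0 < c ∧ 0 < ρ ∧ ∀ δ > 0, ∃ l η₀ c' : ℝ, 1 < l ∧ 0 < η₀ ∧ 0 < c' ∧
      ∀ η ≤ η₀, ∀ x, PseudoOrbit a p η x → ∀ n, (∀ i < n, δ ≤ |x i|) →
        c' * l ^ n ≤ growth x n ∧ (|x n| ≤ ρ → c * l ^ n ≤ growth x n) := by
  obtain ⟨σ, hσ, hlow⟩ := h.exists_postCrit_lower
  have hp := h.p_pos
  set c₀ := min 1 (σ / 2 / p) with hc₀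
  have hc₀0 : 0 < c₀ := lt_min one_pos (by positivity)
  refine ⟨c₀ / 3, σ / 4, by positivity, by positivity, fun δ hδ => ?_⟩
  obtain ⟨m, hm, hexp⟩ := h.exists_expansion_away (half_pos hδ)
  obtain ⟨l, hl, hl'⟩ := exists_root_pow_le (show (1 : ℝ) < 3 / 2 by norm_num) hm
  set η₀ := min (1 / 2) (min (δ / 2) (min (σ / 4) (c₀ / 2))) / 25 ^ m with hη₀
  have hη₀0 : 0 < η₀ := by positivity
  set τ := min 1 (2 * δ) with hτ
  have hτ0 : 0 < τ := lt_min one_pos (by linarith)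
  refine ⟨l, η₀, τ ^ m / (3 / 2), hl, hη₀0, by positivity, fun η hη x hx n hn => ?_⟩
  have hη25 : ∀ r ≤ m, 25 ^ r * η ≤ min (1 / 2) (min (δ / 2) (min (σ / 4) (c₀ / 2))) := by
    intro r hr
    calc 25 ^ r * η ≤ 25 ^ m * η₀ := by
          refine mul_le_mul (pow_le_pow_right₀ (by norm_num) hr) hη hx.nonneg (by positivity)
      _ = _ := by rw [hη₀]; field_simp
  have hη5 : ∀ r ≤ m, 5 ^ r * η ≤ min (1 / 2) (min (δ / 2) (min (σ / 4) (c₀ / 2))) := fun r hr =>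
    le_trans (mul_le_mul_of_nonneg_right (pow_le_pow_left₀ (by norm_num) (by norm_num) r)
      hx.nonneg) (hη25 r hr)
  -- For small `η` the pseudo-orbit follows a true orbit during each block of length `m`.
  have hblock : ∀ b : ℕ, b * m ≤ n → (3 / 2) ^ b ≤ growth x (b * m) := by
    intro b
    induction b with
    | zero => intro _; simp [growth_zero]
    | succ b ih =>
      intro hb
      have e : (b + 1) * m = b * m + m := by ring
      rw [e, growth_add, pow_succ]
      refine mul_le_mul (ih (by omega)) ?_ (by norm_num) (growth_nonneg _ _)
      have hy := hx.shift (b * m)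
      have h2 := hexp _ (hy.bound 0) fun i hi => by
        have h3 := hy.dist_qorb_le h i
        have h4 := (hη5 i hi.le).trans ((min_le_right _ _).trans (min_le_left _ _))
        have h5 := hn (b * m + i) (by omega)
        have h6 := abs_sub_abs_le_abs_sub (x (b * m + i)) (qorb a (x (b * m + 0)) i)
        linarith
      have h3 := (abs_le.1 (hy.dist_growth_le h m)).1
      have h4 := (hη25 m le_rfl).trans (min_le_left _ _)
      linarith
  have hsplit : growth x n = growth x (n / m * m) * growth (fun i => x (n / m * m + i)) (n % m) := by
    rw [← growth_add, Nat.div_add_mod']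
  have hB := hblock (n / m) (Nat.div_mul_le_self n m)
  have hy := hx.shift (n / m * m)
  have hmod : n / m * m + n % m = n := Nat.div_add_mod' n m
  have hlt := Nat.mod_lt n (show m > 0 by omega)
  -- The remainder of length `n % m` is estimated trivially in the first bound. In the second one
  -- the endpoint is far from the postcritical set, and `le_growth_of_far` applies.
  constructor
  · rw [hsplit]
    have : τ ^ m ≤ growth (fun i => x (n / m * m + i)) (n % m) :=
      (pow_le_pow_of_le_one hτ0.le (min_le_left _ _) hlt.le).trans
        ((pow_le_pow_left₀ hτ0.le (min_le_right _ _) _).trans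
          (pow_le_growth hδ.le fun i hi => hn _ (by omega)))
    calc τ ^ m / (3 / 2) * l ^ n ≤ τ ^ m / (3 / 2) * ((3 / 2) ^ (n / m) * (3 / 2)) := by
          gcongr; exact hl' n
      _ = (3 / 2) ^ (n / m) * τ ^ m := by ring
      _ ≤ _ := mul_le_mul hB this (by positivity) (growth_nonneg _ _)
  · intro hend
    rw [hsplit]
    have : c₀ / 2 ≤ growth (fun i => x (n / m * m + i)) (n % m) := by
      have h1 : c₀ ≤ growth (qorb a (x (n / m * m + 0))) (n % m) := by
        rcases Nat.eq_zero_or_pos (n % m) with h0 | h0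
        · rw [h0, growth_zero]; exact min_le_left _ _
        · refine (min_le_right _ _).trans
            (h.le_growth_of_far h0 (hy.bound 0) (by positivity) fun e he => ?_)
          have h2 := hy.dist_qorb_le h (n % m)
          have h3 := (hη5 _ hlt.le).trans ((min_le_right _ _).trans ((min_le_right _ _).trans
            (min_le_left _ _)))
          simp only [hmod] at h2
          have h4 := hlow e he
          have h5 : |e| ≤ |x n - qorb a (x (n / m * m + 0)) (n % m)| + |x n| +
              |qorb a (x (n / m * m + 0)) (n % m) - e| := by
            have : e = -(x n - qorb a (x (n / m * m + 0)) (n % m)) + x n -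
              (qorb a (x (n / m * m + 0)) (n % m) - e) := by ring
            nth_rewrite 1 [this]
            refine (abs_sub _ _).trans ?_
            gcongr
            refine (abs_add_le _ _).trans ?_
            rw [abs_neg]
          linarith
      have h2 := (abs_le.1 (hy.dist_growth_le h (n % m))).1
      have h3 := (hη25 _ hlt.le).trans ((min_le_right _ _).trans ((min_le_right _ _).trans
            (min_le_right _ _)))
      linarith
    calc c₀ / 3 * l ^ n ≤ c₀ / 3 * ((3 / 2) ^ (n / m) * (3 / 2)) := by
          gcongr; exact hl' n
      _ = (3 / 2) ^ (n / m) * (c₀ / 2) := by ring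
      _ ≤ _ := mul_le_mul hB this (by positivity) (growth_nonneg _ _)

end PreperiodicParam

/-! ### Shadowing the critical orbit -/

lemma one_sub_sum_le_prod_one_sub {z : ℕ → ℝ} (n : ℕ) (h0 : ∀ i < n, 0 ≤ z i)
    (h1 : ∀ i < n, z i ≤ 1) :
    1 - ∑ i ∈ Finset.range n, z i ≤ ∏ i ∈ Finset.range n, (1 - z i) := by
  induction n with
  | zero => simp
  | succ n ih =>
    rw [Finset.sum_range_succ, Finset.prod_range_succ]
    have e1 := ih (fun i hi => h0 i (by omega)) fun i hi => h1 i (by omega)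
    have e2 : ∏ i ∈ Finset.range n, (1 - z i) ≤ 1 := Finset.prod_le_one
      (fun i hi => by linarith [h1 i (by have := Finset.mem_range.1 hi; omega)])
      (fun i hi => by linarith [h0 i (by have := Finset.mem_range.1 hi; omega)])
    have e3 := h0 n (by omega)
    nlinarith

lemma prod_one_add_le_exp_sum {z : ℕ → ℝ} (n : ℕ) (h0 : ∀ i < n, 0 ≤ z i) :
    ∏ i ∈ Finset.range n, (1 + z i) ≤ Real.exp (∑ i ∈ Finset.range n, z i) := by
  rw [Real.exp_sum]
  refine Finset.prod_le_prod (fun i hi => ?_) fun i _ => ?_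
  · linarith [h0 i (Finset.mem_range.1 hi)]
  · rw [add_comm]; exact Real.add_one_le_exp _

lemma exp_half_le_two : Real.exp (1 / 2) ≤ 2 := by
  have h1 : Real.exp (1 / 2) ^ 2 = Real.exp 1 := by rw [← Real.exp_nat_mul]; norm_num
  have h2 := Real.exp_one_lt_d9
  nlinarith [Real.exp_pos (1 / 2)]

/-- Constants describing the orbit of the critical value `a`: `Λₙ = growth (qorb a a) n` grows
exponentially, the orbit is `σ`-far from `0`, `∑_{i<n} Λᵢ ≤ C Λₙ`, `∑_{i<n} 1/Λᵢ₊₁ ≤ C`. The number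
`d₀` is the distance up to which orbits are compared with that of the critical value. -/
structure CritConst (a κ l σ C d₀ : ℝ) : Prop where
  κ_pos : 0 < κ
  one_lt_l : 1 < l
  l_le : l ≤ 4
  σ_pos : 0 < σ
  C_pos : 0 < C
  d₀_pos : 0 < d₀
  d₀_le : d₀ ≤ σ / 4
  small : 4 * (C * d₀) ≤ σ / 2
  σ_le : ∀ n, σ ≤ |qorb a a n|
  lower : ∀ i n, κ * l ^ n * growth (qorb a a) i ≤ growth (qorb a a) (i + n)
  sum_le : ∀ n, ∑ i ∈ Finset.range n, growth (qorb a a) i ≤ C * growth (qorb a a) n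
  sum_inv_le : ∀ n, ∑ i ∈ Finset.range n, 1 / growth (qorb a a) (i + 1) ≤ C

namespace PreperiodicParam

variable {a p : ℝ}

lemma qorb_a_mem (_h : PreperiodicParam a p) (n : ℕ) : qorb a a n ∈ postCrit a p := by
  refine Or.inr ⟨1 + n, by omega, ?_⟩
  rw [qorb_add, qorb_succ, qorb_zero]
  norm_num

lemma abs_a_le (h : PreperiodicParam a p) : |a| ≤ p := by
  rw [abs_of_pos (by linarith [h.one_lt])]; exact h.a_lt_p.le

/-- The sums are controlled by the exponential growth along every postcritical orbit. -/
lemma exists_critConst (h : PreperiodicParam a p) : ∃ κ l σ C d₀, CritConst a κ l σ C d₀ := by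
  obtain ⟨σ, hσ, hlow⟩ := h.exists_postCrit_lower
  obtain ⟨κ, l', hκ, hl', hgrow'⟩ := h.exists_postCrit_growth
  set l := min l' 4
  have hl : 1 < l := lt_min hl' (by norm_num)
  have hgrow : ∀ e ∈ postCrit a p, ∀ n, κ * l ^ n ≤ growth (qorb a e) n := fun e he n =>
    le_trans (mul_le_mul_of_nonneg_left
      (pow_le_pow_left₀ (by linarith) (min_le_left _ _) n) hκ.le) (hgrow' e he n)
  have hlower : ∀ i n, κ * l ^ n * growth (qorb a a) i ≤ growth (qorb a a) (i + n) := by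
    intro i n
    rw [growth_qorb_add, mul_comm (κ * l ^ n)]
    exact mul_le_mul_of_nonneg_left (hgrow _ (h.qorb_a_mem i) n) (growth_nonneg _ _)
  have hpos : ∀ n, 0 < growth (qorb a a) n := fun n =>
    lt_of_lt_of_le (by positivity) (hgrow a (h.qorb_a_mem 0) n)
  have hgeom : ∀ n : ℕ, ∑ i ∈ Finset.range n, (l⁻¹) ^ (i + 1) ≤ 1 / (l - 1) := by
    intro n
    have h1 : ∑ i ∈ Finset.range n, (l⁻¹) ^ (i + 1) = l⁻¹ * ∑ i ∈ Finset.range n, (l⁻¹) ^ i := by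
      rw [Finset.mul_sum]; exact Finset.sum_congr rfl fun i _ => by ring
    rw [h1]
    have h2 : ∑ i ∈ Finset.range n, (l⁻¹) ^ i ≤ (1 - l⁻¹)⁻¹ :=
      (summable_geometric_of_lt_one (by positivity) (inv_lt_one_of_one_lt₀ hl)).sum_le_tsum _
        (fun i _ => by positivity) |>.trans_eq
        (tsum_geometric_of_lt_one (by positivity) (inv_lt_one_of_one_lt₀ hl))
    calc l⁻¹ * ∑ i ∈ Finset.range n, (l⁻¹) ^ i ≤ l⁻¹ * (1 - l⁻¹)⁻¹ := by gcongr
      _ = 1 / (l - 1) := by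
        have : l - 1 ≠ 0 := by linarith
        field_simp
  set C := 1 / (l - 1) / κ with hC
  have hC0 : 0 < C := by
    have : 0 < l - 1 := by linarith
    positivity
  refine ⟨κ, l, σ, C, min (σ / 4) (σ / (8 * C)), hκ, hl, min_le_right _ _, hσ,
    hC0, lt_min (by positivity) (by positivity), min_le_left _ _, ?_,
    fun n => hlow _ (h.qorb_a_mem n), hlower, fun n => ?_, fun n => ?_⟩
  · have h1 : min (σ / 4) (σ / (8 * C)) ≤ σ / (8 * C) := min_le_right _ _
    rw [le_div_iff₀ (by positivity)] at h1
    linarith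
  · have h1 : ∀ i ∈ Finset.range n, growth (qorb a a) (n - 1 - i) ≤
        (l⁻¹) ^ (i + 1) / κ * growth (qorb a a) n := by
      intro i hi
      have hi' := Finset.mem_range.1 hi
      have h2 := hlower (n - 1 - i) (i + 1)
      rw [show n - 1 - i + (i + 1) = n by omega] at h2
      rw [inv_pow, div_mul_eq_mul_div, le_div_iff₀ hκ, ← div_eq_inv_mul,
        le_div_iff₀ (by positivity)]
      linarith
    rw [← Finset.sum_range_reflect]
    refine (Finset.sum_le_sum h1).trans ?_
    rw [← Finset.sum_mul, ← Finset.sum_div]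
    exact mul_le_mul_of_nonneg_right (div_le_div_of_nonneg_right (hgeom n) hκ.le) (hpos n).le
  · refine le_trans (Finset.sum_le_sum fun i _ => ?_) (le_trans
      (Finset.sum_div (Finset.range n) (fun i => (l⁻¹) ^ (i + 1)) κ).symm.le
      (div_le_div_of_nonneg_right (hgeom n) hκ.le))
    have h2 := hgrow a (h.qorb_a_mem 0) (i + 1)
    rw [inv_pow, div_le_div_iff₀ (hpos _) hκ, one_mul, ← div_eq_inv_mul, le_div_iff₀ (by positivity)]
    exact h2

end PreperiodicParam

namespace CritConst

variable {a p κ l σ C d₀ η S : ℝ} {y : ℕ → ℝ}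

lemma pos (H : CritConst a κ l σ C d₀) (n : ℕ) : 0 < growth (qorb a a) n := by
  have h1 := H.lower 0 n
  rw [growth_zero, zero_add, mul_one] at h1
  have := H.κ_pos
  have := H.one_lt_l
  exact lt_of_lt_of_le (by positivity) h1

lemma κ_mul_pow_le (H : CritConst a κ l σ C d₀) (n : ℕ) : κ * l ^ n ≤ growth (qorb a a) n := by
  simpa [growth_zero] using H.lower 0 n

/-- An `η`-pseudo-orbit of `f` starting near the critical value `a` follows the orbit of `a` as long
as `Λₙ S` is at most `d₀`, where `S` bounds the initial displacement plus the total effect of the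
perturbations; the displacement at time `j` is of order `Λⱼ S`. -/
lemma shadow (H : CritConst a κ l σ C d₀) (hy : PseudoOrbit a p η y)
    (hS : |y 0 - a| + η * C ≤ S) {n : ℕ} (hn : growth (qorb a a) n * S ≤ d₀) {j : ℕ} (hj : j ≤ n) :
    |y j - qorb a a j| ≤ 2 * growth (qorb a a) j * S ∧
      ∑ i ∈ Finset.range j, |y i - qorb a a i| ≤ 2 * C * growth (qorb a a) j * S := by
  have hσ := H.σ_pos
  have hC := H.C_pos
  have hη := hy.nonneg
  have hS0 : 0 ≤ S := le_trans (by positivity) hS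
  set ε : ℕ → ℝ := fun i => |y i - qorb a a i| with hε
  set Λ : ℕ → ℝ := growth (qorb a a) with hΛ
  have hpos : ∀ n, 0 < Λ n := H.pos
  have hε0 : ∀ i, 0 ≤ ε i := fun i => abs_nonneg _
  -- The recursion for the displacement, solved with the distortion factor kept as a product.
  have hrec : ∀ j, ε j ≤ Λ j * ((∏ i ∈ Finset.range j, (1 + ε i / (2 * σ))) *
      (ε 0 + η * ∑ i ∈ Finset.range j, 1 / Λ (i + 1))) := by
    intro j
    induction j with
    | zero => simp [hΛ, growth_zero]
    | succ j ih =>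
      rw [Finset.prod_range_succ, Finset.sum_range_succ]
      set A := ∏ i ∈ Finset.range j, (1 + ε i / (2 * σ)) with hA
      set B := ε 0 + η * ∑ i ∈ Finset.range j, 1 / Λ (i + 1) with hB
      have hA1 : 1 ≤ A := by
        rw [hA]
        exact Finset.one_le_prod fun i _ => by
          have := hε0 i
          have : 0 ≤ ε i / (2 * σ) := by positivity
          linarith
      have hz : 0 ≤ ε j / (2 * σ) := div_nonneg (hε0 j) (by positivity)
      have e1 : y (j + 1) - qorb a a (j + 1) = (y (j + 1) - (a - y j ^ 2)) +
          (-(y j + qorb a a j) * (y j - qorb a a j)) := by rw [qorb_succ]; ring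
      have e2 : |y j + qorb a a j| ≤ |2 * qorb a a j| * (1 + ε j / (2 * σ)) := by
        have : y j + qorb a a j = 2 * qorb a a j + (y j - qorb a a j) := by ring
        rw [this]
        refine (abs_add_le _ _).trans ?_
        have h3 : 2 * σ ≤ |2 * qorb a a j| := by
          rw [abs_mul, abs_two]; linarith [H.σ_le j]
        have h4 : ε j ≤ |2 * qorb a a j| * (ε j / (2 * σ)) := by
          rw [← mul_div_assoc, le_div_iff₀ (by positivity), mul_comm]
          exact mul_le_mul_of_nonneg_right h3 (hε0 j)
        rw [mul_add, mul_one]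
        linarith
      have e3 : ε (j + 1) ≤ η + |2 * qorb a a j| * (1 + ε j / (2 * σ)) * ε j := by
        simp only [hε]
        rw [e1]
        refine (abs_add_le _ _).trans (add_le_add (hy.step j) ?_)
        rw [abs_mul, abs_neg]
        exact mul_le_mul_of_nonneg_right e2 (abs_nonneg _)
      have e4 : Λ (j + 1) = Λ j * |2 * qorb a a j| := growth_succ _ _
      have e5 : η = Λ (j + 1) * (η * (1 / Λ (j + 1))) := by
        have := (hpos (j + 1)).ne'
        field_simp
      calc ε (j + 1) ≤ η + |2 * qorb a a j| * (1 + ε j / (2 * σ)) * ε j := e3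
        _ ≤ η + |2 * qorb a a j| * (1 + ε j / (2 * σ)) * (Λ j * (A * B)) := by gcongr
        _ = Λ (j + 1) * (η * (1 / Λ (j + 1))) +
            Λ (j + 1) * (A * (1 + ε j / (2 * σ)) * B) := by rw [← e5, e4]; ring
        _ ≤ Λ (j + 1) * (A * (1 + ε j / (2 * σ)) * (η * (1 / Λ (j + 1)))) +
            Λ (j + 1) * (A * (1 + ε j / (2 * σ)) * B) := by
          have h6 : 0 ≤ η * (1 / Λ (j + 1)) := mul_nonneg hη (by have := hpos (j + 1); positivity)
          have h7 : 1 ≤ A * (1 + ε j / (2 * σ)) := by nlinarith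
          have h8 := hpos (j + 1)
          refine add_le_add (mul_le_mul_of_nonneg_left ?_ h8.le) le_rfl
          exact le_mul_of_one_le_left h6 h7
        _ = _ := by rw [hB]; ring
  have hsum : ∀ j, (∀ i < j, ε i ≤ 2 * Λ i * S) →
      ∑ i ∈ Finset.range j, ε i ≤ 2 * C * Λ j * S := by
    intro j hj
    calc ∑ i ∈ Finset.range j, ε i ≤ ∑ i ∈ Finset.range j, 2 * Λ i * S :=
          Finset.sum_le_sum fun i hi => hj i (Finset.mem_range.1 hi)
      _ = 2 * (∑ i ∈ Finset.range j, Λ i) * S := by rw [Finset.mul_sum, Finset.sum_mul]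
      _ ≤ 2 * (C * Λ j) * S := by have := H.sum_le j; gcongr
      _ = _ := by ring
  have hsum' : ∀ j ≤ n, (∀ i < j, ε i ≤ 2 * Λ i * S) →
      ∑ i ∈ Finset.range j, ε i ≤ 2 * C * d₀ := by
    intro j hj hi
    have h1 : ∑ i ∈ Finset.range j, ε i ≤ ∑ i ∈ Finset.range j, 2 * Λ i * S :=
      Finset.sum_le_sum fun i hi' => hi i (Finset.mem_range.1 hi')
    have h2 : ∑ i ∈ Finset.range j, Λ i ≤ ∑ i ∈ Finset.range n, Λ i :=
      Finset.sum_le_sum_of_subset_of_nonneg (Finset.range_mono hj) fun i _ _ => (hpos i).le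
    calc _ ≤ _ := h1
      _ = 2 * (∑ i ∈ Finset.range j, Λ i) * S := by rw [Finset.mul_sum, Finset.sum_mul]
      _ ≤ 2 * (C * Λ n) * S := by have := h2.trans (H.sum_le n); gcongr
      _ = 2 * C * (Λ n * S) := by ring
      _ ≤ _ := by gcongr
  -- By induction the distortion is at most `2`: the sum of the displacements is at most `σ / 2`.
  have hmain : ∀ j ≤ n, ε j ≤ 2 * Λ j * S := by
    intro j
    induction j using Nat.strong_induction_on with
    | _ j ih =>
      intro hj
      have hlt : ∀ i < j, ε i ≤ 2 * Λ i * S := fun i hi => ih i hi (by omega)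
      have h1 := hsum' j hj hlt
      have h2 : ∏ i ∈ Finset.range j, (1 + ε i / (2 * σ)) ≤ 2 := by
        refine (prod_one_add_le_exp_sum j fun i _ => div_nonneg (hε0 i) (by positivity)).trans ?_
        refine le_trans (Real.exp_le_exp.2 ?_) exp_half_le_two
        rw [← Finset.sum_div, div_le_iff₀ (by positivity)]
        have := H.small
        nlinarith
      have h3 : ε 0 + η * ∑ i ∈ Finset.range j, 1 / Λ (i + 1) ≤ S := by
        refine le_trans ?_ hS
        have := H.sum_inv_le j
        have : η * ∑ i ∈ Finset.range j, 1 / Λ (i + 1) ≤ η * C := by gcongr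
        simpa [hε, qorb_zero] using this
      have h4 : 0 ≤ ε 0 + η * ∑ i ∈ Finset.range j, 1 / Λ (i + 1) :=
        add_nonneg (hε0 0) (mul_nonneg hη (Finset.sum_nonneg fun i _ => by
          have := hpos (i + 1); positivity))
      calc ε j ≤ _ := hrec j
        _ ≤ Λ j * (2 * S) := by
          have := (hpos j).le
          gcongr
        _ = _ := by ring
  exact ⟨hmain j hj, hsum j fun i hi => hmain i (by omega)⟩

lemma shadow_sum_le (H : CritConst a κ l σ C d₀) (hy : PseudoOrbit a p η y)
    (hS : |y 0 - a| + η * C ≤ S) {n : ℕ} (hn : growth (qorb a a) n * S ≤ d₀) {j : ℕ} (hj : j ≤ n) :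
    ∑ i ∈ Finset.range j, |y i - qorb a a i| ≤ σ / 4 := by
  have h1 : ∑ i ∈ Finset.range j, |y i - qorb a a i| ≤ ∑ i ∈ Finset.range n, |y i - qorb a a i| :=
    Finset.sum_le_sum_of_subset_of_nonneg (Finset.range_mono hj) fun i _ _ => abs_nonneg _
  have h2 := (H.shadow hy hS hn le_rfl).2
  have h3 : 2 * C * growth (qorb a a) n * S ≤ 2 * C * d₀ := by
    rw [mul_assoc]; have := H.C_pos; gcongr
  linarith [H.small]

/-- The expansion along the pseudo-orbit is that of the orbit of `a` up to a factor `2`. -/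
lemma shadow_growth (H : CritConst a κ l σ C d₀) (hy : PseudoOrbit a p η y)
    (hS : |y 0 - a| + η * C ≤ S) {n : ℕ} (hn : growth (qorb a a) n * S ≤ d₀) {j : ℕ} (hj : j ≤ n) :
    growth (qorb a a) j / 2 ≤ growth y j := by
  have hσ := H.σ_pos
  have h1 := H.shadow_sum_le hy hS hn hj
  have h3 : ∀ i, |qorb a a i| * (1 - |y i - qorb a a i| / σ) ≤ |y i| := by
    intro i
    have h4 := H.σ_le i
    have h5 : |y i - qorb a a i| ≤ |qorb a a i| * (|y i - qorb a a i| / σ) := by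
      rw [← mul_div_assoc, le_div_iff₀ hσ, mul_comm]
      exact mul_le_mul_of_nonneg_right h4 (abs_nonneg _)
    have h6 := abs_sub_abs_le_abs_sub (qorb a a i) (y i)
    rw [abs_sub_comm (qorb a a i)] at h6
    rw [mul_sub, mul_one]
    linarith
  have h4 : ∀ i < j, |y i - qorb a a i| / σ ≤ 1 := by
    intro i hi
    rw [div_le_one hσ]
    have := Finset.single_le_sum (f := fun i => |y i - qorb a a i|) (fun i _ => abs_nonneg _)
      (Finset.mem_range.2 hi)
    linarith
  have h5 := one_sub_sum_le_prod_one_sub (z := fun i => |y i - qorb a a i| / σ) j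
    (fun i _ => by positivity) h4
  have h6 : ∑ i ∈ Finset.range j, |y i - qorb a a i| / σ ≤ 1 / 2 := by
    rw [← Finset.sum_div, div_le_iff₀ hσ]; linarith
  calc growth (qorb a a) j / 2 ≤ growth (qorb a a) j *
        ∏ i ∈ Finset.range j, (1 - |y i - qorb a a i| / σ) := by
        have := growth_nonneg (qorb a a) j
        nlinarith
    _ = ∏ i ∈ Finset.range j, (|2 * qorb a a i| * (1 - |y i - qorb a a i| / σ)) := by
        rw [growth, Finset.prod_mul_distrib]
    _ ≤ growth y j := by
        refine Finset.prod_le_prod (fun i hi => ?_) fun i _ => ?_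
        · have := h4 i (Finset.mem_range.1 hi)
          have : 0 ≤ 1 - |y i - qorb a a i| / σ := by linarith
          positivity
        · rw [abs_mul, abs_mul, abs_two, mul_assoc]
          exact mul_le_mul_of_nonneg_left (h3 i) (by norm_num)

/-- The last time at which the displacement `S`, multiplied by the expansion along the critical
orbit, is at most `d₀`. -/
lemma exists_binding_time (h : PreperiodicParam a p) (H : CritConst a κ l σ C d₀) (hS : 0 < S)
    (hS' : S ≤ d₀) :
    ∃ n : ℕ, growth (qorb a a) n * S ≤ d₀ ∧ d₀ < 4 * (growth (qorb a a) n * S) := by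
  have hex : ∃ n, d₀ < growth (qorb a a) n * S := by
    have h1 := ((tendsto_pow_atTop_atTop_of_one_lt H.one_lt_l).const_mul_atTop H.κ_pos).atTop_mul_const hS
    obtain ⟨n, hn⟩ := (h1.eventually_gt_atTop d₀).exists
    exact ⟨n, hn.trans_le (mul_le_mul_of_nonneg_right (H.κ_mul_pow_le n) hS.le)⟩
  classical
  have h0 : Nat.find hex ≠ 0 := by
    intro h0
    have := Nat.find_spec hex
    rw [h0, growth_zero, one_mul] at this
    linarith
  obtain ⟨n, hn⟩ := Nat.exists_eq_succ_of_ne_zero h0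
  refine ⟨n, not_lt.1 (Nat.find_min hex (by omega)), ?_⟩
  have h1 := Nat.find_spec hex
  rw [hn, Nat.succ_eq_add_one, growth_succ] at h1
  have h2 : |2 * qorb a a n| ≤ 4 := by
    rw [abs_mul, abs_two]; linarith [h.qorb_le h.abs_a_le n, h.p_lt_two]
  have h3 := (H.pos n).le
  calc d₀ < growth (qorb a a) n * |2 * qorb a a n| * S := h1
    _ ≤ growth (qorb a a) n * 4 * S := by gcongr
    _ = _ := by ring

end CritConst

/-! ### Binding and free growth -/

namespace CritConst

variable {a p κ l σ C d₀ η S : ℝ} {x : ℕ → ℝ}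

/-- Passage of a pseudo-orbit near the critical point: at the first step the derivative contracts by
`2|x₀|`, and then it expands as along the orbit of the critical value, while the orbit stays away
from `0`. -/
lemma passage (H : CritConst a κ l σ C d₀) (hx : PseudoOrbit a p η x)
    (hS : x 0 ^ 2 + η * (1 + C) ≤ S) {n : ℕ} (hn : growth (qorb a a) n * S ≤ d₀) {r : ℕ}
    (hr1 : 1 ≤ r) (hr : r ≤ n + 1) :
    |x 0| * growth (qorb a a) (r - 1) ≤ growth x r ∧ σ / 2 ≤ |x r| := by
  have hy := hx.shift 1
  have hS' : |x (1 + 0) - a| + η * C ≤ S := by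
    have h1 := hx.step 0
    have : x (1 + 0) - a = (x (0 + 1) - (a - x 0 ^ 2)) - x 0 ^ 2 := by norm_num; ring
    rw [this]
    have h2 := abs_sub (x (0 + 1) - (a - x 0 ^ 2)) (x 0 ^ 2)
    rw [abs_of_nonneg (sq_nonneg (x 0))] at h2
    linarith
  obtain ⟨j, rfl⟩ := Nat.exists_eq_add_of_le hr1
  have hj : j ≤ n := by omega
  have h1 := H.shadow_growth hy hS' hn hj
  refine ⟨?_, ?_⟩
  · rw [growth_add, Nat.add_sub_cancel_left]
    have : growth x 1 = |2 * x 0| := by simp [growth]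
    rw [this, abs_mul, abs_two]
    have := abs_nonneg (x 0)
    nlinarith
  · have h2 : |x (1 + j) - qorb a a j| ≤ σ / 2 := by
      rcases hj.eq_or_lt with rfl | hlt
      · refine (H.shadow hy hS' hn le_rfl).1.trans ?_
        have := H.d₀_le
        linarith
      · have h3 := H.shadow_sum_le hy hS' hn (Nat.succ_le_of_lt hlt)
        have h4 := Finset.single_le_sum (f := fun i => |x (1 + i) - qorb a a i|)
          (fun i _ => abs_nonneg _) (Finset.mem_range.2 (Nat.lt_succ_self j))
        have := H.σ_pos
        simp only [Nat.succ_eq_add_one] at h4 h3 ⊢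
        linarith
    have h3 := H.σ_le j
    have h4 := abs_sub_abs_le_abs_sub (qorb a a j) (x (1 + j))
    rw [abs_sub_comm] at h4
    linarith

/-- A visit close to the critical point, at a distance large with respect to `√η`, is followed by
a binding period at the end of which the derivative has grown by any prescribed factor, and
exponentially in the length of the period. -/
lemma exists_binding (h : PreperiodicParam a p) (H : CritConst a κ l σ C d₀) {K : ℝ} (hK : 0 < K) :
    ∃ m δ : ℝ, 1 < m ∧ 0 < δ ∧ ∀ η x, PseudoOrbit a p η x → |x 0| ≤ δ → x 0 ≠ 0 →
      (1 + C) * η ≤ x 0 ^ 2 → ∃ b, 1 ≤ b ∧ K * m ^ b ≤ growth x b ∧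
        ∀ r, 1 ≤ r → r ≤ b → κ / 4 * |x 0| * m ^ r ≤ growth x r ∧ σ / 2 ≤ |x r| := by
  have hκ := H.κ_pos
  have hd := H.d₀_pos
  -- `m⁴ = l`
  set m := √(√l) with hm
  have hm4 : m ^ 4 = l := by
    have h0 : 0 ≤ l := by linarith [H.one_lt_l]
    calc m ^ 4 = ((√(√l)) ^ 2) ^ 2 := by rw [hm]; ring
      _ = l := by rw [Real.sq_sqrt (Real.sqrt_nonneg _), Real.sq_sqrt h0]
  have hm1 : 1 < m := by
    rw [hm]
    exact Real.lt_sqrt_of_sq_lt (by rw [one_pow]; exact Real.lt_sqrt_of_sq_lt (by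
      rw [one_pow]; exact H.one_lt_l))
  have hmle : m ≤ 4 := by
    have h1 : m ≤ m ^ 4 := le_self_pow₀ hm1.le (by norm_num)
    linarith [H.l_le]
  -- the derivative over the period is at least `d₀ / (8 |x₀|)`, and `|x₀|⁻¹ ≥ √(c lⁿ)`
  set c := 2 * κ / d₀ with hc
  have hc0 : 0 < c := by positivity
  set E := 32 * K / (d₀ * √(√c)) with hE
  have hE0 : 0 < E := by positivity
  refine ⟨m, min (√(d₀ / 2)) (min 1 ((1 / E) ^ 2)), hm1, by positivity, ?_⟩
  intro η x hx hxδ hx0 hxη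
  have hpos : 0 < |x 0| := abs_pos.2 hx0
  have hsq : 0 < x 0 ^ 2 := by positivity
  have hS : x 0 ^ 2 + η * (1 + C) ≤ 2 * x 0 ^ 2 := by linarith
  have hS' : 2 * x 0 ^ 2 ≤ d₀ := by
    have h1 : |x 0| ≤ √(d₀ / 2) := hxδ.trans (min_le_left _ _)
    have h2 := Real.sq_sqrt (show 0 ≤ d₀ / 2 by positivity)
    have h3 := pow_le_pow_left₀ hpos.le h1 2
    rw [sq_abs] at h3
    linarith
  obtain ⟨n, hn1, hn2⟩ := H.exists_binding_time h (S := 2 * x 0 ^ 2) (by positivity) hS'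
  refine ⟨n + 1, by omega, ?_, fun r hr1 hr => ?_⟩
  · have h1 := (H.passage hx hS hn1 (r := n + 1) (by omega) le_rfl).1
    rw [Nat.add_sub_cancel] at h1
    refine le_trans ?_ h1
    set Λ := growth (qorb a a) n
    set u := √|x 0| with hu
    have hu0 : 0 < u := Real.sqrt_pos.2 hpos
    have hu2 : u ^ 2 = |x 0| := Real.sq_sqrt hpos.le
    have huE : u * E ≤ 1 := by
      have h3 : u ≤ 1 / E := by
        rw [hu]
        refine Real.sqrt_le_iff.2 ⟨by positivity, ?_⟩
        exact hxδ.trans ((min_le_right _ _).trans (min_le_right _ _))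
      rwa [le_div_iff₀ hE0] at h3
    have h4 : d₀ ≤ 8 * (Λ * |x 0| ^ 2) := by rw [sq_abs]; linarith
    -- `c lⁿ x₀² ≤ 1`
    have h5 : c * l ^ n * |x 0| ^ 2 ≤ 1 := by
      have h6 := H.κ_mul_pow_le n
      rw [sq_abs]
      rw [hc, div_mul_eq_mul_div, div_mul_eq_mul_div, div_le_one hd]
      nlinarith
    have h7 : √(√c) * m ^ n * u ≤ 1 := by
      have e1 : (√(√c)) ^ 4 = c := by
        calc (√(√c)) ^ 4 = ((√(√c)) ^ 2) ^ 2 := by ring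
          _ = c := by rw [Real.sq_sqrt (Real.sqrt_nonneg _), Real.sq_sqrt hc0.le]
      have e2 : (√(√c) * m ^ n * u) ^ 4 = c * l ^ n * |x 0| ^ 2 := by
        rw [mul_pow, mul_pow, e1, ← pow_mul, mul_comm n 4, pow_mul, hm4, ← hu2]; ring
      refine (pow_le_one_iff_of_nonneg (by positivity) (by norm_num : (4 : ℕ) ≠ 0)).1 ?_
      rw [e2]; exact h5
    have h8 : E * (d₀ * √(√c)) = 32 * K := by
      rw [hE]; field_simp
    -- combine
    have h9 : K * m ^ (n + 1) * (8 * |x 0|) ≤ d₀ := by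
      have : K * m ^ (n + 1) * (8 * |x 0|) = (E * u) * (m / 4) * d₀ * (√(√c) * m ^ n * u) := by
        rw [← hu2, pow_succ]
        linear_combination (-(m ^ n * m * u ^ 2) / 4) * h8
      rw [this]
      have hh : (E * u) * (m / 4) ≤ 1 := by
        refine mul_le_one₀ (by linarith) (by positivity) (by linarith)
      calc (E * u) * (m / 4) * d₀ * (√(√c) * m ^ n * u) ≤ 1 * d₀ * 1 := by gcongr
        _ = d₀ := by ring
    have h10 : K * m ^ (n + 1) * (8 * |x 0|) ≤ |x 0| * Λ * (8 * |x 0|) := by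
      calc _ ≤ d₀ := h9
        _ ≤ _ := by linarith
    exact le_of_mul_le_mul_right h10 (by positivity)
  · obtain ⟨h1, h2⟩ := H.passage hx hS hn1 hr1 hr
    refine ⟨le_trans ?_ h1, h2⟩
    have h3 := H.κ_mul_pow_le (r - 1)
    have h4 : m ^ r ≤ 4 * l ^ (r - 1) := by
      obtain ⟨k, rfl⟩ := Nat.exists_eq_add_of_le' hr1
      rw [pow_succ, Nat.add_sub_cancel, mul_comm]
      refine mul_le_mul hmle (pow_le_pow_left₀ (by linarith) ?_ k) (by positivity) (by norm_num)
      rw [← hm4]; exact le_self_pow₀ hm1.le (by norm_num)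
    calc κ / 4 * |x 0| * m ^ r ≤ κ / 4 * |x 0| * (4 * l ^ (r - 1)) := by gcongr
      _ = |x 0| * (κ * l ^ (r - 1)) := by ring
      _ ≤ _ := by gcongr

/-- Exponential expansion of pseudo-orbits that do not enter the zone `x² < (1 + C) η`. -/
lemma exists_free_growth (h : PreperiodicParam a p) (H : CritConst a κ l σ C d₀) :
    ∃ c m δ η₀ : ℝ, 0 < c ∧ 1 < m ∧ 0 < δ ∧ 0 < η₀ ∧ ∀ η, 0 < η → η ≤ η₀ → ∃ c', 0 < c' ∧
      ∀ n x, PseudoOrbit a p η x → (∀ i < n, (1 + C) * η ≤ x i ^ 2) →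
        c' * m ^ n ≤ growth x n ∧ (|x n| ≤ δ → c * m ^ n ≤ growth x n) := by
  obtain ⟨c₁, ρ, hc₁, hρ, haway⟩ := h.exists_growth_away
  obtain ⟨m₂, δ₂, hm₂, hδ₂, hbind⟩ := H.exists_binding h (K := 1 / c₁) (by positivity)
  have hσ := H.σ_pos
  have hκ := H.κ_pos
  have hC := H.C_pos
  set δ := min δ₂ (min ρ (σ / 4)) with hδ
  have hδ0 : 0 < δ := by positivity
  obtain ⟨m₁, η₀, c₂, hm₁, hη₀, hc₂, haway⟩ := haway δ hδ0
  set m := min m₁ m₂ with hm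
  have hm0 : 1 < m := lt_min hm₁ hm₂
  refine ⟨c₁, m, δ, η₀, hc₁, hm0, hδ0, hη₀, fun η hη hη' => ?_⟩
  set c' := min c₂ (c₁ * (κ / 4 * √((1 + C) * η))) with hc'
  have hc'0 : 0 < c' := by positivity
  refine ⟨c', hc'0, fun n => ?_⟩
  -- The orbit is cut at its first visit to `|x| ≤ δ`: before it the growth lemma away from `0`
  -- applies, with the constant `c₁` of a segment that ends near `0`. The binding period that
  -- follows, with `K = 1 / c₁`, makes up for this constant, and the remaining segment is shorter.
  induction n using Nat.strong_induction_on with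
  | _ n ih =>
    intro x hx hfree
    by_cases hvisit : ∃ i < n, |x i| ≤ δ
    · classical
      set i := Nat.find hvisit with hi
      obtain ⟨hin, hiδ⟩ := Nat.find_spec hvisit
      rw [← hi] at hin hiδ
      have hbefore : ∀ j < i, δ ≤ |x j| := fun j hj => by
        by_contra! hh
        exact Nat.find_min hvisit hj ⟨by omega, hh.le⟩
      have h1 : c₁ * m ^ i ≤ growth x i := by
        refine le_trans ?_ ((haway η hη' x hx i hbefore).2
          (hiδ.trans ((min_le_right _ _).trans (min_le_left _ _))))
        have : m ≤ m₁ := min_le_left _ _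
        gcongr
      have hxi : 0 < x i ^ 2 := lt_of_lt_of_le (by positivity) (hfree i hin)
      obtain ⟨b, hb1, hb, hb'⟩ := hbind η _ (hx.shift i) (hiδ.trans (min_le_left _ _))
        (fun h0 => by simp only [add_zero] at h0; rw [h0] at hxi; simp at hxi) (hfree i hin)
      have hmm : m ≤ m₂ := min_le_right _ _
      rcases le_or_gt (i + b) n with hcase | hcase
      · have h2 : m ^ (i + b) ≤ growth x (i + b) := by
          rw [growth_add, pow_add]
          calc m ^ i * m ^ b = (c₁ * m ^ i) * (1 / c₁ * m ^ b) := by field_simp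
            _ ≤ (c₁ * m ^ i) * (1 / c₁ * m₂ ^ b) := by gcongr
            _ ≤ _ := mul_le_mul h1 hb (by positivity) (growth_nonneg _ _)
        obtain ⟨h3, h4⟩ := ih (n - (i + b)) (by omega) _ (hx.shift (i + b))
          fun j hj => hfree _ (by omega)
        have h5 : growth x n = growth x (i + b) *
            growth (fun j => x (i + b + j)) (n - (i + b)) := by
          rw [← growth_add, Nat.add_sub_cancel' hcase]
        have h6 : m ^ n = m ^ (i + b) * m ^ (n - (i + b)) := by
          rw [← pow_add, Nat.add_sub_cancel' hcase]
        rw [Nat.add_sub_cancel' hcase] at h4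
        constructor
        · rw [h5, h6]
          calc c' * (m ^ (i + b) * m ^ (n - (i + b))) = m ^ (i + b) * (c' * m ^ (n - (i + b))) := by
                ring
            _ ≤ _ := mul_le_mul h2 h3 (by positivity) (growth_nonneg _ _)
        · intro hnδ
          rw [h5, h6]
          calc c₁ * (m ^ (i + b) * m ^ (n - (i + b))) = m ^ (i + b) * (c₁ * m ^ (n - (i + b))) := by
                ring
            _ ≤ _ := mul_le_mul h2 (h4 hnδ) (by positivity) (growth_nonneg _ _)
      -- Time `n` lies in the binding period: only the weak bound is left, and `x n` is not near
      -- `0`.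
      · obtain ⟨h2, h3⟩ := hb' (n - i) (by omega) (by omega)
        rw [Nat.add_sub_cancel' hin.le] at h3
        have h5 : growth x n = growth x i * growth (fun j => x (i + j)) (n - i) := by
          rw [← growth_add, Nat.add_sub_cancel' hin.le]
        have h6 : m ^ n = m ^ i * m ^ (n - i) := by
          rw [← pow_add, Nat.add_sub_cancel' hin.le]
        constructor
        · rw [h5, h6]
          have h7 : √((1 + C) * η) ≤ |x i| := by
            rw [← Real.sqrt_sq_eq_abs]; exact Real.sqrt_le_sqrt (hfree i hin)
          calc c' * (m ^ i * m ^ (n - i))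
              ≤ c₁ * (κ / 4 * √((1 + C) * η)) * (m ^ i * m ^ (n - i)) := by
                gcongr; exact min_le_right _ _
            _ ≤ c₁ * (κ / 4 * |x i|) * (m ^ i * m₂ ^ (n - i)) := by gcongr
            _ = (c₁ * m ^ i) * (κ / 4 * |x i| * m₂ ^ (n - i)) := by ring
            _ ≤ _ := mul_le_mul h1 h2 (by positivity) (growth_nonneg _ _)
        · intro hnδ
          have : δ ≤ σ / 4 := (min_le_right _ _).trans (min_le_right _ _)
          linarith
    · push Not at hvisit
      obtain ⟨h1, h2⟩ := haway η hη' x hx n fun i hi => (hvisit i hi).le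
      have hmm : m ≤ m₁ := min_le_left _ _
      constructor
      · refine le_trans ?_ h1
        have : c' ≤ c₂ := min_le_left _ _
        gcongr
      · intro hnδ
        refine le_trans ?_ (h2 (hnδ.trans ((min_le_right _ _).trans (min_le_left _ _))))
        gcongr

end CritConst

/-! ### Domination and the skew product -/

/-- Uniform domination: the vertical expansion along pseudo-orbits in `[-β, β]`, `β < p`, grows at
most like `Rⁿ` with `R < 2`. The weight `1 / √(p² - x²)` is adapted: with respect to it the
expansion of `f` at `x` is exactly `2|x| / √(x² + p - a)`. -/
lemma exists_domination {a p β : ℝ} (hp : p ^ 2 = a + p) (hap : a < p) (hβ : 0 < β)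
    (hβp : β < p) : ∃ C R η₀ : ℝ, 0 < C ∧ 0 < R ∧ R < 2 ∧ 0 < η₀ ∧ ∀ η ≤ η₀, ∀ x : ℕ → ℝ,
      (∀ i, |x i| ≤ β) → (∀ i, |x (i + 1) - (a - x i ^ 2)| ≤ η) → ∀ n, growth x n ≤ C * R ^ n := by
  have hp0 : 0 < p := hβ.trans hβp
  set q := p - a with hq
  have hq0 : 0 < q := by rw [hq]; linarith
  set k := p ^ 2 - β ^ 2 with hk
  have hk0 : 0 < k := by rw [hk]; nlinarith
  set ρ := 4 * β ^ 2 / (β ^ 2 + q / 2) with hρ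
  have hρ0 : 0 < ρ := by positivity
  have hρ4 : ρ < 4 := by rw [hρ, div_lt_iff₀ (by positivity)]; linarith
  set η₀ := q * k / 2 / (4 * p) with hη₀
  have hη₀0 : 0 < η₀ := by positivity
  refine ⟨√(p ^ 2 / k), √ρ, η₀, by positivity, by positivity, ?_, hη₀0, ?_⟩
  · rw [Real.sqrt_lt' (by norm_num)]; linarith
  intro η hη x hx hstep n
  have hw : ∀ i, k ≤ p ^ 2 - x i ^ 2 := fun i => by
    have := sq_le_sq' (abs_le.1 (hx i)).1 (abs_le.1 (hx i)).2
    rw [hk]; linarith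
  have hone : ∀ i, (2 * x i) ^ 2 * (p ^ 2 - x i ^ 2) ≤ ρ * (p ^ 2 - x (i + 1) ^ 2) := by
    intro i
    set y := x i
    set z := a - y ^ 2 with hz
    have hyp : y ^ 2 ≤ β ^ 2 := sq_le_sq' (abs_le.1 (hx i)).1 (abs_le.1 (hx i)).2
    have hy0 := sq_nonneg y
    -- The identity that makes the weight adapted to `f`.
    have h1 : p ^ 2 - z ^ 2 = (q + y ^ 2) * (p ^ 2 - y ^ 2) := by
      rw [hz, hq]; linear_combination -(p - a + y ^ 2) * hp
    have h2 : x (i + 1) ^ 2 - z ^ 2 ≤ q * k / 2 := by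
      have e : x (i + 1) ^ 2 - z ^ 2 = (x (i + 1) - z) * (x (i + 1) + z) := by ring
      have hzp : |z| ≤ p := by
        rw [abs_le, hz]
        constructor <;> nlinarith
      have h3 : |x (i + 1) + z| ≤ 4 * p := (abs_add_le _ _).trans (by linarith [hx (i + 1)])
      calc _ ≤ |(x (i + 1) - z) * (x (i + 1) + z)| := by rw [e]; exact le_abs_self _
        _ = |x (i + 1) - z| * |x (i + 1) + z| := abs_mul _ _
        _ ≤ η₀ * (4 * p) := mul_le_mul ((hstep i).trans hη) h3 (abs_nonneg _) hη₀0.le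
        _ = q * k / 2 := by rw [hη₀]; field_simp
    have h4 : (q / 2 + y ^ 2) * (p ^ 2 - y ^ 2) ≤ p ^ 2 - x (i + 1) ^ 2 := by
      have h5 := mul_le_mul_of_nonneg_left (hw i) (half_pos hq0).le
      nlinarith
    have h6 : (2 * y) ^ 2 ≤ ρ * (q / 2 + y ^ 2) := by
      rw [hρ, div_mul_eq_mul_div, le_div_iff₀ (by positivity)]
      nlinarith
    calc (2 * y) ^ 2 * (p ^ 2 - y ^ 2) ≤ ρ * (q / 2 + y ^ 2) * (p ^ 2 - y ^ 2) :=
          mul_le_mul_of_nonneg_right h6 (hk0.le.trans (hw i))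
      _ = ρ * ((q / 2 + y ^ 2) * (p ^ 2 - y ^ 2)) := by ring
      _ ≤ _ := by gcongr
  have hind : ∀ n, growth x n ^ 2 * (p ^ 2 - x 0 ^ 2) ≤ ρ ^ n * (p ^ 2 - x n ^ 2) := by
    intro n
    induction n with
    | zero => simp [growth_zero]
    | succ n ih =>
      rw [growth_succ, mul_pow, sq_abs]
      have h1 := hone n
      calc growth x n ^ 2 * (2 * x n) ^ 2 * (p ^ 2 - x 0 ^ 2)
          = (2 * x n) ^ 2 * (growth x n ^ 2 * (p ^ 2 - x 0 ^ 2)) := by ring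
        _ ≤ (2 * x n) ^ 2 * (ρ ^ n * (p ^ 2 - x n ^ 2)) := by gcongr
        _ = ρ ^ n * ((2 * x n) ^ 2 * (p ^ 2 - x n ^ 2)) := by ring
        _ ≤ ρ ^ n * (ρ * (p ^ 2 - x (n + 1) ^ 2)) := by gcongr
        _ = _ := by ring
  have h1 := hind n
  have h2 : growth x n ^ 2 ≤ p ^ 2 / k * ρ ^ n := by
    rw [div_mul_eq_mul_div, le_div_iff₀ hk0]
    calc growth x n ^ 2 * k ≤ growth x n ^ 2 * (p ^ 2 - x 0 ^ 2) := by gcongr; exact hw 0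
      _ ≤ ρ ^ n * (p ^ 2 - x n ^ 2) := h1
      _ ≤ p ^ 2 * ρ ^ n := by
        have := sq_nonneg (x n)
        have : 0 < ρ ^ n := by positivity
        nlinarith
  have h3 : √(p ^ 2 / k) * √ρ ^ n = √(p ^ 2 / k * ρ ^ n) := by
    rw [Real.sqrt_mul (by positivity)]
    congr 1
    rw [Real.sqrt_eq_rpow, Real.sqrt_eq_rpow, ← Real.rpow_natCast, ← Real.rpow_natCast,
      ← Real.rpow_mul hρ0.le, ← Real.rpow_mul hρ0.le, mul_comm]
  rw [h3]
  exact Real.le_sqrt_of_sq_le h2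

section Skew

variable {a : ℝ} {d : ℕ} {φ : UnitAddCircle → ℝ} {α : ℝ}

lemma skewMap_iterate_fst (n : ℕ) (q : UnitAddCircle × ℝ) :
    ((skewMap a d φ α)^[n] q).1 = d ^ n • q.1 := by
  induction n with
  | zero => simp
  | succ n ih =>
    rw [Function.iterate_succ_apply']
    change d • ((skewMap a d φ α)^[n] q).1 = _
    rw [ih, pow_succ', mul_smul]

lemma fibreIter_zero (θ : UnitAddCircle) (x : ℝ) : fibreIter a d φ α 0 θ x = x := rfl

lemma fibreIter_succ (n : ℕ) (θ : UnitAddCircle) (x : ℝ) :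
    fibreIter a d φ α (n + 1) θ x =
      a - fibreIter a d φ α n θ x ^ 2 + α * φ (d ^ n • θ) := by
  simp only [fibreIter]
  rw [Function.iterate_succ_apply']
  conv_lhs => rw [skewMap]
  simp only [quadMap]
  rw [skewMap_iterate_fst]

lemma fibreIter_add (m n : ℕ) (θ : UnitAddCircle) (x : ℝ) :
    fibreIter a d φ α (m + n) θ x =
      fibreIter a d φ α n (d ^ m • θ) (fibreIter a d φ α m θ x) := by
  induction n with
  | zero => simp [fibreIter_zero]
  | succ n ih => rw [← add_assoc, fibreIter_succ, ih, fibreIter_succ, ← mul_smul, pow_add, mul_comm (d ^ m)]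

lemma hasDerivAt_fibreIter (n : ℕ) (θ : UnitAddCircle) (x : ℝ) :
    HasDerivAt (fun y => fibreIter a d φ α n θ y)
      (∏ i ∈ Finset.range n, (-2 * fibreIter a d φ α i θ x)) x := by
  induction n with
  | zero => simpa [fibreIter_zero] using hasDerivAt_id' x
  | succ n ih =>
    simp only [fibreIter_succ, Finset.prod_range_succ]
    refine (((ih.pow 2).const_sub a).add_const _).congr_deriv ?_
    push_cast
    ring

lemma abs_vertDeriv (n : ℕ) (θ : UnitAddCircle) (x : ℝ) :
    |vertDeriv a d φ α n θ x| = growth (fun i => fibreIter a d φ α i θ x) n := by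
  rw [vertDeriv, (hasDerivAt_fibreIter n θ x).deriv, Finset.abs_prod, growth]
  exact Finset.prod_congr rfl fun i _ => by rw [neg_mul, abs_neg]

/-- The fibre coordinates of an orbit of the skew product form a pseudo-orbit of `f`. -/
lemma fibreIter_step {Φ : ℝ} (hα : 0 ≤ α) (hΦ : ∀ θ, |φ θ| ≤ Φ) (n : ℕ) (θ : UnitAddCircle)
    (x : ℝ) : |fibreIter a d φ α (n + 1) θ x - (a - fibreIter a d φ α n θ x ^ 2)| ≤ α * Φ := by
  rw [fibreIter_succ, add_sub_cancel_left, abs_mul, abs_of_nonneg hα]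
  exact mul_le_mul_of_nonneg_left (hΦ _) hα

/-- `B = [-β, β]` is invariant for all maps uniformly close to `f`. -/
lemma exists_invariant_margin {β : ℝ} (hβ : 0 < β)
    (hB : MapsTo (quadMap a) (Icc (-β) β) (interior (Icc (-β) β))) :
    ∃ η₀ : ℝ, 0 < η₀ ∧ ∀ x y, |x| ≤ β → |y - (a - x ^ 2)| ≤ η₀ → |y| ≤ β := by
  rw [interior_Icc] at hB
  have h0 := hB (x := 0) ⟨by linarith, hβ.le⟩
  have h1 := hB (x := β) ⟨by linarith, le_rfl⟩
  simp only [quadMap, mem_Ioo] at h0 h1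
  refine ⟨min (β - a) (a - β ^ 2 + β), lt_min (by linarith) (by linarith), fun x y hx hy => ?_⟩
  have h2 := sq_le_sq' (abs_le.1 hx).1 (abs_le.1 hx).2
  have h3 := abs_le.1 (hy.trans (min_le_left _ _))
  have h4 := abs_le.1 (hy.trans (min_le_right _ _))
  rw [abs_le]
  constructor <;> nlinarith [sq_nonneg x]

lemma fibreIter_le {β Φ η₀ : ℝ} (hinv : ∀ x y, |x| ≤ β → |y - (a - x ^ 2)| ≤ η₀ → |y| ≤ β)
    (hα : 0 ≤ α) (hΦ : ∀ θ, |φ θ| ≤ Φ) (hη : α * Φ ≤ η₀) (θ : UnitAddCircle) {x : ℝ}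
    (hx : |x| ≤ β) (n : ℕ) : |fibreIter a d φ α n θ x| ≤ β := by
  induction n with
  | zero => exact hx
  | succ n ih => exact hinv _ _ ih ((fibreIter_step hα hΦ n θ x).trans hη)

end Skew

/-- Uniform domination with `R < 2 ≤ d` yields domination times, with the rate `(R + 2) / 2`. -/
lemma exists_isDominationTime {a β Φ p : ℝ} {d : ℕ} {φ : UnitAddCircle → ℝ} (hd : 2 ≤ d)
    (hp : p ^ 2 = a + p) (hap : a < p) (hβ : 0 < β) (hβp : β < p)
    (hB : MapsTo (quadMap a) (Icc (-β) β) (interior (Icc (-β) β)))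
    (hΦ : ∀ θ, |φ θ| ≤ Φ) : ∃ n₀ : ℕ, IsDominationTime a d φ β n₀ := by
  obtain ⟨C, R, η₀, hC, hR, hR2, hη₀, hdom⟩ := exists_domination hp hap hβ hβp
  obtain ⟨η₁, hη₁, hinv⟩ := exists_invariant_margin hβ hB
  have hΦ0 : 0 ≤ Φ := (abs_nonneg _).trans (hΦ 0)
  set R' := (R + 2) / 2 with hR'
  have hRR' : R < R' := by rw [hR']; linarith
  have hR'2 : R' < 2 := by rw [hR']; linarith
  have hR'0 : 0 < R' := by linarith
  have e1 : ∀ᶠ k : ℕ in atTop, C * R ^ k ≤ R' ^ k := by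
    have h1 : Tendsto (fun k : ℕ => C * (R / R') ^ k) atTop (𝓝 (C * 0)) :=
      (tendsto_pow_atTop_nhds_zero_of_lt_one (by positivity)
        ((div_lt_one hR'0).2 hRR')).const_mul C
    filter_upwards [h1.eventually_le_const (show C * 0 < 1 by simp)] with k hk
    rw [div_pow, ← mul_div_assoc, div_le_one (by positivity)] at hk
    exact hk
  have e2 : ∀ᶠ k : ℕ in atTop, R' ^ k ≤ (d : ℝ) ^ k / 6 := by
    have h1 : Tendsto (fun k : ℕ => 6 * (R' / 2) ^ k) atTop (𝓝 (6 * 0)) :=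
      (tendsto_pow_atTop_nhds_zero_of_lt_one (by positivity)
        ((div_lt_one (by norm_num)).2 hR'2)).const_mul 6
    filter_upwards [h1.eventually_le_const (show (6 : ℝ) * 0 < 1 by simp)] with k hk
    rw [div_pow, ← mul_div_assoc, div_le_one (by positivity)] at hk
    have h2 : (2 : ℝ) ^ k ≤ (d : ℝ) ^ k := pow_le_pow_left₀ (by norm_num) (by exact_mod_cast hd) k
    linarith
  obtain ⟨n₀, hn₀⟩ := eventually_atTop.1 (e1.and e2)
  have hmin : 0 < min η₀ η₁ := lt_min hη₀ hη₁
  refine ⟨n₀, C, R', hC, hR'0, hR'2, min η₀ η₁ / (Φ + 1), by positivity, ?_⟩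
  intro α hα hα' θ x hx
  have hαΦ : α * Φ ≤ min η₀ η₁ := by
    rw [lt_div_iff₀ (by linarith)] at hα'
    nlinarith
  have hx' : |x| ≤ β := abs_le.2 hx
  have hg : ∀ k, |vertDeriv a d φ α k θ x| ≤ C * R ^ k := fun k => by
    rw [abs_vertDeriv]
    exact hdom _ (hαΦ.trans (min_le_left _ _)) _
      (fun i => fibreIter_le hinv hα.le hΦ (hαΦ.trans (min_le_right _ _)) θ hx' i)
      (fun i => fibreIter_step hα.le hΦ i θ x) k
  refine ⟨fun k => (hg k).trans (by gcongr), fun k hk => ⟨(hg k).trans (hn₀ k hk).1, (hn₀ k hk).2⟩⟩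

/-! ### Towers of derivatives of analytic functions -/

open scoped Nat in
/-- A sequence of functions on `ℝ`, each the derivative of the one before, with derivatives of
positive order bounded as those of a function that is analytic on a strip about the real axis. -/
structure AnalyticTower (g : ℕ → ℝ → ℝ) (C ρ : ℝ) : Prop where
  hasDerivAt : ∀ i t, HasDerivAt (g i) (g (i + 1) t) t
  C_nonneg : 0 ≤ C
  ρ_pos : 0 < ρ
  bound : ∀ i, 1 ≤ i → ∀ t, |g i t| ≤ C * ρ ^ i * (i ! : ℝ)

open scoped Nat in
/-- Local Cauchy estimates, from a power series and its re-expansions at nearby points. -/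
lemma AnalyticAt.exists_iteratedDeriv_bound {f : ℝ → ℝ} {x : ℝ} (hf : AnalyticAt ℝ f x) :
    ∃ C ρ : ℝ, ∀ᶠ t in 𝓝 x, ∀ i, |iteratedDeriv i f t| ≤ C * ρ ^ i * (i ! : ℝ) := by
  obtain ⟨P, r, hP⟩ := hf
  obtain ⟨δ, hδ0, hδ⟩ := ENNReal.lt_iff_exists_nnreal_btwn.1 hP.r_pos
  set r' := δ / 2 with hr'
  have hr'0 : 0 < r' := by
    have : (0 : NNReal) < δ := by exact_mod_cast hδ0
    positivity
  have hsum : (r' + r' : ENNReal) < P.radius := by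
    rw [← ENNReal.coe_add, hr', add_halves]
    exact hδ.trans_le hP.r_le
  have hS := P.changeOriginSeries_summable_aux₁ hsum
  obtain ⟨hS1, hS2⟩ := NNReal.summable_sigma.1 hS
  dsimp only at hS1 hS2
  set T := ∑' k : ℕ, ∑' s : Σ l : ℕ, { s : Finset (Fin (k + l)) // s.card = l },
    ‖P (k + s.1)‖₊ * r' ^ s.1 * r' ^ k with hT
  refine ⟨T, (r' : ℝ)⁻¹, ?_⟩
  filter_upwards [Metric.closedBall_mem_nhds x (show (0 : ℝ) < r' from hr'0)] with t ht i
  set y := t - x with hy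
  have hyr : ‖y‖₊ ≤ r' := by
    rw [Metric.mem_closedBall, Real.dist_eq] at ht
    exact_mod_cast ht
  have hyr2 : (‖y‖₊ : ENNReal) < r := by
    refine lt_of_le_of_lt ?_ hδ
    rw [ENNReal.coe_le_coe]
    exact hyr.trans (by rw [hr']; exact half_le_self zero_le)
  have hps := hP.changeOrigin hyr2
  have e1 := hps.factorial_smul (1 : ℝ) i
  rw [show x + y = t by rw [hy]; ring] at e1
  have e2 : iteratedDeriv i f t = i ! • (P.changeOrigin y i) (fun _ => 1) := by
    rw [e1]; rfl
  -- One convergent double sum bounds the coefficients of all re-expansions in the disc of radius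
  -- `r'`.
  have e3 : ‖P.changeOrigin y i‖₊ * r' ^ i ≤ T := by
    refine le_trans ?_ (hS2.le_tsum i (fun _ _ => zero_le))
    rw [NNReal.tsum_mul_right]
    gcongr
    refine (P.nnnorm_changeOrigin_le i (hyr2.trans_le hP.r_le)).trans ?_
    have h1 : Summable fun s : Σ l : ℕ, { s : Finset (Fin (i + l)) // s.card = l } =>
        ‖P (i + s.1)‖₊ * r' ^ s.1 := by
      have := (hS1 i).mul_right ((r' ^ i)⁻¹)
      refine this.congr fun s => ?_
      rw [mul_assoc, mul_inv_cancel₀ (by positivity), mul_one]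
    have h2 : ∀ s : Σ l : ℕ, { s : Finset (Fin (i + l)) // s.card = l },
        ‖P (i + s.1)‖₊ * ‖y‖₊ ^ s.1 ≤ ‖P (i + s.1)‖₊ * r' ^ s.1 := fun s => by gcongr
    exact (NNReal.summable_of_le h2 h1).tsum_le_tsum h2 h1
  have e4 : ‖P.changeOrigin y i‖ * (r' : ℝ) ^ i ≤ T := by exact_mod_cast e3
  have hr'i : (0 : ℝ) < (r' : ℝ) ^ i := pow_pos (by exact_mod_cast hr'0) i
  have e5 : |(P.changeOrigin y i) (fun _ => (1 : ℝ))| ≤ ‖P.changeOrigin y i‖ := by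
    have := (P.changeOrigin y i).le_opNorm (fun _ => (1 : ℝ))
    simpa only [norm_one, Finset.prod_const_one, mul_one, Real.norm_eq_abs] using this
  rw [e2, nsmul_eq_mul, abs_mul, abs_of_nonneg (by positivity : (0 : ℝ) ≤ (i ! : ℝ)), mul_comm]
  refine mul_le_mul_of_nonneg_right ?_ (by positivity)
  rw [inv_pow, ← div_eq_mul_inv, le_div_iff₀ hr'i]
  exact (mul_le_mul_of_nonneg_right e5 hr'i.le).trans e4

open scoped Nat in
/-- For a periodic function the Cauchy estimates are uniform, by compactness of the period. -/
lemma exists_iteratedDeriv_bound {f : ℝ → ℝ} (hf : AnalyticOnNhd ℝ f univ)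
    (hper : Function.Periodic f 1) :
    ∃ C ρ : ℝ, 0 ≤ C ∧ 0 < ρ ∧ ∀ i t, |iteratedDeriv i f t| ≤ C * ρ ^ i * (i ! : ℝ) := by
  have key : ∃ C ρ : ℝ, 0 ≤ C ∧ 0 < ρ ∧
      ∀ t ∈ Icc (0 : ℝ) 1, ∀ i, |iteratedDeriv i f t| ≤ C * ρ ^ i * (i ! : ℝ) := by
    have hmono : ∀ C ρ C' ρ' : ℝ, 0 ≤ C' → |C| ≤ C' → |ρ| ≤ ρ' → ∀ i : ℕ,
        C * ρ ^ i * (i ! : ℝ) ≤ C' * ρ' ^ i * (i ! : ℝ) := fun C ρ C' ρ' h0 hC hρ i => by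
      refine mul_le_mul_of_nonneg_right ?_ (by positivity)
      refine (le_abs_self _).trans ?_
      rw [abs_mul, abs_pow]
      gcongr
    refine isCompact_Icc.induction_on (p := fun s => ∃ C ρ : ℝ, 0 ≤ C ∧ 0 < ρ ∧
      ∀ t ∈ s, ∀ i, |iteratedDeriv i f t| ≤ C * ρ ^ i * (i ! : ℝ)) ?_ ?_ ?_ ?_
    · exact ⟨0, 1, le_rfl, one_pos, fun t ht => absurd ht (notMem_empty t)⟩
    · rintro s t hst ⟨C, ρ, hC, hρ, h⟩
      exact ⟨C, ρ, hC, hρ, fun u hu => h u (hst hu)⟩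
    · rintro s t ⟨C, ρ, hC, hρ, h⟩ ⟨C', ρ', hC', hρ', h'⟩
      refine ⟨max C C', max ρ ρ', le_max_of_le_left hC, lt_max_of_lt_left hρ, ?_⟩
      rintro u (hu | hu) i
      · exact (h u hu i).trans (hmono _ _ _ _ (le_max_of_le_left hC)
          (by rw [abs_of_nonneg hC]; exact le_max_left _ _)
          (by rw [abs_of_nonneg hρ.le]; exact le_max_left _ _) i)
      · exact (h' u hu i).trans (hmono _ _ _ _ (le_max_of_le_left hC)
          (by rw [abs_of_nonneg hC']; exact le_max_right _ _)
          (by rw [abs_of_nonneg hρ'.le]; exact le_max_right _ _) i)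
    · intro x _
      obtain ⟨C, ρ, h⟩ := (hf x (mem_univ x)).exists_iteratedDeriv_bound
      refine ⟨_, mem_nhdsWithin_of_mem_nhds h, |C|, |ρ| + 1, abs_nonneg _, by positivity, ?_⟩
      intro t ht i
      exact (ht i).trans (hmono _ _ _ _ (abs_nonneg _) le_rfl (by linarith [abs_nonneg ρ]) i)
  obtain ⟨C, ρ, hC, hρ, h⟩ := key
  refine ⟨C, ρ, hC, hρ, fun i t => ?_⟩
  have hp : Function.Periodic (iteratedDeriv i f) 1 := fun u => by
    have := congrFun (iteratedDeriv_comp_add_const i f 1) u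
    rw [← this, show (fun z => f (z + 1)) = f from funext hper]
  have e : iteratedDeriv i f t = iteratedDeriv i f (Int.fract t) := by
    have := hp.sub_int_mul_eq (x := t) ⌊t⌋
    rw [mul_one] at this
    exact this.symm
  rw [e]
  exact h _ ⟨Int.fract_nonneg t, (Int.fract_lt_one t).le⟩ i

/-- A periodic real-analytic function, seen as the tower of its derivatives. -/
lemma exists_analyticTower {f : ℝ → ℝ} (hf : AnalyticOnNhd ℝ f univ)
    (hper : Function.Periodic f 1) :
    ∃ C ρ : ℝ, AnalyticTower (fun i => iteratedDeriv i f) C ρ ∧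
      ∀ i, Function.Periodic (iteratedDeriv i f) 1 := by
  obtain ⟨C, ρ, hC, hρ, h⟩ := exists_iteratedDeriv_bound hf hper
  have hcd : ContDiff ℝ (⊤ : ℕ∞) f := contDiff_iff_contDiffAt.2 fun x => (hf x (mem_univ x)).contDiffAt
  refine ⟨C, ρ, ⟨fun i t => ?_, hC, hρ, fun i _ t => h i t⟩, fun i u => ?_⟩
  · have h1 : DifferentiableAt ℝ (iteratedDeriv i f) t :=
      (hcd.differentiable_iteratedDeriv i (by exact_mod_cast WithTop.coe_lt_top _)) t
    have := h1.hasDerivAt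
    rwa [← iteratedDeriv_succ] at this
  · have := congrFun (iteratedDeriv_comp_add_const i f 1) u
    rw [← this, show (fun z => f (z + 1)) = f from funext hper]

namespace AnalyticTower

variable {g : ℕ → ℝ → ℝ} {C ρ : ℝ}

lemma continuous (hg : AnalyticTower g C ρ) (i : ℕ) : Continuous (g i) :=
  continuous_iff_continuousAt.2 fun t => (hg.hasDerivAt i t).continuousAt

open scoped Nat in
/-- Taylor's formula: a bound near a point where all derivatives of order at least `k` vanish. -/
lemma abs_le_of_zero (hg : AnalyticTower g C ρ) {k : ℕ} (hk : 1 ≤ k) {s₀ : ℝ}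
    (h0 : ∀ i, k ≤ i → g i s₀ = 0) (n : ℕ) : ∀ i, k ≤ i → ∀ s, s₀ ≤ s →
      |g i s| ≤ C * ρ ^ (i + n) * ((i + n)! : ℝ) * ((s - s₀) ^ n / (n ! : ℝ)) := by
  induction n with
  | zero => intro i hi s _; simpa using hg.bound i (hk.trans hi) s
  | succ n ih =>
    intro i hi s hs
    set M := C * ρ ^ (i + (n + 1)) * (i + (n + 1))! with hM
    have hB : ∀ x, HasDerivAt (fun x => M * ((x - s₀) ^ (n + 1) / (n + 1)!))
        (M * ((x - s₀) ^ n / (n ! : ℝ))) x := fun x => by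
      have h1 := ((((hasDerivAt_id' x).sub_const s₀).pow (n + 1)).div_const ((n + 1)! : ℝ)).const_mul M
      refine h1.congr_deriv ?_
      have : ((n + 1)! : ℝ) = (n + 1) * (n ! : ℝ) := by push_cast [Nat.factorial_succ]; ring
      rw [this]
      have h2 : (n ! : ℝ) ≠ 0 := by positivity
      simp only [Nat.add_sub_cancel, mul_one]
      push_cast
      field_simp
    have := image_norm_le_of_norm_deriv_right_le_deriv_boundary (f := g i) (a := s₀) (b := s)
      (f' := g (i + 1)) (hg.continuous i).continuousOn
      (fun x _ => (hg.hasDerivAt i x).hasDerivWithinAt)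
      (B := fun x => M * ((x - s₀) ^ (n + 1) / (n + 1)!)) (B' := fun x => M * ((x - s₀) ^ n / (n ! : ℝ)))
      (by simp [h0 i hi]) hB (fun x hx => ?_) (right_mem_Icc.2 hs)
    · exact this
    · have h1 := ih (i + 1) (by lia) x hx.1
      rwa [show i + 1 + n = i + (n + 1) by ring] at h1

open scoped Nat in
/-- Unique continuation to the right: the vanishing of the derivatives of order at least `k`
propagates by steps of length `1 / (4ρ)`, within which the Taylor estimate tends to `0`. -/
lemma eq_zero_of_le (hg : AnalyticTower g C ρ) {k : ℕ} (hk : 1 ≤ k) {s₀ : ℝ}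
    (h0 : ∀ i, k ≤ i → g i s₀ = 0) {s : ℝ} (hs : s₀ ≤ s) {i : ℕ} (hi : k ≤ i) : g i s = 0 := by
  set δ := 1 / (4 * ρ) with hδ
  have hρ := hg.ρ_pos
  have hδ0 : 0 < δ := by positivity
  have step : ∀ s₁, (∀ i, k ≤ i → g i s₁ = 0) → ∀ s, s₁ ≤ s → s ≤ s₁ + δ → ∀ i, k ≤ i →
      g i s = 0 := by
    intro s₁ h1 s hs hsδ i hi
    have hb : ∀ n : ℕ, |g i s| ≤ C * (2 * ρ) ^ i * (i ! : ℝ) * (1 / 2) ^ n := fun n => by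
      refine (hg.abs_le_of_zero hk h1 n i hi s hs).trans ?_
      have e1 : ((i + n)! : ℝ) ≤ 2 ^ (i + n) * ((i ! : ℝ) * (n ! : ℝ)) := by
        have := Nat.add_choose_mul_factorial_mul_factorial i n
        rw [← this]
        push_cast
        rw [mul_assoc]
        gcongr
        exact_mod_cast Nat.choose_le_two_pow _ _
      have e2 : (s - s₁) ^ n ≤ δ ^ n := pow_le_pow_left₀ (by linarith) (by linarith) n
      have hC := hg.C_nonneg
      calc C * ρ ^ (i + n) * (i + n)! * ((s - s₁) ^ n / n !)
          ≤ C * ρ ^ (i + n) * (2 ^ (i + n) * ((i ! : ℝ) * (n ! : ℝ))) * (δ ^ n / (n ! : ℝ)) := by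
            gcongr
        _ = C * (2 * ρ) ^ i * (i ! : ℝ) * (2 * ρ * δ) ^ n := by
            have : (n ! : ℝ) ≠ 0 := by positivity
            rw [pow_add, pow_add, mul_pow, mul_pow, mul_pow]
            field_simp
        _ = _ := by
            congr 2
            rw [hδ]; field_simp; norm_num
    have hlim : Tendsto (fun n : ℕ => C * (2 * ρ) ^ i * (i ! : ℝ) * (1 / 2 : ℝ) ^ n) atTop (𝓝 0) := by
      have := (tendsto_pow_atTop_nhds_zero_of_lt_one (r := (1 / 2 : ℝ)) (by norm_num)
        (by norm_num)).const_mul (C * (2 * ρ) ^ i * (i ! : ℝ))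
      rwa [mul_zero] at this
    exact abs_nonpos_iff.1 (ge_of_tendsto' hlim hb)
  have hind : ∀ N : ℕ, ∀ s, s₀ ≤ s → s ≤ s₀ + N * δ → ∀ i, k ≤ i → g i s = 0 := by
    intro N
    induction N with
    | zero =>
      intro s h1 h2
      have : s = s₀ := le_antisymm (by simpa using h2) h1
      rw [this]; exact h0
    | succ N ih =>
      intro s h1 h2
      by_cases h3 : s ≤ s₀ + N * δ
      · exact ih s h1 h3
      · exact step (s₀ + N * δ) (ih _ (by linarith [show 0 ≤ N * δ by positivity]) le_rfl) s
          (by linarith) (by push_cast at h2; linarith)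
  obtain ⟨N, hN⟩ := exists_nat_ge ((s - s₀) / δ)
  exact hind N s hs (by rw [div_le_iff₀ hδ0] at hN; linarith) i hi

/-- A `1`-periodic tower in which some derivative vanishes is constant. -/
lemma const_of_eq_zero (hg : AnalyticTower g C ρ) (hper : ∀ i, Function.Periodic (g i) 1)
    {i : ℕ} (hi : ∀ t, g (i + 1) t = 0) : ∀ s t, g 0 s = g 0 t := by
  induction i with
  | zero =>
    exact is_const_of_deriv_eq_zero (fun t => (hg.hasDerivAt 0 t).differentiableAt)
      (fun t => by rw [(hg.hasDerivAt 0 t).deriv, hi])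
  | succ i ih =>
    refine ih fun t => ?_
    have hc := is_const_of_deriv_eq_zero (fun t => (hg.hasDerivAt (i + 1) t).differentiableAt)
      (fun t => by rw [(hg.hasDerivAt (i + 1) t).deriv, hi])
    obtain ⟨c, _, hc'⟩ := exists_hasDerivAt_eq_slope (g i) (g (i + 1)) (zero_lt_one (α := ℝ))
      (hg.continuous i).continuousOn (fun x _ => hg.hasDerivAt i x)
    rw [hc t c, hc']
    have := hper i 0
    simp only [zero_add] at this
    rw [this]; simp

end AnalyticTower

/-! ### Limits of image curves -/

/-- The series `∑ λ_k (ψ(t_k + s / d^{k+1}) - ψ(t_k))` and its derivatives in `s`, where `g` is the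
sequence of derivatives of `ψ`. Up to scaling, these functions are the limits of the images of
horizontal curves under high iterates of the skew product: `t_k` is the branch of the preimage of
the circle and `λ_k` the expansion along the fibre over the last `k` steps. -/
noncomputable def branchSeries (g : ℕ → ℝ → ℝ) (d : ℕ) (ω : (ℕ → ℝ) × (ℕ → ℝ)) (i : ℕ) (s : ℝ) :
    ℝ :=
  ∑' k, ω.1 k * ((1 / (d : ℝ) ^ (k + 1)) ^ i *
    (g i (ω.2 k + 1 / (d : ℝ) ^ (k + 1) * s) - if i = 0 then g 0 (ω.2 k) else 0))

/-- The compact space of data of the functions `branchSeries`. -/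
def branchData (C R : ℝ) : Set ((ℕ → ℝ) × (ℕ → ℝ)) :=
  ((univ.pi fun k => Icc (-(C * R ^ k)) (C * R ^ k)) ×ˢ (univ.pi fun _ => Icc (0 : ℝ) 1)) ∩
    {ω | ω.1 0 = 1}

lemma mem_branchData {C R : ℝ} {ω : (ℕ → ℝ) × (ℕ → ℝ)} : ω ∈ branchData C R ↔
    (∀ k, |ω.1 k| ≤ C * R ^ k) ∧ (∀ k, ω.2 k ∈ Icc (0 : ℝ) 1) ∧ ω.1 0 = 1 := by
  simp only [branchData, mem_inter_iff, mem_prod, mem_univ_pi, mem_ofPred_eq, and_assoc, abs_le,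
    mem_Icc]

lemma isCompact_branchData (C R : ℝ) : IsCompact (branchData C R) :=
  ((isCompact_univ_pi fun _ => isCompact_Icc).prod (isCompact_univ_pi fun _ => isCompact_Icc)).inter_right
    (isClosed_singleton.preimage (by fun_prop : Continuous fun ω : (ℕ → ℝ) × (ℕ → ℝ) => ω.1 0))

section Branch

variable {g : ℕ → ℝ → ℝ} {d : ℕ} {A ρ C R : ℝ}

lemma branchScale_pos (hd : 2 ≤ d) (k : ℕ) : 0 < 1 / (d : ℝ) ^ (k + 1) := by
  have : (0 : ℝ) < d := by exact_mod_cast (by lia : 0 < d)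
  positivity

lemma branchScale_le (hd : 2 ≤ d) (k : ℕ) : 1 / (d : ℝ) ^ (k + 1) ≤ (1 / (d : ℝ)) ^ k := by
  have hd1 : (1 : ℝ) ≤ d := by exact_mod_cast (by lia : 1 ≤ d)
  rw [div_pow, one_pow]
  exact one_div_le_one_div_of_le (by positivity) (pow_le_pow_right₀ hd1 (by lia))

lemma branchScale_le_one (hd : 2 ≤ d) (k : ℕ) : 1 / (d : ℝ) ^ (k + 1) ≤ 1 := by
  have hd1 : (1 : ℝ) ≤ d := by exact_mod_cast (by lia : 1 ≤ d)
  rw [div_le_one (by positivity)]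
  exact one_le_pow₀ hd1

lemma branchScale_pow_le (hd : 2 ≤ d) (k : ℕ) {i : ℕ} (hi : 1 ≤ i) :
    (1 / (d : ℝ) ^ (k + 1)) ^ i ≤ (1 / (d : ℝ)) ^ k :=
  (pow_le_of_le_one (branchScale_pos hd k).le (branchScale_le_one hd k) (by lia)).trans
    (branchScale_le hd k)

/-- The terms of the derivatives of positive order decay like `(R / d)ᵏ`, because `R < d`. -/
lemma branchTerm_le (hd : 2 ≤ d) {ω : (ℕ → ℝ) × (ℕ → ℝ)} (hω : ∀ k, |ω.1 k| ≤ C * R ^ k) {i : ℕ}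
    (hi : 1 ≤ i) {B x : ℝ} (hB : |x| ≤ B) (k : ℕ) :
    ‖ω.1 k * ((1 / (d : ℝ) ^ (k + 1)) ^ i * (x - if i = 0 then g 0 (ω.2 k) else 0))‖ ≤
      C * B * (R / d) ^ k := by
  have h0 := branchScale_pos hd k
  rw [Real.norm_eq_abs, if_neg (by lia), sub_zero, abs_mul, abs_mul,
    abs_of_nonneg (pow_nonneg h0.le i)]
  calc |ω.1 k| * ((1 / (d : ℝ) ^ (k + 1)) ^ i * |x|)
      ≤ C * R ^ k * ((1 / (d : ℝ)) ^ k * B) := by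
        gcongr
        · exact (abs_nonneg _).trans (hω k)
        · exact hω k
        · exact branchScale_pow_le hd k hi
    _ = _ := by rw [div_pow, div_pow, one_pow]; ring

lemma hasDerivAt_branchSeries (hg : AnalyticTower g A ρ) (hd : 2 ≤ d) (hR : 0 ≤ R) (hRd : R < d)
    {ω : (ℕ → ℝ) × (ℕ → ℝ)} (hω : ∀ k, |ω.1 k| ≤ C * R ^ k) (i : ℕ) (s : ℝ) :
    HasDerivAt (branchSeries g d ω i) (branchSeries g d ω (i + 1) s) s := by
  have hd0 : (0 : ℝ) < d := by exact_mod_cast (by lia : 0 < d)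
  have hq : R / d < 1 := (div_lt_one hd0).2 hRd
  have hsum : ∀ B : ℝ, Summable fun k : ℕ => B * (R / (d : ℝ)) ^ k := fun B =>
    (summable_geometric_of_lt_one (by positivity) hq).mul_left B
  refine hasDerivAt_tsum (y₀ := 0) (hsum (C * _)) (fun k y => ?_) (fun k y =>
    branchTerm_le (g := g) (x := g (i + 1) (ω.2 k + 1 / (d : ℝ) ^ (k + 1) * y)) hd hω
      (show 1 ≤ i + 1 by lia) (hg.bound (i + 1) (by lia) _) k) ?_ s
  · have h1 : HasDerivAt (fun y => ω.2 k + 1 / (d : ℝ) ^ (k + 1) * y) (1 / (d : ℝ) ^ (k + 1)) y := by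
      simpa using ((hasDerivAt_id' y).const_mul (1 / (d : ℝ) ^ (k + 1))).const_add (ω.2 k)
    have h2 := ((((hg.hasDerivAt i _).comp y h1).sub_const
      (if i = 0 then g 0 (ω.2 k) else 0)).const_mul ((1 / (d : ℝ) ^ (k + 1)) ^ i)).const_mul (ω.1 k)
    refine h2.congr_deriv ?_
    rw [if_neg (by lia)]
    ring
  · rcases Nat.eq_zero_or_pos i with rfl | hi
    · simp
    · exact (hsum (C * _)).of_norm_bounded fun k =>
        branchTerm_le hd hω hi (hg.bound i hi _) k

lemma abs_branchSeries_le (hd : 2 ≤ d) (hR : 0 ≤ R) (hRd : R < d)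
    {ω : (ℕ → ℝ) × (ℕ → ℝ)} (hω : ∀ k, |ω.1 k| ≤ C * R ^ k) {i : ℕ} (hi : 1 ≤ i) {B : ℝ}
    (hB : ∀ t, |g i t| ≤ B) (s : ℝ) : |branchSeries g d ω i s| ≤ C * B * (1 - R / d)⁻¹ := by
  have hd0 : (0 : ℝ) < d := by exact_mod_cast (by lia : 0 < d)
  have hq : R / d < 1 := (div_lt_one hd0).2 hRd
  exact tsum_of_norm_bounded ((hasSum_geometric_of_lt_one (by positivity) hq).mul_left (C * B))
    (fun k => branchTerm_le (g := g) hd hω hi (hB _) k)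

lemma analyticTower_branchSeries (hg : AnalyticTower g A ρ) (hd : 2 ≤ d) (hC : 0 ≤ C) (hR : 0 ≤ R)
    (hRd : R < d) {ω : (ℕ → ℝ) × (ℕ → ℝ)} (hω : ∀ k, |ω.1 k| ≤ C * R ^ k) :
    AnalyticTower (branchSeries g d ω) (C * A * (1 - R / d)⁻¹) ρ := by
  have hd0 : (0 : ℝ) < d := by exact_mod_cast (by lia : 0 < d)
  have hq : 0 < 1 - R / d := sub_pos.2 ((div_lt_one hd0).2 hRd)
  refine ⟨hasDerivAt_branchSeries hg hd hR hRd hω, ?_, hg.ρ_pos, fun i hi t => ?_⟩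
  · have := hg.C_nonneg
    positivity
  · refine (abs_branchSeries_le hd hR hRd hω hi (hg.bound i hi) t).trans (le_of_eq ?_)
    ring

/-- The limit curves depend continuously on their data, in the product topology. -/
lemma continuousOn_branchSeries (hg : AnalyticTower g A ρ) (hd : 2 ≤ d) (hR : 0 ≤ R)
    (hRd : R < d) (i : ℕ) (s : ℝ) :
    ContinuousOn (fun ω => branchSeries g d ω i s) (branchData C R) := by
  have hd0 : (0 : ℝ) < d := by exact_mod_cast (by lia : 0 < d)
  have hq : R / d < 1 := (div_lt_one hd0).2 hRd
  have hc := hg.continuous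
  have hsum : ∀ B : ℝ, Summable fun k : ℕ => B * (R / (d : ℝ)) ^ k := fun B =>
    (summable_geometric_of_lt_one (by positivity) hq).mul_left B
  rcases Nat.eq_zero_or_pos i with rfl | hi
  · -- for the function itself the terms are controlled through the mean value theorem
    have hb : ∀ t u, |g 0 u - g 0 t| ≤ A * ρ * |u - t| := fun t u => by
      have := (convex_univ).norm_image_sub_le_of_norm_hasDerivWithin_le
        (f := g 0) (f' := g 1) (C := A * ρ) (x := t) (y := u)
        (fun x _ => (hg.hasDerivAt 0 x).hasDerivWithinAt)
        (fun x _ => by simpa using hg.bound 1 le_rfl x) (mem_univ _) (mem_univ _)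
      simpa [Real.norm_eq_abs] using this
    refine continuousOn_tsum (u := fun k => C * (A * ρ * |s|) * (R / (d : ℝ)) ^ k)
      (fun k => ?_) (hsum _) (fun k ω hω => ?_)
    · refine Continuous.continuousOn ?_
      have := hc 0
      simp only [if_true, pow_zero, one_mul]
      fun_prop
    · have hω' := (mem_branchData.1 hω).1 k
      have h0 := branchScale_pos hd k
      have := hb (ω.2 k) (ω.2 k + 1 / (d : ℝ) ^ (k + 1) * s)
      rw [add_sub_cancel_left, abs_mul, abs_of_pos h0] at this
      have hAρ : 0 ≤ A * ρ := mul_nonneg hg.C_nonneg hg.ρ_pos.le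
      rw [if_pos rfl, pow_zero, one_mul, Real.norm_eq_abs, abs_mul]
      calc |ω.1 k| * |g 0 (ω.2 k + 1 / (d : ℝ) ^ (k + 1) * s) - g 0 (ω.2 k)|
          ≤ C * R ^ k * (A * ρ * ((1 / (d : ℝ)) ^ k * |s|)) := by
            refine mul_le_mul hω' (this.trans ?_) (abs_nonneg _) ((abs_nonneg _).trans hω')
            gcongr
            exact branchScale_le hd k
        _ = _ := by rw [div_pow, div_pow, one_pow]; ring
  · refine continuousOn_tsum (fun k => ?_) (hsum (C * _)) (fun k ω hω =>
      branchTerm_le hd (mem_branchData.1 hω).1 hi (hg.bound i hi _) k)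
    refine Continuous.continuousOn ?_
    have := hc i
    simp only [if_neg (show ¬ i = 0 by lia)]
    fun_prop

/-- If all derivatives of positive order of a limit curve vanish at one point, then `ψ` is constant:
the vanishing propagates along the real line, and in high order the series for the derivative is
dominated by its first term. -/
lemma const_of_branchSeries_eq_zero (hg : AnalyticTower g A ρ)
    (hper : ∀ i, Function.Periodic (g i) 1) (hd : 2 ≤ d) (hC : 0 ≤ C) (hR : 0 ≤ R) (hRd : R < d)
    {ω : (ℕ → ℝ) × (ℕ → ℝ)} (hω : ω ∈ branchData C R)
    (h0 : ∀ i, 1 ≤ i → branchSeries g d ω i 0 = 0) : ∀ s t, g 0 s = g 0 t := by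
  obtain ⟨hω1, -, hω3⟩ := mem_branchData.1 hω
  have hd0 : (0 : ℝ) < d := by exact_mod_cast (by lia : 0 < d)
  have hd2 : (2 : ℝ) ≤ d := by exact_mod_cast hd
  set q := R / (d : ℝ) with hq
  have hq0 : 0 ≤ q := by positivity
  have hq1 : q < 1 := (div_lt_one hd0).2 hRd
  have hall : ∀ i, 1 ≤ i → ∀ s, 0 ≤ s → branchSeries g d ω i s = 0 := fun i hi s hs =>
    (analyticTower_branchSeries hg hd hC hR hRd hω1).eq_zero_of_le le_rfl h0 hs hi
  -- contraction of sup norms in high order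
  have hcontr : ∀ i B, 1 ≤ i → (∀ t, |g (i + 1) t| ≤ B) → ∀ u,
      |g (i + 1) u| ≤ C * q * (1 - q)⁻¹ * (1 / d : ℝ) ^ i * B := by
    intro i B hi hB u
    -- By periodicity the argument `t_0 + s / d` of the first term may be taken to be `u`, for some
    -- `s ≥ 0`.
    obtain ⟨N, hN⟩ := exists_nat_ge (ω.2 0 - u)
    set s := (d : ℝ) * (u + N - ω.2 0) with hs
    have hs0 : 0 ≤ s := mul_nonneg hd0.le (by linarith)
    have hz := hall (i + 1) (by lia) s hs0
    have hbd : ∀ k, ‖ω.1 (k + 1) * ((1 / (d : ℝ) ^ (k + 1 + 1)) ^ (i + 1) *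
        (g (i + 1) (ω.2 (k + 1) + 1 / (d : ℝ) ^ (k + 1 + 1) * s) -
          if i + 1 = 0 then g 0 (ω.2 (k + 1)) else 0))‖ ≤
          C * q * (1 / (d : ℝ)) ^ (2 * i + 1) * B * q ^ k := by
      intro k
      have h1 := branchScale_pos hd (k + 1)
      have hB0 : 0 ≤ B := (abs_nonneg _).trans (hB 0)
      rw [Real.norm_eq_abs, if_neg (by lia), sub_zero, abs_mul, abs_mul,
        abs_of_nonneg (pow_nonneg h1.le _)]
      have h2 : (1 / (d : ℝ) ^ (k + 1 + 1)) ^ (i + 1) ≤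
          (1 / (d : ℝ)) ^ (k + 1) * (1 / (d : ℝ)) ^ (2 * i + 1) := by
        rw [← one_div_pow, ← pow_mul, ← pow_add]
        refine pow_le_pow_of_le_one (by positivity) ?_ (by nlinarith [Nat.zero_le (k * i)])
        rw [div_le_one hd0]; linarith
      calc |ω.1 (k + 1)| * ((1 / (d : ℝ) ^ (k + 1 + 1)) ^ (i + 1) * |g (i + 1) _|)
          ≤ C * R ^ (k + 1) * ((1 / (d : ℝ)) ^ (k + 1) * (1 / (d : ℝ)) ^ (2 * i + 1) * B) := by
            refine mul_le_mul (hω1 _) ?_ (by positivity) ((abs_nonneg _).trans (hω1 _))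
            exact mul_le_mul h2 (hB _) (abs_nonneg _) (by positivity)
        _ = _ := by rw [hq, div_pow, div_pow, one_pow]; ring
    have hsum : Summable fun k => ω.1 k * ((1 / (d : ℝ) ^ (k + 1)) ^ (i + 1) *
        (g (i + 1) (ω.2 k + 1 / (d : ℝ) ^ (k + 1) * s) - if i + 1 = 0 then g 0 (ω.2 k) else 0)) :=
      ((summable_geometric_of_lt_one hq0 hq1).mul_left (C * B)).of_norm_bounded fun k =>
        branchTerm_le hd hω1 (by lia) (hB _) k
    have htail := tsum_of_norm_bounded ((hasSum_geometric_of_lt_one hq0 hq1).mul_left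
      (C * q * (1 / (d : ℝ)) ^ (2 * i + 1) * B)) hbd
    rw [branchSeries, hsum.tsum_eq_zero_add, hω3, zero_add, pow_one, if_neg (by lia), sub_zero,
      one_mul] at hz
    have harg : ω.2 0 + 1 / (d : ℝ) * s = u + N * 1 := by rw [hs]; field_simp; ring
    rw [harg, (hper (i + 1)).nat_mul N u] at hz
    have h3 : |(1 / (d : ℝ)) ^ (i + 1) * g (i + 1) u| ≤
        C * q * (1 / (d : ℝ)) ^ (2 * i + 1) * B * (1 - q)⁻¹ := by
      rw [eq_neg_of_add_eq_zero_left hz, abs_neg]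
      exact htail
    rw [abs_mul, abs_of_nonneg (by positivity)] at h3
    have h4 : (0 : ℝ) < (1 / (d : ℝ)) ^ (i + 1) := by positivity
    refine le_of_mul_le_mul_left (h3.trans (le_of_eq ?_)) h4
    rw [show 2 * i + 1 = (i + 1) + i by ring, pow_add]
    ring
  have hlim : Tendsto (fun i : ℕ => C * q * (1 - q)⁻¹ * (1 / d : ℝ) ^ i) atTop (𝓝 0) := by
    have := (tendsto_pow_atTop_nhds_zero_of_lt_one (r := (1 / d : ℝ)) (by positivity)
      (by rw [div_lt_one hd0]; linarith)).const_mul (C * q * (1 - q)⁻¹)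
    rwa [mul_zero] at this
  obtain ⟨i, hi2, hi1⟩ := ((hlim.eventually_le_const (by norm_num : (0 : ℝ) < 1 / 2)).and
    (eventually_ge_atTop 1)).exists
  have hit : ∀ n : ℕ, ∀ t, |g (i + 1) t| ≤
      A * ρ ^ (i + 1) * ((i + 1).factorial : ℝ) * (1 / 2) ^ n := by
    intro n
    induction n with
    | zero => intro t; simpa using hg.bound (i + 1) (by lia) t
    | succ n ih =>
      intro t
      refine (hcontr i _ hi1 ih t).trans ?_
      have hA := hg.C_nonneg
      have hρ := hg.ρ_pos
      calc _ ≤ 1 / 2 * (A * ρ ^ (i + 1) * ((i + 1).factorial : ℝ) * (1 / 2) ^ n) := by gcongr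
        _ = _ := by ring
  refine hg.const_of_eq_zero hper (i := i) fun t => abs_nonpos_iff.1 ?_
  have hl2 : Tendsto (fun n : ℕ => A * ρ ^ (i + 1) * ((i + 1).factorial : ℝ) * (1 / 2 : ℝ) ^ n)
      atTop (𝓝 0) := by
    have := (tendsto_pow_atTop_nhds_zero_of_lt_one (r := (1 / 2 : ℝ)) (by norm_num)
      (by norm_num)).const_mul (A * ρ ^ (i + 1) * ((i + 1).factorial : ℝ))
    rwa [mul_zero] at this
  exact ge_of_tendsto' hl2 fun n => hit n t

/-- Uniform non-flatness of the limit curves, by compactness of their data. -/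
lemma exists_nonflat (hg : AnalyticTower g A ρ) (hper : ∀ i, Function.Periodic (g i) 1)
    (hnc : ∃ s t, g 0 s ≠ g 0 t) (hd : 2 ≤ d) (hC : 0 ≤ C) (hR : 0 ≤ R) (hRd : R < d) :
    ∃ (m : ℕ) (c : ℝ), 0 < c ∧ ∀ ω ∈ branchData C R, ∃ i, 1 ≤ i ∧ i ≤ m ∧
      c ≤ |branchSeries g d ω i 0| := by
  by_contra! hcon
  have h1 : ∀ n : ℕ, ∃ ω ∈ branchData C R, ∀ i, 1 ≤ i → i ≤ n →
      |branchSeries g d ω i 0| < 1 / ((n : ℝ) + 1) := fun n => hcon n _ (by positivity)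
  choose ω hω hω' using h1
  obtain ⟨ω₀, hω₀, u, hu, hlim⟩ := (isCompact_branchData C R).tendsto_subseq hω
  obtain ⟨s, t, hst⟩ := hnc
  refine hst (const_of_branchSeries_eq_zero hg hper hd hC hR hRd hω₀ (fun i hi => ?_) s t)
  have h2 : Tendsto (fun n => |branchSeries g d (ω (u n)) i 0|) atTop
      (𝓝 |branchSeries g d ω₀ i 0|) :=
    ((continuousOn_branchSeries hg hd hR hRd i 0 ω₀ hω₀).tendsto.comp
      (tendsto_nhdsWithin_iff.2 ⟨hlim, Eventually.of_forall fun n => hω _⟩)).abs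
  have h3 : Tendsto (fun n : ℕ => 1 / ((u n : ℝ) + 1)) atTop (𝓝 0) :=
    (tendsto_one_div_add_atTop_nhds_zero_nat (𝕜 := ℝ)).comp hu.tendsto_atTop
  refine abs_nonpos_iff.1 (le_of_tendsto_of_tendsto h2 h3 ?_)
  filter_upwards [hu.tendsto_atTop.eventually_ge_atTop i] with n hn
  exact (hω' (u n) i hi hn).le

end Branch

/-! ### Sublevel sets -/

/-- A set of measure more than `2nγ` contains `n` points with gaps at least `γ`. -/
lemma exists_spaced_points {γ : ℝ} (hγ : 0 < γ) (n : ℕ) : ∀ {E : Set ℝ}, BddBelow E →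
    ENNReal.ofReal (2 * n * γ) < volume E →
      ∃ x : ℕ → ℝ, (∀ k < n, x k ∈ E) ∧ ∀ k, k + 1 < n → x k + γ ≤ x (k + 1) := by
  induction n with
  | zero => exact fun _ _ => ⟨fun _ => 0, fun k hk => absurd hk (by lia), fun k hk => absurd hk (by lia)⟩
  | succ n ih =>
    intro E hE hvol
    have hne : E.Nonempty := by
      rw [nonempty_iff_ne_empty]
      rintro rfl
      simp at hvol
    obtain ⟨x₀, hx₀, hlt⟩ := exists_lt_of_csInf_lt hne (show sInf E < sInf E + γ by linarith)
    have hsub : E ⊆ Icc (sInf E) (sInf E + 2 * γ) ∪ (E ∩ Ici (x₀ + γ)) := fun x hx => by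
      by_cases h : x ≤ sInf E + 2 * γ
      · exact Or.inl ⟨csInf_le hE hx, h⟩
      · exact Or.inr ⟨hx, by rw [mem_Ici]; linarith⟩
    have hvol' : ENNReal.ofReal (2 * n * γ) < volume (E ∩ Ici (x₀ + γ)) := by
      by_contra! hcon
      refine absurd hvol (not_lt.2 ((measure_mono hsub).trans ((measure_union_le _ _).trans ?_)))
      rw [Real.volume_Icc, show sInf E + 2 * γ - sInf E = 2 * γ by ring]
      refine (add_le_add_right hcon _).trans ?_
      rw [← ENNReal.ofReal_add (by positivity) (by positivity)]
      refine ENNReal.ofReal_le_ofReal (le_of_eq ?_)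
      push_cast; ring
    obtain ⟨x, hx, hgap⟩ := ih (hE.mono inter_subset_left) hvol'
    refine ⟨fun k => Nat.casesOn k x₀ x, fun k hk => ?_, fun k hk => ?_⟩
    · rcases k with _ | k
      · exact hx₀
      · exact (hx k (by lia)).1
    · rcases k with _ | k
      · exact (hx 0 (by lia)).2
      · exact hgap k (by lia)

/-- A substitute for divided differences: small values at `2^i` well spaced points force a small
`i`-th derivative somewhere, by pairing the points and applying the mean value theorem. -/
lemma exists_small_deriv {γ u v : ℝ} (hγ : 0 < γ) (i : ℕ) : ∀ {f : ℕ → ℝ → ℝ},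
    (∀ j t, HasDerivAt (f j) (f (j + 1) t) t) → ∀ {ε : ℝ}, ∀ {x : ℕ → ℝ},
    (∀ k < 2 ^ i, x k ∈ Icc u v ∧ |f 0 (x k)| ≤ ε) → (∀ k, k + 1 < 2 ^ i → x k + γ ≤ x (k + 1)) →
      ∃ ξ ∈ Icc u v, |f i ξ| ≤ ε * (2 / γ) ^ i := by
  induction i with
  | zero =>
    intro f _ ε x hx _
    exact ⟨x 0, (hx 0 (by simp)).1, by simpa using (hx 0 (by simp)).2⟩
  | succ i ih =>
    intro f hf ε x hx hgap
    have hpow : 2 ^ (i + 1) = 2 * 2 ^ i := by ring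
    have h1 : ∀ k, ∃ y, k < 2 ^ i → (x (2 * k) ≤ y ∧ y ≤ x (2 * k + 1)) ∧
        |f 1 y| ≤ ε * (2 / γ) := by
      intro k
      by_cases hk : k < 2 ^ i
      · have h2 := hgap (2 * k) (by lia)
        obtain ⟨y, hy, hy'⟩ := exists_hasDerivAt_eq_slope (f 0) (f 1)
          (show x (2 * k) < x (2 * k + 1) by linarith)
          (fun t _ => (hf 0 t).continuousAt.continuousWithinAt) (fun t _ => hf 0 t)
        refine ⟨y, fun _ => ⟨⟨hy.1.le, hy.2.le⟩, ?_⟩⟩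
        rw [hy', abs_div, abs_of_pos (by linarith : 0 < x (2 * k + 1) - x (2 * k))]
        have h3 := (abs_sub (f 0 (x (2 * k + 1))) (f 0 (x (2 * k)))).trans
          (add_le_add (hx (2 * k + 1) (by lia)).2 (hx (2 * k) (by lia)).2)
        have hε : 0 ≤ ε := (abs_nonneg _).trans (hx (2 * k) (by lia)).2
        rw [← mul_div_assoc]
        exact div_le_div₀ (by linarith) (by linarith) hγ (by linarith)
      · exact ⟨0, fun h => absurd h hk⟩
    choose y hy using h1
    obtain ⟨ξ, hξ, hξ'⟩ := ih (f := fun j => f (j + 1)) (fun j t => hf (j + 1) t)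
      (ε := ε * (2 / γ)) (x := y)
      (fun k hk => ⟨⟨(hx (2 * k) (by lia)).1.1.trans (hy k hk).1.1,
        (hy k hk).1.2.trans (hx (2 * k + 1) (by lia)).1.2⟩, (hy k hk).2⟩)
      (fun k hk => by
        have h2 := (hy k (by lia)).1.2
        have h3 := (hy (k + 1) hk).1.1
        have h4 := hgap (2 * k + 1) (by lia)
        rw [show 2 * k + 1 + 1 = 2 * (k + 1) by ring] at h4
        linarith)
    exact ⟨ξ, hξ, hξ'.trans (le_of_eq (by ring))⟩

/-- A function whose `i`-th derivative is bounded away from `0` is `ε`-small only on a set of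
measure of order `ε^{1/i}`. -/
lemma volume_sublevel_le {u v b ε : ℝ} {f : ℕ → ℝ → ℝ}
    (hf : ∀ j t, HasDerivAt (f j) (f (j + 1) t) t) {i : ℕ} (hi : 1 ≤ i) (hb : 0 < b)
    (hfb : ∀ t ∈ Icc u v, b ≤ |f i t|) (hε : 0 < ε) :
    volume {t | t ∈ Icc u v ∧ |f 0 t| ≤ ε} ≤
      ENNReal.ofReal (2 ^ (i + 2) * (2 * ε / b) ^ (1 / (i : ℝ))) := by
  by_contra! hcon
  set γ := 2 * (2 * ε / b) ^ (1 / (i : ℝ)) with hγ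
  have hγ0 : 0 < γ := by positivity
  have e1 : (2 : ℝ) ^ (i + 2) * (2 * ε / b) ^ (1 / (i : ℝ)) = 2 * (2 ^ i : ℕ) * γ := by
    rw [hγ]; push_cast; ring
  rw [e1] at hcon
  obtain ⟨x, hx, hgap⟩ := exists_spaced_points hγ0 (2 ^ i) ⟨u, fun t ht => ht.1.1⟩ hcon
  obtain ⟨ξ, hξ, hξ'⟩ := exists_small_deriv (ε := ε) hγ0 i hf hx hgap
  have e2 : ε * (2 / γ) ^ i = b / 2 := by
    have : (2 / γ) ^ i = b / (2 * ε) := by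
      rw [hγ, div_mul_eq_div_div, div_self two_ne_zero, div_pow, one_pow, ← Real.rpow_natCast,
        ← Real.rpow_mul (by positivity), one_div_mul_cancel (by positivity), Real.rpow_one, one_div_div]
    rw [this]
    field_simp
  have := hfb ξ hξ
  linarith

/-- Sublevel set estimate for a function whose jet is nowhere flat. -/
lemma exists_sublevel_estimate {m : ℕ} {c K : ℝ} (hc : 0 < c) (hK : 0 ≤ K) :
    ∃ S : ℝ, 0 < S ∧ ∀ f : ℕ → ℝ → ℝ, (∀ j t, HasDerivAt (f j) (f (j + 1) t) t) →
      (∀ i, 1 ≤ i → i ≤ m + 1 → ∀ t, |f i t| ≤ K) →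
      (∀ t, ∃ i, 1 ≤ i ∧ i ≤ m ∧ c ≤ |f i t|) → ∀ ε, 0 < ε → ε ≤ 1 →
        volume {t | t ∈ Icc (0 : ℝ) 1 ∧ |f 0 t| ≤ ε} ≤ ENNReal.ofReal (S * ε ^ (1 / (m : ℝ))) := by
  obtain ⟨M, hM⟩ := exists_nat_gt (2 * K / c)
  have hM0 : (0 : ℝ) < M := lt_of_le_of_lt (by positivity) hM
  refine ⟨(M + 1) * (2 ^ (m + 2) * (1 + 4 / c)), by positivity, fun f hf hfK hfc ε hε hε1 => ?_⟩
  -- On an interval of length `1 / M` one and the same derivative is at least `c / 2`.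
  have hpiece : ∀ j : ℕ, volume {t | t ∈ Icc ((j : ℝ) / M) ((j + 1 : ℝ) / M) ∧ |f 0 t| ≤ ε} ≤
      ENNReal.ofReal (2 ^ (m + 2) * (1 + 4 / c) * ε ^ (1 / (m : ℝ))) := by
    intro j
    obtain ⟨i, hi1, him, hi⟩ := hfc ((j : ℝ) / M)
    have hi0 : (0 : ℝ) < i := by exact_mod_cast hi1
    have hlow : ∀ t ∈ Icc ((j : ℝ) / M) ((j + 1 : ℝ) / M), c / 2 ≤ |f i t| := by
      intro t ht
      have h1 := (convex_univ).norm_image_sub_le_of_norm_hasDerivWithin_le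
        (f := f i) (f' := f (i + 1)) (C := K) (x := (j : ℝ) / M) (y := t)
        (fun x _ => (hf i x).hasDerivWithinAt) (fun x _ => hfK (i + 1) (by lia) (by lia) x)
        (mem_univ _) (mem_univ _)
      rw [Real.norm_eq_abs, Real.norm_eq_abs, abs_of_nonneg (sub_nonneg.2 ht.1)] at h1
      have h2 : t - j / M ≤ 1 / M := by
        have := ht.2
        rw [add_div] at this
        linarith
      have h3 : K * (t - j / M) ≤ c / 2 := by
        refine (mul_le_mul_of_nonneg_left h2 hK).trans ?_
        rw [div_lt_iff₀ hc] at hM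
        rw [mul_one_div, div_le_iff₀ hM0]
        linarith
      have h4 := abs_sub_abs_le_abs_sub (f i (j / M)) (f i t)
      rw [abs_sub_comm] at h4
      linarith
    refine (volume_sublevel_le hf hi1 (half_pos hc) hlow hε).trans (ENNReal.ofReal_le_ofReal ?_)
    have e1 : 2 * ε / (c / 2) = 4 / c * ε := by field_simp; norm_num
    rw [e1, Real.mul_rpow (by positivity) hε.le, mul_assoc]
    have h5 : (4 / c) ^ (1 / (i : ℝ)) ≤ 1 + 4 / c := by
      have hc4 : 0 < 4 / c := by positivity
      have hi' : 1 / (i : ℝ) ≤ 1 := by rw [div_le_one hi0]; exact_mod_cast hi1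
      calc (4 / c) ^ (1 / (i : ℝ)) ≤ (1 + 4 / c) ^ (1 / (i : ℝ)) :=
            Real.rpow_le_rpow hc4.le (by linarith) (by positivity)
        _ ≤ (1 + 4 / c) ^ (1 : ℝ) := Real.rpow_le_rpow_of_exponent_le (by linarith) hi'
        _ = _ := Real.rpow_one _
    have h6 : ε ^ (1 / (i : ℝ)) ≤ ε ^ (1 / (m : ℝ)) :=
      Real.rpow_le_rpow_of_exponent_ge hε hε1
        (one_div_le_one_div_of_le hi0 (by exact_mod_cast him))
    have h7 : (2 : ℝ) ^ (i + 2) ≤ 2 ^ (m + 2) := pow_le_pow_right₀ (by norm_num) (by lia)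
    gcongr
  have hcover : {t | t ∈ Icc (0 : ℝ) 1 ∧ |f 0 t| ≤ ε} ⊆ ⋃ j ∈ Finset.range (M + 1),
      {t | t ∈ Icc ((j : ℝ) / M) ((j + 1 : ℝ) / M) ∧ |f 0 t| ≤ ε} := by
    intro t ht
    simp only [mem_iUnion]
    refine ⟨⌊t * M⌋₊, Finset.mem_range.2 ?_, ⟨?_, ?_⟩, ht.2⟩
    · have h1 : t * M ≤ M := mul_le_of_le_one_left hM0.le ht.1.2
      have := Nat.floor_le_floor h1
      rw [Nat.floor_natCast] at this
      lia
    · rw [div_le_iff₀ hM0]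
      exact Nat.floor_le (mul_nonneg ht.1.1 hM0.le)
    · rw [le_div_iff₀ hM0]
      exact (Nat.lt_floor_add_one _).le
  refine (measure_mono hcover).trans ((measure_biUnion_finset_le _ _).trans
    ((Finset.sum_le_sum fun j _ => hpiece j).trans (le_of_eq ?_)))
  rw [Finset.sum_const, Finset.card_range, nsmul_eq_mul, ← ENNReal.ofReal_natCast,
    ← ENNReal.ofReal_mul (by positivity)]
  congr 1
  push_cast; ring

/-! ### Derivatives of image curves -/

/-- The `i`-th derivative in `s` of `f_n(s, x₀)`, where `g` is the sequence of derivatives of the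
lift of `φ`. -/
noncomputable def curveDeriv (g : ℕ → ℝ → ℝ) (a : ℝ) (d : ℕ) (α x₀ : ℝ) : ℕ → ℕ → ℝ → ℝ
  | 0, i, _ => if i = 0 then x₀ else 0
  | n + 1, i, s => (if i = 0 then a else 0) -
      ∑ p ∈ Finset.HasAntidiagonal.antidiagonal i, (i.choose p.1 : ℝ) *
        (curveDeriv g a d α x₀ n p.1 s * curveDeriv g a d α x₀ n p.2 s) +
      α * (((d : ℝ) ^ n) ^ i * g i ((d : ℝ) ^ n * s))

/-- The derivative of the expression that the Leibniz rule gives for the `i`-th derivative of `u²`.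
-/
lemma hasDerivAt_leibniz {u : ℕ → ℝ → ℝ} (hu : ∀ i s, HasDerivAt (u i) (u (i + 1) s) s) (i : ℕ)
    (s : ℝ) : HasDerivAt
      (fun s => ∑ p ∈ Finset.HasAntidiagonal.antidiagonal i, (i.choose p.1 : ℝ) * (u p.1 s * u p.2 s))
      (∑ p ∈ Finset.HasAntidiagonal.antidiagonal (i + 1), ((i + 1).choose p.1 : ℝ) * (u p.1 s * u p.2 s)) s := by
  have h1 : HasDerivAt
      (fun s => ∑ p ∈ Finset.HasAntidiagonal.antidiagonal i, (i.choose p.1 : ℝ) * (u p.1 s * u p.2 s))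
      (∑ p ∈ Finset.HasAntidiagonal.antidiagonal i, (i.choose p.1 : ℝ) *
        (u (p.1 + 1) s * u p.2 s + u p.1 s * u (p.2 + 1) s)) s :=
    HasDerivAt.fun_sum fun p _ => ((hu p.1 s).mul (hu p.2 s)).const_mul _
  refine h1.congr_deriv ?_
  rw [Finset.sum_antidiagonal_choose_succ_mul (fun k l => u k s * u l s) i, ← Finset.sum_add_distrib]
  refine Finset.sum_congr rfl fun p hp => ?_
  have hp' := Finset.HasAntidiagonal.mem_antidiagonal.1 hp
  rw [Nat.choose_symm_of_eq_add (n := i) (a := p.2) (b := p.1) (by lia)]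
  ring

/-- The terms of the Leibniz rule for `u²` in which the derivative of top order occurs. -/
lemma leibniz_sum_split (u : ℕ → ℝ) (j : ℕ) :
    ∑ p ∈ Finset.HasAntidiagonal.antidiagonal (j + 1), ((j + 1).choose p.1 : ℝ) * (u p.1 * u p.2) =
      2 * u 0 * u (j + 1) +
        ∑ l ∈ Finset.range j, ((j + 1).choose (l + 1) : ℝ) * (u (l + 1) * u (j - l)) := by
  rw [Finset.Nat.sum_antidiagonal_eq_sum_range_succ_mk, Finset.sum_range_succ,
    Finset.sum_range_succ']
  simp only [Nat.choose_self, Nat.choose_zero_right, Nat.sub_self, Nat.sub_zero, Nat.add_sub_add_right]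
  push_cast
  ring

section Curve

variable {g : ℕ → ℝ → ℝ} {a A ρ α x₀ C R : ℝ} {d : ℕ}

lemma hasDerivAt_curveDeriv (hg : AnalyticTower g A ρ) (n : ℕ) :
    ∀ i s, HasDerivAt (curveDeriv g a d α x₀ n i) (curveDeriv g a d α x₀ n (i + 1) s) s := by
  induction n with
  | zero =>
    intro i s
    have h0 : curveDeriv g a d α x₀ 0 (i + 1) s = 0 := by simp [curveDeriv]
    rw [h0]
    exact hasDerivAt_const _ _
  | succ n ih =>
    intro i s
    have h1 : HasDerivAt (fun s : ℝ => (d : ℝ) ^ n * s) ((d : ℝ) ^ n) s := by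
      simpa using (hasDerivAt_id' s).const_mul ((d : ℝ) ^ n)
    have h2 := ((((hg.hasDerivAt i _).comp s h1).const_mul (((d : ℝ) ^ n) ^ i)).const_mul α)
    have h3 := ((hasDerivAt_leibniz ih i s).const_sub (if i = 0 then a else 0)).add h2
    refine h3.congr_deriv ?_
    simp only [curveDeriv]
    rw [if_neg (by lia)]
    ring

lemma curveDeriv_zero_eq {φ : UnitAddCircle → ℝ} (hφ : ∀ t : ℝ, g 0 t = φ (t : UnitAddCircle))
    (n : ℕ) (s : ℝ) : curveDeriv g a d α x₀ n 0 s = fibreIter a d φ α n (s : UnitAddCircle) x₀ := by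
  induction n with
  | zero => simp [curveDeriv, fibreIter_zero]
  | succ n ih =>
    rw [fibreIter_succ, ← ih]
    simp only [curveDeriv, Finset.Nat.antidiagonal_zero, Finset.sum_singleton, pow_zero, one_mul,
      if_true, Nat.choose_self, Nat.cast_one, hφ]
    have : (((d : ℝ) ^ n * s : ℝ) : UnitAddCircle) = d ^ n • (s : UnitAddCircle) := by
      rw [← AddCircle.coe_nsmul, nsmul_eq_mul]
      push_cast; rfl
    rw [this, pow_two]

/-- Variation of constants for a linear recurrence with zero initial value. -/
lemma linear_recurrence {u m r : ℕ → ℝ} (h0 : u 0 = 0) (hs : ∀ n, u (n + 1) = m n * u n + r n)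
    (n : ℕ) : u n = ∑ k ∈ Finset.range n, (∏ l ∈ Finset.Ico (n - k) n, m l) * r (n - 1 - k) := by
  induction n with
  | zero => simpa using h0
  | succ n ih =>
    rw [hs, ih, Finset.sum_range_succ']
    simp only [Nat.sub_zero, Finset.Ico_self, Finset.prod_empty, one_mul, Nat.add_sub_cancel]
    congr 1
    rw [Finset.mul_sum]
    refine Finset.sum_congr rfl fun k hk => ?_
    have hk' := Finset.mem_range.1 hk
    rw [show n + 1 - (k + 1) = n - k by lia, Finset.prod_Ico_succ_top (by lia),
      show n - 1 - k = n - (k + 1) by lia]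
    ring

/-- The data of the limit curve approximating the image of a horizontal curve under the `n`-th
iterate, near the point `s`. -/
noncomputable def curveData (d : ℕ) (h : ℕ → ℝ) (n : ℕ) (s : ℝ) : (ℕ → ℝ) × (ℕ → ℝ) :=
  (fun k => if k < n then ∏ l ∈ Finset.Ico (n - k) n, (-2 * h l) else 0,
    fun k => Int.fract ((d : ℝ) ^ (n - 1 - k) * s))

/-- The data lie in the compact space, by domination. -/
lemma curveData_mem {h : ℕ → ℝ} {n : ℕ} (hn : 1 ≤ n) (hC : 0 ≤ C) (hR : 0 ≤ R)
    (hdom : ∀ k ≤ n, |∏ l ∈ Finset.Ico (n - k) n, (-2 * h l)| ≤ C * R ^ k) (s : ℝ) :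
    curveData d h n s ∈ branchData C R := by
  refine mem_branchData.2 ⟨fun k => ?_, fun k => ⟨Int.fract_nonneg _, (Int.fract_lt_one _).le⟩, ?_⟩
  · simp only [curveData]
    split_ifs with hk
    · exact hdom k hk.le
    · rw [abs_zero]; positivity
  · simp [curveData, show 0 < n by lia]

lemma branchSeries_curveData (hper : ∀ i, Function.Periodic (g i) 1) (h : ℕ → ℝ) (n : ℕ) {i : ℕ}
    (hi : 1 ≤ i) (s : ℝ) : branchSeries g d (curveData d h n s) i 0 =
      ∑ k ∈ Finset.range n, (∏ l ∈ Finset.Ico (n - k) n, (-2 * h l)) *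
        ((1 / (d : ℝ) ^ (k + 1)) ^ i * g i ((d : ℝ) ^ (n - 1 - k) * s)) := by
  rw [branchSeries, tsum_eq_sum (s := Finset.range n)]
  · refine Finset.sum_congr rfl fun k hk => ?_
    simp only [curveData]
    rw [if_pos (Finset.mem_range.1 hk), if_neg (by lia), sub_zero, mul_zero, add_zero]
    have := (hper i).sub_int_mul_eq (x := (d : ℝ) ^ (n - 1 - k) * s) ⌊(d : ℝ) ^ (n - 1 - k) * s⌋
    rw [mul_one] at this
    rw [← Int.self_sub_floor, this]
  · intro k hk
    simp only [curveData]
    rw [if_neg (fun h => hk (Finset.mem_range.2 h)), zero_mul]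

/-- The derivatives of `f_n(·, x₀)`, up to the scale `α d^{ni}` and up to an error of order `α²`, are
those of a limit curve. -/
lemma exists_curveDeriv_approx (hg : AnalyticTower g A ρ) (hper : ∀ i, Function.Periodic (g i) 1)
    (hd : 2 ≤ d) (hC : 0 ≤ C) (hR : 0 ≤ R) (hRd : R < d) (i : ℕ) (hi : 1 ≤ i) :
    ∃ K : ℝ, 0 ≤ K ∧ ∀ a α x₀ s : ℝ, 0 ≤ α → α ≤ 1 →
      (∀ n, ∀ k ≤ n, |∏ l ∈ Finset.Ico (n - k) n, (-2 * curveDeriv g a d α x₀ l 0 s)| ≤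
        C * R ^ k) →
      ∀ n, 1 ≤ n → |curveDeriv g a d α x₀ n i s - α * ((d : ℝ) ^ n) ^ i *
          branchSeries g d (curveData d (fun l => curveDeriv g a d α x₀ l 0 s) n s) i 0| ≤
            α * α * ((d : ℝ) ^ n) ^ i * K ∧
        |curveDeriv g a d α x₀ n i s| ≤ α * ((d : ℝ) ^ n) ^ i * K := by
  have hd0 : (0 : ℝ) < d := by exact_mod_cast (by lia : 0 < d)
  have hd1 : (1 : ℝ) ≤ d := by exact_mod_cast (by lia : 1 ≤ d)
  set q := R / (d : ℝ) with hq
  have hq0 : 0 ≤ q := by positivity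
  have hq1 : q < 1 := (div_lt_one hd0).2 hRd
  have hq2 : 0 < 1 - q := sub_pos.2 hq1
  -- The derivative of order `i` satisfies a linear recurrence with multipliers `-2 f_n`. Its
  -- inhomogeneous part consists of the derivative of `αφ(dⁿs)` and of products of two derivatives
  -- of lower order, which are of order `α²` by induction.
  induction i using Nat.strong_induction_on with
  | _ i ih =>
  obtain ⟨j, rfl⟩ : ∃ j, i = j + 1 := ⟨i - 1, by lia⟩
  have hchoose : ∃ K : ℕ → ℝ, ∀ l, 0 ≤ K l ∧ (1 ≤ l → l < j + 1 → ∀ a α x₀ s : ℝ, 0 ≤ α → α ≤ 1 →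
      (∀ n, ∀ k ≤ n, |∏ l ∈ Finset.Ico (n - k) n, (-2 * curveDeriv g a d α x₀ l 0 s)| ≤
        C * R ^ k) →
      ∀ n, 1 ≤ n → |curveDeriv g a d α x₀ n l s| ≤ α * ((d : ℝ) ^ n) ^ l * K l) := by
    have : ∀ l, ∃ K : ℝ, 0 ≤ K ∧ (1 ≤ l → l < j + 1 → ∀ a α x₀ s : ℝ, 0 ≤ α → α ≤ 1 →
      (∀ n, ∀ k ≤ n, |∏ l ∈ Finset.Ico (n - k) n, (-2 * curveDeriv g a d α x₀ l 0 s)| ≤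
        C * R ^ k) →
      ∀ n, 1 ≤ n → |curveDeriv g a d α x₀ n l s| ≤ α * ((d : ℝ) ^ n) ^ l * K) := by
      intro l
      by_cases hl : 1 ≤ l ∧ l < j + 1
      · obtain ⟨K, hK, h⟩ := ih l hl.2 hl.1
        exact ⟨K, hK, fun _ _ a α x₀ s h1 h2 h3 n hn => (h a α x₀ s h1 h2 h3 n hn).2⟩
      · exact ⟨0, le_rfl, fun h1 h2 => absurd ⟨h1, h2⟩ hl⟩
    choose K hK using this
    exact ⟨K, hK⟩
  obtain ⟨K, hK⟩ := hchoose
  set D := ∑ l ∈ Finset.range j, ((j + 1).choose (l + 1) : ℝ) * (K (l + 1) * K (j - l)) with hD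
  have hD0 : 0 ≤ D := Finset.sum_nonneg fun l _ =>
    mul_nonneg (by positivity) (mul_nonneg (hK _).1 (hK _).1)
  set B := A * ρ ^ (j + 1) * ((j + 1).factorial : ℝ) with hB
  have hB0 : 0 ≤ B := (abs_nonneg _).trans (hg.bound (j + 1) (by lia) 0)
  refine ⟨C * D * (1 - q)⁻¹ + C * B * (1 - q)⁻¹, by positivity, ?_⟩
  intro a α x₀ s hα hα1 hdom n hn
  set h : ℕ → ℕ → ℝ := fun n i => curveDeriv g a d α x₀ n i s with hh
  set E : ℕ → ℝ := fun n =>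
    ∑ l ∈ Finset.range j, ((j + 1).choose (l + 1) : ℝ) * (h n (l + 1) * h n (j - l)) with hE
  have hEb : ∀ n, |E n| ≤ α * α * ((d : ℝ) ^ n) ^ (j + 1) * D := by
    intro n
    rw [hD, Finset.mul_sum]
    refine (Finset.abs_sum_le_sum_abs _ _).trans (Finset.sum_le_sum fun l hl => ?_)
    have hl' := Finset.mem_range.1 hl
    rcases Nat.eq_zero_or_pos n with rfl | hn
    · have : h 0 (l + 1) = 0 := by simp [hh, curveDeriv]
      rw [this, zero_mul, mul_zero, abs_zero]
      have := mul_nonneg (hK (l + 1)).1 (hK (j - l)).1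
      positivity
    · have h1 := (hK (l + 1)).2 (by lia) (by lia) a α x₀ s hα hα1 hdom n hn
      have h2 := (hK (j - l)).2 (by lia) (by lia) a α x₀ s hα hα1 hdom n hn
      rw [abs_mul, abs_mul, abs_of_nonneg (by positivity : (0 : ℝ) ≤ ((j + 1).choose (l + 1) : ℝ))]
      calc _ ≤ ((j + 1).choose (l + 1) : ℝ) * ((α * ((d : ℝ) ^ n) ^ (l + 1) * K (l + 1)) *
            (α * ((d : ℝ) ^ n) ^ (j - l) * K (j - l))) := by
            refine mul_le_mul_of_nonneg_left ?_ (by positivity)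
            exact mul_le_mul h1 h2 (abs_nonneg _) ((abs_nonneg _).trans h1)
        _ = _ := by
            rw [show j + 1 = (l + 1) + (j - l) by lia, pow_add]
            ring
  have hrec : ∀ n, h (n + 1) (j + 1) = (-2 * h n 0) * h n (j + 1) +
      (-E n + α * (((d : ℝ) ^ n) ^ (j + 1) * g (j + 1) ((d : ℝ) ^ n * s))) := by
    intro n
    simp only [hh, curveDeriv]
    rw [if_neg (by lia), leibniz_sum_split (fun i => curveDeriv g a d α x₀ n i s) j]
    ring
  have hsol := linear_recurrence (u := fun n => h n (j + 1)) (by simp [hh, curveDeriv]) hrec n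
  have hmain : h n (j + 1) - α * ((d : ℝ) ^ n) ^ (j + 1) *
      branchSeries g d (curveData d (fun l => h l 0) n s) (j + 1) 0 =
      ∑ k ∈ Finset.range n, (∏ l ∈ Finset.Ico (n - k) n, (-2 * h l 0)) * (-E (n - 1 - k)) := by
    rw [hsol, branchSeries_curveData hper _ _ (by lia), Finset.mul_sum, ← Finset.sum_sub_distrib]
    refine Finset.sum_congr rfl fun k hk => ?_
    have hk' := Finset.mem_range.1 hk
    have e : (d : ℝ) ^ n = (d : ℝ) ^ (n - 1 - k) * (d : ℝ) ^ (k + 1) := by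
      rw [← pow_add]; congr 1; lia
    have e2 : ((d : ℝ) ^ n) ^ (j + 1) * (1 / (d : ℝ) ^ (k + 1)) ^ (j + 1) =
        ((d : ℝ) ^ (n - 1 - k)) ^ (j + 1) := by
      rw [← mul_pow, e, mul_assoc, mul_one_div_cancel (by positivity), mul_one]
    rw [← e2]
    ring
  have hfirst : |h n (j + 1) - α * ((d : ℝ) ^ n) ^ (j + 1) *
      branchSeries g d (curveData d (fun l => h l 0) n s) (j + 1) 0| ≤
      α * α * ((d : ℝ) ^ n) ^ (j + 1) * (C * D * (1 - q)⁻¹) := by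
    rw [hmain]
    refine (Finset.abs_sum_le_sum_abs _ _).trans ?_
    have hterm : ∀ k ∈ Finset.range n, |(∏ l ∈ Finset.Ico (n - k) n, (-2 * h l 0)) *
        (-E (n - 1 - k))| ≤ α * α * ((d : ℝ) ^ n) ^ (j + 1) * (C * D) * q ^ k := by
      intro k hk
      have hk' := Finset.mem_range.1 hk
      rw [abs_mul, abs_neg]
      have h1 : ((d : ℝ) ^ (n - 1 - k)) ^ (j + 1) * (d : ℝ) ^ k ≤ ((d : ℝ) ^ n) ^ (j + 1) := by
        rw [← pow_mul, ← pow_mul, ← pow_add]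
        refine pow_le_pow_right₀ hd1 ?_
        calc (n - 1 - k) * (j + 1) + k ≤ (n - 1 - k) * (j + 1) + k * (j + 1) := by nlinarith
          _ = (n - 1 - k + k) * (j + 1) := by ring
          _ ≤ n * (j + 1) := Nat.mul_le_mul_right _ (by lia)
      calc _ ≤ C * R ^ k * (α * α * ((d : ℝ) ^ (n - 1 - k)) ^ (j + 1) * D) :=
            mul_le_mul (hdom n k hk'.le) (hEb _) (abs_nonneg _) (by positivity)
        _ = α * α * (((d : ℝ) ^ (n - 1 - k)) ^ (j + 1) * (d : ℝ) ^ k) * (C * D) * q ^ k := by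
            rw [hq, div_pow]; field_simp
        _ ≤ _ := by gcongr
    refine (Finset.sum_le_sum hterm).trans ?_
    rw [← Finset.mul_sum]
    have h2 : ∑ k ∈ Finset.range n, q ^ k ≤ (1 - q)⁻¹ :=
      (summable_geometric_of_lt_one hq0 hq1).sum_le_tsum _ (fun _ _ => by positivity) |>.trans_eq
        (tsum_geometric_of_lt_one hq0 hq1)
    calc _ ≤ α * α * ((d : ℝ) ^ n) ^ (j + 1) * (C * D) * (1 - q)⁻¹ := by gcongr
      _ = _ := by ring
  have hdn : (0 : ℝ) ≤ ((d : ℝ) ^ n) ^ (j + 1) := by positivity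
  refine ⟨hfirst.trans ?_, ?_⟩
  · refine mul_le_mul_of_nonneg_left ?_ (by positivity)
    have : 0 ≤ C * B * (1 - q)⁻¹ := by positivity
    linarith
  · have hmem := curveData_mem (d := d) hn hC hR (hdom n) s
    have hb := abs_branchSeries_le (g := g) hd hR hRd (mem_branchData.1 hmem).1
      (show 1 ≤ j + 1 by lia) (hg.bound (j + 1) (by lia)) 0
    have h3 : |α * ((d : ℝ) ^ n) ^ (j + 1) *
        branchSeries g d (curveData d (fun l => h l 0) n s) (j + 1) 0| ≤
        α * ((d : ℝ) ^ n) ^ (j + 1) * (C * B * (1 - q)⁻¹) := by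
      rw [abs_mul, abs_of_nonneg (by positivity)]
      gcongr
    have h4 : α * α * ((d : ℝ) ^ n) ^ (j + 1) * (C * D * (1 - q)⁻¹) ≤
        α * ((d : ℝ) ^ n) ^ (j + 1) * (C * D * (1 - q)⁻¹) := by
      have : α * α ≤ α := mul_le_of_le_one_left hα hα1
      gcongr
    have h5 := abs_sub_abs_le_abs_sub (h n (j + 1)) (α * ((d : ℝ) ^ n) ^ (j + 1) *
        branchSeries g d (curveData d (fun l => h l 0) n s) (j + 1) 0)
    change |h n (j + 1)| ≤ _
    linarith

end Curve

/-! ### The cocycle series -/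

/-- The series `∑ ψ(dᵏ θ) / (v_r ⋯ v_{r+k-1})`, the solution of the cohomological equation
`W_r(θ) = ψ(θ) + W_{r+1}(dθ) / v_r` over an expanding sequence of multipliers `v`. -/
noncomputable def cocycleSeries (ψ : ℝ → ℝ) (d : ℕ) (v : ℕ → ℝ) (r : ℕ) (θ : ℝ) : ℝ :=
  ∑' k, ψ ((d : ℝ) ^ k * θ) / ∏ l ∈ Finset.range k, v (r + l)

/-- Multipliers of an expanding, eventually periodic orbit, with constants of expansion
(`κ`, `L`) and of domination (`C`, `R`). -/
structure Multipliers (v : ℕ → ℝ) (κ L C R : ℝ) (r₀ q : ℕ) : Prop where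
  κ_pos : 0 < κ
  one_lt_L : 1 < L
  C_nonneg : 0 ≤ C
  R_nonneg : 0 ≤ R
  q_pos : 0 < q
  lower : ∀ r k, κ * L ^ k ≤ |∏ l ∈ Finset.range k, v (r + l)|
  upper : ∀ m, ∀ k ≤ m, |∏ l ∈ Finset.Ico (m - k) m, v l| ≤ C * R ^ k
  periodic : ∀ n, r₀ ≤ n → v (n + q) = v n

section Cocycle

variable {g : ℕ → ℝ → ℝ} {v : ℕ → ℝ} {κ L C R A ρ Φ : ℝ} {r₀ q d : ℕ}

namespace Multipliers

lemma prod_ne_zero (hv : Multipliers v κ L C R r₀ q) (r k : ℕ) :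
    ∏ l ∈ Finset.range k, v (r + l) ≠ 0 := by
  have h1 := hv.lower r k
  have h2 : 0 < κ * L ^ k := mul_pos hv.κ_pos (pow_pos (by linarith [hv.one_lt_L]) k)
  exact abs_pos.1 (h2.trans_le h1)

lemma ne_zero (hv : Multipliers v κ L C R r₀ q) (r : ℕ) : v r ≠ 0 := by
  simpa using hv.prod_ne_zero r 1

lemma term_le (hv : Multipliers v κ L C R r₀ q) (hΦ : ∀ t, |g 0 t| ≤ Φ) (r k : ℕ) (θ : ℝ) :
    ‖g 0 ((d : ℝ) ^ k * θ) / ∏ l ∈ Finset.range k, v (r + l)‖ ≤ Φ / κ * (1 / L) ^ k := by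
  have h2 : 0 < κ * L ^ k := mul_pos hv.κ_pos (pow_pos (by linarith [hv.one_lt_L]) k)
  have hκ := hv.κ_pos
  have hL : 0 < L := by linarith [hv.one_lt_L]
  rw [Real.norm_eq_abs, abs_div]
  calc _ ≤ Φ / (κ * L ^ k) :=
        div_le_div₀ ((abs_nonneg _).trans (hΦ 0)) (hΦ _) h2 (hv.lower r k)
    _ = _ := by rw [one_div_pow]; field_simp

lemma summable_geometric (hv : Multipliers v κ L C R r₀ q) (B : ℝ) :
    Summable fun k : ℕ => B * (1 / L) ^ k := by
  have hL := hv.one_lt_L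
  exact (summable_geometric_of_lt_one (by positivity) (by rw [div_lt_one] <;> linarith)).mul_left B

lemma summable (hv : Multipliers v κ L C R r₀ q) (hΦ : ∀ t, |g 0 t| ≤ Φ) (r : ℕ) (θ : ℝ) :
    Summable fun k => g 0 ((d : ℝ) ^ k * θ) / ∏ l ∈ Finset.range k, v (r + l) :=
  (hv.summable_geometric _).of_norm_bounded fun k => hv.term_le hΦ r k θ

lemma continuous_series (hv : Multipliers v κ L C R r₀ q) (hΦ : ∀ t, |g 0 t| ≤ Φ)
    (hc : Continuous (g 0)) (r : ℕ) : Continuous (cocycleSeries (g 0) d v r) :=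
  continuous_tsum (fun _ => (hc.comp (continuous_const.mul continuous_id)).div_const _)
    (hv.summable_geometric _) fun _ _ => hv.term_le hΦ r _ _

lemma series_eq (hv : Multipliers v κ L C R r₀ q) (hΦ : ∀ t, |g 0 t| ≤ Φ) (r : ℕ) (θ : ℝ) :
    cocycleSeries (g 0) d v r θ = g 0 θ + cocycleSeries (g 0) d v (r + 1) (d * θ) / v r := by
  rw [cocycleSeries, (hv.summable hΦ r θ).tsum_eq_zero_add, cocycleSeries, ← tsum_div_const]
  congr 1
  · simp
  · refine tsum_congr fun k => ?_
    rw [Finset.prod_range_succ', add_zero, div_div]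
    congr 1
    · rw [pow_succ]; ring_nf
    · congr 1
      exact Finset.prod_congr rfl fun l _ => by rw [show r + (l + 1) = r + 1 + l by ring]

lemma series_eq_sum (hv : Multipliers v κ L C R r₀ q) (hΦ : ∀ t, |g 0 t| ≤ Φ) (r n : ℕ) (θ : ℝ) :
    cocycleSeries (g 0) d v r θ =
      ∑ k ∈ Finset.range n, g 0 ((d : ℝ) ^ k * θ) / ∏ l ∈ Finset.range k, v (r + l) +
        cocycleSeries (g 0) d v (r + n) ((d : ℝ) ^ n * θ) / ∏ l ∈ Finset.range n, v (r + l) := by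
  induction n with
  | zero => simp
  | succ n ih =>
    rw [ih, Finset.sum_range_succ, Finset.prod_range_succ, hv.series_eq hΦ (r + n)]
    have := hv.prod_ne_zero r n
    have := hv.ne_zero (r + n)
    rw [add_div, div_div, ← add_assoc, show (d : ℝ) * ((d : ℝ) ^ n * θ) = (d : ℝ) ^ (n + 1) * θ by
      ring, show r + n + 1 = r + (n + 1) by ring, mul_comm (v (r + n))]

lemma series_add_period (hv : Multipliers v κ L C R r₀ q) {r : ℕ} (hr : r₀ ≤ r) :
    cocycleSeries (g 0) d v (r + q) = cocycleSeries (g 0) d v r := by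
  funext θ
  refine tsum_congr fun k => ?_
  congr 1
  exact Finset.prod_congr rfl fun l _ => by
    rw [show r + q + l = r + l + q by ring, hv.periodic _ (by lia)]

/-- Only finitely many pairs `(v_m, W_{m+1})` occur. -/
lemma exists_representative (hv : Multipliers v κ L C R r₀ q) (m : ℕ) : ∃ m' < r₀ + q,
    v m' = v m ∧ cocycleSeries (g 0) d v (m' + 1) = cocycleSeries (g 0) d v (m + 1) := by
  induction m using Nat.strong_induction_on with
  | _ m ih =>
    by_cases hm : m < r₀ + q
    · exact ⟨m, hm, rfl, rfl⟩
    · have hq := hv.q_pos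
      obtain ⟨m', h1, h2, h3⟩ := ih (m - q) (by lia)
      refine ⟨m', h1, h2.trans ?_, h3.trans ?_⟩
      · rw [← hv.periodic (m - q) (by lia), Nat.sub_add_cancel (by lia)]
      · rw [← hv.series_add_period (r := m - q + 1) (by lia)]
        congr 1; lia

end Multipliers

lemma periodic_cocycleSeries (hper : Function.Periodic (g 0) 1) (r : ℕ) :
    Function.Periodic (cocycleSeries (g 0) d v r) 1 := fun θ => by
  refine tsum_congr fun k => ?_
  have := hper.nat_mul (d ^ k) ((d : ℝ) ^ k * θ)
  rw [mul_add, mul_one]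
  push_cast at this
  rw [mul_one] at this
  rw [this]

/-- The data of the limit curve that describes `W_0` on a cylinder of rank `m + 1`. -/
noncomputable def cocycleData (d : ℕ) (v : ℕ → ℝ) (m j : ℕ) : (ℕ → ℝ) × (ℕ → ℝ) :=
  (fun k => if k ≤ m then ∏ l ∈ Finset.Ico (m - k) m, v l else 0,
    fun k => Int.fract ((j : ℝ) / (d : ℝ) ^ (k + 1)))

lemma cocycleData_mem (hv : Multipliers v κ L C R r₀ q) (m j : ℕ) :
    cocycleData d v m j ∈ branchData C R := by
  refine mem_branchData.2 ⟨fun k => ?_, fun k => ⟨Int.fract_nonneg _, (Int.fract_lt_one _).le⟩, ?_⟩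
  · simp only [cocycleData]
    split_ifs with hk
    · exact hv.upper m k hk
    · have := hv.C_nonneg
      have := hv.R_nonneg
      rw [abs_zero]; positivity
  · simp [cocycleData]

lemma fract_shift (hper : Function.Periodic (g 0) 1) (s t : ℝ) :
    g 0 (Int.fract s + t) = g 0 (s + t) := by
  have := hper.sub_int_mul_eq (x := s + t) ⌊s⌋
  rw [mul_one] at this
  rw [← this, ← Int.self_sub_floor]
  congr 1; ring

/-- Self-similarity: on a cylinder of rank `m + 1`, rescaled to `[0, 1]`, the function `W_0` is up
to a constant a limit curve plus `W_{m+1} / v_m`. -/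
lemma cocycleSeries_cylinder (hv : Multipliers v κ L C R r₀ q) (hΦ : ∀ t, |g 0 t| ≤ Φ)
    (hper : Function.Periodic (g 0) 1) (hd : 2 ≤ d) (m j : ℕ) : ∃ e : ℝ, ∀ τ : ℝ,
      (∏ l ∈ Finset.range m, v l) * cocycleSeries (g 0) d v 0 ((j + τ) / (d : ℝ) ^ (m + 1)) =
        e + branchSeries g d (cocycleData d v m j) 0 τ + cocycleSeries (g 0) d v (m + 1) τ / v m := by
  have hd0 : (0 : ℝ) < d := by exact_mod_cast (by lia : 0 < d)
  refine ⟨∑ k ∈ Finset.range (m + 1), (∏ l ∈ Finset.Ico (m - k) m, v l) *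
    g 0 ((j : ℝ) / (d : ℝ) ^ (k + 1)), fun τ => ?_⟩
  have hP : ∀ k, ∏ l ∈ Finset.range k, v l ≠ 0 := fun k => by simpa using hv.prod_ne_zero 0 k
  have hb : branchSeries g d (cocycleData d v m j) 0 τ =
      ∑ k ∈ Finset.range (m + 1), (∏ l ∈ Finset.Ico (m - k) m, v l) *
        (g 0 ((j + τ) / (d : ℝ) ^ (k + 1)) - g 0 ((j : ℝ) / (d : ℝ) ^ (k + 1))) := by
    rw [branchSeries, tsum_eq_sum (s := Finset.range (m + 1))]
    · refine Finset.sum_congr rfl fun k hk => ?_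
      have hk' := Finset.mem_range.1 hk
      simp only [cocycleData]
      rw [if_pos (by lia), if_pos trivial, pow_zero, one_mul, fract_shift hper]
      have := fract_shift hper ((j : ℝ) / (d : ℝ) ^ (k + 1)) 0
      rw [add_zero, add_zero] at this
      rw [this]
      congr 3
      ring
    · intro k hk
      simp only [cocycleData]
      rw [if_neg (fun h => hk (Finset.mem_range.2 (by lia))), zero_mul]
  rw [hb, hv.series_eq_sum hΦ 0 (m + 1), ← Finset.sum_add_distrib, mul_add]
  congr 1
  · rw [Finset.mul_sum, ← Finset.sum_range_reflect]
    refine Finset.sum_congr rfl fun k hk => ?_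
    have hk' := Finset.mem_range.1 hk
    rw [show m + 1 - 1 - k = m - k by lia]
    have e1 : ∏ l ∈ Finset.range m, v l =
        (∏ l ∈ Finset.range (m - k), v l) * ∏ l ∈ Finset.Ico (m - k) m, v l :=
      (Finset.prod_range_mul_prod_Ico _ (by lia)).symm
    have e2 : (d : ℝ) ^ (m - k) * ((j + τ) / (d : ℝ) ^ (m + 1)) = (j + τ) / (d : ℝ) ^ (k + 1) := by
      rw [show m + 1 = (m - k) + (k + 1) by lia, pow_add]
      field_simp
    rw [e1, e2]
    simp only [zero_add]
    have := hP (m - k)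
    field_simp
    ring
  · rw [zero_add, mul_div_cancel₀ _ (by positivity : (d : ℝ) ^ (m + 1) ≠ 0)]
    have : cocycleSeries (g 0) d v (m + 1) (j + τ) = cocycleSeries (g 0) d v (m + 1) τ := by
      have := (periodic_cocycleSeries (d := d) (v := v) hper (m + 1)).nat_mul j τ
      rw [mul_one] at this
      rw [add_comm (j : ℝ) τ, this]
    rw [this]
    simp only [zero_add]
    rw [Finset.prod_range_succ]
    have := hP m
    have := hv.ne_zero m
    field_simp

/-- The series `W_0` is not constant: otherwise `ψ` would have all the periods `d⁻ʲ`. -/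
lemma cocycleSeries_not_const (hv : Multipliers v κ L C R r₀ q) (hΦ : ∀ t, |g 0 t| ≤ Φ)
    (hper : Function.Periodic (g 0) 1) (hc : Continuous (g 0)) (hnc : ∃ s t, g 0 s ≠ g 0 t)
    (hd : 2 ≤ d) (w : ℝ) : ¬ ∀ θ, cocycleSeries (g 0) d v 0 θ = w := by
  intro hw
  have hd1 : (1 : ℝ) < d := by exact_mod_cast (by lia : 1 < d)
  have hd0 : (0 : ℝ) < d := by linarith
  -- In the expansion of the constant `W_0` up to order `j`, all terms except the first are
  -- invariant under the translation by `d⁻ʲ`.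
  have hP : ∀ j : ℕ, Function.Periodic (g 0) (1 / (d : ℝ) ^ j) := by
    intro j
    induction j using Nat.strong_induction_on with
    | _ j ih =>
    rcases Nat.eq_zero_or_pos j with rfl | hj
    · simpa using hper
    intro θ
    have h1 := hv.series_eq_sum (d := d) hΦ 0 j θ
    have h2 := hv.series_eq_sum (d := d) hΦ 0 j (θ + 1 / (d : ℝ) ^ j)
    have h3 : cocycleSeries (g 0) d v (0 + j) ((d : ℝ) ^ j * (θ + 1 / (d : ℝ) ^ j)) =
        cocycleSeries (g 0) d v (0 + j) ((d : ℝ) ^ j * θ) := by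
      rw [mul_add, mul_one_div_cancel (by positivity)]
      exact periodic_cocycleSeries hper _ _
    rw [h3, hw] at h2
    rw [hw] at h1
    obtain ⟨j', rfl⟩ : ∃ j', j = j' + 1 := ⟨j - 1, by lia⟩
    rw [Finset.sum_range_succ'] at h1 h2
    have h4 : ∀ k ∈ Finset.range j', g 0 ((d : ℝ) ^ (k + 1) * (θ + 1 / (d : ℝ) ^ (j' + 1))) /
        ∏ l ∈ Finset.range (k + 1), v (0 + l) =
        g 0 ((d : ℝ) ^ (k + 1) * θ) / ∏ l ∈ Finset.range (k + 1), v (0 + l) := by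
      intro k hk
      have hk' := Finset.mem_range.1 hk
      have e : (d : ℝ) ^ (k + 1) * (θ + 1 / (d : ℝ) ^ (j' + 1)) =
          (d : ℝ) ^ (k + 1) * θ + 1 / (d : ℝ) ^ (j' - k) := by
        rw [mul_add, mul_one_div]
        congr 1
        rw [div_eq_div_iff (by positivity) (by positivity), ← pow_add, one_mul]
        congr 1; lia
      rw [e, ih (j' - k) (by lia)]
    rw [Finset.sum_congr rfl h4] at h2
    simp only [pow_zero, one_mul, Finset.prod_range_zero, div_one] at h1 h2
    linarith
  obtain ⟨s, t, hst⟩ := hnc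
  refine hst ?_
  -- A continuous function with arbitrarily small periods is constant.
  have hlim : Tendsto (fun j : ℕ => s - ⌊(s - t) * (d : ℝ) ^ j⌋ * (1 / (d : ℝ) ^ j)) atTop (𝓝 t) := by
    have h1 : Tendsto (fun j : ℕ => t + (1 / (d : ℝ)) ^ j) atTop (𝓝 (t + 0)) :=
      (tendsto_pow_atTop_nhds_zero_of_lt_one (by positivity)
        ((div_lt_one hd0).2 hd1)).const_add t
    rw [add_zero] at h1
    refine tendsto_of_tendsto_of_tendsto_of_le_of_le tendsto_const_nhds h1 (fun j => ?_) fun j => ?_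
    · have hj : 0 < (d : ℝ) ^ j := by positivity
      have := Int.floor_le ((s - t) * (d : ℝ) ^ j)
      have h2 : (⌊(s - t) * (d : ℝ) ^ j⌋ : ℝ) * (1 / (d : ℝ) ^ j) ≤ s - t := by
        rw [mul_one_div, div_le_iff₀ hj]; exact this
      dsimp only
      linarith
    · have hj : 0 < (d : ℝ) ^ j := by positivity
      have := Int.lt_floor_add_one ((s - t) * (d : ℝ) ^ j)
      have h2 : s - t ≤ (⌊(s - t) * (d : ℝ) ^ j⌋ + 1 : ℝ) * (1 / (d : ℝ) ^ j) := by
        rw [mul_one_div, le_div_iff₀ hj]; exact this.le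
      rw [one_div_pow]
      dsimp only
      linarith
  have h5 : Tendsto (fun j : ℕ => g 0 (s - ⌊(s - t) * (d : ℝ) ^ j⌋ * (1 / (d : ℝ) ^ j))) atTop
      (𝓝 (g 0 t)) := (hc.tendsto t).comp hlim
  have h6 : (fun j : ℕ => g 0 (s - ⌊(s - t) * (d : ℝ) ^ j⌋ * (1 / (d : ℝ) ^ j))) = fun _ => g 0 s :=
    funext fun j => (hP j).sub_int_mul_eq _
  rw [h6] at h5
  exact tendsto_nhds_unique tendsto_const_nhds h5

end Cocycle

/-! ### Analyticity or oscillation of the cocycle series -/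

namespace AnalyticTower

variable {g g' : ℕ → ℝ → ℝ} {C C' ρ ρ' : ℝ}

lemma const_mul (hg : AnalyticTower g C ρ) (b : ℝ) :
    AnalyticTower (fun i t => b * g i t) (|b| * C) ρ :=
  ⟨fun i t => (hg.hasDerivAt i t).const_mul b, mul_nonneg (abs_nonneg _) hg.C_nonneg, hg.ρ_pos,
    fun i hi t => by
      rw [abs_mul, mul_assoc, mul_assoc]
      exact mul_le_mul_of_nonneg_left (by rw [← mul_assoc]; exact hg.bound i hi t) (abs_nonneg b)⟩

lemma add (hg : AnalyticTower g C ρ) (hg' : AnalyticTower g' C' ρ') :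
    AnalyticTower (fun i t => g i t + g' i t) (C + C') (max ρ ρ') :=
  ⟨fun i t => (hg.hasDerivAt i t).add (hg'.hasDerivAt i t), add_nonneg hg.C_nonneg hg'.C_nonneg,
    lt_max_of_lt_left hg.ρ_pos, fun i hi t => by
      have h1 := hg.C_nonneg
      have h2 := hg'.C_nonneg
      have h3 := hg.ρ_pos.le
      have h4 := hg'.ρ_pos.le
      calc |g i t + g' i t| ≤ |g i t| + |g' i t| := abs_add_le _ _
        _ ≤ C * ρ ^ i * (i.factorial : ℝ) + C' * ρ' ^ i * (i.factorial : ℝ) :=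
            add_le_add (hg.bound i hi t) (hg'.bound i hi t)
        _ ≤ C * max ρ ρ' ^ i * (i.factorial : ℝ) + C' * max ρ ρ' ^ i * (i.factorial : ℝ) := by
            gcongr
            · exact le_max_left _ _
            · exact le_max_right _ _
        _ = _ := by ring⟩

lemma comp_affine (hg : AnalyticTower g C ρ) {c : ℝ} (hc : 0 < c) (e : ℝ) :
    AnalyticTower (fun i t => c ^ i * g i (c * t + e)) C (c * ρ) :=
  ⟨fun i t => by
      have h1 : HasDerivAt (fun t => c * t + e) c t := by
        simpa using ((hasDerivAt_id' t).const_mul c).add_const e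
      refine (((hg.hasDerivAt i _).comp t h1).const_mul (c ^ i)).congr_deriv ?_
      ring,
    hg.C_nonneg, mul_pos hc hg.ρ_pos, fun i hi t => by
      rw [abs_mul, abs_of_pos (pow_pos hc i), mul_pow]
      calc _ ≤ c ^ i * (C * ρ ^ i * (i.factorial : ℝ)) :=
            mul_le_mul_of_nonneg_left (hg.bound i hi _) (pow_pos hc i).le
        _ = _ := by ring⟩

lemma add_const (hg : AnalyticTower g C ρ) (e : ℝ) :
    AnalyticTower (fun i t => g i t + if i = 0 then e else 0) C ρ :=
  ⟨fun i t => by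
      refine ((hg.hasDerivAt i t).add_const (if i = 0 then e else 0)).congr_deriv ?_
      rw [if_neg (by lia), add_zero],
    hg.C_nonneg, hg.ρ_pos, fun i hi t => by
      rw [if_neg (by lia), add_zero]
      exact hg.bound i hi t⟩

lemma exists_add_sum {G : ℕ → ℕ → ℝ → ℝ} (n : ℕ) (hg : AnalyticTower g C ρ)
    (hG : ∀ k, ∃ C ρ, AnalyticTower (G k) C ρ) :
    ∃ C ρ, AnalyticTower (fun i t => ∑ k ∈ Finset.range n, G k i t + g i t) C ρ := by
  induction n with
  | zero => exact ⟨C, ρ, by simpa using hg⟩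
  | succ n ih =>
    obtain ⟨C₁, ρ₁, h₁⟩ := ih
    obtain ⟨C₂, ρ₂, h₂⟩ := hG n
    have h₃ := h₂.add h₁
    have e : (fun i t => ∑ k ∈ Finset.range (n + 1), G k i t + g i t) =
        fun i t => G n i t + (∑ k ∈ Finset.range n, G k i t + g i t) := by
      funext i t
      rw [Finset.sum_range_succ]; ring
    rw [e]
    exact ⟨_, _, h₃⟩

/-- Level sets of a nowhere flat function are null. -/
lemma volume_level_eq_zero (hg : AnalyticTower g C ρ)
    (hne : ∀ t ∈ Icc (0 : ℝ) 1, ∃ i, 1 ≤ i ∧ g i t ≠ 0) (y : ℝ) :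
    volume {t | t ∈ Icc (0 : ℝ) 1 ∧ g 0 t = y} = 0 := by
  refine measure_null_of_locally_null _ fun t ht => ?_
  obtain ⟨i, hi, hne⟩ := hne t ht.1
  have hb : 0 < |g i t| / 2 := by positivity
  have hev : ∀ᶠ s in 𝓝 t, |g i t| / 2 < |g i s| :=
    (hg.continuous i).abs.continuousAt.eventually (lt_mem_nhds (half_lt_self (abs_pos.2 hne)))
  obtain ⟨δ, hδ, hδ'⟩ := Metric.eventually_nhds_iff_ball.1 hev
  refine ⟨{s | s ∈ Icc (t - δ / 2) (t + δ / 2) ∧ g 0 s = y}, ?_, ?_⟩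
  · have h1 : Icc (t - δ / 2) (t + δ / 2) ∈ 𝓝 t := Icc_mem_nhds (by linarith) (by linarith)
    filter_upwards [mem_nhdsWithin_of_mem_nhds h1, self_mem_nhdsWithin] with s hs hs'
    exact ⟨hs, hs'.2⟩
  · have hf := (hg.add_const (-y)).hasDerivAt
    have hbd : ∀ s ∈ Icc (t - δ / 2) (t + δ / 2),
        |g i t| / 2 ≤ |g i s + if i = 0 then -y else 0| := fun s hs => by
      rw [if_neg (by lia), add_zero]
      refine (hδ' s ?_).le
      rw [Metric.mem_ball, Real.dist_eq, abs_lt]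
      constructor <;> linarith [hs.1, hs.2]
    have hi0 : (0 : ℝ) < 1 / (i : ℝ) := by
      have : (0 : ℝ) < i := by exact_mod_cast hi
      positivity
    have hlim : Tendsto (fun ε : ℝ => ENNReal.ofReal
        (2 ^ (i + 2) * (2 * ε / (|g i t| / 2)) ^ (1 / (i : ℝ)))) (𝓝[>] 0) (𝓝 0) := by
      have h1 : Continuous fun ε : ℝ => ENNReal.ofReal
          (2 ^ (i + 2) * (2 * ε / (|g i t| / 2)) ^ (1 / (i : ℝ))) := by
        refine ENNReal.continuous_ofReal.comp (continuous_const.mul ?_)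
        exact (Real.continuous_rpow_const hi0.le).comp (by fun_prop)
      have h2 := h1.tendsto 0
      simp only [mul_zero, zero_div, Real.zero_rpow hi0.ne', ENNReal.ofReal_zero] at h2
      exact h2.mono_left nhdsWithin_le_nhds
    refine le_antisymm (ge_of_tendsto hlim ?_) zero_le
    filter_upwards [self_mem_nhdsWithin] with ε hε
    refine le_trans (measure_mono fun s hs => ?_) (volume_sublevel_le hf hi hb hbd hε)
    refine ⟨hs.1, ?_⟩
    simp only [if_true, hs.2, add_neg_cancel, abs_zero]
    exact le_of_lt hε

end AnalyticTower

section Cocycle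

variable {g : ℕ → ℝ → ℝ} {v : ℕ → ℝ} {κ L C R A ρ Φ : ℝ} {r₀ q d : ℕ}

/-- If `W_{m+1}` agrees on `[0, 1]` with an analytic function, the cohomological equation and
periodicity make `W_0` analytic on `[0, ∞)`. -/
lemma exists_tower_of_branch_const (hg : AnalyticTower g A ρ)
    (hv : Multipliers v κ L C R r₀ q) (hΦ : ∀ t, |g 0 t| ≤ Φ)
    (hper : Function.Periodic (g 0) 1) (hd : 2 ≤ d) (hRd : R < d) {ω : (ℕ → ℝ) × (ℕ → ℝ)}
    (hω : ω ∈ branchData C R) {m : ℕ} {e : ℝ} (h : ∀ τ ∈ Icc (0 : ℝ) 1,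
      branchSeries g d ω 0 τ + cocycleSeries (g 0) d v (m + 1) τ / v m = e) :
    ∃ T C' ρ', AnalyticTower T C' ρ' ∧ ∀ θ, 0 ≤ θ → cocycleSeries (g 0) d v 0 θ = T 0 θ := by
  have hd2 : (2 : ℝ) ≤ d := by exact_mod_cast hd
  have hd0 : (0 : ℝ) < d := by linarith
  have hB := analyticTower_branchSeries hg hd hv.C_nonneg hv.R_nonneg hRd (mem_branchData.1 hω).1
  -- By the hypothesis and the cohomological equation `W_{m+2}` coincides with the analytic function
  -- `E` on `[0, d]`, an interval longer than a period.
  have hE := ((((hB.const_mul (-v m)).add (hg.const_mul (-1))).const_mul (v (m + 1))).add_const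
    (v (m + 1) * (v m * e))).comp_affine (c := 1 / (d : ℝ)) (by positivity) 0
  set E : ℕ → ℝ → ℝ := fun i t => (1 / (d : ℝ)) ^ i * (v (m + 1) *
    (-v m * branchSeries g d ω i (1 / d * t + 0) + -1 * g i (1 / d * t + 0)) +
      if i = 0 then v (m + 1) * (v m * e) else 0) with hEdef
  have hperW := periodic_cocycleSeries (d := d) (v := v) hper (m + 2)
  have hEV : ∀ t ∈ Icc (0 : ℝ) d, cocycleSeries (g 0) d v (m + 2) t = E 0 t := by
    intro t ht
    have ht' : 1 / (d : ℝ) * t ∈ Icc (0 : ℝ) 1 := by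
      refine ⟨mul_nonneg (by positivity) ht.1, ?_⟩
      rw [one_div, inv_mul_le_iff₀ hd0, mul_one]
      exact ht.2
    have h1 := h _ ht'
    have h2 := hv.series_eq (d := d) hΦ (m + 1) (1 / (d : ℝ) * t)
    rw [show (d : ℝ) * (1 / d * t) = t by field_simp] at h2
    have hm := hv.ne_zero m
    have hm1 := hv.ne_zero (m + 1)
    have h3 : cocycleSeries (g 0) d v (m + 2) t = v (m + 1) *
        (cocycleSeries (g 0) d v (m + 1) (1 / (d : ℝ) * t) - g 0 (1 / (d : ℝ) * t)) := by
      rw [h2]; field_simp; ring_nf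
    have h4 : cocycleSeries (g 0) d v (m + 1) (1 / (d : ℝ) * t) =
        v m * (e - branchSeries g d ω 0 (1 / (d : ℝ) * t)) := by
      rw [← h1]; field_simp; ring
    rw [h3, h4]
    simp only [hEdef, if_true, pow_zero, one_mul, add_zero]
    ring
  -- the identity `E(t + 1) = E(t)` holds on `[0, 1]`, hence on `[0, ∞)`
  have hD := (hE.comp_affine (c := 1) one_pos 1).add (hE.const_mul (-1))
  set D : ℕ → ℝ → ℝ := fun i t => 1 ^ i * E i (1 * t + 1) + -1 * E i t with hDdef
  have hD0 : ∀ t ∈ Icc (0 : ℝ) 1, D 0 t = 0 := by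
    intro t ht
    simp only [hDdef]
    rw [one_mul, ← hEV (t + 1) ⟨by linarith [ht.1], by linarith [ht.2]⟩,
      ← hEV t ⟨ht.1, by linarith [ht.2]⟩, hperW]
    ring
  have hDi : ∀ i, ∀ t ∈ Ioo (0 : ℝ) 1, D i t = 0 := by
    intro i
    induction i with
    | zero => exact fun t ht => hD0 t (Ioo_subset_Icc_self ht)
    | succ i ih =>
      intro t ht
      have h1 : D i =ᶠ[𝓝 t] fun _ => 0 := by
        filter_upwards [isOpen_Ioo.mem_nhds ht] with s hs using ih s hs
      exact (hD.hasDerivAt i t).unique ((hasDerivAt_const t (0 : ℝ)).congr_of_eventuallyEq h1)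
  have hDz : ∀ t, 0 ≤ t → D 0 t = 0 := by
    intro t ht
    by_cases h1 : t ≤ 1
    · exact hD0 t ⟨ht, h1⟩
    · have hz : ∀ s, 1 / 2 ≤ s → D 1 s = 0 := fun s hs =>
        hD.eq_zero_of_le le_rfl (fun i _ => hDi i (1 / 2) (by norm_num)) hs le_rfl
      obtain ⟨c, hc, hc'⟩ := exists_hasDerivAt_eq_slope (D 0) (D 1)
        (show (1 / 2 : ℝ) < t by linarith) (hD.continuous 0).continuousOn
        (fun x _ => hD.hasDerivAt 0 x)
      rw [hz c hc.1.le, hDi 0 (1 / 2) (by norm_num), sub_zero] at hc'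
      exact (div_eq_zero_iff.1 hc'.symm).resolve_right (by linarith)
  -- Therefore `W_{m+2} = E` on `[0, ∞)`, both functions being periodic there.
  have hEall : ∀ N : ℕ, ∀ t : ℝ, 0 ≤ t → t ≤ N + 1 → cocycleSeries (g 0) d v (m + 2) t = E 0 t := by
    intro N
    induction N with
    | zero => exact fun t h0 h1 => hEV t ⟨h0, by push_cast at h1; linarith⟩
    | succ N ih =>
      intro t h0 h1
      by_cases h2 : t ≤ 1
      · exact hEV t ⟨h0, by linarith⟩
      · have h3 := ih (t - 1) (by linarith) (by push_cast at h1; linarith)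
        have h4 := hDz (t - 1) (by linarith)
        simp only [hDdef, pow_zero, one_mul, sub_add_cancel] at h4
        have h5 := hperW (t - 1)
        rw [sub_add_cancel] at h5
        rw [h5, h3]
        linarith
  have hEall' : ∀ t : ℝ, 0 ≤ t → cocycleSeries (g 0) d v (m + 2) t = E 0 t := fun t ht => by
    obtain ⟨N, hN⟩ := exists_nat_ge t
    exact hEall N t ht (by linarith)
  have hcp : 0 < (d : ℝ) ^ (m + 2) := by positivity
  obtain ⟨C', ρ', hT⟩ := ((hE.comp_affine hcp 0).const_mul
    (1 / ∏ l ∈ Finset.range (m + 2), v (0 + l))).exists_add_sum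
    (G := fun k i t => 1 / (∏ l ∈ Finset.range k, v (0 + l)) *
      (((d : ℝ) ^ k) ^ i * g i ((d : ℝ) ^ k * t + 0))) (m + 2)
    (fun k => ⟨_, _, (hg.comp_affine (c := (d : ℝ) ^ k) (by positivity) 0).const_mul
      (1 / ∏ l ∈ Finset.range k, v (0 + l))⟩)
  refine ⟨_, C', ρ', hT, fun θ hθ => ?_⟩
  rw [hv.series_eq_sum hΦ 0 (m + 2), show 0 + (m + 2) = m + 2 by ring, hEall' _ (by positivity)]
  simp only [pow_zero, one_mul, add_zero]
  congr 1
  · exact Finset.sum_congr rfl fun k _ => by ring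
  · ring

/-- Either some limit of rescalings of `W_0` is constant on `[0, 1]`, or `W_0` oscillates on every
cylinder, uniformly after rescaling. -/
lemma branch_const_or_oscillation (hg : AnalyticTower g A ρ)
    (hv : Multipliers v κ L C R r₀ q) (hd : 2 ≤ d) (hRd : R < d) :
    (∃ ω ∈ branchData C R, ∃ m : ℕ, ∃ e : ℝ, ∀ τ ∈ Icc (0 : ℝ) 1,
      branchSeries g d ω 0 τ + cocycleSeries (g 0) d v (m + 1) τ / v m = e) ∨
    ∃ c : ℝ, 0 < c ∧ ∀ ω ∈ branchData C R, ∀ m : ℕ, ∃ τ ∈ Icc (0 : ℝ) 1, ∃ τ' ∈ Icc (0 : ℝ) 1,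
      c ≤ |(branchSeries g d ω 0 τ + cocycleSeries (g 0) d v (m + 1) τ / v m) -
        (branchSeries g d ω 0 τ' + cocycleSeries (g 0) d v (m + 1) τ' / v m)| := by
  by_contra! hcon
  obtain ⟨h1, h2⟩ := hcon
  have h3 : ∀ n : ℕ, ∃ ω ∈ branchData C R, ∃ m : ℕ, ∀ τ ∈ Icc (0 : ℝ) 1, ∀ τ' ∈ Icc (0 : ℝ) 1,
      |(branchSeries g d ω 0 τ + cocycleSeries (g 0) d v (m + 1) τ / v m) -
        (branchSeries g d ω 0 τ' + cocycleSeries (g 0) d v (m + 1) τ' / v m)| <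
          1 / ((n : ℝ) + 1) := fun n => h2 _ (by positivity)
  choose ω hω m hm using h3
  choose m' hm'1 hm'2 hm'3 using fun n => hv.exists_representative (g := g) (d := d) (m n)
  -- Only finitely many pairs `(v_m, W_{m+1})` occur and the space of the data `ω` is compact, so
  -- that rescalings with oscillation tending to `0` have a constant limit.
  obtain ⟨⟨ω₀, m₀⟩, hω₀, u, hu, hlim⟩ := ((isCompact_branchData C R).prod
    (finite_Iio (r₀ + q)).isCompact).tendsto_subseq (x := fun n => (ω n, m' n))
    (fun n => ⟨hω n, hm'1 n⟩)
  obtain ⟨hl1, hl2⟩ := (Prod.tendsto_iff _ _).1 hlim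
  have hev : ∀ᶠ n in atTop, m' (u n) = m₀ := by
    have := hl2.eventually (show ∀ᶠ x in 𝓝 m₀, x = m₀ by rw [nhds_discrete]; exact rfl)
    exact this
  obtain ⟨τ, hτ1, hτ2⟩ := h1 ω₀ hω₀.1 m₀
    (branchSeries g d ω₀ 0 0 + cocycleSeries (g 0) d v (m₀ + 1) 0 / v m₀)
  refine hτ2 ?_
  have hcont : ∀ s : ℝ, Tendsto (fun n => branchSeries g d (ω (u n)) 0 s) atTop
      (𝓝 (branchSeries g d ω₀ 0 s)) := fun s =>
    (continuousOn_branchSeries hg hd hv.R_nonneg hRd 0 s ω₀ hω₀.1).tendsto.comp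
      (tendsto_nhdsWithin_iff.2 ⟨hl1, Eventually.of_forall fun n => hω _⟩)
  have h4 := (((hcont τ).add_const (cocycleSeries (g 0) d v (m₀ + 1) τ / v m₀)).sub
    ((hcont 0).add_const (cocycleSeries (g 0) d v (m₀ + 1) 0 / v m₀))).abs
  have h5 : Tendsto (fun n : ℕ => 1 / ((u n : ℝ) + 1)) atTop (𝓝 0) :=
    (tendsto_one_div_add_atTop_nhds_zero_nat (𝕜 := ℝ)).comp hu.tendsto_atTop
  have h6 := le_of_tendsto_of_tendsto h4 h5 (by
    filter_upwards [hev] with n hn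
    have := (hm (u n) τ hτ1 0 (by norm_num)).le
    rwa [← hm'2, ← hm'3, hn] at this)
  exact sub_eq_zero.1 (abs_nonpos_iff.1 h6)

end Cocycle

/-! ### The distribution of the cocycle series -/

/-- The closed cylinder of rank `n` and index `j` for the map `θ ↦ dθ`. -/
def closedCyl (d n j : ℕ) : Set ℝ := Icc ((j : ℝ) / (d : ℝ) ^ n) (((j : ℝ) + 1) / (d : ℝ) ^ n)

lemma exists_mem_closedCyl {d n j : ℕ} (hd : 1 ≤ d) (q : ℕ) {t : ℝ} (ht : t ∈ closedCyl d n j) :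
    ∃ k < d ^ q, t ∈ closedCyl d (n + q) (j * d ^ q + k) := by
  have hd0 : (0 : ℝ) < d := by exact_mod_cast hd
  have hn : (0 : ℝ) < (d : ℝ) ^ n := by positivity
  have hq : (0 : ℝ) < (d : ℝ) ^ q := by positivity
  have hqN : 0 < d ^ q := by positivity
  obtain ⟨h1, h2⟩ := ht
  rw [div_le_iff₀ hn] at h1
  rw [le_div_iff₀ hn] at h2
  set s := (t * (d : ℝ) ^ n - j) * (d : ℝ) ^ q with hs
  have hs0 : 0 ≤ s := mul_nonneg (by linarith) hq.le
  have hs1 : s ≤ (d : ℝ) ^ q := by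
    rw [hs]; exact mul_le_of_le_one_left hq.le (by linarith)
  have key : ∀ k : ℕ, (k : ℝ) ≤ s → s ≤ k + 1 → t ∈ closedCyl d (n + q) (j * d ^ q + k) := by
    intro k hk1 hk2
    rw [hs] at hk1 hk2
    rw [closedCyl, mem_Icc, div_le_iff₀ (by positivity), le_div_iff₀ (by positivity), pow_add]
    push_cast
    constructor <;> nlinarith
  by_cases hlt : s < (d : ℝ) ^ q
  · refine ⟨⌊s⌋₊, ?_, key _ (Nat.floor_le hs0) (Nat.lt_floor_add_one s).le⟩
    rw [Nat.floor_lt hs0]; exact_mod_cast hlt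
  · refine ⟨d ^ q - 1, by lia, key _ ?_ ?_⟩
    · rw [Nat.cast_sub hqN]; push_cast; linarith
    · rw [Nat.cast_sub hqN]; push_cast; linarith

/-- A set that misses a subcylinder of relative rank `q` of every cylinder is null. -/
lemma volume_eq_zero_of_gaps {d q : ℕ} (hd : 2 ≤ d) {E : Set ℝ}
    (hE : ∀ n j, ∃ k < d ^ q, E ∩ closedCyl d (n + 1 + q) (j * d ^ q + k) = ∅) :
    volume (E ∩ Icc 0 1) = 0 := by
  have hd0 : (0 : ℝ) < d := by exact_mod_cast (by lia : 0 < d)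
  have hqN : 1 ≤ d ^ q := Nat.one_le_pow _ _ (by lia)
  have hq0 : (0 : ℝ) < (d : ℝ) ^ q := by positivity
  have hq1 : (1 : ℝ) ≤ (d : ℝ) ^ q := one_le_pow₀ (by exact_mod_cast (by lia : 1 ≤ d))
  set x := 1 - 1 / (d : ℝ) ^ q with hx
  have hx0 : 0 ≤ x := by rw [hx, sub_nonneg, div_le_one hq0]; exact hq1
  have hx1 : x < 1 := by rw [hx]; linarith [show 0 < 1 / (d : ℝ) ^ q by positivity]
  -- The fraction of a cylinder that is covered loses a factor `x = 1 - d^{-q}` at each refinement.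
  have key : ∀ k n j : ℕ, volume (E ∩ closedCyl d (n + 1) j) ≤
      ENNReal.ofReal (x ^ k / (d : ℝ) ^ (n + 1)) := by
    intro k
    induction k with
    | zero =>
      intro n j
      refine (measure_mono inter_subset_right).trans ?_
      rw [closedCyl, Real.volume_Icc]
      refine ENNReal.ofReal_le_ofReal (le_of_eq ?_)
      rw [pow_zero]; ring
    | succ k ih =>
      intro n j
      obtain ⟨k₀, hk₀, hempty⟩ := hE n j
      have hsub : E ∩ closedCyl d (n + 1) j ⊆ ⋃ i ∈ (Finset.range (d ^ q)).erase k₀,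
          E ∩ closedCyl d (n + 1 + q) (j * d ^ q + i) := by
        rintro t ⟨htE, ht⟩
        obtain ⟨i, hi, hti⟩ := exists_mem_closedCyl (by lia) q ht
        simp only [mem_iUnion]
        refine ⟨i, Finset.mem_erase.2 ⟨?_, Finset.mem_range.2 hi⟩, htE, hti⟩
        rintro rfl
        exact (hempty ▸ (⟨htE, hti⟩ : t ∈ E ∩ _) : t ∈ (∅ : Set ℝ))
      refine (measure_mono hsub).trans ((measure_biUnion_finset_le _ _).trans
        ((Finset.sum_le_sum fun i _ => ?_).trans (le_of_eq (Finset.sum_const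
          (ENNReal.ofReal (x ^ k / (d : ℝ) ^ (n + q + 1))))) |>.trans (le_of_eq ?_)))
      · have := ih (n + q) (j * d ^ q + i)
        rwa [show n + q + 1 = n + 1 + q by ring] at this ⊢
      · rw [Finset.card_erase_of_mem (Finset.mem_range.2 hk₀), Finset.card_range, nsmul_eq_mul,
          ← ENNReal.ofReal_natCast, ← ENNReal.ofReal_mul (by positivity)]
        congr 1
        rw [Nat.cast_sub hqN, show n + q + 1 = q + (n + 1) by ring, pow_add, pow_succ x]
        push_cast
        rw [hx]
        field_simp
  have hz : ∀ j : ℕ, volume (E ∩ closedCyl d 1 j) = 0 := by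
    intro j
    have h1 : Tendsto (fun k : ℕ => ENNReal.ofReal (x ^ k / (d : ℝ) ^ (0 + 1))) atTop (𝓝 0) := by
      have := (tendsto_pow_atTop_nhds_zero_of_lt_one hx0 hx1).div_const ((d : ℝ) ^ (0 + 1))
      rw [zero_div] at this
      simpa using ENNReal.tendsto_ofReal this
    exact le_antisymm (ge_of_tendsto' h1 fun k => key k 0 j) zero_le
  have hsub : E ∩ Icc 0 1 ⊆ ⋃ j : ℕ, E ∩ closedCyl d 1 j := by
    rintro t ⟨htE, ht⟩
    obtain ⟨j, -, hj⟩ := exists_mem_closedCyl (n := 0) (j := 0) (by lia : 1 ≤ d) 1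
      (t := t) (by simpa [closedCyl] using ht)
    exact mem_iUnion.2 ⟨_, htE, by simpa using hj⟩
  exact measure_mono_null hsub (measure_iUnion_null fun j => hz j)

section Cocycle

variable {g : ℕ → ℝ → ℝ} {v : ℕ → ℝ} {κ L C R A ρ Φ : ℝ} {r₀ q d : ℕ}

/-- The rescalings of `W_0` to cylinders are equicontinuous. -/
lemma exists_uniform_modulus (hg : AnalyticTower g A ρ) (hv : Multipliers v κ L C R r₀ q)
    (hΦ : ∀ t, |g 0 t| ≤ Φ) (hd : 2 ≤ d) (hRd : R < d) {ε : ℝ} (hε : 0 < ε) :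
    ∃ δ : ℝ, 0 < δ ∧ ∀ ω ∈ branchData C R, ∀ m : ℕ, ∀ τ ∈ Icc (0 : ℝ) 1, ∀ τ' ∈ Icc (0 : ℝ) 1,
      |τ - τ'| ≤ δ →
      |(branchSeries g d ω 0 τ + cocycleSeries (g 0) d v (m + 1) τ / v m) -
        (branchSeries g d ω 0 τ' + cocycleSeries (g 0) d v (m + 1) τ' / v m)| ≤ ε := by
  have hd0 : (0 : ℝ) < d := by exact_mod_cast (by lia : 0 < d)
  have hq : 0 < 1 - R / d := sub_pos.2 ((div_lt_one hd0).2 hRd)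
  set K := C * (A * ρ) * (1 - R / d)⁻¹ with hK
  have hK0 : 0 ≤ K := by
    have := hv.C_nonneg
    have := hg.C_nonneg
    have := hg.ρ_pos
    positivity
  have h1 : ∀ m ∈ Iio (r₀ + q), ∃ δ : ℝ, 0 < δ ∧ ∀ τ ∈ Icc (0 : ℝ) 1, ∀ τ' ∈ Icc (0 : ℝ) 1,
      |τ - τ'| ≤ δ → |cocycleSeries (g 0) d v (m + 1) τ / v m -
        cocycleSeries (g 0) d v (m + 1) τ' / v m| ≤ ε / 2 := by
    intro m _
    have hc : Continuous fun τ => cocycleSeries (g 0) d v (m + 1) τ / v m :=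
      (hv.continuous_series hΦ (hg.continuous 0) (m + 1)).div_const _
    have hu := isCompact_Icc.uniformContinuousOn_of_continuous
      (hc.continuousOn (s := Icc (0 : ℝ) 1))
    obtain ⟨δ, hδ, h⟩ := Metric.uniformContinuousOn_iff.1 hu (ε / 2) (half_pos hε)
    refine ⟨δ / 2, half_pos hδ, fun τ hτ τ' hτ' hd => ?_⟩
    exact (h τ hτ τ' hτ' (by rw [Real.dist_eq]; linarith)).le
  choose! δ₁ hδ₁ hδ₁' using h1
  obtain ⟨δ, hδ, hδle⟩ : ∃ δ : ℝ, 0 < δ ∧ ∀ m ∈ Iio (r₀ + q), δ ≤ δ₁ m := by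
    have : ∀ᶠ δ in 𝓝[>] (0 : ℝ), ∀ m ∈ Iio (r₀ + q), δ ≤ δ₁ m :=
      (eventually_all_finite (finite_Iio _)).2 fun m hm =>
        (eventually_le_nhds (hδ₁ m hm)).filter_mono nhdsWithin_le_nhds
    obtain ⟨δ, h1, h2⟩ := (this.and self_mem_nhdsWithin).exists
    exact ⟨δ, h2, h1⟩
  refine ⟨min δ (ε / 2 / (K + 1)), lt_min hδ (by positivity), ?_⟩
  intro ω hω m τ hτ τ' hτ' hdist
  obtain ⟨m', hm', e1, e2⟩ := hv.exists_representative (g := g) (d := d) m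
  rw [← e1, ← e2]
  have h3 := hδ₁' m' hm' τ hτ τ' hτ' (hdist.trans ((min_le_left _ _).trans (hδle m' hm')))
  have hω1 := (mem_branchData.1 hω).1
  have h4 : |branchSeries g d ω 0 τ - branchSeries g d ω 0 τ'| ≤ ε / 2 := by
    have := (convex_univ).norm_image_sub_le_of_norm_hasDerivWithin_le
      (f := branchSeries g d ω 0) (f' := branchSeries g d ω 1) (C := K) (x := τ') (y := τ)
      (fun x _ => (hasDerivAt_branchSeries hg hd hv.R_nonneg hRd hω1 0 x).hasDerivWithinAt)
      (fun x _ => abs_branchSeries_le hd hv.R_nonneg hRd hω1 le_rfl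
        (fun t => by simpa using hg.bound 1 le_rfl t) x) (mem_univ _) (mem_univ _)
    rw [Real.norm_eq_abs, Real.norm_eq_abs] at this
    refine this.trans ?_
    calc K * |τ - τ'| ≤ K * (ε / 2 / (K + 1)) := by
          gcongr; exact hdist.trans (min_le_right _ _)
      _ ≤ (K + 1) * (ε / 2 / (K + 1)) := by
          have : 0 ≤ ε / 2 / (K + 1) := by positivity
          nlinarith
      _ = ε / 2 := by field_simp
  rw [add_sub_add_comm]
  exact (abs_add_le _ _).trans (by linarith)

/-- The distribution of `W_0` has no atoms: either `W_0` is analytic and not constant, or, by its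
uniform oscillation, every cylinder has a subcylinder of bounded relative rank on which `W_0` differs
from `y`. -/
lemma volume_cocycleSeries_level (hg : AnalyticTower g A ρ) (hv : Multipliers v κ L C R r₀ q)
    (hΦ : ∀ t, |g 0 t| ≤ Φ) (hper : Function.Periodic (g 0) 1) (hnc : ∃ s t, g 0 s ≠ g 0 t)
    (hd : 2 ≤ d) (hRd : R < d) (y : ℝ) :
    volume {t | t ∈ Icc (0 : ℝ) 1 ∧ cocycleSeries (g 0) d v 0 t = y} = 0 := by
  have hd0 : (0 : ℝ) < d := by exact_mod_cast (by lia : 0 < d)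
  have hd1 : (1 : ℝ) < d := by exact_mod_cast (by lia : 1 < d)
  rcases branch_const_or_oscillation hg hv hd hRd with ⟨ω, hω, m, e, h⟩ | ⟨c, hc, hosc⟩
  · obtain ⟨T, C', ρ', hT, hWT⟩ := exists_tower_of_branch_const hg hv hΦ hper hd hRd hω h
    have hset : {t | t ∈ Icc (0 : ℝ) 1 ∧ cocycleSeries (g 0) d v 0 t = y} =
        {t | t ∈ Icc (0 : ℝ) 1 ∧ T 0 t = y} := by
      ext t
      exact and_congr_right fun ht => by rw [hWT t ht.1]
    rw [hset]
    refine hT.volume_level_eq_zero (fun t₀ ht₀ => ?_) y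
    by_contra! hz
    have h1 : ∀ s, t₀ ≤ s → T 1 s = 0 := fun s hs =>
      hT.eq_zero_of_le le_rfl hz hs le_rfl
    have h2 : ∀ s, t₀ ≤ s → T 0 s = T 0 t₀ := fun s hs => by
      rcases hs.eq_or_lt with rfl | hs
      · rfl
      · obtain ⟨c, hc, hc'⟩ := exists_hasDerivAt_eq_slope (T 0) (T 1) hs
          (hT.continuous 0).continuousOn (fun x _ => hT.hasDerivAt 0 x)
        rw [h1 c hc.1.le] at hc'
        have := (div_eq_zero_iff.1 hc'.symm).resolve_right (by linarith)
        linarith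
    refine cocycleSeries_not_const hv hΦ hper (hg.continuous 0) hnc hd (T 0 t₀) fun θ => ?_
    obtain ⟨N, hN⟩ := exists_nat_ge (t₀ - θ)
    have h3 := (periodic_cocycleSeries (d := d) (v := v) hper 0).nat_mul N θ
    rw [mul_one] at h3
    rw [← h3, hWT _ (by linarith [ht₀.1]), h2 _ (by linarith)]
  · obtain ⟨δ, hδ, hmod⟩ := exists_uniform_modulus hg hv hΦ hd hRd (show 0 < c / 4 by positivity)
    obtain ⟨q', hq'⟩ := exists_pow_lt_of_lt_one hδ (show 1 / (d : ℝ) < 1 by rwa [div_lt_one hd0])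
    have hgap := volume_eq_zero_of_gaps (q := q') hd
      (E := {t | cocycleSeries (g 0) d v 0 t = y}) ?_
    · rwa [inter_comm] at hgap
    intro m j
    obtain ⟨e, he⟩ := cocycleSeries_cylinder hv hΦ hper hd m j
    set P := ∏ l ∈ Finset.range m, v l with hP
    set Ψ := fun τ => branchSeries g d (cocycleData d v m j) 0 τ +
      cocycleSeries (g 0) d v (m + 1) τ / v m with hΨ
    have hmem := cocycleData_mem (d := d) hv m j
    obtain ⟨τ, hτ, τ', hτ', hττ'⟩ := hosc _ hmem m
    -- a point of the cylinder where `W_0` is far from `y`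
    obtain ⟨τ₀, hτ₀, hfar⟩ : ∃ τ₀ ∈ Icc (0 : ℝ) 1, c / 2 ≤ |e + Ψ τ₀ - P * y| := by
      by_contra! hcon
      have h1 := hcon τ hτ
      have h2 := hcon τ' hτ'
      have h3 := abs_sub (e + Ψ τ - P * y) (e + Ψ τ' - P * y)
      rw [show e + Ψ τ - P * y - (e + Ψ τ' - P * y) = Ψ τ - Ψ τ' by ring] at h3
      have h4 : c ≤ |Ψ τ - Ψ τ'| := hττ'
      linarith
    obtain ⟨k, hk, hτk⟩ := exists_mem_closedCyl (n := 0) (j := 0) (by lia : 1 ≤ d) q'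
      (t := τ₀) (by simpa [closedCyl] using hτ₀)
    refine ⟨k, hk, ?_⟩
    rw [eq_empty_iff_forall_notMem]
    rintro t ⟨hty, ht⟩
    replace hty : cocycleSeries (g 0) d v 0 t = y := hty
    rw [zero_mul, zero_add, zero_add, closedCyl, mem_Icc, div_le_iff₀ (by positivity),
      le_div_iff₀ (by positivity)] at hτk
    rw [closedCyl, mem_Icc, div_le_iff₀ (by positivity), le_div_iff₀ (by positivity), pow_add] at ht
    push_cast at ht
    set s := t * (d : ℝ) ^ (m + 1) - j with hs
    have hqp : (0 : ℝ) < (d : ℝ) ^ q' := by positivity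
    have hs1 : (k : ℝ) ≤ s * (d : ℝ) ^ q' := by rw [hs]; nlinarith [ht.1]
    have hs2 : s * (d : ℝ) ^ q' ≤ k + 1 := by rw [hs]; nlinarith [ht.2]
    have hk1 : (k : ℝ) + 1 ≤ (d : ℝ) ^ q' := by exact_mod_cast hk
    have hsI : s ∈ Icc (0 : ℝ) 1 := by
      refine ⟨?_, ?_⟩
      · exact nonneg_of_mul_nonneg_left ((Nat.cast_nonneg k).trans hs1) hqp
      · exact le_of_mul_le_mul_right (by linarith) hqp
    have hclose : |s - τ₀| ≤ δ := by
      rw [one_div_pow] at hq'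
      refine le_trans ?_ hq'.le
      rw [le_div_iff₀ hqp, ← abs_of_pos hqp, ← abs_mul, sub_mul, abs_le]
      constructor <;> linarith [hτk.1, hτk.2]
    have h5 : |Ψ s - Ψ τ₀| ≤ c / 4 := hmod _ hmem m s hsI τ₀ hτ₀ hclose
    have h6 := he s
    rw [show (j + s) / (d : ℝ) ^ (m + 1) = t by rw [hs]; field_simp; ring, hty] at h6
    have h7 : e + Ψ τ₀ - P * y = -(Ψ s - Ψ τ₀) := by rw [h6, hΨ]; ring
    rw [h7, abs_neg] at hfar
    linarith

end Cocycle

/-- If all level sets of a continuous function are null, then small balls have uniformly small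
probability, by compactness of the range. -/
lemma exists_small_ball_of_level_null {f : ℝ → ℝ} (hf : Continuous f)
    (hnull : ∀ y, volume {t | t ∈ Icc (0 : ℝ) 1 ∧ f t = y} = 0) {ε : ENNReal} (hε : 0 < ε) :
    ∃ δ : ℝ, 0 < δ ∧ ∀ y, volume {t | t ∈ Icc (0 : ℝ) 1 ∧ |f t - y| ≤ δ} ≤ ε := by
  by_contra! hcon
  have h1 : ∀ n : ℕ, ∃ y, ε < volume {t | t ∈ Icc (0 : ℝ) 1 ∧ |f t - y| ≤ 1 / ((n : ℝ) + 1)} :=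
    fun n => hcon _ (by positivity)
  choose y hy using h1
  obtain ⟨M, hM⟩ := isCompact_Icc.exists_bound_of_continuousOn (hf.continuousOn (s := Icc (0 : ℝ) 1))
  have hyM : ∀ n, y n ∈ Icc (-(M + 1)) (M + 1) := by
    intro n
    obtain ⟨t, ht, hty⟩ : {t | t ∈ Icc (0 : ℝ) 1 ∧ |f t - y n| ≤ 1 / ((n : ℝ) + 1)}.Nonempty := by
      rw [nonempty_iff_ne_empty]
      intro h
      have := hy n
      rw [h, measure_empty] at this
      exact absurd this (not_lt.2 zero_le)
    have h2 : 1 / ((n : ℝ) + 1) ≤ 1 := by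
      rw [div_le_one (by positivity)]; linarith [(Nat.cast_nonneg n : (0 : ℝ) ≤ n)]
    have h3 := abs_le.1 (hM t ht)
    have h4 := abs_le.1 (hty.trans h2)
    constructor <;> linarith
  obtain ⟨y₀, -, u, hu, hlim⟩ := isCompact_Icc.tendsto_subseq hyM
  have hA : Tendsto (fun k : ℕ => volume {t | t ∈ Icc (0 : ℝ) 1 ∧ |f t - y₀| ≤ 1 / ((k : ℝ) + 1)})
      atTop (𝓝 (volume (⋂ k : ℕ, {t | t ∈ Icc (0 : ℝ) 1 ∧ |f t - y₀| ≤ 1 / ((k : ℝ) + 1)}))) := by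
    refine tendsto_measure_iInter_atTop (fun k => ?_) (fun k l hkl t ht => ⟨ht.1, ht.2.trans ?_⟩)
      ⟨0, ?_⟩
    · refine (IsClosed.measurableSet ?_).nullMeasurableSet
      exact isClosed_Icc.inter
        (isClosed_le ((hf.sub continuous_const).abs) continuous_const)
    · exact one_div_le_one_div_of_le (by positivity) (by simpa using hkl)
    · refine ne_top_of_le_ne_top (b := volume (Icc (0 : ℝ) 1)) (by simp) ?_
      exact measure_mono fun t ht => ht.1
  have hinter : (⋂ k : ℕ, {t | t ∈ Icc (0 : ℝ) 1 ∧ |f t - y₀| ≤ 1 / ((k : ℝ) + 1)}) ⊆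
      {t | t ∈ Icc (0 : ℝ) 1 ∧ f t = y₀} := by
    intro t ht
    rw [mem_iInter] at ht
    refine ⟨(ht 0).1, ?_⟩
    have := ge_of_tendsto' (tendsto_one_div_add_atTop_nhds_zero_nat (𝕜 := ℝ)) fun k => (ht k).2
    exact sub_eq_zero.1 (abs_nonpos_iff.1 this)
  rw [measure_mono_null hinter (hnull y₀)] at hA
  obtain ⟨k, hk⟩ := (hA.eventually (gt_mem_nhds hε)).exists
  have hk0 : (0 : ℝ) < 1 / ((k : ℝ) + 1) / 2 := by positivity
  have h5 : Tendsto (fun n : ℕ => 1 / ((u n : ℝ) + 1)) atTop (𝓝 0) :=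
    (tendsto_one_div_add_atTop_nhds_zero_nat (𝕜 := ℝ)).comp hu.tendsto_atTop
  obtain ⟨n, hn1, hn2⟩ := ((h5.eventually (gt_mem_nhds hk0)).and
    (hlim.eventually (Metric.ball_mem_nhds y₀ hk0))).exists
  suffices hsub : {t | t ∈ Icc (0 : ℝ) 1 ∧ |f t - y (u n)| ≤ 1 / ((u n : ℝ) + 1)} ⊆
      {t | t ∈ Icc (0 : ℝ) 1 ∧ |f t - y₀| ≤ 1 / ((k : ℝ) + 1)} by
    exact absurd (hy (u n)) (not_lt.2 ((measure_mono hsub).trans hk.le))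
  rintro t ⟨ht, h8⟩
  refine ⟨ht, ?_⟩
  have h6 : |y (u n) - y₀| < 1 / ((k : ℝ) + 1) / 2 := by rw [← Real.dist_eq]; exact hn2
  have h7 := abs_sub_le (f t) (y (u n)) y₀
  linarith

/-! ### Curve families -/

/-- The data that do not depend on `α`: the parameters of the skew product, the derivatives `g i` of
the lift of `φ`, and constants of expansion along the critical orbit, of domination and of
invariance of `[-β, β]`. -/
structure SkewData where
  (a p β Φ A ρ κ l σ C d₀ Cd R η₀ : ℝ)
  (d r₀ q : ℕ)
  g : ℕ → ℝ → ℝ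
  pre : PreperiodicParam a p
  crit : CritConst a κ l σ C d₀
  mult : Multipliers (fun n => -2 * qorb a a n) κ l Cd R r₀ q
  two_le_d : 2 ≤ d
  R_lt : R < d
  tower : AnalyticTower g A ρ
  per : ∀ i, Function.Periodic (g i) 1
  nonconst : ∃ s t, g 0 s ≠ g 0 t
  Φ_pos : 0 < Φ
  g_le : ∀ t, |g 0 t| ≤ Φ
  β_pos : 0 < β
  β_lt : β < p
  η₀_pos : 0 < η₀
  inv : ∀ x y, |x| ≤ β → |y - (a - x ^ 2)| ≤ η₀ → |y| ≤ β
  dom : ∀ x : ℕ → ℝ, (∀ i, |x i| ≤ β) → (∀ i, |x (i + 1) - (a - x i ^ 2)| ≤ η₀) →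
    ∀ n, growth x n ≤ Cd * R ^ n

/-- A sequence of functions of `θ` that obeys the recursion of the skew product and whose
restrictions to cylinders are images of horizontal curves: on every cylinder of rank `i`, rescaled
to `[0, 1]`, the function `x i` is `Kα`-Lipschitz and has small sublevel sets at scale `α`. -/
structure CurveFamily (D : SkewData) (α K S γ : ℝ) (x : ℕ → ℝ → ℝ) : Prop where
  bound : ∀ i θ, |x i θ| ≤ D.β
  step : ∀ i θ, x (i + 1) θ = D.a - x i θ ^ 2 + α * D.g 0 ((D.d : ℝ) ^ i * θ)
  lip : ∀ i (k : ℕ) τ τ', |x i ((k + τ) / (D.d : ℝ) ^ i) - x i ((k + τ') / (D.d : ℝ) ^ i)| ≤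
    K * α * |τ - τ'|
  sub : ∀ i (k : ℕ) ε, 0 < ε → ε ≤ 1 →
    volume {τ | τ ∈ Icc (0 : ℝ) 1 ∧ |x i ((k + τ) / (D.d : ℝ) ^ i)| ≤ α * ε} ≤
      ENNReal.ofReal (S * ε ^ γ)

namespace SkewData

variable (D : SkewData)

lemma d_pos : (0 : ℝ) < D.d := by
  have := D.two_le_d
  exact_mod_cast (by lia : 0 < D.d)

lemma one_lt_d : (1 : ℝ) < D.d := by
  have := D.two_le_d
  exact_mod_cast (by lia : 1 < D.d)

/-- Along an image curve the values form a pseudo-orbit in `[-β, β]`. -/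
lemma abs_curveDeriv_le {α x₀ : ℝ} (hα : 0 ≤ α) (hαη : α * D.Φ ≤ D.η₀) (hx₀ : |x₀| ≤ D.β) (s : ℝ)
    (n : ℕ) : |curveDeriv D.g D.a D.d α x₀ n 0 s| ≤ D.β ∧
      |curveDeriv D.g D.a D.d α x₀ (n + 1) 0 s - (D.a - curveDeriv D.g D.a D.d α x₀ n 0 s ^ 2)| ≤
        D.η₀ := by
  have hstep : ∀ n, |curveDeriv D.g D.a D.d α x₀ (n + 1) 0 s -
      (D.a - curveDeriv D.g D.a D.d α x₀ n 0 s ^ 2)| ≤ D.η₀ := by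
    intro n
    simp only [curveDeriv, Finset.Nat.antidiagonal_zero, Finset.sum_singleton, pow_zero, one_mul,
      if_true, Nat.choose_self, Nat.cast_one]
    rw [show D.a - curveDeriv D.g D.a D.d α x₀ n 0 s * curveDeriv D.g D.a D.d α x₀ n 0 s +
      α * D.g 0 ((D.d : ℝ) ^ n * s) - (D.a - curveDeriv D.g D.a D.d α x₀ n 0 s ^ 2) =
      α * D.g 0 ((D.d : ℝ) ^ n * s) by ring, abs_mul, abs_of_nonneg hα]
    exact (mul_le_mul_of_nonneg_left (D.g_le _) hα).trans hαη
  refine ⟨?_, hstep n⟩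
  induction n with
  | zero => simpa [curveDeriv] using hx₀
  | succ n ih => exact D.inv _ _ ih (hstep n)

/-- Domination along image curves. -/
lemma abs_prod_curveDeriv_le {α x₀ : ℝ} (hα : 0 ≤ α) (hαη : α * D.Φ ≤ D.η₀) (hx₀ : |x₀| ≤ D.β)
    (s : ℝ) (n k : ℕ) (hk : k ≤ n) :
    |∏ l ∈ Finset.Ico (n - k) n, (-2 * curveDeriv D.g D.a D.d α x₀ l 0 s)| ≤ D.Cd * D.R ^ k := by
  have h := D.abs_curveDeriv_le hα hαη hx₀ s
  have h1 := D.dom (fun i => curveDeriv D.g D.a D.d α x₀ (n - k + i) 0 s) (fun i => (h _).1)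
    (fun i => (h _).2) k
  refine le_trans (le_of_eq ?_) h1
  rw [Finset.abs_prod, Finset.prod_Ico_eq_prod_range, show n - (n - k) = k by lia, growth]
  exact Finset.prod_congr rfl fun l _ => by rw [neg_mul, abs_neg]

/-- Images of horizontal curves form curve families, with constants independent of `α`. -/
lemma exists_curveFamily : ∃ K S γ α₁ : ℝ, 0 < K ∧ 0 < S ∧ 0 < γ ∧ 0 < α₁ ∧
    ∀ α, 0 < α → α ≤ α₁ → ∀ x₀, |x₀| ≤ D.β → ∀ n, 1 ≤ n → ∀ j : ℕ,
      CurveFamily D α K S γ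
        (fun i θ => curveDeriv D.g D.a D.d α x₀ (n + i) 0 ((θ + j) / (D.d : ℝ) ^ n)) := by
  have hd0 := D.d_pos
  obtain ⟨m, c, hc, hnf⟩ := exists_nonflat D.tower D.per D.nonconst D.two_le_d D.mult.C_nonneg
    D.mult.R_nonneg D.R_lt
  choose! K hK0 hK using fun i (hi : 1 ≤ i) => exists_curveDeriv_approx D.tower D.per D.two_le_d
    D.mult.C_nonneg D.mult.R_nonneg D.R_lt i hi
  set K' := 1 + ∑ i ∈ Finset.Icc 1 (m + 1), K i with hK'
  have hKle : ∀ i, 1 ≤ i → i ≤ m + 1 → K i ≤ K' := fun i h1 h2 => by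
    have := Finset.single_le_sum (f := K) (fun i hi => hK0 i (Finset.mem_Icc.1 hi).1)
      (Finset.mem_Icc.2 ⟨h1, h2⟩)
    rw [hK']; linarith
  have hK'0 : 0 < K' := by
    have := Finset.sum_nonneg (s := Finset.Icc 1 (m + 1)) (f := K)
      (fun i hi => hK0 i (Finset.mem_Icc.1 hi).1)
    rw [hK']; linarith
  obtain ⟨S, hS, hsub⟩ := exists_sublevel_estimate (m := m) (half_pos hc) hK'0.le
  -- Non-flatness of any datum provides an order between `1` and `m`, so `m ≠ 0` and the exponent `1
  -- / m` is positive.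
  have hm : 1 ≤ m := by
    have hmem : ((fun k => if k = 0 then 1 else 0, fun _ => 0) : (ℕ → ℝ) × (ℕ → ℝ)) ∈
        branchData (max D.Cd 1) D.R := by
      refine mem_branchData.2 ⟨fun k => ?_, fun k => by norm_num, by simp⟩
      rcases Nat.eq_zero_or_pos k with rfl | hk
      · simp
      · have h1 := D.mult.R_nonneg
        have h2 : 0 ≤ max D.Cd 1 := le_max_of_le_right zero_le_one
        simp only [show k ≠ 0 by lia, if_false, abs_zero]
        positivity
    by_contra hm0
    have hx : |(0 : ℝ)| ≤ D.β := by rw [abs_zero]; exact D.β_pos.le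
    have := D.abs_prod_curveDeriv_le (α := 0) le_rfl (by rw [zero_mul]; exact D.η₀_pos.le) hx 0 1
    obtain ⟨i, h1, h2, -⟩ := hnf _ (curveData_mem (d := D.d) le_rfl D.mult.C_nonneg D.mult.R_nonneg
      this 0)
    lia
  refine ⟨K', S, 1 / m, min 1 (min (D.η₀ / D.Φ) (c / 2 / K')), hK'0, hS, by positivity,
    lt_min one_pos (lt_min (div_pos D.η₀_pos D.Φ_pos) (by positivity)), ?_⟩
  intro α hα hα1 x₀ hx₀ n hn j
  have hα2 : α ≤ 1 := hα1.trans (min_le_left _ _)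
  have hαη : α * D.Φ ≤ D.η₀ := by
    rw [← le_div_iff₀ D.Φ_pos]
    exact hα1.trans ((min_le_right _ _).trans (min_le_left _ _))
  have hαK : α * K' ≤ c / 2 := by
    rw [← le_div_iff₀ hK'0]
    exact hα1.trans ((min_le_right _ _).trans (min_le_right _ _))
  have hbd := fun s => D.abs_curveDeriv_le hα.le hαη hx₀ s
  have happrox := fun i (hi : 1 ≤ i) s N hN => hK i hi D.a α x₀ s hα.le hα2
    (fun n k hk => D.abs_prod_curveDeriv_le hα.le hαη hx₀ s n k hk) N hN
  -- the rescaled curves over cylinders, divided by `α`, and their derivatives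
  set f : ℕ → ℕ → ℕ → ℝ → ℝ := fun i k r τ => α⁻¹ * ((1 / (D.d : ℝ) ^ (n + i)) ^ r *
    curveDeriv D.g D.a D.d α x₀ (n + i) r
      (1 / (D.d : ℝ) ^ (n + i) * τ + (k + j * (D.d : ℝ) ^ i) / (D.d : ℝ) ^ (n + i))) with hf
  have hf0 : ∀ (i k : ℕ) (τ : ℝ), curveDeriv D.g D.a D.d α x₀ (n + i) 0
      (((k + τ) / (D.d : ℝ) ^ i + j) / (D.d : ℝ) ^ n) = α * f i k 0 τ := by
    intro i k τ
    simp only [hf]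
    rw [pow_zero, one_mul, mul_inv_cancel_left₀ hα.ne']
    congr 1
    rw [pow_add]; field_simp; ring
  have hfd : ∀ (i k r : ℕ) (τ : ℝ), HasDerivAt (f i k r) (f i k (r + 1) τ) τ := by
    intro i k r τ
    have h1 : HasDerivAt (fun τ => 1 / (D.d : ℝ) ^ (n + i) * τ +
        (k + j * (D.d : ℝ) ^ i) / (D.d : ℝ) ^ (n + i)) (1 / (D.d : ℝ) ^ (n + i)) τ := by
      simpa using ((hasDerivAt_id' τ).const_mul (1 / (D.d : ℝ) ^ (n + i))).add_const
        ((k + j * (D.d : ℝ) ^ i) / (D.d : ℝ) ^ (n + i))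
    refine ((((hasDerivAt_curveDeriv D.tower (n + i) r _).comp τ h1).const_mul
      ((1 / (D.d : ℝ) ^ (n + i)) ^ r)).const_mul α⁻¹).congr_deriv ?_
    simp only [hf]
    ring
  have hcancel : ∀ i r : ℕ, (1 / (D.d : ℝ) ^ (n + i)) ^ r * ((D.d : ℝ) ^ (n + i)) ^ r = 1 := by
    intro i r
    rw [← mul_pow, one_div_mul_cancel (by positivity), one_pow]
  have hfK : ∀ i k r : ℕ, 1 ≤ r → r ≤ m + 1 → ∀ τ : ℝ, |f i k r τ| ≤ K' := by
    intro i k r h1 h2 τ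
    have h3 := (happrox r h1 (1 / (D.d : ℝ) ^ (n + i) * τ +
      (k + j * (D.d : ℝ) ^ i) / (D.d : ℝ) ^ (n + i)) (n + i) (by lia)).2
    simp only [hf]
    rw [abs_mul, abs_mul, abs_of_pos (inv_pos.2 hα), abs_of_nonneg (by positivity)]
    calc _ ≤ α⁻¹ * ((1 / (D.d : ℝ) ^ (n + i)) ^ r * (α * ((D.d : ℝ) ^ (n + i)) ^ r * K r)) := by
          gcongr
      _ = (α⁻¹ * α) * ((1 / (D.d : ℝ) ^ (n + i)) ^ r * ((D.d : ℝ) ^ (n + i)) ^ r) * K r := by ring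
      _ = K r := by rw [hcancel, inv_mul_cancel₀ hα.ne']; ring
      _ ≤ K' := hKle r h1 h2
  -- The rescaled curve differs from its limit curve by at most `α K`, so it inherits half of the
  -- lower bound `c` on the derivatives of the limit.
  have hfc : ∀ (i k : ℕ) (τ : ℝ), ∃ r, 1 ≤ r ∧ r ≤ m ∧ c / 2 ≤ |f i k r τ| := by
    intro i k τ
    set s := 1 / (D.d : ℝ) ^ (n + i) * τ + (k + j * (D.d : ℝ) ^ i) / (D.d : ℝ) ^ (n + i) with hs
    have hmem := curveData_mem (d := D.d) (show 1 ≤ n + i by lia) D.mult.C_nonneg D.mult.R_nonneg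
      (D.abs_prod_curveDeriv_le hα.le hαη hx₀ s (n + i)) s
    obtain ⟨r, h1, h2, h3⟩ := hnf _ hmem
    refine ⟨r, h1, h2, ?_⟩
    have h4 := (happrox r h1 s (n + i) (by lia)).1
    set G := branchSeries D.g D.d
      (curveData D.d (fun l => curveDeriv D.g D.a D.d α x₀ l 0 s) (n + i) s) r 0 with hG
    have h5 : |f i k r τ - G| ≤ α * K r := by
      have e : f i k r τ - G = α⁻¹ * (1 / (D.d : ℝ) ^ (n + i)) ^ r *
          (curveDeriv D.g D.a D.d α x₀ (n + i) r s - α * ((D.d : ℝ) ^ (n + i)) ^ r * G) := by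
        have e1 : α⁻¹ * (1 / (D.d : ℝ) ^ (n + i)) ^ r * (α * ((D.d : ℝ) ^ (n + i)) ^ r * G) =
            (α⁻¹ * α) * ((1 / (D.d : ℝ) ^ (n + i)) ^ r * ((D.d : ℝ) ^ (n + i)) ^ r) * G := by ring
        rw [hcancel, inv_mul_cancel₀ hα.ne'] at e1
        rw [mul_sub, e1]
        simp only [hf, ← hs]
        ring
      rw [e, abs_mul, abs_of_nonneg (by positivity)]
      calc _ ≤ α⁻¹ * (1 / (D.d : ℝ) ^ (n + i)) ^ r * (α * α * ((D.d : ℝ) ^ (n + i)) ^ r * K r) := by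
            gcongr
        _ = (α⁻¹ * α) * ((1 / (D.d : ℝ) ^ (n + i)) ^ r * ((D.d : ℝ) ^ (n + i)) ^ r) * (α * K r) := by
            ring
        _ = α * K r := by rw [hcancel, inv_mul_cancel₀ hα.ne']; ring
    have h6 := abs_sub_abs_le_abs_sub G (f i k r τ)
    rw [abs_sub_comm] at h6
    have h7 : α * K r ≤ α * K' := mul_le_mul_of_nonneg_left (hKle r h1 (by lia)) hα.le
    linarith
  refine ⟨fun i θ => (hbd _ _).1, fun i θ => ?_, fun i k τ τ' => ?_, fun i k ε hε hε1 => ?_⟩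
  · rw [← add_assoc]
    simp only [curveDeriv, Finset.Nat.antidiagonal_zero, Finset.sum_singleton, pow_zero, one_mul,
      if_true, Nat.choose_self, Nat.cast_one]
    have e1 : (D.d : ℝ) ^ (n + i) * ((θ + j) / (D.d : ℝ) ^ n) =
        (D.d : ℝ) ^ i * θ + ((D.d ^ i * j : ℕ) : ℝ) * 1 := by
      rw [pow_add]; push_cast; field_simp
    rw [e1, (D.per 0).nat_mul]
    ring
  · rw [hf0, hf0, ← mul_sub, abs_mul, abs_of_pos hα]
    have h1 := (convex_univ).norm_image_sub_le_of_norm_hasDerivWithin_le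
      (f := f i k 0) (f' := f i k 1) (C := K') (x := τ') (y := τ)
      (fun x _ => (hfd i k 0 x).hasDerivWithinAt) (fun x _ => hfK i k 1 le_rfl (by lia) x)
      (mem_univ _) (mem_univ _)
    rw [Real.norm_eq_abs, Real.norm_eq_abs] at h1
    calc _ ≤ α * (K' * |τ - τ'|) := mul_le_mul_of_nonneg_left h1 hα.le
      _ = _ := by ring
  · refine le_trans (measure_mono ?_) (hsub (f i k) (hfd i k) (hfK i k) (hfc i k) ε hε hε1)
    intro τ hτ
    have h1 := hτ.2
    simp only [hf0] at h1
    rw [abs_mul, abs_of_pos hα] at h1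
    exact ⟨hτ.1, le_of_mul_le_mul_left h1 hα⟩

end SkewData

/-! ### Comparison of orbits after a passage -/

/-- The quotients `∏ (mᵢ / cᵢ)` of midpoints of two orbits that shadow the orbit of the critical
value are close to `1`. -/
lemma CritConst.midpoint_prod {a p κ l σ C d₀ η S : ℝ} {y y' : ℕ → ℝ}
    (H : CritConst a κ l σ C d₀) (hy : PseudoOrbit a p η y) (hy' : PseudoOrbit a p η y')
    (hS : |y 0 - a| + η * C ≤ S) (hS' : |y' 0 - a| + η * C ≤ S) {n : ℕ}
    (hn : growth (qorb a a) n * S ≤ d₀) {j : ℕ} (hj : j ≤ n) :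
    growth (qorb a a) j / 2 ≤ |∏ i ∈ Finset.range j, -(y i + y' i)| ∧
      |1 / (∏ i ∈ Finset.range j, -(y i + y' i)) -
        1 / ∏ i ∈ Finset.range j, (-2 * qorb a a i)| ≤ 8 * C * S / σ := by
  have hσ := H.σ_pos
  have hC := H.C_pos
  have hc : ∀ i, qorb a a i ≠ 0 := fun i => abs_pos.1 (hσ.trans_le (H.σ_le i))
  set e : ℕ → ℝ := fun i => ((y i + y' i) / 2 - qorb a a i) / qorb a a i with he
  have hP : ∏ i ∈ Finset.range j, -(y i + y' i) =
      (∏ i ∈ Finset.range j, (-2 * qorb a a i)) * ∏ i ∈ Finset.range j, (1 + e i) := by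
    rw [← Finset.prod_mul_distrib]
    refine Finset.prod_congr rfl fun i _ => ?_
    have := hc i
    simp only [he]; field_simp; ring
  have hΛ : |∏ i ∈ Finset.range j, (-2 * qorb a a i)| = growth (qorb a a) j := by
    rw [Finset.abs_prod, growth]
    exact Finset.prod_congr rfl fun i _ => by rw [neg_mul, abs_neg]
  have hΛ0 := H.pos j
  have he_le : ∀ i, |e i| ≤ (|y i - qorb a a i| + |y' i - qorb a a i|) / (2 * σ) := by
    intro i
    simp only [he]
    rw [abs_div, div_le_div_iff₀ (hσ.trans_le (H.σ_le i)) (by positivity)]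
    have h1 : |(y i + y' i) / 2 - qorb a a i| ≤ (|y i - qorb a a i| + |y' i - qorb a a i|) / 2 := by
      rw [show (y i + y' i) / 2 - qorb a a i =
        ((y i - qorb a a i) + (y' i - qorb a a i)) / 2 by ring, abs_div, abs_two]
      gcongr
      exact abs_add_le _ _
    have h2 := H.σ_le i
    have h3 := abs_nonneg (y i - qorb a a i)
    have h4 := abs_nonneg (y' i - qorb a a i)
    nlinarith
  have hsum : ∑ i ∈ Finset.range j, |e i| ≤
      (∑ i ∈ Finset.range j, |y i - qorb a a i| + ∑ i ∈ Finset.range j, |y' i - qorb a a i|) /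
        (2 * σ) := by
    rw [← Finset.sum_add_distrib, Finset.sum_div]
    exact Finset.sum_le_sum fun i _ => he_le i
  set E := ∑ i ∈ Finset.range j, |e i| with hE
  have hE0 : 0 ≤ E := Finset.sum_nonneg fun i _ => abs_nonneg _
  have hE1 : E ≤ 1 / 4 := by
    refine hsum.trans ?_
    rw [div_le_iff₀ (by positivity)]
    linarith [H.shadow_sum_le hy hS hn hj, H.shadow_sum_le hy' hS' hn hj]
  have hE2 : E ≤ 2 * C * growth (qorb a a) j * S / σ := by
    refine hsum.trans ?_
    rw [div_le_div_iff₀ (by positivity) hσ]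
    nlinarith [(H.shadow hy hS hn hj).2, (H.shadow hy' hS' hn hj).2]
  set ratio := ∏ i ∈ Finset.range j, (1 + e i) with hr
  have hr1 : |ratio - 1| ≤ 2 * E := by
    have h1 := Finset.norm_prod_one_add_sub_one_le (Finset.range j) e
    simp only [Real.norm_eq_abs] at h1
    have h2 := Real.abs_exp_sub_one_le (x := E) (by rw [abs_of_nonneg hE0]; linarith)
    rw [abs_of_nonneg hE0] at h2
    exact h1.trans ((le_abs_self _).trans h2)
  have hr2 : 1 / 2 ≤ ratio := by
    have := (abs_le.1 hr1).1
    linarith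
  have hr0 : 0 < ratio := by linarith
  refine ⟨?_, ?_⟩
  · rw [hP, abs_mul, hΛ, abs_of_pos hr0]
    nlinarith
  · set P := ∏ i ∈ Finset.range j, (-2 * qorb a a i) with hPdef
    have hP0 : P ≠ 0 := abs_pos.1 (hΛ ▸ hΛ0)
    have e1 : 1 / (∏ i ∈ Finset.range j, -(y i + y' i)) - 1 / P = (1 - ratio) / (P * ratio) := by
      rw [hP]; field_simp
    rw [e1, abs_div, abs_mul, hΛ, abs_of_pos hr0, abs_sub_comm,
      div_le_div_iff₀ (by positivity) hσ]
    have h3 : E * σ ≤ 2 * C * growth (qorb a a) j * S := by rwa [le_div_iff₀ hσ] at hE2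
    have h0 : 0 ≤ 2 * C * growth (qorb a a) j * S := (by positivity : 0 ≤ E * σ).trans h3
    calc |ratio - 1| * σ ≤ 2 * E * σ := by gcongr
      _ ≤ 2 * (2 * C * growth (qorb a a) j * S) := by linarith
      _ ≤ 8 * C * S * (growth (qorb a a) j * ratio) := by nlinarith

/-- Two orbits of the skew product that shadow the orbit of the critical value, compared at the end
of the shadowing: their distance controls the partial sum of the cocycle series. -/
lemma CritConst.sum_le_of_shadow {a p κ l σ C d₀ η S α Φ s : ℝ} {y y' b : ℕ → ℝ}
    (H : CritConst a κ l σ C d₀) (hy : PseudoOrbit a p η y) (hy' : PseudoOrbit a p η y')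
    (hS : |y 0 - a| + η * C ≤ S) (hS' : |y' 0 - a| + η * C ≤ S) (hS0 : 0 < S) {n : ℕ}
    (hn : growth (qorb a a) n * S ≤ d₀) (hn' : d₀ < 4 * (growth (qorb a a) n * S)) (hα : 0 < α)
    (hb : ∀ i, |b i| ≤ Φ)
    (hstep : ∀ i, y (i + 1) - y' (i + 1) = -(y i + y' i) * (y i - y' i) + α * b (i + 1))
    (h0 : |y 0 - y' 0 - α * b 0| ≤ s) :
    |∑ i ∈ Finset.range (n + 1), b i / ∏ j ∈ Finset.range i, (-2 * qorb a a j)| ≤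
      8 * (S / α) * |y n - y' n| / d₀ + s / α + (n + 1) * (8 * Φ * C * S / σ) := by
  have hd₀ := H.d₀_pos
  have hσ := H.σ_pos
  have hC := H.C_pos
  set Q : ℕ → ℝ := fun j => ∏ i ∈ Finset.range j, -(y i + y' i) with hQ
  have hQ1 : ∀ j ≤ n, growth (qorb a a) j / 2 ≤ |Q j| := fun j hj =>
    (H.midpoint_prod hy hy' hS hS' hn hj).1
  have hQ0 : ∀ j ≤ n, Q j ≠ 0 := fun j hj =>
    abs_pos.1 ((half_pos (H.pos j)).trans_le (hQ1 j hj))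
  -- The product `Q j` of the midpoint multipliers is the exact factor by which the difference of
  -- the orbits grows, apart from the forcing `α b`.
  have hrec : ∀ j ≤ n, (y j - y' j) / Q j =
      (y 0 - y' 0 - α * b 0) + α * ∑ i ∈ Finset.range (j + 1), b i / Q i := by
    intro j
    induction j with
    | zero => intro _; simp [hQ]
    | succ j ih =>
      intro hj
      have hs : Q (j + 1) = Q j * -(y j + y' j) := Finset.prod_range_succ _ _
      have h1 := hQ0 (j + 1) hj
      have h2 := hQ0 j (by lia)
      have h3 : y j + y' j ≠ 0 := by
        intro h3; apply h1; rw [hs, h3]; simp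
      rw [Finset.sum_range_succ, mul_add, ← add_assoc, ← ih (by lia), hstep]
      have e1 : -(y j + y' j) * (y j - y' j) / Q (j + 1) = (y j - y' j) / Q j := by
        rw [hs]; field_simp
      rw [add_div, e1, mul_div_assoc]
  have hmain : |∑ i ∈ Finset.range (n + 1), b i / Q i| ≤ 8 * (S / α) * |y n - y' n| / d₀ + s / α := by
    have h1 := hrec n le_rfl
    have h2 : α * ∑ i ∈ Finset.range (n + 1), b i / Q i =
        (y n - y' n) / Q n - (y 0 - y' 0 - α * b 0) := by rw [h1]; ring
    have h3 : |(y n - y' n) / Q n| ≤ 8 * S * |y n - y' n| / d₀ := by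
      have hq := hQ1 n le_rfl
      have hq0 := abs_pos.2 (hQ0 n le_rfl)
      rw [abs_div, div_le_div_iff₀ hq0 hd₀]
      have : d₀ ≤ 8 * S * |Q n| := by nlinarith
      have h5 := abs_nonneg (y n - y' n)
      nlinarith
    have h4 : α * |∑ i ∈ Finset.range (n + 1), b i / Q i| ≤ 8 * S * |y n - y' n| / d₀ + s := by
      have h5 := abs_mul α (∑ i ∈ Finset.range (n + 1), b i / Q i)
      rw [abs_of_pos hα] at h5
      rw [← h5, h2]
      exact (abs_sub _ _).trans (add_le_add h3 h0)
    rw [← le_div_iff₀' hα] at h4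
    refine h4.trans (le_of_eq ?_)
    field_simp
  have hdiff : |∑ i ∈ Finset.range (n + 1), b i / ∏ j ∈ Finset.range i, (-2 * qorb a a j) -
      ∑ i ∈ Finset.range (n + 1), b i / Q i| ≤ (n + 1) * (8 * Φ * C * S / σ) := by
    rw [← Finset.sum_sub_distrib]
    refine (Finset.abs_sum_le_sum_abs _ _).trans ?_
    refine (Finset.sum_le_card_nsmul _ _ (8 * Φ * C * S / σ) fun i hi => ?_).trans (le_of_eq ?_)
    · have h1 := (H.midpoint_prod hy hy' hS hS' hn (Nat.lt_succ_iff.1 (Finset.mem_range.1 hi))).2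
      rw [div_eq_mul_one_div, div_eq_mul_one_div (b i), ← mul_sub, abs_mul, abs_sub_comm]
      calc _ ≤ Φ * (8 * C * S / σ) :=
            mul_le_mul (hb i) h1 (abs_nonneg _) ((abs_nonneg _).trans (hb 0))
        _ = _ := by ring
    · rw [Finset.card_range, nsmul_eq_mul]; push_cast; ring
  have := abs_le.1 hdiff
  have := abs_le.1 hmain
  rw [abs_le]
  constructor <;> linarith

namespace SkewData

variable (D : SkewData)

/-- The threshold at scale `√α` that separates free iterates from returns to the critical region. -/
noncomputable def threshold (α : ℝ) : ℝ := √((1 + D.C) * D.Φ * α)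

/-- Twice the threshold, squared, plus the accumulated perturbation, is `G α`. -/
noncomputable def G : ℝ := 5 * (1 + D.C) * D.Φ

/-- `n` is the time for which an orbit that starts at distance at most twice the threshold from `0`
shadows the orbit of the critical value. -/
def IsBindingTime (α : ℝ) (n : ℕ) : Prop :=
  growth (qorb D.a D.a) n * (D.G * α) ≤ D.d₀ ∧ D.d₀ < 4 * (growth (qorb D.a D.a) n * (D.G * α))

lemma G_pos : 0 < D.G := by
  have := D.crit.C_pos
  have := D.Φ_pos
  unfold G; positivity

lemma exists_isBindingTime : ∀ᶠ α in 𝓝[>] (0 : ℝ), ∃ n, D.IsBindingTime α n := by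
  have hd := D.crit.d₀_pos
  have hG := D.G_pos
  filter_upwards [self_mem_nhdsWithin, Ioo_mem_nhdsGT (div_pos hd hG)] with α h0 h1
  exact D.crit.exists_binding_time D.pre (mul_pos hG h0)
    (by rw [← le_div_iff₀' hG]; exact h1.2.le)

lemma threshold_nonneg (α : ℝ) : 0 ≤ D.threshold α := Real.sqrt_nonneg _

lemma sq_threshold {α : ℝ} (hα : 0 ≤ α) : D.threshold α ^ 2 = (1 + D.C) * D.Φ * α := by
  have := D.crit.C_pos
  have := D.Φ_pos
  exact Real.sq_sqrt (by positivity)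

lemma tendsto_threshold : Tendsto D.threshold (𝓝[>] 0) (𝓝 0) := by
  have h : Continuous D.threshold := by unfold threshold; fun_prop
  have h0 : D.threshold 0 = 0 := by simp [threshold]
  exact (h0 ▸ h.tendsto 0).mono_left nhdsWithin_le_nhds

/-- All the cocycle series along the critical orbit are bounded by a common constant. -/
lemma abs_cocycleSeries_le : ∃ B, 0 ≤ B ∧ ∀ r θ,
    |cocycleSeries (D.g 0) D.d (fun n => -2 * qorb D.a D.a n) r θ| ≤ B := by
  refine ⟨∑' k : ℕ, D.Φ / D.κ * (1 / D.l) ^ k, tsum_nonneg fun k => ?_, fun r θ => ?_⟩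
  · have := D.crit.κ_pos
    have := D.Φ_pos
    have := D.crit.one_lt_l
    positivity
  · exact tsum_of_norm_bounded (D.mult.summable_geometric (D.Φ / D.κ)).hasSum
      fun k => D.mult.term_le D.g_le r k θ

/-- A bound for the growth of the binding time: it is of order `log (1 / α)`. -/
lemma exists_bindingTime_mul_le : ∃ B, 0 ≤ B ∧ ∀ α, 0 < α → ∀ n, D.IsBindingTime α n →
    (n + 1) * α ≤ B * √α := by
  have hl := D.crit.one_lt_l
  have hG := D.G_pos
  have hκ := D.crit.κ_pos
  have hd := D.crit.d₀_pos
  have h1 : Tendsto (fun n : ℕ => (n : ℝ) ^ 2 / D.l ^ n) atTop (𝓝 0) :=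
    tendsto_pow_const_div_const_pow_of_one_lt 2 hl
  obtain ⟨M, hM⟩ := h1.bddAbove_range
  have hM' : ∀ n : ℕ, (n : ℝ) ^ 2 ≤ M * D.l ^ n := fun n => by
    have := hM (mem_range_self n)
    rwa [div_le_iff₀ (by positivity)] at this
  have hM0 : 0 ≤ M := by simpa using hM' 0
  -- As `lⁿ α` is bounded and `n² / lⁿ` is bounded, so is `n² α`.
  refine ⟨√(M * D.l * (D.d₀ / (D.κ * D.G))), Real.sqrt_nonneg _, fun α hα n hn => ?_⟩
  rw [← Real.sqrt_mul (by positivity)]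
  refine Real.le_sqrt_of_sq_le ?_
  have h2 := hM' (n + 1)
  have h3 : D.κ * D.l ^ n * (D.G * α) ≤ D.d₀ :=
    (mul_le_mul_of_nonneg_right (D.crit.κ_mul_pow_le n) (by positivity)).trans hn.1
  have h4 : D.l ^ n * α ≤ D.d₀ / (D.κ * D.G) := by
    rw [le_div_iff₀ (by positivity)]; linarith
  push_cast at h2
  calc ((n + 1) * α) ^ 2 = (n + 1 : ℝ) ^ 2 * α * α := by ring
    _ ≤ M * D.l ^ (n + 1) * α * α := by gcongr
    _ = M * D.l * (D.l ^ n * α) * α := by ring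
    _ ≤ M * D.l * (D.d₀ / (D.κ * D.G)) * α := by gcongr

/-- After the binding time, the position of an orbit that passed near the critical point determines
the value of the cocycle series at its base point up to a small error. -/
lemma exists_cocycleSeries_dist_le {K : ℝ} (hK : 0 ≤ K) : ∃ C₁, 0 < C₁ ∧ ∀ α, 0 < α → ∀ n,
    D.IsBindingTime α n → ∀ (u u' : ℕ → ℝ) (τ τ' : ℝ),
    (∀ i, |u i| ≤ D.β) → (∀ i, |u' i| ≤ D.β) →
    (∀ i, u (i + 1) = D.a - u i ^ 2 + α * D.g 0 ((D.d : ℝ) ^ i * τ)) →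
    (∀ i, u' (i + 1) = D.a - u' i ^ 2 + α * D.g 0 ((D.d : ℝ) ^ i * τ')) →
    |u 0| ≤ 2 * D.threshold α → |u' 0| ≤ 2 * D.threshold α → |u 0 - u' 0| ≤ K * α →
    |cocycleSeries (D.g 0) D.d (fun n => -2 * qorb D.a D.a n) 0 τ -
      cocycleSeries (D.g 0) D.d (fun n => -2 * qorb D.a D.a n) 0 τ'| ≤
      C₁ * (|u (n + 1) - u' (n + 1)| + √α) := by
  have hG := D.G_pos
  have hσ := D.crit.σ_pos
  have hd := D.crit.d₀_pos
  have hC := D.crit.C_pos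
  have hΦ := D.Φ_pos
  obtain ⟨B, hB0, hB⟩ := D.abs_cocycleSeries_le
  obtain ⟨B', hB'0, hB'⟩ := D.exists_bindingTime_mul_le
  set T := √((1 + D.C) * D.Φ) with hT
  have hT0 : 0 ≤ T := Real.sqrt_nonneg _
  set M₁ := 8 * D.G / D.d₀ with hM₁
  set M₂ := 4 * T * K + B' * (16 * D.Φ * D.C * D.G / D.σ) with hM₂
  set M₃ := B' * (4 * B * D.G / (D.σ * D.d₀)) with hM₃
  have hM₁0 : 0 < M₁ := by positivity
  have hM₂0 : 0 ≤ M₂ := by positivity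
  have hM₃0 : 0 ≤ M₃ := by positivity
  refine ⟨M₁ + M₂ + M₃, by positivity, ?_⟩
  intro α hα n hn u u' τ τ' hu hu' hs hs' h0 h0' hd0
  have hthr : D.threshold α = T * √α := by
    rw [threshold, hT, ← Real.sqrt_mul (by positivity)]
  have hpo : ∀ {u : ℕ → ℝ} {τ : ℝ}, (∀ i, |u i| ≤ D.β) →
      (∀ i, u (i + 1) = D.a - u i ^ 2 + α * D.g 0 ((D.d : ℝ) ^ i * τ)) →
      PseudoOrbit D.a D.p (α * D.Φ) u := by
    intro u τ hu hs
    refine ⟨fun i => (hu i).trans D.β_lt.le, fun i => ?_⟩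
    rw [hs i, add_sub_cancel_left, abs_mul, abs_of_pos hα]
    exact mul_le_mul_of_nonneg_left (D.g_le _) hα.le
  have hS : ∀ {u : ℕ → ℝ} {τ : ℝ}, (∀ i, |u i| ≤ D.β) →
      (∀ i, u (i + 1) = D.a - u i ^ 2 + α * D.g 0 ((D.d : ℝ) ^ i * τ)) →
      |u 0| ≤ 2 * D.threshold α → |u 1 - D.a| + α * D.Φ * D.C ≤ D.G * α := by
    intro u τ hu hs h0
    have h1 := hs 0
    rw [zero_add] at h1
    have h2 : |u 1 - D.a| ≤ u 0 ^ 2 + α * D.Φ := by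
      rw [h1, show D.a - u 0 ^ 2 + α * D.g 0 ((D.d : ℝ) ^ 0 * τ) - D.a =
        -(u 0 ^ 2) + α * D.g 0 ((D.d : ℝ) ^ 0 * τ) by ring]
      refine (abs_add_le _ _).trans ?_
      rw [abs_neg, abs_of_nonneg (sq_nonneg _), abs_mul, abs_of_pos hα]
      have := mul_le_mul_of_nonneg_left (D.g_le ((D.d : ℝ) ^ 0 * τ)) hα.le
      linarith
    have h3 : u 0 ^ 2 ≤ 4 * ((1 + D.C) * D.Φ * α) := by
      rw [← D.sq_threshold hα.le, ← sq_abs]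
      calc |u 0| ^ 2 ≤ (2 * D.threshold α) ^ 2 := by gcongr
        _ = _ := by ring
    unfold G
    linarith
  have hbb : ∀ i : ℕ, |D.g 0 ((D.d : ℝ) ^ i * τ) - D.g 0 ((D.d : ℝ) ^ i * τ')| ≤ 2 * D.Φ := by
    intro i
    have h1 := D.g_le ((D.d : ℝ) ^ i * τ)
    have h2 := D.g_le ((D.d : ℝ) ^ i * τ')
    exact (abs_sub _ _).trans (by linarith)
  have key := D.crit.sum_le_of_shadow (Φ := 2 * D.Φ)
    (y := fun i => u (1 + i)) (y' := fun i => u' (1 + i))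
    (b := fun i => D.g 0 ((D.d : ℝ) ^ i * τ) - D.g 0 ((D.d : ℝ) ^ i * τ')) (α := α)
    (s := 4 * D.threshold α * (K * α))
    ((hpo hu hs).shift 1) ((hpo hu' hs').shift 1) (hS hu hs h0) (hS hu' hs' h0')
    (mul_pos hG hα) hn.1 hn.2 hα
    hbb
    (fun i => by
      rw [← add_assoc, add_comm 1 i, hs (i + 1), hs' (i + 1)]; ring)
    (by
      have e : u (1 + 0) - u' (1 + 0) - α * (D.g 0 ((D.d : ℝ) ^ 0 * τ) -
          D.g 0 ((D.d : ℝ) ^ 0 * τ')) = -(u 0 + u' 0) * (u 0 - u' 0) := by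
        rw [add_zero, ← zero_add 1, hs 0, hs' 0]; ring
      rw [e, abs_mul, abs_neg]
      exact mul_le_mul ((abs_add_le _ _).trans (by linarith)) hd0 (abs_nonneg _)
        (by have := D.threshold_nonneg α; positivity))
  rw [D.mult.series_eq_sum D.g_le 0 (n + 1) τ, D.mult.series_eq_sum D.g_le 0 (n + 1) τ']
  simp only [zero_add]
  set P := ∏ j ∈ Finset.range (n + 1), (-2 * qorb D.a D.a j) with hP
  have hPl : D.σ * D.d₀ / (2 * (D.G * α)) ≤ |P| := by
    have h1 : |P| = growth (qorb D.a D.a) (n + 1) := by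
      rw [hP, Finset.abs_prod, growth]
      exact Finset.prod_congr rfl fun i _ => by rw [neg_mul, abs_neg]
    rw [h1, growth_succ, abs_mul, abs_two, div_le_iff₀ (by positivity)]
    have h2 := D.crit.σ_le n
    have h3 := hn.2
    have h4 := D.crit.pos n
    have h5 : 0 < growth (qorb D.a D.a) n * (D.G * α) := by positivity
    nlinarith
  have hP0 : 0 < |P| := lt_of_lt_of_le (by positivity) hPl
  set W := cocycleSeries (D.g 0) D.d (fun n => -2 * qorb D.a D.a n) (n + 1) with hW
  -- The tails of the two series are of order `1 / |P|`, that is of order `α`.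
  have htail : |W ((D.d : ℝ) ^ (n + 1) * τ) / P - W ((D.d : ℝ) ^ (n + 1) * τ') / P| ≤ M₃ * √α := by
    rw [← sub_div, abs_div]
    have h1 : |W ((D.d : ℝ) ^ (n + 1) * τ) - W ((D.d : ℝ) ^ (n + 1) * τ')| ≤ 2 * B := by
      have h3 := hB (n + 1) ((D.d : ℝ) ^ (n + 1) * τ)
      have h4 := hB (n + 1) ((D.d : ℝ) ^ (n + 1) * τ')
      exact (abs_sub _ _).trans (by linarith)
    have h2 : α ≤ B' * √α := by
      refine le_trans ?_ (hB' α hα n hn)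
      have : (0 : ℝ) ≤ n * α := by positivity
      linarith
    calc _ ≤ 2 * B / (D.σ * D.d₀ / (2 * (D.G * α))) := by gcongr
      _ = (4 * B * D.G / (D.σ * D.d₀)) * α := by field_simp; ring
      _ ≤ (4 * B * D.G / (D.σ * D.d₀)) * (B' * √α) := by gcongr
      _ = _ := by rw [hM₃]; ring
  have hsum : |∑ i ∈ Finset.range (n + 1), D.g 0 ((D.d : ℝ) ^ i * τ) /
        ∏ j ∈ Finset.range i, (-2 * qorb D.a D.a j) -
      ∑ i ∈ Finset.range (n + 1), D.g 0 ((D.d : ℝ) ^ i * τ') /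
        ∏ j ∈ Finset.range i, (-2 * qorb D.a D.a j)| ≤
      M₁ * |u (n + 1) - u' (n + 1)| + M₂ * √α := by
    rw [← Finset.sum_sub_distrib]
    simp only [← sub_div]
    refine key.trans ?_
    rw [add_comm 1 n]
    have e1 : 8 * (D.G * α / α) * |u (n + 1) - u' (n + 1)| / D.d₀ = M₁ * |u (n + 1) - u' (n + 1)| := by
      rw [hM₁]; field_simp
    have e2 : 4 * D.threshold α * (K * α) / α = 4 * T * K * √α := by
      rw [hthr]; field_simp
    have e3 : ((n : ℝ) + 1) * (8 * (2 * D.Φ) * D.C * (D.G * α) / D.σ) =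
        ((n + 1) * α) * (16 * D.Φ * D.C * D.G / D.σ) := by ring
    rw [e1, e2, e3, hM₂, add_assoc]
    have h3 : ((n + 1) * α) * (16 * D.Φ * D.C * D.G / D.σ) ≤
        B' * √α * (16 * D.Φ * D.C * D.G / D.σ) :=
      mul_le_mul_of_nonneg_right (hB' α hα n hn) (by positivity)
    linarith
  have h1 := abs_le.1 htail
  have h2 := abs_le.1 hsum
  have h3 : 0 ≤ (M₂ + M₃) * |u (n + 1) - u' (n + 1)| := by positivity
  have h4 : 0 ≤ M₁ * √α := by positivity
  rw [abs_le]
  constructor <;> nlinarith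

end SkewData

/-! ### Early returns -/

/-- A point whose orbit comes close to `0` before time `M` is close to a point whose orbit visits
`0` before time `M`. -/
lemma exists_near_zero_preimage (a p : ℝ) (M : ℕ) :
    ∃ Z : Finset ℝ, ∀ ε > 0, ∃ ζ : ℝ, 0 < ζ ∧ ∀ x, |x| ≤ p → (∃ l < M, |qorb a x l| ≤ ζ) →
      ∃ z ∈ Z, |x - z| ≤ ε := by
  induction M with
  | zero => exact ⟨∅, fun ε _ => ⟨1, one_pos, fun x _ ⟨l, hl, _⟩ => absurd hl (by lia)⟩⟩
  | succ M ih =>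
    obtain ⟨Z, hZ⟩ := ih
    have hfin := finite_qorb_preimage a (Set.finite_singleton (0 : ℝ)) M
    set Z' := hfin.toFinset with hZ'
    refine ⟨Z ∪ Z', fun ε hε => ?_⟩
    obtain ⟨ζ, hζ, h⟩ := hZ ε hε
    set T : Set ℝ := {x | |x| ≤ p ∧ ∀ z ∈ Z', ε ≤ |x - z|} with hT
    have hTc : IsCompact T := by
      have hcl : IsClosed T := by
        have e : T = {x | |x| ≤ p} ∩ ⋂ z ∈ Z', {x | ε ≤ |x - z|} := by
          ext x; simp [hT]
        rw [e]
        exact (isClosed_le (by fun_prop) (by fun_prop)).inter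
          (isClosed_biInter fun z _ => isClosed_le (by fun_prop) (by fun_prop))
      exact isCompact_Icc.of_isClosed_subset hcl (fun x hx => abs_le.1 hx.1)
    have hpos : ∃ ζ' > 0, ∀ x ∈ T, ζ' < |qorb a x M| := by
      rcases T.eq_empty_or_nonempty with hT0 | hT0
      · exact ⟨1, one_pos, fun x hx => by rw [hT0] at hx; exact absurd hx (notMem_empty x)⟩
      obtain ⟨x₀, hx₀, hmin⟩ := hTc.exists_isMinOn hT0
        ((continuous_qorb a M).abs.continuousOn)
      have h0 : 0 < |qorb a x₀ M| := by
        rw [abs_pos]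
        intro h0
        have := hx₀.2 x₀ (hfin.mem_toFinset.2 h0)
        rw [sub_self, abs_zero] at this
        linarith
      refine ⟨|qorb a x₀ M| / 2, half_pos h0, fun x hx => ?_⟩
      have := hmin hx
      simp only [mem_ofPred_eq] at this
      linarith
    obtain ⟨ζ', hζ', h'⟩ := hpos
    refine ⟨min ζ ζ', lt_min hζ hζ', fun x hx ⟨l, hl, hle⟩ => ?_⟩
    rcases (Nat.lt_succ_iff.1 hl).lt_or_eq with hl | rfl
    · obtain ⟨z, hz, hxz⟩ := h x hx ⟨l, hl, hle.trans (min_le_left _ _)⟩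
      exact ⟨z, Finset.mem_union_left _ hz, hxz⟩
    · by_contra! hcon
      have hxT : x ∈ T := ⟨hx, fun z hz => (hcon z (Finset.mem_union_right _ hz)).le⟩
      exact absurd (hle.trans (min_le_right _ _)) (not_le.2 (h' x hxT))

namespace SkewData

variable (D : SkewData)

/-- The oscillation `Kα` of a curve is small compared with the threshold, which is of order `√α`. -/
lemma eventually_mul_le_threshold (K : ℝ) :
    ∀ᶠ α in 𝓝[>] (0 : ℝ), K * α ≤ D.threshold α := by
  have hΦ := D.Φ_pos
  have hC := D.crit.C_pos
  have h : Tendsto (fun α : ℝ => K * √α) (𝓝[>] 0) (𝓝 0) := by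
    have h : Continuous fun α : ℝ => K * √α := by fun_prop
    simpa using (h.tendsto 0).mono_left nhdsWithin_le_nhds
  filter_upwards [self_mem_nhdsWithin,
    h.eventually_lt_const (Real.sqrt_pos.2 (by positivity : 0 < (1 + D.C) * D.Φ))] with α hα h1
  rw [threshold, Real.sqrt_mul (by positivity)]
  calc K * α = K * √α * √α := by rw [mul_assoc, Real.mul_self_sqrt (le_of_lt hα)]
    _ ≤ _ := by gcongr

/-- For small `α`, after a passage near the critical point the next return to the critical region
happens within a given time `M` only with small conditional probability. -/
lemma volume_short_return_le (K S γ : ℝ) (hK : 0 ≤ K) (M : ℕ) {q : ENNReal} (hq : 0 < q) :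
    ∀ᶠ α in 𝓝[>] (0 : ℝ), ∀ x, CurveFamily D α K S γ x → ∀ n, D.IsBindingTime α n →
      ∀ i k : ℕ, (∃ τ ∈ Icc (0 : ℝ) 1, |x i ((k + τ) / (D.d : ℝ) ^ i)| ≤ D.threshold α) →
      volume {τ | τ ∈ Icc (0 : ℝ) 1 ∧
        ∃ l < M, |x (i + (n + 1) + l) ((k + τ) / (D.d : ℝ) ^ i)| ≤ 2 * D.threshold α} ≤ q := by
  have hd0 := D.d_pos
  have hΦ := D.Φ_pos
  obtain ⟨C₁, hC₁, hdist⟩ := D.exists_cocycleSeries_dist_le hK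
  set W := cocycleSeries (D.g 0) D.d (fun n => -2 * qorb D.a D.a n) 0 with hW
  have hWc : Continuous W := D.mult.continuous_series D.g_le (D.tower.continuous 0) 0
  obtain ⟨Z, hZ⟩ := exists_near_zero_preimage D.a D.p M
  have hq1 : 0 < q / (Z.card + 1 : ℕ) := ENNReal.div_pos hq.ne' (ENNReal.natCast_ne_top _)
  obtain ⟨δ, hδ, hball⟩ := exists_small_ball_of_level_null hWc
    (volume_cocycleSeries_level D.tower D.mult D.g_le (D.per 0) D.nonconst D.two_le_d D.R_lt) hq1
  obtain ⟨ζ, hζ, hnear⟩ := hZ (δ / (4 * C₁)) (by positivity)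
  have hlim1 : Tendsto (fun α : ℝ => C₁ * √α) (𝓝[>] 0) (𝓝 0) := by
    have h : Continuous fun α : ℝ => C₁ * √α := by fun_prop
    simpa using (h.tendsto 0).mono_left nhdsWithin_le_nhds
  have hlim2 : Tendsto (fun α : ℝ => 2 * D.threshold α + 5 ^ M * (α * D.Φ)) (𝓝[>] 0) (𝓝 0) := by
    have h : Tendsto (fun α : ℝ => 5 ^ M * (α * D.Φ)) (𝓝[>] 0) (𝓝 0) := by
      have h : Continuous fun α : ℝ => 5 ^ M * (α * D.Φ) := by fun_prop
      simpa using (h.tendsto 0).mono_left nhdsWithin_le_nhds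
    simpa using (D.tendsto_threshold.const_mul 2).add h
  have hlim3 := D.eventually_mul_le_threshold K
  filter_upwards [self_mem_nhdsWithin, hlim1.eventually_lt_const (half_pos hδ),
    hlim2.eventually_lt_const hζ, hlim3] with α hα hs1 hs2 hs3 x hx n hn i k ⟨τ₀, hτ₀, hit⟩
  replace hα : 0 < α := hα
  -- the orbits over the cylinder, from the `i`-th iterate on
  set u : ℝ → ℕ → ℝ := fun τ m => x (i + m) ((k + τ) / (D.d : ℝ) ^ i) with hu
  have hub : ∀ τ m, |u τ m| ≤ D.β := fun τ m => hx.bound _ _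
  have hus : ∀ τ m, u τ (m + 1) = D.a - u τ m ^ 2 + α * D.g 0 ((D.d : ℝ) ^ m * τ) := by
    intro τ m
    simp only [hu]
    rw [← add_assoc, hx.step]
    have e1 : (D.d : ℝ) ^ (i + m) * ((k + τ) / (D.d : ℝ) ^ i) =
        (D.d : ℝ) ^ m * τ + ((D.d ^ m * k : ℕ) : ℝ) * 1 := by
      rw [pow_add]; push_cast; field_simp; ring
    rw [e1, (D.per 0).nat_mul]
  have hlip : ∀ τ ∈ Icc (0 : ℝ) 1, ∀ τ' ∈ Icc (0 : ℝ) 1, |u τ 0 - u τ' 0| ≤ K * α := by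
    intro τ h1 τ' h2
    refine (hx.lip i k τ τ').trans (mul_le_of_le_one_right (by positivity) ?_)
    rw [abs_le]; constructor <;> linarith [h1.1, h1.2, h2.1, h2.2]
  have hu0 : ∀ τ ∈ Icc (0 : ℝ) 1, |u τ 0| ≤ 2 * D.threshold α := by
    intro τ hτ
    have h1 := hlip τ hτ τ₀ hτ₀
    have h2 := abs_sub_abs_le_abs_sub (u τ 0) (u τ₀ 0)
    have h3 : |u τ₀ 0| ≤ D.threshold α := hit
    linarith
  -- An early return forces the position after the passage to be close to one of finitely many
  -- preimages of `0`.
  have hcover : {τ | τ ∈ Icc (0 : ℝ) 1 ∧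
      ∃ l < M, |x (i + (n + 1) + l) ((k + τ) / (D.d : ℝ) ^ i)| ≤ 2 * D.threshold α} ⊆
      ⋃ z ∈ Z, {τ | τ ∈ Icc (0 : ℝ) 1 ∧ |u τ (n + 1) - z| ≤ δ / (4 * C₁)} := by
    rintro τ ⟨hτ, l, hl, hle⟩
    have hpo : PseudoOrbit D.a D.p (α * D.Φ) (fun m => u τ (n + 1 + m)) := by
      refine ⟨fun m => (hub _ _).trans D.β_lt.le, fun m => ?_⟩
      rw [← add_assoc, hus, add_sub_cancel_left, abs_mul, abs_of_pos hα]
      exact mul_le_mul_of_nonneg_left (D.g_le _) hα.le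
    have h1 := hpo.dist_qorb_le D.pre l
    simp only [add_zero] at h1
    have h2 : |u τ (n + 1 + l)| ≤ 2 * D.threshold α := by
      simp only [hu]; rw [← add_assoc]; exact hle
    have h3 : (5 : ℝ) ^ l * (α * D.Φ) ≤ 5 ^ M * (α * D.Φ) :=
      mul_le_mul_of_nonneg_right (pow_le_pow_right₀ (by norm_num) hl.le) (by positivity)
    have h4 := abs_sub_abs_le_abs_sub (qorb D.a (u τ (n + 1)) l) (u τ (n + 1 + l))
    rw [abs_sub_comm] at h4
    obtain ⟨z, hz, hzd⟩ := hnear (u τ (n + 1)) ((hub _ _).trans D.β_lt.le) ⟨l, hl, by linarith⟩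
    exact mem_biUnion hz ⟨hτ, hzd⟩
  -- Parameters with nearby positions after the passage have nearby values of the cocycle series,
  -- whose distribution has no atoms.
  have hpiece : ∀ z ∈ Z, volume {τ | τ ∈ Icc (0 : ℝ) 1 ∧ |u τ (n + 1) - z| ≤ δ / (4 * C₁)} ≤
      q / (Z.card + 1 : ℕ) := by
    intro z _
    rcases eq_empty_or_nonempty {τ | τ ∈ Icc (0 : ℝ) 1 ∧ |u τ (n + 1) - z| ≤ δ / (4 * C₁)} with
      h | ⟨τ₁, hτ₁, hz₁⟩
    · rw [h, measure_empty]; exact bot_le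
    · refine (measure_mono ?_).trans (hball (W τ₁))
      rintro τ ⟨hτ, hz⟩
      refine ⟨hτ, ?_⟩
      refine (hdist α hα n hn (u τ) (u τ₁) τ τ₁ (hub τ) (hub τ₁) (hus τ) (hus τ₁) (hu0 τ hτ)
        (hu0 τ₁ hτ₁) (hlip τ hτ τ₁ hτ₁)).trans ?_
      have h1 : |u τ (n + 1) - u τ₁ (n + 1)| ≤ δ / (2 * C₁) := by
        have h2 := abs_sub_le (u τ (n + 1)) z (u τ₁ (n + 1))
        rw [abs_sub_comm z] at h2
        have h3 : δ / (2 * C₁) = δ / (4 * C₁) + δ / (4 * C₁) := by field_simp; ring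
        linarith
      have h2 : C₁ * |u τ (n + 1) - u τ₁ (n + 1)| ≤ δ / 2 := by
        calc _ ≤ C₁ * (δ / (2 * C₁)) := by gcongr
          _ = δ / 2 := by field_simp
      rw [mul_add]; linarith
  refine (measure_mono hcover).trans ((measure_biUnion_finset_le _ _).trans ?_)
  refine (Finset.sum_le_card_nsmul _ _ _ hpiece).trans ?_
  rw [nsmul_eq_mul]
  calc (Z.card : ENNReal) * (q / (Z.card + 1 : ℕ)) ≤ (Z.card + 1 : ℕ) * (q / (Z.card + 1 : ℕ)) := by
        gcongr; exact le_self_add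
    _ = q := ENNReal.mul_div_cancel (by positivity) (ENNReal.natCast_ne_top _)

end SkewData

/-! ### Counting free times and passages -/

open Classical in
/-- The clock counts down the time that remains in the current passage near the critical point. A
passage of length `N` starts whenever the clock shows `0` and `hit i` holds. -/
noncomputable def clock (N : ℕ) (hit : ℕ → Prop) : ℕ → ℕ
  | 0 => 0
  | i + 1 => if clock N hit i = 0 then (if hit i then N - 1 else 0) else clock N hit i - 1

/-- A passage starts at time `i`. -/
def IsStart (N : ℕ) (hit : ℕ → Prop) (i : ℕ) : Prop := clock N hit i = 0 ∧ hit i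

/-- Time `i` is outside of all passages. -/
def IsFree (N : ℕ) (hit : ℕ → Prop) (i : ℕ) : Prop := clock N hit i = 0 ∧ ¬hit i

open Classical in
/-- The number of times `i < n` with `E i`. -/
noncomputable def countBefore (E : ℕ → Prop) (n : ℕ) : ℕ :=
  ∑ i ∈ Finset.range n, if E i then 1 else 0

lemma countBefore_zero (E : ℕ → Prop) : countBefore E 0 = 0 := by simp [countBefore]

lemma countBefore_succ_of {E : ℕ → Prop} {n : ℕ} (h : E n) :
    countBefore E (n + 1) = countBefore E n + 1 := by
  rw [countBefore, Finset.sum_range_succ, if_pos h]; rfl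

lemma countBefore_succ_of_not {E : ℕ → Prop} {n : ℕ} (h : ¬E n) :
    countBefore E (n + 1) = countBefore E n := by
  rw [countBefore, Finset.sum_range_succ, if_neg h]; rfl

section Clock

variable {N : ℕ} {hit : ℕ → Prop} {n : ℕ}

lemma clock_succ_of_isStart (h : IsStart N hit n) : clock N hit (n + 1) = N - 1 := by
  rw [clock, if_pos h.1, if_pos h.2]

lemma clock_succ_of_isFree (h : IsFree N hit n) : clock N hit (n + 1) = 0 := by
  rw [clock, if_pos h.1, if_neg h.2]

lemma clock_succ_of_ne (h : clock N hit n ≠ 0) : clock N hit (n + 1) = clock N hit n - 1 := by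
  rw [clock, if_neg h]

lemma isStart_or_isFree (N : ℕ) (hit : ℕ → Prop) (n : ℕ) :
    IsStart N hit n ∨ IsFree N hit n ∨ clock N hit n ≠ 0 := by
  by_cases h : clock N hit n = 0 <;> by_cases h' : hit n
  · exact Or.inl ⟨h, h'⟩
  · exact Or.inr (Or.inl ⟨h, h'⟩)
  · exact Or.inr (Or.inr h)
  · exact Or.inr (Or.inr h)

lemma IsStart.not_isFree (h : IsStart N hit n) : ¬IsFree N hit n := fun h' => h'.2 h.2

lemma clock_congr {hit' : ℕ → Prop} (h : ∀ i < n, hit i ↔ hit' i) :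
    clock N hit n = clock N hit' n := by
  induction n with
  | zero => rfl
  | succ n ih =>
    have h1 := ih fun i hi => h i (by lia)
    have h2 := h n (by lia)
    by_cases h3 : hit' n <;> simp [clock, h1, h2, h3]

/-- Every time is free or belongs to one of the passages of length `N`. -/
lemma le_free_add_start (hN : 1 ≤ N) (n : ℕ) :
    n ≤ countBefore (IsFree N hit) n + N * countBefore (IsStart N hit) n := by
  -- The bound is proved by induction together with the time left on the clock.
  suffices n + clock N hit n ≤ countBefore (IsFree N hit) n + N * countBefore (IsStart N hit) n by
    lia
  induction n with
  | zero => simp [clock, countBefore_zero]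
  | succ n ih =>
    rcases isStart_or_isFree N hit n with h | h | h
    · rw [clock_succ_of_isStart h, countBefore_succ_of h, countBefore_succ_of_not h.not_isFree,
        mul_add]
      have := h.1
      lia
    · rw [clock_succ_of_isFree h, countBefore_succ_of h,
        countBefore_succ_of_not fun h' => h'.not_isFree h]
      lia
    · rw [clock_succ_of_ne h, countBefore_succ_of_not fun h' => h h'.1,
        countBefore_succ_of_not fun h' => h h'.1]
      lia

/-- A passage that is not followed by a hit within time `M` contributes `M` free times. -/
lemma mul_long_le_free (hN : 1 ≤ N) {M : ℕ} (hM : 1 ≤ M) (n : ℕ) :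
    M * countBefore (fun s => IsStart N hit s ∧ ∀ l < M, ¬hit (s + N + l)) n ≤
      countBefore (IsFree N hit) n + M := by
  set long : ℕ → Prop := fun s => IsStart N hit s ∧ ∀ l < M, ¬hit (s + N + l) with hlong
  -- The inductive statement records the last long passage while the `M` free times that follow it
  -- are not over.
  suffices M * countBefore long n ≤ countBefore (IsFree N hit) n ∨
      ∃ s, s < n ∧ n < s + N + M ∧ long s ∧ clock N hit n = s + N - n ∧
        M * countBefore long n + (n - (s + N)) ≤ countBefore (IsFree N hit) n + M by
    rcases this with h | ⟨s, -, -, -, -, h⟩ <;> lia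
  induction n with
  | zero => left; simp [countBefore_zero]
  | succ n ih =>
    rcases ih with ih | ⟨s, h1, h2, h3, h4, h5⟩
    · by_cases h : long n
      · right
        refine ⟨n, by lia, by lia, h, ?_, ?_⟩
        · rw [clock_succ_of_isStart h.1]; lia
        · rw [countBefore_succ_of h, countBefore_succ_of_not h.1.not_isFree, mul_add]
          lia
      · left
        rw [countBefore_succ_of_not h]
        by_cases hf : IsFree N hit n
        · rw [countBefore_succ_of hf]; lia
        · rw [countBefore_succ_of_not hf]; lia
    · rcases Nat.lt_or_ge n (s + N) with hn | hn
      · have h0 : clock N hit n ≠ 0 := by lia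
        right
        refine ⟨s, by lia, by lia, h3, ?_, ?_⟩
        · rw [clock_succ_of_ne h0]; lia
        · rw [countBefore_succ_of_not fun h : long n => h0 h.1.1,
            countBefore_succ_of_not fun h : IsFree N hit n => h0 h.1]
          lia
      · have hf : IsFree N hit n := by
          refine ⟨by lia, ?_⟩
          have := h3.2 (n - (s + N)) (by lia)
          rwa [show s + N + (n - (s + N)) = n by lia] at this
        have hnl : ¬long n := fun h => h.1.not_isFree hf
        rw [countBefore_succ_of hf, countBefore_succ_of_not hnl, clock_succ_of_isFree hf]
        by_cases hend : n + 1 < s + N + M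
        · right
          exact ⟨s, by lia, hend, h3, by lia, by lia⟩
        · left; lia

end Clock

open Classical in
/-- The lower bound for the growth of an orbit that is accumulated up to time `n`: a factor `m` for
every free time and a factor `w i` for a passage that starts at time `i`. -/
noncomputable def passageProduct (N : ℕ) (hit : ℕ → Prop) (m : ℝ) (w : ℕ → ℝ) (n : ℕ) : ℝ :=
  ∏ i ∈ Finset.range n, if clock N hit i = 0 then (if hit i then w i else m) else 1

section PassageProduct

variable {N : ℕ} {hit : ℕ → Prop} {m : ℝ} {w : ℕ → ℝ} {n : ℕ}

lemma passageProduct_zero : passageProduct N hit m w 0 = 1 := by simp [passageProduct]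

lemma passageProduct_succ_of_isStart (h : IsStart N hit n) :
    passageProduct N hit m w (n + 1) = passageProduct N hit m w n * w n := by
  rw [passageProduct, Finset.prod_range_succ, if_pos h.1, if_pos h.2]; rfl

lemma passageProduct_succ_of_isFree (h : IsFree N hit n) :
    passageProduct N hit m w (n + 1) = passageProduct N hit m w n * m := by
  rw [passageProduct, Finset.prod_range_succ, if_pos h.1, if_neg h.2]; rfl

lemma passageProduct_succ_of_ne (h : clock N hit n ≠ 0) :
    passageProduct N hit m w (n + 1) = passageProduct N hit m w n := by
  rw [passageProduct, Finset.prod_range_succ, if_neg h, mul_one]; rfl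

lemma passageProduct_nonneg (hm : 0 ≤ m) (hw : ∀ i, 0 ≤ w i) (n : ℕ) :
    0 ≤ passageProduct N hit m w n := by
  refine Finset.prod_nonneg fun i _ => ?_
  split_ifs
  exacts [hw i, hm, zero_le_one]

open Classical in
/-- The passage product in exponential form. -/
lemma exp_le_passageProduct {Γ L : ℝ} {cnt : ℕ → ℕ} (hm : 0 < m) (n : ℕ)
    (hw : ∀ i < n, IsStart N hit i → Real.exp (-(Γ + L * cnt i)) ≤ w i) :
    Real.exp (Real.log m * countBefore (IsFree N hit) n - (Γ * countBefore (IsStart N hit) n +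
      L * ∑ i ∈ Finset.range n, if IsStart N hit i then (cnt i : ℝ) else 0)) ≤
      passageProduct N hit m w n := by
  induction n with
  | zero => simp [countBefore_zero, passageProduct_zero]
  | succ n ih =>
    specialize ih fun i hi => hw i (by lia)
    rw [Finset.sum_range_succ]
    rcases isStart_or_isFree N hit n with h | h | h
    · rw [passageProduct_succ_of_isStart h, countBefore_succ_of h,
        countBefore_succ_of_not h.not_isFree, if_pos h]
      refine le_trans (le_of_eq ?_) (mul_le_mul ih (hw n (by lia) h) (Real.exp_pos _).le
        ((Real.exp_pos _).le.trans ih))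
      rw [← Real.exp_add]
      congr 1
      push_cast; ring
    · rw [passageProduct_succ_of_isFree h, countBefore_succ_of h,
        countBefore_succ_of_not fun h' => h'.not_isFree h, if_neg fun h' => h'.not_isFree h]
      refine le_trans (le_of_eq ?_) (mul_le_mul_of_nonneg_right ih hm.le)
      rw [← Real.exp_log hm, ← Real.exp_add, Real.exp_log hm]
      congr 1
      push_cast; ring
    · rw [passageProduct_succ_of_ne h, countBefore_succ_of_not fun h' => h h'.1,
        countBefore_succ_of_not fun h' => h h'.1, if_neg fun h' => h h'.1]
      simpa using ih

end PassageProduct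

namespace SkewData

variable (D : SkewData)

/-- The growth of the derivative along an orbit of the skew product: a factor `m > 1` for each free
time, and a factor of order `|x i| / α` for a passage that starts at time `i`, however close to the
critical point. The hypotheses on `hit` leave a margin between one and two thresholds. -/
lemma exists_passage_growth : ∃ m c δ : ℝ, 1 < m ∧ 0 < c ∧ 0 < δ ∧ ∀ᶠ α in 𝓝[>] (0 : ℝ),
    2 * D.threshold α ≤ δ → ∃ c', 0 < c' ∧ ∀ k, D.IsBindingTime α k → ∀ (x : ℕ → ℝ) (hit : ℕ → Prop),
      PseudoOrbit D.a D.p (α * D.Φ) x → (∀ i, hit i → |x i| ≤ 2 * D.threshold α) →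
      (∀ i, ¬hit i → D.threshold α ≤ |x i|) → ∀ n,
      c' * passageProduct (k + 1) hit m (fun i => c * |x i| / α) n ≤ growth x n := by
  have hG := D.G_pos
  have hd₀ := D.crit.d₀_pos
  have hκ := D.crit.κ_pos
  have hΦ := D.Φ_pos
  have hC := D.crit.C_pos
  obtain ⟨c, m, δ, η₀, hc, hm, hδ, hη₀, hfree⟩ := D.crit.exists_free_growth D.pre
  refine ⟨m, c * (D.d₀ / (4 * D.G)), δ, hm, by positivity, hδ, ?_⟩
  filter_upwards [self_mem_nhdsWithin, Ioo_mem_nhdsGT (div_pos hη₀ hΦ)] with α hα hα1 hthr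
  replace hα : 0 < α := hα
  obtain ⟨c', hc', hgr⟩ := hfree (α * D.Φ) (by positivity)
    (by rw [← le_div_iff₀ hΦ]; exact hα1.2.le)
  set c₃ := D.d₀ / (4 * D.G) with hc₃
  have hc₃0 : 0 < c₃ := by positivity
  refine ⟨min 1 (min c' (D.κ * α / c₃)), by positivity, ?_⟩
  intro k hk x hit hx hhit hnot n
  set Pr := passageProduct (k + 1) hit m (fun i => c * c₃ * |x i| / α) with hPr
  have hPr0 : ∀ n, 0 ≤ Pr n := passageProduct_nonneg (by linarith) fun i => by positivity
  have hsq : ∀ i, D.threshold α ≤ |x i| → (1 + D.C) * (α * D.Φ) ≤ x i ^ 2 := by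
    intro i hi
    have h1 := D.sq_threshold hα.le
    have h2 : D.threshold α ^ 2 ≤ |x i| ^ 2 := by
      have := D.threshold_nonneg α
      gcongr
    rw [sq_abs] at h2
    linarith
  -- growth over free blocks
  have hblock : ∀ e j, (∀ i < j, D.threshold α ≤ |x (e + i)|) →
      c' * m ^ j ≤ growth (fun i => x (e + i)) j ∧
      (|x (e + j)| ≤ 2 * D.threshold α → c * m ^ j ≤ growth (fun i => x (e + i)) j) := by
    intro e j h
    have h1 := hgr j _ (hx.shift e) fun i hi => hsq _ (h i hi)
    exact ⟨h1.1, fun h2 => h1.2 (h2.trans hthr)⟩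
  -- growth over passages
  have hpass : ∀ s, |x s| ≤ 2 * D.threshold α → ∀ j, 1 ≤ j → j ≤ k + 1 →
      |x s| * growth (qorb D.a D.a) (j - 1) ≤ growth (fun i => x (s + i)) j := by
    intro s hs j h1 h2
    refine (D.crit.passage (S := D.G * α) (hx.shift s) ?_ hk.1 h1 h2).1
    have h3 : x (s + 0) ^ 2 ≤ 4 * ((1 + D.C) * D.Φ * α) := by
      rw [← D.sq_threshold hα.le, ← sq_abs]
      calc |x s| ^ 2 ≤ (2 * D.threshold α) ^ 2 := by gcongr
        _ = _ := by ring
    unfold G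
    linarith
  have hfull : ∀ s, |x s| ≤ 2 * D.threshold α →
      c₃ * |x s| / α ≤ growth (fun i => x (s + i)) (k + 1) := by
    intro s hs
    refine le_trans ?_ (hpass s hs (k + 1) (by lia) le_rfl)
    rw [Nat.add_sub_cancel, div_le_iff₀ hα, hc₃]
    have h1 : D.d₀ / (4 * D.G) ≤ growth (qorb D.a D.a) k * α := by
      rw [div_le_iff₀ (by positivity)]; linarith [hk.2]
    have h2 := abs_nonneg (x s)
    nlinarith
  have hpart : ∀ s, |x s| ≤ 2 * D.threshold α → ∀ j, 1 ≤ j → j ≤ k + 1 →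
      D.κ * |x s| ≤ growth (fun i => x (s + i)) j := by
    intro s hs j h1 h2
    refine le_trans ?_ (hpass s hs j h1 h2)
    rw [mul_comm]
    refine mul_le_mul_of_nonneg_left (le_trans ?_ (D.crit.κ_mul_pow_le _)) (abs_nonneg _)
    exact le_mul_of_one_le_right hκ.le (one_le_pow₀ D.crit.one_lt_l.le)
  -- Here `e` is the end of the last complete passage before time `n`. The constant `c` of the free
  -- block that leads into a passage is absorbed in the factor of the passage.
  have key : ∀ n, ∃ e, Pr e ≤ growth x e ∧
      ((e ≤ n ∧ clock (k + 1) hit n = 0 ∧ (∀ i, e ≤ i → i < n → D.threshold α ≤ |x i|) ∧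
        Pr n = Pr e * m ^ (n - e)) ∨
      ∃ s, e ≤ s ∧ s < n ∧ n < s + (k + 1) ∧ clock (k + 1) hit n = s + (k + 1) - n ∧
        |x s| ≤ 2 * D.threshold α ∧ (∀ i, e ≤ i → i < s → D.threshold α ≤ |x i|) ∧
        Pr n = Pr e * m ^ (s - e) * (c * c₃ * |x s| / α)) := by
    -- the end of a passage
    have hcomplete : ∀ e s, e ≤ s → Pr e ≤ growth x e → |x s| ≤ 2 * D.threshold α →
        (∀ i, e ≤ i → i < s → D.threshold α ≤ |x i|) →
        Pr e * m ^ (s - e) * (c * c₃ * |x s| / α) ≤ growth x (s + (k + 1)) := by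
      intro e s hes he hs hfr
      have h1 := (hblock e (s - e) fun i hi => hfr _ (by lia) (by lia)).2
        (by rwa [Nat.add_sub_cancel' hes])
      have h2 := hfull s hs
      have h3 : growth x s = growth x e * growth (fun i => x (e + i)) (s - e) := by
        rw [← growth_add, Nat.add_sub_cancel' hes]
      rw [growth_add, h3]
      calc Pr e * m ^ (s - e) * (c * c₃ * |x s| / α)
          = Pr e * (c * m ^ (s - e)) * (c₃ * |x s| / α) := by ring
        _ ≤ growth x e * growth (fun i => x (e + i)) (s - e) *
            growth (fun i => x (s + i)) (k + 1) := by
          have := growth_nonneg x e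
          have := growth_nonneg (fun i => x (e + i)) (s - e)
          gcongr
    intro n
    induction n with
    | zero => exact ⟨0, by simp [hPr, passageProduct_zero, growth_zero],
        Or.inl ⟨le_rfl, rfl, fun i _ h => absurd h (by lia), by simp⟩⟩
    | succ n ih =>
      obtain ⟨e, he, ⟨hen, hcl, hfr, hprod⟩ | ⟨s, hes, hsn, hn, hcl, hs, hfr, hprod⟩⟩ := ih
      · by_cases hh : hit n
        · have hst : IsStart (k + 1) hit n := ⟨hcl, hh⟩
          have hp : Pr (n + 1) = Pr e * m ^ (n - e) * (c * c₃ * |x n| / α) := by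
            rw [hPr, passageProduct_succ_of_isStart hst, ← hPr, hprod]
          have hcl' := clock_succ_of_isStart hst
          rcases Nat.eq_zero_or_pos k with hk0 | hk0
          · have h1 := hcomplete e n hen he (hhit n hh) hfr
            rw [hk0, zero_add, ← hp] at h1
            exact ⟨n + 1, h1, Or.inl ⟨le_rfl, by lia, fun i h h' => absurd h (by lia), by simp⟩⟩
          · exact ⟨e, he, Or.inr ⟨n, hen, by lia, by lia, by lia, hhit n hh, hfr, hp⟩⟩
        · have hf : IsFree (k + 1) hit n := ⟨hcl, hh⟩
          refine ⟨e, he, Or.inl ⟨by lia, clock_succ_of_isFree hf, fun i h1 h2 => ?_, ?_⟩⟩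
          · rcases (Nat.lt_succ_iff.1 h2).lt_or_eq with h | rfl
            · exact hfr i h1 h
            · exact hnot i hh
          · rw [hPr, passageProduct_succ_of_isFree hf, ← hPr, hprod, Nat.sub_add_comm hen, pow_succ,
              mul_assoc]
      · have h0 : clock (k + 1) hit n ≠ 0 := by lia
        have hp : Pr (n + 1) = Pr e * m ^ (s - e) * (c * c₃ * |x s| / α) := by
          rw [hPr, passageProduct_succ_of_ne h0, ← hPr, hprod]
        have hcl' := clock_succ_of_ne h0
        by_cases hend : n + 1 < s + (k + 1)
        · exact ⟨e, he, Or.inr ⟨s, hes, by lia, hend, by lia, hs, hfr, hp⟩⟩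
        · have h1 := hcomplete e s hes he hs hfr
          rw [← hp, show s + (k + 1) = n + 1 by lia] at h1
          exact ⟨n + 1, h1, Or.inl ⟨le_rfl, by lia, fun i h h' => absurd h (by lia), by simp⟩⟩
  obtain ⟨e, he, ⟨hen, -, hfr, hprod⟩ | ⟨s, hes, hsn, hn, -, hs, hfr, hprod⟩⟩ := key n
  · have h1 := (hblock e (n - e) fun i hi => hfr _ (by lia) (by lia)).1
    have h3 : growth x n = growth x e * growth (fun i => x (e + i)) (n - e) := by
      rw [← growth_add, Nat.add_sub_cancel' hen]
    rw [h3, hprod]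
    calc min 1 (min c' (D.κ * α / c₃)) * (Pr e * m ^ (n - e)) ≤ c' * (Pr e * m ^ (n - e)) := by
          have := hPr0 e
          exact mul_le_mul_of_nonneg_right ((min_le_right _ _).trans (min_le_left _ _))
            (by positivity)
      _ = Pr e * (c' * m ^ (n - e)) := by ring
      _ ≤ _ := mul_le_mul he h1 (by positivity) (growth_nonneg _ _)
  · have h1 := (hblock e (s - e) fun i hi => hfr _ (by lia) (by lia)).2
      (by rwa [Nat.add_sub_cancel' hes])
    have h2 := hpart s hs (n - s) (by lia) (by lia)
    have h3 : growth x s = growth x e * growth (fun i => x (e + i)) (s - e) := by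
      rw [← growth_add, Nat.add_sub_cancel' hes]
    have h4 : growth x n = growth x s * growth (fun i => x (s + i)) (n - s) := by
      rw [← growth_add, Nat.add_sub_cancel' hsn.le]
    rw [h4, h3, hprod]
    have hE := hPr0 e
    calc min 1 (min c' (D.κ * α / c₃)) * (Pr e * m ^ (s - e) * (c * c₃ * |x s| / α))
        ≤ D.κ * α / c₃ * (Pr e * m ^ (s - e) * (c * c₃ * |x s| / α)) :=
          mul_le_mul_of_nonneg_right ((min_le_right _ _).trans (min_le_right _ _)) (by positivity)
      _ = Pr e * (c * m ^ (s - e)) * (D.κ * |x s|) := by field_simp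
      _ ≤ growth x e * growth (fun i => x (e + i)) (s - e) *
            growth (fun i => x (s + i)) (n - s) := by
          have := growth_nonneg x e
          have := growth_nonneg (fun i => x (e + i)) (s - e)
          gcongr

end SkewData

/-! ### An exponential supermartingale on d-adic intervals -/

/-- The index of the `d`-adic interval of rank `i` that contains `θ ≥ 0`. -/
noncomputable def cylIndex (d i : ℕ) (θ : ℝ) : ℕ := ⌊(d : ℝ) ^ i * θ⌋₊

/-- `f` is constant on the `d`-adic intervals of rank `i`. -/
def ConstOnCyl {X : Type*} (d i : ℕ) (f : ℝ → X) : Prop :=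
  ∀ θ θ', cylIndex d i θ = cylIndex d i θ' → f θ = f θ'

section Cylinders

variable {d : ℕ}

lemma cylIndex_eq_div (hd : 1 ≤ d) (i j : ℕ) (θ : ℝ) :
    cylIndex d i θ = cylIndex d (i + j) θ / d ^ j := by
  have hd0 : (0 : ℝ) < d := by exact_mod_cast hd
  rw [cylIndex, cylIndex, ← Nat.floor_div_natCast]
  congr 1
  push_cast
  rw [pow_add]; field_simp

lemma cylIndex_eq_of_le (hd : 1 ≤ d) {i i' : ℕ} (h : i ≤ i') {θ θ' : ℝ}
    (h' : cylIndex d i' θ = cylIndex d i' θ') : cylIndex d i θ = cylIndex d i θ' := by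
  obtain ⟨j, rfl⟩ := Nat.exists_eq_add_of_le h
  rw [cylIndex_eq_div hd i j, h', ← cylIndex_eq_div hd i j]

lemma ConstOnCyl.mono {X : Type*} {f : ℝ → X} {i i' : ℕ} (hf : ConstOnCyl d i f) (hd : 1 ≤ d)
    (h : i ≤ i') : ConstOnCyl d i' f := fun θ θ' h' => hf θ θ' (cylIndex_eq_of_le hd h h')

lemma measurable_cylIndex (d i : ℕ) : Measurable (cylIndex d i) :=
  Nat.measurable_floor.comp (measurable_const.mul measurable_id)

lemma ConstOnCyl.measurable {X : Type*} [MeasurableSpace X] [Nonempty X] {f : ℝ → X} {i : ℕ}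
    (hf : ConstOnCyl d i f) : Measurable f := by
  have h : f = Function.extend (cylIndex d i) f (fun _ => Classical.arbitrary X) ∘ cylIndex d i :=
    (Function.FactorsThrough.extend_comp _ (fun θ θ' h => hf θ θ' h)).symm
  rw [h]
  exact (measurable_from_nat).comp (measurable_cylIndex d i)

lemma ConstOnCyl.measurableSet {P : ℝ → Prop} {i : ℕ} (hP : ConstOnCyl d i P) :
    MeasurableSet {θ | P θ} := measurableSet_setOfPred.2 hP.measurable

/-- The `d`-adic interval of rank `i` with index `k`. -/
def dCylinder (d i k : ℕ) : Set ℝ := Ico ((k : ℝ) / (d : ℝ) ^ i) (((k : ℝ) + 1) / (d : ℝ) ^ i)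

lemma mem_cylinder_iff (hd : 1 ≤ d) {i k : ℕ} {θ : ℝ} :
    θ ∈ dCylinder d i k ↔ 0 ≤ θ ∧ cylIndex d i θ = k := by
  have hd0 : (0 : ℝ) < (d : ℝ) ^ i := pow_pos (by exact_mod_cast hd) i
  rw [dCylinder, mem_Ico, div_le_iff₀ hd0, lt_div_iff₀ hd0, cylIndex, mul_comm θ]
  constructor
  · rintro ⟨h1, h2⟩
    have h3 : 0 ≤ (d : ℝ) ^ i * θ := (Nat.cast_nonneg k).trans h1
    exact ⟨nonneg_of_mul_nonneg_right h3 hd0, (Nat.floor_eq_iff h3).2 ⟨h1, h2⟩⟩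
  · rintro ⟨h1, h2⟩
    exact (Nat.floor_eq_iff (by positivity)).1 h2

lemma volume_cylinder (i k : ℕ) : volume (dCylinder d i k) = ENNReal.ofReal (1 / (d : ℝ) ^ i) := by
  rw [dCylinder, Real.volume_Ico]
  congr 1
  ring

lemma cylIndex_lt (hd : 1 ≤ d) {i : ℕ} {θ : ℝ} (hθ : θ ∈ Ico (0 : ℝ) 1) : cylIndex d i θ < d ^ i := by
  have hd0 : (0 : ℝ) < (d : ℝ) ^ i := pow_pos (by exact_mod_cast hd) i
  rw [cylIndex, Nat.floor_lt (mul_nonneg hd0.le hθ.1)]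
  push_cast
  exact mul_lt_of_lt_one_right hd0 hθ.2

lemma Ico_eq_biUnion_cylinder (hd : 1 ≤ d) (i : ℕ) :
    Ico (0 : ℝ) 1 = ⋃ k ∈ Finset.range (d ^ i), dCylinder d i k := by
  have hd0 : (0 : ℝ) < (d : ℝ) ^ i := pow_pos (by exact_mod_cast hd) i
  ext θ
  simp only [mem_iUnion, Finset.mem_range, exists_prop]
  constructor
  · intro hθ
    exact ⟨_, cylIndex_lt hd hθ, (mem_cylinder_iff hd).2 ⟨hθ.1, rfl⟩⟩
  · rintro ⟨k, hk, h⟩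
    refine ⟨((mem_cylinder_iff hd).1 h).1, h.2.trans_le ?_⟩
    rw [div_le_one hd0]
    exact_mod_cast hk

lemma pairwiseDisjoint_cylinder (hd : 1 ≤ d) (i : ℕ) (s : Set ℕ) :
    s.PairwiseDisjoint (dCylinder d i) := by
  intro k _ k' _ hkk'
  refine Set.disjoint_left.2 fun θ h h' => hkk' ?_
  rw [← ((mem_cylinder_iff hd).1 h).2, ((mem_cylinder_iff hd).1 h').2]

/-- A measure bound in the coordinate `τ = dⁱ θ - k` gives one on the cylinder. -/
lemma volume_cylinder_inter_le (hd : 1 ≤ d) {i k : ℕ} {V : ℝ → Prop} {T : Set ℝ} {b : ℝ}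
    (hT : volume T ≤ ENNReal.ofReal b)
    (h : ∀ τ ∈ Ico (0 : ℝ) 1, V ((k + τ) / (d : ℝ) ^ i) → τ ∈ T) :
    volume {θ | θ ∈ dCylinder d i k ∧ V θ} ≤ ENNReal.ofReal (b * (1 / (d : ℝ) ^ i)) := by
  have hd0 : (0 : ℝ) < (d : ℝ) ^ i := pow_pos (by exact_mod_cast hd) i
  have hsub : {θ | θ ∈ dCylinder d i k ∧ V θ} ⊆
      ((d : ℝ) ^ i * ·) ⁻¹' ((fun y => y + -(k : ℝ)) ⁻¹' T) := by
    rintro θ ⟨hθ, hV⟩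
    have h1 := (div_le_iff₀ hd0).1 hθ.1
    have h2 := (lt_div_iff₀ hd0).1 hθ.2
    refine h _ ⟨by linarith, by linarith⟩ ?_
    rwa [show ((k : ℝ) + ((d : ℝ) ^ i * θ + -(k : ℝ))) / (d : ℝ) ^ i = θ by field_simp; ring]
  refine (measure_mono hsub).trans ?_
  rw [Real.volume_preimage_mul_left hd0.ne', measure_preimage_add_right,
    abs_of_pos (inv_pos.2 hd0), mul_comm b, ENNReal.ofReal_mul (by positivity), one_div]
  gcongr

end Cylinders

section Supermartingale

open Classical in
/-- The logarithm of the one-step factor of the exponential supermartingale: it is positive when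
the rare event `V` occurs together with `S`, and slightly negative whenever `S` occurs. -/
noncomputable def excess (q : ℝ) (S V : Prop) : ℝ :=
  (if S ∧ V then 1 else 0) - if S then 2 * q else 0

variable {d : ℕ} {q : ℝ}

/-- The conditional expectation of the exponential of the excess is at most `1`, since `1 + (e - 1)
q ≤ exp (2 q)`. -/
lemma lintegral_mul_exp_excess_le (hd : 1 ≤ d) {i : ℕ} {G : ℝ → ENNReal} (hG : ConstOnCyl d i G)
    {S V : ℝ → Prop} (hS : ConstOnCyl d i S) (hV : MeasurableSet {θ | V θ}) (hq : 0 ≤ q)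
    (hb : ∀ θ ∈ Ico (0 : ℝ) 1, S θ → volume {θ' | θ' ∈ dCylinder d i (cylIndex d i θ) ∧ V θ'} ≤
      ENNReal.ofReal (q * (1 / (d : ℝ) ^ i))) :
    ∫⁻ θ in Ico (0 : ℝ) 1, G θ * ENNReal.ofReal (Real.exp (excess q (S θ) (V θ))) ≤
      ∫⁻ θ in Ico (0 : ℝ) 1, G θ := by
  have hd0 : (0 : ℝ) < (d : ℝ) ^ i := pow_pos (by exact_mod_cast hd) i
  have hm : ∀ k ∈ Finset.range (d ^ i), MeasurableSet (dCylinder d i k) := fun k _ => measurableSet_Ico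
  rw [Ico_eq_biUnion_cylinder hd i,
    lintegral_biUnion_finset (pairwiseDisjoint_cylinder hd i _) hm,
    lintegral_biUnion_finset (pairwiseDisjoint_cylinder hd i _) hm]
  refine Finset.sum_le_sum fun k hk => ?_
  set θ₀ : ℝ := k / (d : ℝ) ^ i with hθ₀
  have hθ₀k : θ₀ ∈ dCylinder d i k := by
    refine ⟨le_rfl, ?_⟩
    rw [hθ₀]; gcongr; linarith
  have hθ₀I : θ₀ ∈ Ico (0 : ℝ) 1 := by
    rw [Ico_eq_biUnion_cylinder hd i]; exact mem_biUnion hk hθ₀k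
  have hidx := ((mem_cylinder_iff hd).1 hθ₀k).2
  have heq : ∀ θ ∈ dCylinder d i k, cylIndex d i θ = cylIndex d i θ₀ := fun θ hθ => by
    rw [hidx, ((mem_cylinder_iff hd).1 hθ).2]
  by_cases hS0 : S θ₀
  · rw [setLIntegral_congr_fun (g := fun θ => G θ₀ * (ENNReal.ofReal (Real.exp (-(2 * q))) +
        {θ | V θ}.indicator (fun _ => ENNReal.ofReal ((Real.exp 1 - 1) * Real.exp (-(2 * q)))) θ))
        (hm k hk) ?_,
      setLIntegral_congr_fun (g := fun _ => G θ₀) (f := G) (hm k hk)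
        fun θ hθ => hG _ _ (heq θ hθ)]
    · have hmeas : Measurable fun θ => ENNReal.ofReal (Real.exp (-(2 * q))) +
          {θ | V θ}.indicator
            (fun _ => ENNReal.ofReal ((Real.exp 1 - 1) * Real.exp (-(2 * q)))) θ :=
        (measurable_const.indicator hV).const_add _
      rw [lintegral_const_mul _ hmeas, lintegral_const]
      gcongr
      rw [lintegral_add_left measurable_const, lintegral_const, lintegral_indicator_const hV,
        Measure.restrict_apply MeasurableSet.univ, univ_inter, Measure.restrict_apply hV]
      have h1 := hb θ₀ hθ₀I hS0
      rw [hidx] at h1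
      have h2 : {θ | V θ} ∩ dCylinder d i k = {θ' | θ' ∈ dCylinder d i k ∧ V θ'} := by
        ext θ; exact and_comm
      have he : 0 ≤ Real.exp 1 - 1 := by linarith [Real.add_one_le_exp 1]
      have he2 : Real.exp 1 - 1 ≤ 2 := by linarith [Real.exp_one_lt_d9]
      rw [h2]
      refine (add_le_add_right (mul_le_mul_right h1 _) _).trans ?_
      rw [volume_cylinder, ← ENNReal.ofReal_mul (Real.exp_pos _).le,
        ← ENNReal.ofReal_mul (by positivity), ← ENNReal.ofReal_add (by positivity) (by positivity)]
      refine ENNReal.ofReal_le_ofReal ?_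
      have h3 : Real.exp (-(2 * q)) * (1 + (Real.exp 1 - 1) * q) ≤ 1 := by
        calc _ ≤ Real.exp (-(2 * q)) * Real.exp (2 * q) := by
              gcongr
              nlinarith [Real.add_one_le_exp (2 * q)]
          _ = 1 := by rw [← Real.exp_add]; simp
      have h4 : 0 ≤ 1 / (d : ℝ) ^ i := by positivity
      nlinarith
    · intro θ hθ
      have hSθ : S θ := (hS _ _ (heq θ hθ)) ▸ hS0
      simp only [hG _ _ (heq θ hθ), excess, if_pos hSθ]
      congr 1
      by_cases hVθ : V θ
      · rw [if_pos ⟨hSθ, hVθ⟩, indicator_of_mem (by exact hVθ),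
          ← ENNReal.ofReal_add (by positivity)
          (mul_nonneg (by linarith [Real.add_one_le_exp 1]) (Real.exp_pos _).le)]
        congr 1
        rw [sub_eq_add_neg, Real.exp_add]; ring
      · rw [if_neg fun h => hVθ h.2, indicator_of_notMem (by exact hVθ), add_zero, zero_sub]
  · refine le_of_eq (setLIntegral_congr_fun (hm k hk) fun θ hθ => ?_)
    have hSθ : ¬S θ := fun h => hS0 ((hS _ _ (heq θ hθ)) ▸ h)
    simp [excess, hSθ]

variable {S V : ℕ → ℝ → Prop} {j : ℕ}

/-- Along indices with gaps `j`, the exponentials of the accumulated excess have integral at most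
`1`. -/
lemma lintegral_exp_sum_excess_le (hd : 1 ≤ d) (hS : ∀ i, ConstOnCyl d i (S i))
    (hV : ∀ i, ConstOnCyl d (i + j) (V i)) (hq : 0 ≤ q)
    (hb : ∀ i, ∀ θ ∈ Ico (0 : ℝ) 1, S i θ →
      volume {θ' | θ' ∈ dCylinder d i (cylIndex d i θ) ∧ V i θ'} ≤
        ENNReal.ofReal (q * (1 / (d : ℝ) ^ i))) (r T : ℕ) :
    ∫⁻ θ in Ico (0 : ℝ) 1, ENNReal.ofReal (Real.exp
      (∑ t ∈ Finset.range T, excess q (S (r + t * j) θ) (V (r + t * j) θ))) ≤ 1 := by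
  induction T with
  | zero => simp
  | succ T ih =>
    refine le_trans (le_of_eq ?_) ((lintegral_mul_exp_excess_le hd (i := r + T * j)
      (S := S (r + T * j)) (V := V (r + T * j)) ?_ (hS _) (hV _).measurableSet hq (hb _)).trans ih)
    · refine lintegral_congr fun θ => ?_
      rw [Finset.sum_range_succ, Real.exp_add, ENNReal.ofReal_mul (Real.exp_pos _).le]
    · intro θ θ' h
      beta_reduce
      congr 2
      refine Finset.sum_congr rfl fun t ht => ?_
      have h1 : t * j + j ≤ T * j := by
        have := Finset.mem_range.1 ht
        calc t * j + j = (t + 1) * j := by ring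
          _ ≤ T * j := Nat.mul_le_mul_right j this
      rw [(hS (r + t * j)).mono hd (by lia : r + t * j ≤ r + T * j) θ θ' h,
        (hV (r + t * j)).mono hd (by lia : r + t * j + j ≤ r + T * j) θ θ' h]

/-- Markov's inequality for the supermartingale. -/
lemma volume_sum_excess_ge_le (hd : 1 ≤ d) (hS : ∀ i, ConstOnCyl d i (S i))
    (hV : ∀ i, ConstOnCyl d (i + j) (V i)) (hq : 0 ≤ q)
    (hb : ∀ i, ∀ θ ∈ Ico (0 : ℝ) 1, S i θ →
      volume {θ' | θ' ∈ dCylinder d i (cylIndex d i θ) ∧ V i θ'} ≤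
        ENNReal.ofReal (q * (1 / (d : ℝ) ^ i))) (r T : ℕ) (s : ℝ) :
    volume {θ | θ ∈ Ico (0 : ℝ) 1 ∧
      s ≤ ∑ t ∈ Finset.range T, excess q (S (r + t * j) θ) (V (r + t * j) θ)} ≤
      ENNReal.ofReal (Real.exp (-s)) := by
  set X : ℝ → ℝ := fun θ => ∑ t ∈ Finset.range T, excess q (S (r + t * j) θ) (V (r + t * j) θ)
    with hX
  have hXm : Measurable fun θ => ENNReal.ofReal (Real.exp (X θ)) := by
    refine ENNReal.measurable_ofReal.comp (Real.measurable_exp.comp ?_)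
    refine Finset.measurable_sum _ fun t _ => ?_
    have h1 := (hS (r + t * j)).measurableSet
    have h2 := (hV (r + t * j)).measurableSet
    exact (Measurable.ite (h1.inter h2) measurable_const measurable_const).sub
      (Measurable.ite h1 measurable_const measurable_const)
  have h1 := mul_meas_ge_le_lintegral (μ := volume.restrict (Ico (0 : ℝ) 1)) hXm
    (ENNReal.ofReal (Real.exp s))
  have h2 := h1.trans (lintegral_exp_sum_excess_le hd hS hV hq hb r T)
  have h3 : {θ | θ ∈ Ico (0 : ℝ) 1 ∧ s ≤ X θ} ⊆
      {θ | ENNReal.ofReal (Real.exp s) ≤ ENNReal.ofReal (Real.exp (X θ))} ∩ Ico 0 1 :=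
    fun θ h => ⟨ENNReal.ofReal_le_ofReal (Real.exp_le_exp.2 h.2), h.1⟩
  refine (measure_mono h3).trans ((Measure.le_restrict_apply _ _).trans ?_)
  rw [Real.exp_neg, ENNReal.ofReal_inv_of_pos (Real.exp_pos _)]
  rw [ENNReal.le_inv_iff_mul_le, mul_comm]
  exact h2

lemma sum_range_mul_eq (f : ℕ → ℝ) (n j : ℕ) :
    ∑ i ∈ Finset.range (n * j), f i =
      ∑ r ∈ Finset.range j, ∑ t ∈ Finset.range n, f (r + t * j) := by
  rw [Finset.sum_comm]
  induction n with
  | zero => simp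
  | succ n ih =>
    rw [Nat.succ_mul, Finset.sum_range_add, ih, Finset.sum_range_succ]
    simp only [add_comm]

/-- Up to an event of exponentially small measure, the number of occurrences of `V` together with
`S` is at most proportional to the number of occurrences of `S`. -/
lemma volume_count_gt_le (hd : 1 ≤ d) (hS : ∀ i, ConstOnCyl d i (S i)) (hj : 1 ≤ j)
    (hV : ∀ i, ConstOnCyl d (i + j) (V i)) (hq : 0 ≤ q)
    (hb : ∀ i, ∀ θ ∈ Ico (0 : ℝ) 1, S i θ →
      volume {θ' | θ' ∈ dCylinder d i (cylIndex d i θ) ∧ V i θ'} ≤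
        ENNReal.ofReal (q * (1 / (d : ℝ) ^ i))) (n : ℕ) (s : ℝ) :
    volume {θ | θ ∈ Ico (0 : ℝ) 1 ∧
      2 * q * countBefore (fun i => S i θ) n + j * s < countBefore (fun i => S i θ ∧ V i θ) n} ≤
      j * ENNReal.ofReal (Real.exp (-s)) := by
  set S' : ℕ → ℝ → Prop := fun i θ => i < n ∧ S i θ with hS'
  have hS'c : ∀ i, ConstOnCyl d i (S' i) := fun i θ θ' h => by
    simp only [hS', hS i θ θ' h]
  -- The event `V i` is determined only at rank `i + j`, so the times are split into residue classes
  -- modulo `j`; the condition `i < n` in `S'` lets all classes run over `n` steps.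
  have hcover : {θ | θ ∈ Ico (0 : ℝ) 1 ∧
      2 * q * countBefore (fun i => S i θ) n + j * s < countBefore (fun i => S i θ ∧ V i θ) n} ⊆
      ⋃ r ∈ Finset.range j, {θ | θ ∈ Ico (0 : ℝ) 1 ∧
        s ≤ ∑ t ∈ Finset.range n, excess q (S' (r + t * j) θ) (V (r + t * j) θ)} := by
    rintro θ ⟨hθ, hlt⟩
    by_contra hcon
    simp only [mem_iUnion, not_exists, Finset.mem_range, mem_ofPred_eq, not_and, not_le] at hcon
    have h1 : ∑ i ∈ Finset.range (n * j), excess q (S' i θ) (V i θ) ≤ j * s := by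
      rw [sum_range_mul_eq]
      refine (Finset.sum_le_card_nsmul _ _ s fun r hr =>
        (hcon r (Finset.mem_range.1 hr) hθ).le).trans (le_of_eq ?_)
      rw [Finset.card_range, nsmul_eq_mul]
    have h2 : ∑ i ∈ Finset.range (n * j), excess q (S' i θ) (V i θ) =
        ∑ i ∈ Finset.range n, excess q (S i θ) (V i θ) := by
      have h3 : Finset.range n ⊆ Finset.range (n * j) :=
        Finset.range_mono (Nat.le_mul_of_pos_right n hj)
      rw [← Finset.sum_subset h3]
      · refine Finset.sum_congr rfl fun i hi => ?_
        have := Finset.mem_range.1 hi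
        simp [hS', this]
      · intro i _ hi
        have : ¬i < n := fun h => hi (Finset.mem_range.2 h)
        simp [hS', excess, this]
    have h3 : ∑ i ∈ Finset.range n, excess q (S i θ) (V i θ) =
        countBefore (fun i => S i θ ∧ V i θ) n - 2 * q * countBefore (fun i => S i θ) n := by
      simp only [excess, Finset.sum_sub_distrib, countBefore, Nat.cast_sum, Finset.mul_sum]
      congr 1
      · exact Finset.sum_congr rfl fun i _ => by split_ifs <;> simp
      · exact Finset.sum_congr rfl fun i _ => by split_ifs <;> simp
    linarith
  refine (measure_mono hcover).trans ((measure_biUnion_finset_le _ _).trans ?_)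
  refine (Finset.sum_le_card_nsmul _ _ (ENNReal.ofReal (Real.exp (-s))) fun r _ =>
    volume_sum_excess_ge_le hd hS'c hV hq (fun i θ hθ h => hb i θ hθ h.2) r n s).trans ?_
  rw [Finset.card_range, nsmul_eq_mul]

end Supermartingale

/-! ### Counts along curve families -/

namespace CurveFamily

variable {D : SkewData} {α K S γ : ℝ} {x : ℕ → ℝ → ℝ}

/-- The image curve over the cylinder of rank `i` of `θ` meets the critical region. -/
def Hit (D : SkewData) (α : ℝ) (x : ℕ → ℝ → ℝ) (i : ℕ) (θ : ℝ) : Prop :=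
  ∃ τ ∈ Icc (0 : ℝ) 1, |x i ((cylIndex D.d i θ + τ) / (D.d : ℝ) ^ i)| ≤ D.threshold α

/-- The image curve over the cylinder of rank `i + j` of `θ` comes `α d⁻ʲ`-close to the critical
point at time `i`. -/
def Near (D : SkewData) (α : ℝ) (x : ℕ → ℝ → ℝ) (j i : ℕ) (θ : ℝ) : Prop :=
  ∃ τ ∈ Icc (0 : ℝ) 1, |x i ((cylIndex D.d (i + j) θ + τ) / (D.d : ℝ) ^ (i + j))| ≤
    α * (1 / (D.d : ℝ)) ^ j

/-- A passage of length `N` starts at time `i`. -/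
def Start (D : SkewData) (α : ℝ) (x : ℕ → ℝ → ℝ) (N i : ℕ) (θ : ℝ) : Prop :=
  IsStart N (fun i => Hit D α x i θ) i

/-- A passage of length `N` that starts at time `i` is followed by a hit within time `M`. -/
def Returns (D : SkewData) (α : ℝ) (x : ℕ → ℝ → ℝ) (N M i : ℕ) (θ : ℝ) : Prop :=
  ∃ l < M, Hit D α x (i + N + l) θ

lemma one_le_d (D : SkewData) : 1 ≤ D.d := by have := D.two_le_d; lia

lemma constOnCyl_hit (i : ℕ) : ConstOnCyl D.d i (Hit D α x i) := fun θ θ' h => by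
  simp only [Hit, h]

lemma constOnCyl_near (j i : ℕ) : ConstOnCyl D.d (i + j) (Near D α x j i) := fun θ θ' h => by
  simp only [Near, h]

lemma constOnCyl_start (N i : ℕ) : ConstOnCyl D.d i (Start D α x N i) := fun θ θ' h => by
  have h1 : ∀ i' ≤ i, Hit D α x i' θ ↔ Hit D α x i' θ' := fun i' hi' => by
    rw [(constOnCyl_hit i').mono (one_le_d D) hi' θ θ' h]
  simp only [Start, IsStart, clock_congr (n := i) fun i' hi' => h1 i' hi'.le, h1 i le_rfl]

lemma constOnCyl_returns (N M i : ℕ) :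
    ConstOnCyl D.d (i + (N + M)) (Returns D α x N M i) := fun θ θ' h => by
  refine propext (exists_congr fun l => and_congr_right fun hl => ?_)
  rw [(constOnCyl_hit (i + N + l)).mono (one_le_d D) (by lia : i + N + l ≤ i + (N + M)) θ θ' h]

lemma exists_coord (D : SkewData) (i : ℕ) {θ : ℝ} (hθ : 0 ≤ θ) :
    ∃ τ ∈ Ico (0 : ℝ) 1, θ = (cylIndex D.d i θ + τ) / (D.d : ℝ) ^ i := by
  have hd : (0 : ℝ) < (D.d : ℝ) ^ i := pow_pos D.d_pos i
  refine ⟨(D.d : ℝ) ^ i * θ - cylIndex D.d i θ, ⟨?_, ?_⟩, ?_⟩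
  · exact sub_nonneg.2 (Nat.floor_le (by positivity))
  · have := Nat.lt_floor_add_one ((D.d : ℝ) ^ i * θ)
    rw [cylIndex]; linarith
  · field_simp; ring

variable (hx : CurveFamily D α K S γ x)

include hx

lemma dist_le (i : ℕ) (s s' : ℝ) : |x i s - x i s'| ≤ K * α * ((D.d : ℝ) ^ i * |s - s'|) := by
  have hd : (0 : ℝ) < (D.d : ℝ) ^ i := pow_pos D.d_pos i
  have h := hx.lip i 0 ((D.d : ℝ) ^ i * s) ((D.d : ℝ) ^ i * s')
  rwa [Nat.cast_zero, zero_add, zero_add, mul_div_cancel_left₀ _ hd.ne',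
    mul_div_cancel_left₀ _ hd.ne', ← mul_sub, abs_mul, abs_of_pos hd] at h

/-- The oscillation of `x i` on a cylinder of rank `i + j`. -/
lemma dist_le_of_cyl (hK : 0 ≤ K) (hα : 0 ≤ α) (i j : ℕ) {θ τ : ℝ} (hθ : 0 ≤ θ)
    (hτ : τ ∈ Icc (0 : ℝ) 1) :
    |x i θ - x i ((cylIndex D.d (i + j) θ + τ) / (D.d : ℝ) ^ (i + j))| ≤
      K * α * (1 / (D.d : ℝ)) ^ j := by
  have hd := D.d_pos
  obtain ⟨τ', hτ', e⟩ := exists_coord D (i + j) hθ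
  refine (hx.dist_le i _ _).trans (mul_le_mul_of_nonneg_left ?_ (by positivity))
  set k : ℝ := (cylIndex D.d (i + j) θ : ℝ) with hk
  have e2 : θ - (k + τ) / (D.d : ℝ) ^ (i + j) = (τ' - τ) / (D.d : ℝ) ^ (i + j) := by
    nth_rewrite 1 [e]; ring
  rw [e2, abs_div, abs_of_pos (pow_pos hd (i + j)), one_div_pow, pow_add]
  have h1 : |τ' - τ| ≤ 1 := by
    rw [abs_le]; constructor <;> linarith [hτ.1, hτ.2, hτ'.1, hτ'.2]
  calc (D.d : ℝ) ^ i * (|τ' - τ| / ((D.d : ℝ) ^ i * (D.d : ℝ) ^ j)) = |τ' - τ| / (D.d : ℝ) ^ j := by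
        field_simp
    _ ≤ _ := by gcongr

omit hx in
lemma threshold_le_of_not_hit {i : ℕ} {θ : ℝ} (hθ : 0 ≤ θ) (h : ¬Hit D α x i θ) :
    D.threshold α ≤ |x i θ| := by
  obtain ⟨τ, hτ, e⟩ := exists_coord D i hθ
  by_contra! hlt
  exact h ⟨τ, ⟨hτ.1, hτ.2.le⟩, by rw [← e]; exact hlt.le⟩

omit hx in
lemma le_of_not_near {i j : ℕ} {θ : ℝ} (hθ : 0 ≤ θ) (h : ¬Near D α x j i θ) :
    α * (1 / (D.d : ℝ)) ^ j ≤ |x i θ| := by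
  obtain ⟨τ, hτ, e⟩ := exists_coord D (i + j) hθ
  by_contra! hlt
  exact h ⟨τ, ⟨hτ.1, hτ.2.le⟩, by rw [← e]; exact hlt.le⟩

lemma le_of_hit (hK : 0 ≤ K) (hα : 0 ≤ α) (hKα : K * α ≤ D.threshold α) {i : ℕ} {θ : ℝ}
    (hθ : 0 ≤ θ) (h : Hit D α x i θ) : |x i θ| ≤ 2 * D.threshold α := by
  obtain ⟨τ, hτ, h1⟩ := h
  have h2 := hx.dist_le_of_cyl hK hα i 0 hθ hτ
  rw [pow_zero, mul_one, add_zero] at h2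
  have h3 := abs_sub_abs_le_abs_sub (x i θ) (x i ((cylIndex D.d i θ + τ) / (D.d : ℝ) ^ i))
  linarith

lemma le_of_near (hK : 0 ≤ K) (hα : 0 ≤ α) {i j : ℕ} {θ : ℝ} (hθ : 0 ≤ θ)
    (h : Near D α x j i θ) : |x i θ| ≤ α * ((1 + K) * (1 / (D.d : ℝ)) ^ j) := by
  obtain ⟨τ, hτ, h1⟩ := h
  have h2 := hx.dist_le_of_cyl hK hα i j hθ hτ
  have h3 := abs_sub_abs_le_abs_sub (x i θ)
    (x i ((cylIndex D.d (i + j) θ + τ) / (D.d : ℝ) ^ (i + j)))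
  linarith

omit hx in
/-- A bound for the conditional probability of `Near j i`. -/
noncomputable def nearBound (D : SkewData) (K S γ : ℝ) (j : ℕ) : ℝ :=
  (S + 1) * ((1 + K) * (1 / (D.d : ℝ)) ^ j) ^ γ

omit hx in
lemma nearBound_nonneg (hK : 0 ≤ K) (hS : 0 ≤ S) (j : ℕ) : 0 ≤ nearBound D K S γ j := by
  unfold nearBound; positivity

omit hx in
lemma nearBound_eq (hK : 0 ≤ K) (j : ℕ) :
    nearBound D K S γ j = (S + 1) * (1 + K) ^ γ * ((1 / (D.d : ℝ)) ^ γ) ^ j := by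
  have hd := D.d_pos
  rw [nearBound, Real.mul_rpow (by positivity) (by positivity), ← mul_assoc]
  congr 1
  rw [← Real.rpow_natCast, ← Real.rpow_natCast, ← Real.rpow_mul (by positivity),
    ← Real.rpow_mul (by positivity), mul_comm γ]

omit hx in
lemma rpow_lt_one (hγ : 0 < γ) : 0 ≤ (1 / (D.d : ℝ)) ^ γ ∧ (1 / (D.d : ℝ)) ^ γ < 1 := by
  have hd := D.one_lt_d
  have hd0 := D.d_pos
  exact ⟨by positivity, Real.rpow_lt_one (by positivity) ((div_lt_one hd0).2 hd) hγ⟩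

omit hx in
lemma summable_nearBound (hK : 0 ≤ K) (hγ : 0 < γ) : Summable (nearBound D K S γ) := by
  have h := rpow_lt_one (D := D) hγ
  simp only [funext (nearBound_eq (D := D) (S := S) (γ := γ) hK)]
  exact (summable_geometric_of_lt_one h.1 h.2).mul_left _

/-- On every cylinder of rank `i`, the proportion of points at which the curve comes `α d⁻ʲ`-close
to `0` is at most `nearBound j`. The summand `1` in `S + 1` makes the bound trivial when the scale
`(1 + K) d⁻ʲ` exceeds `1`. -/
lemma volume_near_le (hK : 0 ≤ K) (hS : 0 ≤ S) (hγ : 0 < γ) (hα : 0 ≤ α) (j i k : ℕ) :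
    volume {θ | θ ∈ dCylinder D.d i k ∧ Near D α x j i θ} ≤
      ENNReal.ofReal (nearBound D K S γ j * (1 / (D.d : ℝ) ^ i)) := by
  have hd := D.d_pos
  set ε := (1 + K) * (1 / (D.d : ℝ)) ^ j with hε
  have hε0 : 0 < ε := by positivity
  rcases le_or_gt ε 1 with h1 | h1
  · refine volume_cylinder_inter_le (one_le_d D)
      (T := {τ | τ ∈ Icc (0 : ℝ) 1 ∧ |x i ((k + τ) / (D.d : ℝ) ^ i)| ≤ α * ε})
      ((hx.sub i k ε hε0 h1).trans (ENNReal.ofReal_le_ofReal ?_)) fun τ hτ h => ?_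
    · rw [nearBound]
      have : 0 ≤ ε ^ γ := by positivity
      nlinarith
    · exact ⟨⟨hτ.1, hτ.2.le⟩, hx.le_of_near hK hα (div_nonneg (by linarith [hτ.1,
        (Nat.cast_nonneg k : (0 : ℝ) ≤ k)]) (by positivity)) h⟩
  · refine volume_cylinder_inter_le (one_le_d D) (T := Icc 0 1) ?_ fun τ hτ _ => ⟨hτ.1, hτ.2.le⟩
    rw [Real.volume_Icc]
    refine ENNReal.ofReal_le_ofReal ?_
    rw [nearBound, ← hε]
    have := Real.one_le_rpow h1.le hγ.le
    nlinarith

lemma volume_near_le_total (hK : 0 ≤ K) (hS : 0 ≤ S) (hγ : 0 < γ) (hα : 0 ≤ α) (j i : ℕ) :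
    volume {θ | θ ∈ Ico (0 : ℝ) 1 ∧ Near D α x j i θ} ≤ ENNReal.ofReal (nearBound D K S γ j) := by
  have hd : (0 : ℝ) < (D.d : ℝ) ^ i := pow_pos D.d_pos i
  have hsub : {θ | θ ∈ Ico (0 : ℝ) 1 ∧ Near D α x j i θ} ⊆
      ⋃ k ∈ Finset.range (D.d ^ i), {θ | θ ∈ dCylinder D.d i k ∧ Near D α x j i θ} := by
    rintro θ ⟨h1, h2⟩
    rw [Ico_eq_biUnion_cylinder (one_le_d D) i] at h1
    obtain ⟨k, hk, h3⟩ := mem_iUnion₂.1 h1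
    exact mem_biUnion hk ⟨h3, h2⟩
  refine (measure_mono hsub).trans ((measure_biUnion_finset_le _ _).trans ?_)
  refine (Finset.sum_le_card_nsmul _ _ _ fun k _ =>
    hx.volume_near_le hK hS hγ hα j i k).trans (le_of_eq ?_)
  rw [Finset.card_range, ← ENNReal.ofReal_nsmul, nsmul_eq_mul]
  congr 1
  push_cast
  field_simp

/-- On every cylinder on which a passage starts, the proportion of points with an early return is at
most `q`. -/
lemma volume_returns_le (hK : 0 ≤ K) (hα : 0 ≤ α) (hKα : K * α ≤ D.threshold α) {N M : ℕ} {q : ℝ}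
    (hshort : ∀ i k : ℕ, (∃ τ ∈ Icc (0 : ℝ) 1, |x i ((k + τ) / (D.d : ℝ) ^ i)| ≤ D.threshold α) →
      volume {τ | τ ∈ Icc (0 : ℝ) 1 ∧
        ∃ l < M, |x (i + N + l) ((k + τ) / (D.d : ℝ) ^ i)| ≤ 2 * D.threshold α} ≤
        ENNReal.ofReal q) (i : ℕ) {θ : ℝ} (h : Start D α x N i θ) :
    volume {θ' | θ' ∈ dCylinder D.d i (cylIndex D.d i θ) ∧ Returns D α x N M i θ'} ≤
      ENNReal.ofReal (q * (1 / (D.d : ℝ) ^ i)) := by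
  have hd := D.d_pos
  refine volume_cylinder_inter_le (one_le_d D) (hshort i _ h.2) fun τ hτ h' => ?_
  obtain ⟨l, hl, hhit⟩ := h'
  exact ⟨⟨hτ.1, hτ.2.le⟩, l, hl, hx.le_of_hit hK hα hKα (div_nonneg (by linarith [hτ.1,
    (Nat.cast_nonneg (cylIndex D.d i θ) : (0 : ℝ) ≤ _)]) (by positivity)) hhit⟩

/-- Almost surely, the approaches to the critical point and the early returns obey the bounds that
the conditional probabilities suggest, up to an error of order `n ^ (3 / 4)`. -/
lemma ae_eventually_counts (hK : 0 ≤ K) (hS : 0 ≤ S) (hγ : 0 < γ) (hα : 0 ≤ α)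
    (hKα : K * α ≤ D.threshold α) {N M : ℕ} (hN : 1 ≤ N)
    (hshort : ∀ i k : ℕ, (∃ τ ∈ Icc (0 : ℝ) 1, |x i ((k + τ) / (D.d : ℝ) ^ i)| ≤ D.threshold α) →
      volume {τ | τ ∈ Icc (0 : ℝ) 1 ∧
        ∃ l < M, |x (i + N + l) ((k + τ) / (D.d : ℝ) ^ i)| ≤ 2 * D.threshold α} ≤
        ENNReal.ofReal (1 / 8)) :
    ∀ᵐ θ ∂volume.restrict (Ico (0 : ℝ) 1), ∀ᶠ J : ℕ in atTop, ∀ n < (J + 1) ^ 4,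
      ¬Near D α x J n θ ∧
      (∀ j, 1 ≤ j → j < J → (countBefore (fun i => Start D α x N i θ ∧ Near D α x j i θ) n : ℝ) ≤
        2 * nearBound D K S γ j * countBefore (fun i => Start D α x N i θ) n + j * J) ∧
      (countBefore (fun i => Start D α x N i θ ∧ Returns D α x N M i θ) n : ℝ) ≤
        2 * (1 / 8) * countBefore (fun i => Start D α x N i θ) n + (N + M : ℕ) * J := by
  have hd1 := one_le_d D
  have hS' : ∀ i, ConstOnCyl D.d i (Start D α x N i) := constOnCyl_start N
  -- For the scale `J`, all times `n < (J + 1) ^ 4` are treated together: the polynomial number of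
  -- exceptional events is beaten by the exponential decay in `J`, and the measures are summable.
  set E₁ : ℕ → ℕ → Set ℝ := fun J n => {θ | θ ∈ Ico (0 : ℝ) 1 ∧ Near D α x J n θ} with hE₁
  set E₂ : ℕ → ℕ → ℕ → Set ℝ := fun J n j => {θ | θ ∈ Ico (0 : ℝ) 1 ∧
    2 * nearBound D K S γ j * countBefore (fun i => Start D α x N i θ) n + j * (J : ℝ) <
      countBefore (fun i => Start D α x N i θ ∧ Near D α x j i θ) n} with hE₂
  set E₃ : ℕ → ℕ → Set ℝ := fun J n => {θ | θ ∈ Ico (0 : ℝ) 1 ∧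
    2 * (1 / 8) * countBefore (fun i => Start D α x N i θ) n + (N + M : ℕ) * (J : ℝ) <
      countBefore (fun i => Start D α x N i θ ∧ Returns D α x N M i θ) n} with hE₃
  set E : ℕ → Set ℝ := fun J => ⋃ n ∈ Finset.range ((J + 1) ^ 4),
    (E₁ J n ∪ (⋃ j ∈ Finset.Ico 1 J, E₂ J n j) ∪ E₃ J n) with hE
  set b : ℕ → ℝ := fun J => ((J : ℝ) + 1) ^ 4 *
    (nearBound D K S γ J + ((J : ℝ) + 1) ^ 2 * Real.exp (-J) + (N + M : ℕ) * Real.exp (-J)) with hb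
  have hb0 : ∀ J, 0 ≤ b J := fun J => by
    have := nearBound_nonneg (D := D) (γ := γ) hK hS J
    simp only [hb]; positivity
  have hEb : ∀ J, volume (E J) ≤ ENNReal.ofReal (b J) := by
    intro J
    refine (measure_biUnion_finset_le _ _).trans ?_
    have hn : ∀ n ∈ Finset.range ((J + 1) ^ 4),
        volume (E₁ J n ∪ (⋃ j ∈ Finset.Ico 1 J, E₂ J n j) ∪ E₃ J n) ≤
        ENNReal.ofReal (nearBound D K S γ J + ((J : ℝ) + 1) ^ 2 * Real.exp (-J) +
          (N + M : ℕ) * Real.exp (-J)) := by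
      intro n _
      have hn0 := nearBound_nonneg (D := D) (γ := γ) hK hS
      rw [ENNReal.ofReal_add (by have := hn0 J; positivity) (by positivity),
        ENNReal.ofReal_add (hn0 J) (by positivity)]
      refine (measure_union_le _ _).trans (add_le_add ((measure_union_le _ _).trans
        (add_le_add ?_ ?_)) ?_)
      · exact hx.volume_near_le_total hK hS hγ hα J n
      · refine (measure_biUnion_finset_le _ _).trans ?_
        have hj : ∀ j ∈ Finset.Ico 1 J, volume (E₂ J n j) ≤
            ENNReal.ofReal (((J : ℝ) + 1) * Real.exp (-J)) := by
          intro j hj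
          obtain ⟨h1, h2⟩ := Finset.mem_Ico.1 hj
          refine (volume_count_gt_le hd1 hS' h1 (constOnCyl_near j) (hn0 j)
            (fun i θ _ _ => hx.volume_near_le hK hS hγ hα j i _) n J).trans ?_
          rw [ENNReal.ofReal_mul (by positivity)]
          gcongr
          rw [← ENNReal.ofReal_natCast]
          refine ENNReal.ofReal_le_ofReal ?_
          exact_mod_cast (by lia : j ≤ J + 1)
        refine (Finset.sum_le_card_nsmul _ _ _ hj).trans ?_
        rw [← ENNReal.ofReal_nsmul, nsmul_eq_mul]
        refine ENNReal.ofReal_le_ofReal ?_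
        rw [pow_two, mul_assoc, Nat.card_Ico]
        gcongr
        exact_mod_cast (by lia : J - 1 ≤ J + 1)
      · refine (volume_count_gt_le hd1 hS' (by lia) (constOnCyl_returns N M) (by norm_num)
          (fun i θ _ h => hx.volume_returns_le hK hα hKα hshort i h) n J).trans ?_
        rw [ENNReal.ofReal_mul (by positivity), ENNReal.ofReal_natCast]
    refine (Finset.sum_le_card_nsmul _ _ _ hn).trans (le_of_eq ?_)
    rw [← ENNReal.ofReal_nsmul, nsmul_eq_mul, Finset.card_range]
    congr 1
    simp only [hb]; push_cast; ring
  have hsum : Summable b := by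
    have hgeo : ∀ (k : ℕ) (r : ℝ), 0 < r → r < 1 → Summable fun J : ℕ => ((J : ℝ) + 1) ^ k * r ^ J := by
      intro k r h0 h1
      have h2 := summable_pow_mul_geometric_of_norm_lt_one k (r := r)
        (by rwa [Real.norm_eq_abs, abs_of_pos h0])
      refine (((summable_nat_add_iff 1).2 h2).mul_left r⁻¹).congr fun J => ?_
      push_cast
      rw [pow_succ r]; field_simp
    have he0 := Real.exp_pos (-1)
    have he1 : Real.exp (-1) < 1 := Real.exp_lt_one_iff.2 (by norm_num)
    have hr := rpow_lt_one (D := D) hγ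
    have hr0 : 0 < (1 / (D.d : ℝ)) ^ γ := by have := D.d_pos; positivity
    have hexp : ∀ J : ℕ, Real.exp (-J) = Real.exp (-1) ^ J := fun J => by
      rw [← Real.exp_nat_mul]; congr 1; ring
    refine ((((hgeo 4 _ hr0 hr.2).mul_left ((S + 1) * (1 + K) ^ γ)).add (hgeo 6 _ he0 he1)).add
      ((hgeo 4 _ he0 he1).mul_left ((N + M : ℕ) : ℝ))).congr fun J => ?_
    simp only [hb]
    rw [nearBound_eq hK, hexp]
    ring
  have hfin : ∑' J, volume (E J) ≠ ⊤ := by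
    refine ne_top_of_le_ne_top ?_ (ENNReal.tsum_le_tsum hEb)
    rw [← ENNReal.ofReal_tsum_of_nonneg hb0 hsum]
    exact ENNReal.ofReal_ne_top
  rw [ae_restrict_iff' measurableSet_Ico]
  filter_upwards [ae_eventually_notMem hfin] with θ hθ hI
  filter_upwards [hθ] with J hJ n hn
  have h1 : θ ∉ E₁ J n ∪ (⋃ j ∈ Finset.Ico 1 J, E₂ J n j) ∪ E₃ J n := fun h =>
    hJ (mem_biUnion (Finset.mem_range.2 hn) h)
  refine ⟨fun h => h1 (Or.inl (Or.inl ⟨hI, h⟩)), fun j hj1 hj2 => ?_, ?_⟩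
  · by_contra! h
    exact h1 (Or.inl (Or.inr (mem_biUnion (Finset.mem_Ico.2 ⟨hj1, hj2⟩) ⟨hI, h⟩)))
  · by_contra! h
    exact h1 (Or.inr ⟨hI, h⟩)

end CurveFamily

/-! ### Exponential growth -/

/-- The balance of gains and losses at time `n`. Here `F` is the number of free times, `p` the
number of passages, `r` the number of passages followed by an early return, and `e` the sum of the
logarithmic depths of the passages. At least about three quarters of the passages are followed by
`M` free times, and `M` is so large that half of the gain made there pays for all passages. With `J`
of order `n ^ (1 / 4)` the error `J ^ 3` is `o(n)`. -/
lemma exponent_lower_bound {l Γ Λ Q : ℝ} (hl : 0 < l) (hΛ : 0 ≤ Λ) {N M L : ℕ} (hM : 2 ≤ M)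
    (hM' : Γ + Λ * (2 * Q) ≤ M * (3 / 4) * (l / 2)) :
    ∃ c > 0, ∃ J₀ : ℕ, ∀ (J n : ℕ) (F p r e : ℝ), J₀ ≤ J → J ^ 4 ≤ n → 0 ≤ p → n ≤ F + N * p →
      M * (p - r) ≤ F + M → r ≤ 2 * (1 / 8) * p + L * J → e ≤ 2 * Q * p + J ^ 3 →
      c * n ≤ l * F - (Γ * p + Λ * e) := by
  set c₁ := l / (2 * (N + 1)) with hc₁
  have hc₁0 : 0 < c₁ := by positivity
  set C₂ := l * M * (L + 1) + Λ with hC₂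
  refine ⟨c₁ / 2, half_pos hc₁0, max 1 ⌈2 * C₂ / c₁⌉₊, ?_⟩
  intro J n F p r e hJ hn hp h1 h2 h3 h4
  have hJ1 : (1 : ℝ) ≤ J := by exact_mod_cast (le_max_left _ _).trans hJ
  have hJ2 : C₂ ≤ c₁ / 2 * J := by
    have h : 2 * C₂ / c₁ ≤ J := (Nat.le_ceil _).trans (by exact_mod_cast (le_max_right _ _).trans hJ)
    rw [div_le_iff₀ hc₁0] at h
    linarith
  have hM0 : (2 : ℝ) ≤ M := by exact_mod_cast hM
  have hnJ : (J : ℝ) ^ 4 ≤ n := by exact_mod_cast hn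
  set w : ℝ := L * J + 1 with hw
  have hw0 : 0 ≤ w := by positivity
  have hF : (3 / 4) * M * p - M * w ≤ F := by
    have : (M : ℝ) * (3 / 4 * p - L * J) ≤ M * (p - r) :=
      mul_le_mul_of_nonneg_left (by linarith) (by positivity)
    rw [hw]; linarith
  have hF2 : (Γ + Λ * (2 * Q)) * p - l / 2 * (M * w) ≤ l / 2 * F := by
    have h5 := mul_le_mul_of_nonneg_right hM' hp
    have h6 := mul_le_mul_of_nonneg_left hF (half_pos hl).le
    linarith
  have hp2 : p ≤ F + M * w := by nlinarith
  have hn2 : (n : ℝ) ≤ (N + 1) * F + N * (M * w) := by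
    have := mul_le_mul_of_nonneg_left hp2 (Nat.cast_nonneg (α := ℝ) N)
    linarith
  have hF3 : c₁ * n - l / 2 * (M * w) ≤ l / 2 * F := by
    have h5 : c₁ * ((N : ℝ) + 1) = l / 2 := by rw [hc₁]; field_simp
    have h6 := mul_le_mul_of_nonneg_left hn2 hc₁0.le
    have h7 : c₁ * (N * (M * w)) ≤ l / 2 * (M * w) := by
      rw [← h5]
      have : 0 ≤ c₁ * (M * w) := by positivity
      nlinarith
    have h8 : c₁ * (((N : ℝ) + 1) * F + N * (M * w)) = l / 2 * F + c₁ * (N * (M * w)) := by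
      rw [← h5]; ring
    linarith
  have hw3 : l * (M * w) + Λ * J ^ 3 ≤ C₂ * J ^ 3 := by
    have h5 : (J : ℝ) ≤ J ^ 3 := le_self_pow₀ hJ1 (by norm_num)
    have h6 : w ≤ (L + 1) * J ^ 3 := by
      rw [hw]
      have := mul_le_mul_of_nonneg_left h5 (Nat.cast_nonneg (α := ℝ) L)
      linarith
    have h7 : l * (M * w) ≤ l * (M * ((L + 1) * J ^ 3)) := by gcongr
    rw [hC₂]; linarith
  have hJ4 : C₂ * J ^ 3 ≤ c₁ / 2 * n := by
    calc C₂ * J ^ 3 ≤ c₁ / 2 * J * J ^ 3 := by gcongr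
      _ = c₁ / 2 * J ^ 4 := by ring
      _ ≤ _ := by gcongr
  have h9 := mul_le_mul_of_nonneg_left h4 hΛ
  linarith

lemma le_countBefore {E : ℕ → Prop} {j J : ℕ} (hj : j ≤ J) (h : ∀ i < j, E i) :
    j ≤ countBefore E J := by
  classical
  calc j = ∑ i ∈ Finset.range j, if E i then 1 else 0 := by
        rw [Finset.sum_congr rfl fun i hi => if_pos (h i (Finset.mem_range.1 hi))]; simp
    _ ≤ ∑ i ∈ Finset.range J, if E i then 1 else 0 :=
        Finset.sum_le_sum_of_subset_of_nonneg (Finset.range_mono hj) fun _ _ _ => by positivity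
    _ = countBefore E J := by rw [countBefore]

lemma countBefore_mono {E E' : ℕ → Prop} (h : ∀ i, E i → E' i) (n : ℕ) :
    countBefore E n ≤ countBefore E' n := by
  refine Finset.sum_le_sum fun i _ => ?_
  by_cases h1 : E i
  · simp [h1, h i h1]
  · simp [h1]

lemma countBefore_and_add_not (E E' : ℕ → Prop) (n : ℕ) :
    countBefore (fun i => E i ∧ E' i) n + countBefore (fun i => E i ∧ ¬E' i) n = countBefore E n := by
  rw [countBefore, countBefore, countBefore, ← Finset.sum_add_distrib]
  refine Finset.sum_congr rfl fun i _ => ?_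
  by_cases h1 : E i <;> by_cases h2 : E' i <;> simp [h1, h2]

/-- A passage of depth `j` costs a factor `d⁻ʲ`, that is, `j * log d` in the exponent. -/
lemma exp_neg_le_mul_pow {c d : ℝ} (hc : 0 < c) (hd : 1 < d) {i j : ℕ} (hij : i ≤ j) :
    Real.exp (-(|Real.log c| + Real.log d * j)) ≤ c * (1 / d) ^ i := by
  have hd0 : 0 < d := by linarith
  rw [neg_add, Real.exp_add]
  refine mul_le_mul ?_ ?_ (Real.exp_pos _).le hc.le
  · rw [← Real.le_log_iff_exp_le hc]
    exact neg_abs_le _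
  · rw [← Real.le_log_iff_exp_le (by positivity), Real.log_pow, one_div, Real.log_inv]
    have h1 : (i : ℝ) ≤ j := by exact_mod_cast hij
    have h2 := Real.log_pos hd
    nlinarith

namespace CurveFamily

open Classical in
/-- For small `α`, almost every orbit of a curve family has exponentially growing derivatives. -/
lemma eventually_ae_growth (D : SkewData) {K S γ : ℝ} (hK : 0 < K) (hS : 0 < S) (hγ : 0 < γ) :
    ∀ᶠ α in 𝓝[>] (0 : ℝ), ∀ x, CurveFamily D α K S γ x →
      ∀ᵐ θ ∂volume.restrict (Ico (0 : ℝ) 1), ∃ c > 0, ∀ᶠ n : ℕ in atTop,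
        Real.exp (c * n) ≤ growth (fun i => x i θ) n := by
  have hΦ := D.Φ_pos
  obtain ⟨m, c₄, δ, hm, hc₄, hδ, hgrowth⟩ := D.exists_passage_growth
  have hlm : 0 < Real.log m := Real.log_pos hm
  have hLd : 0 < Real.log D.d := Real.log_pos D.one_lt_d
  set Q := ∑' j, nearBound D K S γ j with hQ
  have hsumm := summable_nearBound (D := D) (S := S) (γ := γ) hK.le hγ
  have hnb := nearBound_nonneg (D := D) (γ := γ) hK.le hS.le
  -- the time `M` within which a return counts as early
  obtain ⟨M, hM2, hM⟩ : ∃ M : ℕ, 2 ≤ M ∧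
      |Real.log c₄| + Real.log D.d * (2 * Q) ≤ M * (3 / 4) * (Real.log m / 2) := by
    obtain ⟨M, hM⟩ := exists_nat_ge ((|Real.log c₄| + Real.log D.d * (2 * Q)) /
      (3 / 4 * (Real.log m / 2)))
    rw [div_le_iff₀ (by positivity)] at hM
    refine ⟨max M 2, le_max_right _ _, hM.trans ?_⟩
    rw [mul_assoc]
    have : (M : ℝ) ≤ (max M 2 : ℕ) := by exact_mod_cast le_max_left _ _
    gcongr
  filter_upwards [self_mem_nhdsWithin, hgrowth, D.exists_isBindingTime,
    D.eventually_mul_le_threshold K,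
    (D.tendsto_threshold.const_mul 2).eventually_lt_const (u := δ) (by rwa [mul_zero]),
    D.volume_short_return_le K S γ hK.le M
      (ENNReal.ofReal_pos.2 (by norm_num : (0 : ℝ) < 1 / 8))] with α hα hgr hbind hKα hthr hshort
  intro x hx
  replace hα : 0 < α := hα
  obtain ⟨k, hk⟩ := hbind
  obtain ⟨c', hc', hgr⟩ := hgr hthr.le
  have hN : 1 ≤ k + 1 := by lia
  obtain ⟨c, hc, J₀, hexp⟩ := exponent_lower_bound (L := k + 1 + M) (N := k + 1) hlm hLd.le hM2 hM
  filter_upwards [hx.ae_eventually_counts hK.le hS.le hγ hα.le hKα hN (hshort x hx k hk),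
    ae_restrict_mem measurableSet_Ico] with θ hθ hθI
  obtain ⟨J₁, hJ₁⟩ := eventually_atTop.1 hθ
  refine ⟨c / 2, half_pos hc, ?_⟩
  have hlog : ∀ᶠ n : ℕ in atTop, -Real.log c' ≤ c / 2 * n :=
    (tendsto_natCast_atTop_atTop.const_mul_atTop (half_pos hc)).eventually_ge_atTop _
  filter_upwards [hlog, eventually_ge_atTop ((max J₀ J₁) ^ 4)] with n hn1 hn2
  -- `J` is the integral part of the fourth root of `n`
  set J := Nat.sqrt (Nat.sqrt n) with hJ
  have hJn : J ^ 4 ≤ n := by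
    calc J ^ 4 = (J * J) * (J * J) := by ring
      _ ≤ Nat.sqrt n * Nat.sqrt n := Nat.mul_le_mul (Nat.sqrt_le _) (Nat.sqrt_le _)
      _ ≤ n := Nat.sqrt_le _
  have hnJ : n < (J + 1) ^ 4 := by
    have h1 : Nat.sqrt n < (J + 1) * (J + 1) := Nat.lt_succ_sqrt _
    have h2 : n < (Nat.sqrt n + 1) * (Nat.sqrt n + 1) := Nat.lt_succ_sqrt _
    calc n < (Nat.sqrt n + 1) * (Nat.sqrt n + 1) := h2
      _ ≤ ((J + 1) * (J + 1)) * ((J + 1) * (J + 1)) := Nat.mul_le_mul h1 h1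
      _ = _ := by ring
  have hJmax : max J₀ J₁ ≤ J := by
    by_contra! hlt
    exact absurd (hnJ.trans_le (Nat.pow_le_pow_left hlt 4)) (not_lt.2 hn2)
  have hgood := hJ₁ J ((le_max_right _ _).trans hJmax)
  obtain ⟨-, hnear, hret⟩ := hgood n hnJ
  set start : ℕ → Prop := fun i => Start D α x (k + 1) i θ with hstart
  set p : ℝ := (countBefore start n : ℝ) with hp
  set cnt : ℕ → ℕ := fun i => countBefore (fun j => Near D α x j i θ) J with hcnt
  set e : ℝ := ∑ i ∈ Finset.range n, if start i then (cnt i : ℝ) else 0 with he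
  -- The depth of a passage at time `i` is bounded by the number of levels `j < J` with `Near j i`:
  -- the first level `j` without `Near j i` gives `d⁻ʲ ≤ |x i| / α`.
  have hprod := exp_le_passageProduct (N := k + 1) (hit := fun i => Hit D α x i θ) (m := m)
    (w := fun i => c₄ * |x i θ| / α) (Γ := |Real.log c₄|) (L := Real.log D.d) (cnt := cnt)
    (by linarith) n (by
      intro i hi _
      have hex : ∃ j, ¬Near D α x j i θ := ⟨J, (hgood i (hi.trans hnJ)).1⟩
      have h1 : Nat.find hex ≤ cnt i := le_countBefore (Nat.find_min' hex (hgood i (hi.trans hnJ)).1)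
        fun j hj => not_not.1 (Nat.find_min hex hj)
      refine (exp_neg_le_mul_pow hc₄ D.one_lt_d h1).trans ?_
      rw [mul_div_assoc]
      refine mul_le_mul_of_nonneg_left ?_ hc₄.le
      rw [le_div_iff₀ hα, mul_comm]
      exact le_of_not_near hθI.1 (Nat.find_spec hex))
  -- Interchanging the sums, `e` counts the passages with `Near j` over all levels `j`. Level `0`
  -- needs no probabilistic bound since `nearBound 0 ≥ 1`.
  have he_le : e ≤ 2 * Q * p + J ^ 3 := by
    have h1 : e = ∑ j ∈ Finset.range J, (countBefore (fun i => start i ∧ Near D α x j i θ) n : ℝ) := by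
      simp only [countBefore, Nat.cast_sum]
      rw [Finset.sum_comm, he]
      refine Finset.sum_congr rfl fun i _ => ?_
      by_cases h : start i
      · simp [h, hcnt, countBefore]
      · simp [h]
    have h2 : ∀ j ∈ Finset.range J, (countBefore (fun i => start i ∧ Near D α x j i θ) n : ℝ) ≤
        2 * nearBound D K S γ j * p + (J : ℝ) * J := by
      intro j hj
      have hj' := Finset.mem_range.1 hj
      rcases Nat.eq_zero_or_pos j with rfl | hj0
      · have h3 : (countBefore (fun i => start i ∧ Near D α x 0 i θ) n : ℝ) ≤ p := by
          rw [hp, Nat.cast_le]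
          exact countBefore_mono (fun i (h : start i ∧ Near D α x 0 i θ) => h.1) n
        have h4 : 1 ≤ nearBound D K S γ 0 := by
          rw [nearBound, pow_zero, mul_one]
          have := Real.one_le_rpow (by linarith : 1 ≤ 1 + K) hγ.le
          nlinarith
        have h5 : 0 ≤ p := Nat.cast_nonneg _
        have h6 : (0 : ℝ) ≤ (J : ℝ) * J := by positivity
        nlinarith
      · refine (hnear j hj0 hj').trans ?_
        have : (j : ℝ) * J ≤ (J : ℝ) * J := by gcongr
        linarith
    rw [h1]
    refine (Finset.sum_le_sum h2).trans ?_
    rw [Finset.sum_add_distrib, Finset.sum_const, Finset.card_range, nsmul_eq_mul,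
      ← Finset.sum_mul, ← Finset.mul_sum]
    have h3 := hsumm.sum_le_tsum (Finset.range J) fun j _ => hnb j
    have h4 : 2 * (∑ j ∈ Finset.range J, nearBound D K S γ j) * p ≤ 2 * Q * p := by gcongr
    linarith [show (J : ℝ) * (J * J) = J ^ 3 by ring]
  have hfree := le_free_add_start (hit := fun i => Hit D α x i θ) hN n
  have hlong := mul_long_le_free (hit := fun i => Hit D α x i θ) hN (by lia : 1 ≤ M) n
  set F : ℝ := (countBefore (IsFree (k + 1) fun i => Hit D α x i θ) n : ℝ) with hF
  have hsplit := countBefore_and_add_not start (fun i => Returns D α x (k + 1) M i θ) n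
  -- Passages without an early return are followed by `M` free times.
  have hlong' : (M : ℝ) * (p - countBefore (fun i => start i ∧ Returns D α x (k + 1) M i θ) n) ≤
      F + M := by
    have h1 : countBefore (fun i => start i ∧ ¬Returns D α x (k + 1) M i θ) n ≤
        countBefore (fun s => IsStart (k + 1) (fun i => Hit D α x i θ) s ∧
          ∀ l < M, ¬Hit D α x (s + (k + 1) + l) θ) n :=
      countBefore_mono (fun i h => ⟨h.1, fun l hl h' => h.2 ⟨l, hl, h'⟩⟩) n
    have h2 : M * countBefore (fun i => start i ∧ ¬Returns D α x (k + 1) M i θ) n ≤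
        countBefore (IsFree (k + 1) fun i => Hit D α x i θ) n + M :=
      (Nat.mul_le_mul_left M h1).trans hlong
    have h3 : p - countBefore (fun i => start i ∧ Returns D α x (k + 1) M i θ) n =
        (countBefore (fun i => start i ∧ ¬Returns D α x (k + 1) M i θ) n : ℝ) := by
      rw [hp, ← hsplit]; push_cast; ring
    rw [h3, hF]
    exact_mod_cast h2
  have hfin := hexp J n F p _ e ((le_max_left _ _).trans hJmax) hJn (Nat.cast_nonneg _)
    (by rw [hF, hp]; exact_mod_cast hfree) hlong' hret he_le
  have hpo : PseudoOrbit D.a D.p (α * D.Φ) fun i => x i θ := by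
    refine ⟨fun i => (hx.bound _ _).trans D.β_lt.le, fun i => ?_⟩
    rw [hx.step, add_sub_cancel_left, abs_mul, abs_of_pos hα]
    exact mul_le_mul_of_nonneg_left (D.g_le _) hα.le
  have hfinal := hgr k hk (fun i => x i θ) (fun i => Hit D α x i θ) hpo
    (fun i h => hx.le_of_hit hK.le hα.le hKα hθI.1 h)
    (fun i h => threshold_le_of_not_hit hθI.1 h) n
  refine le_trans ?_ hfinal
  calc Real.exp (c / 2 * n) ≤ Real.exp (Real.log c' + c * n) := by
        refine Real.exp_le_exp.2 ?_
        linarith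
    _ = c' * Real.exp (c * n) := by rw [Real.exp_add, Real.exp_log hc']
    _ ≤ c' * passageProduct (k + 1) (fun i => Hit D α x i θ) m (fun i => c₄ * |x i θ| / α) n := by
        gcongr
        exact (Real.exp_le_exp.2 hfin).trans hprod

end CurveFamily

namespace SkewData

/-- For small `α`, almost every point of every image of a horizontal curve has exponentially
growing vertical derivatives. -/
lemma exists_ae_growth (D : SkewData) : ∃ α₀ > 0, ∀ α, 0 < α → α < α₀ → ∀ x₀, |x₀| ≤ D.β →
    ∀ n, 1 ≤ n → ∀ j : ℕ, ∀ᵐ θ ∂volume.restrict (Ico (0 : ℝ) 1), ∃ c > 0, ∀ᶠ i : ℕ in atTop,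
      Real.exp (c * i) ≤ growth
        (fun i => curveDeriv D.g D.a D.d α x₀ (n + i) 0 ((θ + j) / (D.d : ℝ) ^ n)) i := by
  obtain ⟨K, S, γ, α₁, hK, hS, hγ, hα₁, hfam⟩ := D.exists_curveFamily
  obtain ⟨α₂, hα₂, h⟩ := mem_nhdsGT_iff_exists_Ioo_subset.1
    (CurveFamily.eventually_ae_growth D hK hS hγ)
  refine ⟨min α₁ α₂, lt_min hα₁ hα₂, fun α h1 h2 x₀ hx₀ n hn j => ?_⟩
  exact h ⟨h1, h2.trans_le (min_le_right _ _)⟩ _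
    (hfam α h1 (h2.le.trans (min_le_left _ _)) x₀ hx₀ n hn j)

end SkewData

/-! ### From curve families to admissible curves -/

/-- The number `|p₁| = (1 + √(1 + 4a)) / 2` is the positive root of `p ^ 2 = a + p`. -/
lemma preperiodicParam_fixedPointOne {a : ℝ} (ha₁ : 1 < a) (ha₂ : a < 2)
    (hpre : IsStrictlyPreperiodicZero (quadMap a)) (h : 1 < |fixedPointOne a|) :
    PreperiodicParam a |fixedPointOne a| := by
  refine ⟨ha₁, ha₂, h, ?_, hpre⟩
  have h1 : 0 ≤ √(1 + 4 * a) := Real.sqrt_nonneg _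
  have h2 : √(1 + 4 * a) ^ 2 = 1 + 4 * a := Real.sq_sqrt (by linarith)
  have h3 : |fixedPointOne a| = (1 + √(1 + 4 * a)) / 2 := by
    rw [fixedPointOne, abs_of_neg (by linarith)]; ring
  rw [h3]
  linarith [show ((1 + √(1 + 4 * a)) / 2) ^ 2 = (1 + 2 * √(1 + 4 * a) + √(1 + 4 * a) ^ 2) / 4 by ring]

/-- The multipliers along the orbit of the critical value. -/
lemma CritConst.multipliers {a p β κ l σ C d₀ Cd R η₀ : ℝ} (h : PreperiodicParam a p)
    (H : CritConst a κ l σ C d₀) (hβ : 0 < β)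
    (hB : MapsTo (quadMap a) (Icc (-β) β) (interior (Icc (-β) β))) (hCd : 0 ≤ Cd) (hR : 0 ≤ R)
    (hη₀ : 0 ≤ η₀)
    (hdom : ∀ x : ℕ → ℝ, (∀ i, |x i| ≤ β) → (∀ i, |x (i + 1) - (a - x i ^ 2)| ≤ η₀) →
      ∀ n, growth x n ≤ Cd * R ^ n) :
    ∃ r₀ q : ℕ, Multipliers (fun n => -2 * qorb a a n) κ l Cd R r₀ q := by
  obtain ⟨r₀, q, hr₀, hq, hper⟩ := h.exists_period
  have habs : ∀ (y : ℕ → ℝ) (s : Finset ℕ),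
      |∏ i ∈ s, (-2 * y i)| = ∏ i ∈ s, |2 * y i| := by
    intro y s
    rw [Finset.abs_prod]
    exact Finset.prod_congr rfl fun i _ => by rw [neg_mul, abs_neg]
  have horb : ∀ n, qorb a a n = qorb a 0 (1 + n) := fun n => by
    rw [qorb_add, qorb_succ, qorb_zero]; congr 1; ring
  have hmem : ∀ n, |qorb a a n| ≤ β := by
    intro n
    have h1 : ∀ x, |x| ≤ β → |a - x ^ 2| ≤ β := fun x hx =>
      abs_le.2 (mem_Icc.1 (interior_subset (s := Icc (-β) β) (hB (abs_le.1 hx))))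
    induction n with
    | zero => simpa [qorb_zero] using h1 0 (by simpa using hβ.le)
    | succ n ih => rw [qorb_succ]; exact h1 _ ih
  refine ⟨r₀, q, H.κ_pos, H.one_lt_l, hCd, hR, hq, fun r k => ?_, fun m k hk => ?_, fun n hn => ?_⟩
  · rw [habs (fun i => qorb a a (r + i))]
    have h1 := H.lower r k
    rw [growth_add, mul_comm] at h1
    exact le_of_mul_le_mul_left h1 (H.pos r)
  · rw [habs, Finset.prod_Ico_eq_prod_range, show m - (m - k) = k by lia]
    refine hdom (fun i => qorb a a (m - k + i)) (fun i => hmem _) (fun i => ?_) k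
    rw [← add_assoc, qorb_succ, sub_self, abs_zero]
    exact hη₀
  · rw [horb, horb, ← add_assoc, hper _ (by lia)]

theorem proposition3 (a : ℝ) (ha₁ : 1 < a) (ha₂ : a < 2)
    (hpre : IsStrictlyPreperiodicZero (quadMap a))
    (d : ℕ) (hd : 2 ≤ d)
    (φ : UnitAddCircle → ℝ) (hφ : IsRealAnalyticOnCircle φ)
    (hφ_nonconst : ∃ θ₁ θ₂ : UnitAddCircle, φ θ₁ ≠ φ θ₂)
    (β : ℝ) (hβ₁ : 1 < β) (hβ₂ : β < |fixedPointOne a|)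
    (hB : MapsTo (quadMap a) (Icc (-β) β) (interior (Icc (-β) β))) :
    (∃ n₀ : ℕ, IsDominationTime a d φ β n₀) ∧
    ∀ n₀ : ℕ, IsDominationTime a d φ β n₀ →
      ∃ α₀ : ℝ, 0 < α₀ ∧ ∀ α : ℝ, 0 < α → α < α₀ →
        ∀ X : ℝ → ℝ, IsAdmissibleCurve a d φ β n₀ α X →
          ∀ᵐ θ : ℝ ∂(volume.restrict (Ico (0 : ℝ) 1)),
            0 < lowerVertExponent a d φ α (θ : UnitAddCircle) (X θ) := by
  have h := preperiodicParam_fixedPointOne ha₁ ha₂ hpre (hβ₁.trans hβ₂)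
  set p := |fixedPointOne a| with hp
  have hβ0 : 0 < β := by linarith
  set ψ : ℝ → ℝ := fun t => φ (t : UnitAddCircle) with hψ
  have hψper : Function.Periodic ψ 1 := fun t => by
    simp only [hψ]; rw [AddCircle.coe_add_period]
  obtain ⟨A, ρ, htower, hper⟩ := exists_analyticTower hφ hψper
  have hcont : Continuous ψ := by simpa using htower.continuous 0
  obtain ⟨Φ₀, hΦ₀⟩ := isCompact_Icc.exists_bound_of_continuousOn (hcont.continuousOn (s := Icc 0 1))
  have hΦψ : ∀ t, |ψ t| ≤ max Φ₀ 1 := by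
    intro t
    rw [← (hψper.sub_int_mul_eq ⌊t⌋ : ψ (t - ⌊t⌋ * 1) = ψ t), mul_one]
    exact (hΦ₀ _ ⟨Int.fract_nonneg t, (Int.fract_lt_one t).le⟩).trans (le_max_left _ _)
  have hΦ : ∀ θ, |φ θ| ≤ max Φ₀ 1 := by
    intro θ
    obtain ⟨t, rfl⟩ := QuotientAddGroup.mk_surjective θ
    exact hΦψ t
  refine ⟨exists_isDominationTime hd h.p_sq h.a_lt_p hβ0 hβ₂ hB hΦ, fun n₀ _ => ?_⟩
  obtain ⟨κ, l, σ, C, d₀, H⟩ := h.exists_critConst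
  obtain ⟨Cd, R, η₁, hCd, hR, hR2, hη₁, hdom⟩ := exists_domination h.p_sq h.a_lt_p hβ0 hβ₂
  obtain ⟨η₂, hη₂, hinv⟩ := exists_invariant_margin hβ0 hB
  obtain ⟨r₀, q, hmult⟩ := H.multipliers h hβ0 hB hCd.le hR.le hη₁.le (hdom η₁ le_rfl)
  have hd2 : (2 : ℝ) ≤ d := by exact_mod_cast hd
  let D : SkewData := {
    a := a, p := p, β := β, Φ := max Φ₀ 1, A := A, ρ := ρ, κ := κ, l := l, σ := σ, C := C, d₀ := d₀
    Cd := Cd, R := R, η₀ := min η₁ η₂, d := d, r₀ := r₀, q := q, g := fun i => iteratedDeriv i ψ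
    pre := h
    crit := H
    mult := hmult
    two_le_d := hd
    R_lt := by linarith
    tower := htower
    per := hper
    nonconst := by
      obtain ⟨θ₁, θ₂, hne⟩ := hφ_nonconst
      obtain ⟨s, rfl⟩ := QuotientAddGroup.mk_surjective θ₁
      obtain ⟨t, rfl⟩ := QuotientAddGroup.mk_surjective θ₂
      exact ⟨s, t, by simpa using hne⟩
    Φ_pos := lt_max_of_lt_right one_pos
    g_le := by simpa using hΦψ
    β_pos := hβ0
    β_lt := hβ₂
    η₀_pos := lt_min hη₁ hη₂
    inv := fun x y hx hy => hinv x y hx (hy.trans (min_le_right _ _))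
    dom := fun x hx hs => hdom η₁ le_rfl x hx fun i => (hs i).trans (min_le_left _ _) }
  obtain ⟨α₀, hα₀, hgrowth⟩ := D.exists_ae_growth
  refine ⟨α₀, hα₀, fun α hα hα' X hadm => ?_⟩
  obtain ⟨-, n, hn, j, -, x₀, hx₀, hX⟩ := hadm
  filter_upwards [hgrowth α hα hα' x₀ (abs_le.2 hx₀) n (by lia) j,
    ae_restrict_mem measurableSet_Ico] with θ ⟨c, hc, hθ⟩ hI
  have hdn : (0 : ℝ) < (d : ℝ) ^ n := by positivity
  -- The point `t` of the interval `ω` satisfies `dⁿ t = θ + j`, so the orbit of `(θ, X θ)`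
  -- continues that of `(t, x₀)` from time `n` on.
  set t : ℝ := (θ + j) / (d : ℝ) ^ n with ht
  have hdt : (d : ℝ) ^ n * t = θ + j := by rw [ht]; field_simp
  have hXθ : X θ = fibreIter a d φ α n (t : UnitAddCircle) x₀ := by
    rw [← hX t ⟨?_, ?_⟩, hdt, Int.fract_add_natCast, Int.fract_eq_self.2 hI]
    · exact div_le_div_of_nonneg_right (by linarith [hI.1]) hdn.le
    · exact div_lt_div_of_pos_right (by linarith [hI.2]) hdn
  have hbase : d ^ n • (t : UnitAddCircle) = (θ : UnitAddCircle) := by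
    rw [← AddCircle.coe_nsmul, nsmul_eq_mul]
    push_cast
    rw [hdt, AddCircle.coe_add]
    have : ((j : ℝ) : UnitAddCircle) = 0 := by
      rw [AddCircle.coe_eq_zero_iff]
      exact ⟨j, by simp⟩
    rw [this, add_zero]
  have horbit : ∀ i, fibreIter a d φ α i (θ : UnitAddCircle) (X θ) =
      curveDeriv D.g a d α x₀ (n + i) 0 t := by
    intro i
    rw [curveDeriv_zero_eq (φ := φ) (fun t => by simp [D, hψ]), fibreIter_add, hbase, hXθ]
  -- Eventual growth by `exp (c i)` bounds the lower limit below by `c`.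
  have hle : ((c : ℝ) : EReal) ≤ lowerVertExponent a d φ α (θ : UnitAddCircle) (X θ) := by
    refine le_liminf_of_le ?_ ?_
    · isBoundedDefault
    filter_upwards [hθ, eventually_ge_atTop 1] with i hi hi1
    have hi0 : (0 : ℝ) < i := by exact_mod_cast hi1
    rw [abs_vertDeriv, funext horbit]
    have h1 : ((c * i : ℝ) : EReal) ≤
        ENNReal.log (ENNReal.ofReal (growth (fun i => curveDeriv D.g a d α x₀ (n + i) 0 t) i)) := by
      rw [← Real.log_exp (c * i), ← ENNReal.log_ofReal_of_pos (Real.exp_pos _)]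
      exact ENNReal.log_le_log (ENNReal.ofReal_le_ofReal hi)
    calc ((c : ℝ) : EReal) = ((1 / (i : ℝ) : ℝ) : EReal) * ((c * i : ℝ) : EReal) := by
          rw [← EReal.coe_mul]; congr 1; field_simp
      _ ≤ _ := mul_le_mul_of_nonneg_left h1 (by exact_mod_cast (by positivity : (0 : ℝ) ≤ 1 / i))
  exact lt_of_lt_of_le (by exact_mod_cast hc) hle
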